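/- Fronts are generic front diagrams whose crossings and cusps have distinct $x$-coordinates, considered up to planar isotopy. Let $K\subset\mathbb R^3$ be an oriented connected Legendrian knot with base point $*$, and let $L\subset J^1(S^1)$ be a Legendrian link. The fronts are in general position: $*$ is away from the singularities of $K$, and the front of $L$, viewed in $[0,1]\times\mathbb R$ with its ends identified, has no singularity on $x=0$. Let $n$ be the number of strands of $L$ at $x=0$. The front of the satellite $S(K,L)\subset\mathbb R^3$ is the $n$-copy of $K$ (made of $n$ copies of $K$, each shifted slightly downward) with the front of $L$ inserted at $*$; if $K$ is oriented to the left at $*$, then the reflection of $L$ across a vertical axis is inserted instead. It is perturbed by a planar isotopy so that its crossings and cusps have distinct $x$-coordinates. A normal ruling of a front is a continuous fixed-point-free involution of the strands over each $x$ away from the singular points such that: the two branches of a cusp are paired and the other strands keep their pairing past the cusp; two strands that meet at a crossing are not paired; and at each crossing the pairing either follows the diagram or has a switch, where the two paths turn a corner, and where the two vertical intervals that join the switching strands to their companions are disjoint or nested. In a generalized normal ruling of $L\subset J^1(S^1)$ fixed strands are allowed; at a switch of a fixed strand with a non-fixed strand, the interval of the non-fixed strand must not meet the fixed one; a crossing of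 two fixed strands is not a switch. Put $j(\rho)=\#\{\text{switches}\}-\#\{\text{right cusps}\}$. Given a $\mathbb Z/p$-valued Maslov potential, i.e. a function on the front that is constant along strands and on the upper branch of each cusp is larger by $1$ than on the lower one, a ruling is $p$-graded if the upper one of any two paired strands has potential larger by $1$ than the lower one. Let $R^p(z)=\sum_\rho z^{j(\rho)}$, summed over the $p$-graded normal rulings. Potentials $\mu$ of $K$ and $\eta$ of $L$ induce a potential of $S(K,L)$: it is $\mu(*)+\eta$ on the inserted $L$, and $\mu(k)+\eta_i$ on the $i$-th strand over $k\in K$, where $\eta_i$ is the value of $\eta$ on the $i$-th strand of $L$ at $x=0$. For a non-empty $L$, a normal ruling of $S(K,L)$ is reduced if $L$ meets $x=0$ and the ruling has no switch at the crossings of $S(K,L)$ that arise from left cusps of $K$; the empty ruling of $S(K,\emptyset)=\emptyset$ is reduced. For a generalized normal ruling $\tau$ of $L$ let $L^\tau$ be the link whose front consists of the strands fixed by $\tau$ (smoothed at the switches of $\tau$). If $\tau$ is $p$-graded, then $\eta$ restricts to a Maslov potential of $L^\tau$, and "$\sigma$ is $p$-graded" below refers to the potential of $S(K,L^\tau)$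 induced by $\mu$ and this restriction. **Theorem.** There is a bijection $\Phi$ from the set of pairs $(\tau,\sigma)$, where $\tau$ is a generalized normal ruling of $L$ and $\sigma$ is a reduced normal ruling of $S(K,L^\tau)$, onto the set of normal rulings of $S(K,L)$, such that $j(\Phi(\tau,\sigma))=j(\tau)+j(\sigma)$ for all $(\tau,\sigma)$, and such that for every $p\ge 0$ and all $\mathbb Z/p$-valued Maslov potentials of $K$ and $L$, $\Phi(\tau,\sigma)$ is $p$-graded if and only if $\tau$ and $\sigma$ are. Consequently, for every $p$ and all such potentials, each coefficient of $R^p_{S(K,L)}(z)$ is at least the corresponding coefficient of $R^p_L(z)$. -/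

import Mathlib

/-!
Generic front diagrams are cut by vertical lines into slices, each containing at most one
singular point.  In a slice with `w` strands at its left end, strands are numbered
`0, 1, …, w - 1` from top to bottom.  The resulting word of slices determines the front up to
planar isotopy, and every generic front whose singular points have distinct `x`-coordinates
arises in this way.
-/

/-- What happens in one vertical slice of a front diagram: no singular point, a crossing of the
strands `k` and `k + 1`, a left cusp whose two branches become the strands `k` and `k + 1`, or a
right cusp at which the strands `k` and `k + 1` end. -/
inductive Slice where
  | triv : Slice
  | cross (k : ℕ) : Slice
  | lcusp (k : ℕ) : Slice
  | rcusp (k : ℕ) : Slice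
  deriving DecidableEq

namespace Slice

/-- The slice makes sense when `w` strands enter it from the left. -/
def Ok : Slice → ℕ → Prop
  | triv, _ => True
  | cross k, w => k + 1 < w
  | lcusp k, w => k ≤ w
  | rcusp k, w => k + 1 < w

/-- The number of strands at the right end of a slice with `w` strands at its left end. -/
def out : Slice → ℕ → ℕ
  | triv, w => w
  | cross _, w => w
  | lcusp _, w => w + 2
  | rcusp _, w => w - 2

/-- The order-preserving renumbering of strands that leaves the places `k` and `k + 1` free. -/
def skip (k i : ℕ) : ℕ := if i < k then i else i + 2

/-- The strand numbered `i` at the left end of the slice continues (as a strand of the front,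
without turning at crossings) to the strand numbered `j` at the right end. -/
def Continues : Slice → ℕ → ℕ → Prop
  | triv, i, j => j = i
  | cross k, i, j => j = Equiv.swap k (k + 1) i
  | lcusp k, i, j => j = skip k i
  | rcusp k, i, j => i = skip k j

/-- Reflection of a slice across a vertical axis. -/
def mirror : Slice → Slice
  | triv => triv
  | cross k => cross k
  | lcusp k => rcusp k
  | rcusp k => lcusp k

/-- Place a slice below `m` further strands. -/
def shift (m : ℕ) : Slice → Slice
  | triv => triv
  | cross k => cross (m + k)
  | lcusp k => lcusp (m + k)
  | rcusp k => rcusp (m + k)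

/-- The (generalized) normality condition for a switch at a crossing of the strands `k` and
`k + 1`, where `f` is the involution next to the crossing.  The vertical intervals joining the two
strands to their companions are disjoint or nested; if one of the two strands is fixed by `f`, then
the interval of the other one has to avoid it. -/
def Normality (k : ℕ) (f : ℕ → ℕ) : Prop :=
  Disjoint (Set.uIcc k (f k)) (Set.uIcc (k + 1) (f (k + 1))) ∨
    (f k ≠ k ∧ f (k + 1) ≠ k + 1 ∧
      (Set.uIcc k (f k) ⊆ Set.uIcc (k + 1) (f (k + 1)) ∨
        Set.uIcc (k + 1) (f (k + 1)) ⊆ Set.uIcc k (f k)))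

/-- The conditions that a generalized normal ruling satisfies in a slice, when it induces the
involution `f` of the strands at the left end and `g` at the right end.  At a crossing the strands
that meet are not paired, and the ruling either follows the diagram or has a switch. -/
def Rules : Slice → (ℕ → ℕ) → (ℕ → ℕ) → Prop
  | triv, f, g => g = f
  | cross k, f, g => f k ≠ k + 1 ∧
      ((∀ i, g (Equiv.swap k (k + 1) i) = Equiv.swap k (k + 1) (f i)) ∨
        (g = f ∧ Normality k f))
  | lcusp k, f, g => g k = k + 1 ∧ ∀ i, g (skip k i) = skip k (f i)
  | rcusp k, f, g => f k = k + 1 ∧ ∀ i, f (skip k i) = skip k (g i)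

/-- Carry a labelling of the strands from the left end to the right end of a slice.  If the slice
is a left cusp, then its upper branch receives the label `a` and its lower branch `a - 1`. -/
def carry {A : Type*} [AddGroupWithOne A] (a : A) : Slice → (ℕ → A) → (ℕ → A)
  | triv, f => f
  | cross k, f => fun i => f (Equiv.swap k (k + 1) i)
  | lcusp k, f => fun i =>
      if i < k then f i else if i = k then a else if i = k + 1 then a - 1 else f (i - 2)
  | rcusp k, f => fun i => f (skip k i)

end Slice

/-- A word of slices, with the number of strands at its left end. -/
structure Front where
  left : ℕ
  word : List Slice

namespace Front

variable (F : Front)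

/-- The number of slices. -/
def length : ℕ := F.word.length

/-- The `t`-th slice, which lies between the vertical lines `t` and `t + 1`
(trivial beyond the end of the diagram). -/
def slice (t : ℕ) : Slice := F.word.getD t Slice.triv

/-- The number of strands at the vertical line `t`. -/
def width (t : ℕ) : ℕ := (F.word.take t).foldl (fun w e => e.out w) F.left

/-- The front diagram, in general position, of a Legendrian link in `J¹(S¹)`: the vertical lines
`0` and `F.length` are identified, and there is no singularity on that line. -/
structure IsAnnular : Prop where
  ok : ∀ t < F.length, (F.slice t).Ok (F.width t)
  closed : F.width F.length = F.left

/-- The front diagram, in general position, of a Legendrian link in `ℝ³`. -/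
structure IsPlanar : Prop where
  ok : ∀ t < F.length, (F.slice t).Ok (F.width t)
  left_eq : F.left = 0
  right_eq : F.width F.length = 0

/-- The diagram of the empty link. -/
def IsEmpty : Prop := ∀ t ≤ F.length, F.width t = 0

/-- `(t, i)` stands for the `i`-th strand at the vertical line `t`. -/
def IsPoint (P : ℕ × ℕ) : Prop := P.1 ≤ F.length ∧ P.2 < F.width P.1

/-- Points of the front that follow each other along the link. -/
inductive Adj : ℕ × ℕ → ℕ × ℕ → Prop
  | strand (t i j : ℕ) (ht : t < F.length) (hi : i < F.width t) (hj : j < F.width (t + 1))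
      (h : (F.slice t).Continues i j) : Adj (t, i) (t + 1, j)
  | lcusp (t k : ℕ) (ht : t < F.length) (h : F.slice t = Slice.lcusp k) :
      Adj (t + 1, k) (t + 1, k + 1)
  | rcusp (t k : ℕ) (ht : t < F.length) (h : F.slice t = Slice.rcusp k) :
      Adj (t, k) (t, k + 1)

/-- The link given by a front in the plane has at most one component. -/
def Connected : Prop :=
  ∀ P Q, F.IsPoint P → F.IsPoint Q → Relation.EqvGen F.Adj P Q

/-- A `ℤ/p`-valued Maslov potential: `μ t i` is its value on the `i`-th strand at the vertical
line `t`. -/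
structure IsMaslov {p : ℕ} (μ : ℕ → ℕ → ZMod p) : Prop where
  strand : ∀ t < F.length, ∀ i < F.width t, ∀ j < F.width (t + 1),
    (F.slice t).Continues i j → μ (t + 1) j = μ t i
  lcusp : ∀ t < F.length, ∀ k, F.slice t = Slice.lcusp k → μ (t + 1) k = μ (t + 1) (k + 1) + 1
  rcusp : ∀ t < F.length, ∀ k, F.slice t = Slice.rcusp k → μ t k = μ t (k + 1) + 1
  closed : ∀ i < F.left, μ F.length i = μ 0 i

/-- A generalized normal ruling: `ρ t` is the involution of the strands at the vertical line `t`,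
extended by the identity to all natural numbers.  Beyond the end of the diagram `ρ t` is constant
in `t`.  (For a planar front the condition `closed` holds trivially.) -/
structure IsGenRuling (ρ : ℕ → ℕ → ℕ) : Prop where
  involutive : ∀ t, Function.Involutive (ρ t)
  support : ∀ t i, F.width t ≤ i → ρ t i = i
  rules : ∀ t, (F.slice t).Rules (ρ t) (ρ (t + 1))
  closed : ρ F.length = ρ 0

/-- A normal ruling is a generalized normal ruling without fixed points. -/
structure IsNormalRuling (ρ : ℕ → ℕ → ℕ) : Prop extends F.IsGenRuling ρ where
  fixedPointFree : ∀ t, ∀ i < F.width t, ρ t i ≠ i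

/-- The set of generalized normal rulings. -/
def GenRuling : Type := {ρ : ℕ → ℕ → ℕ // F.IsGenRuling ρ}

/-- The set of normal rulings. -/
def NormalRuling : Type := {ρ : ℕ → ℕ → ℕ // F.IsNormalRuling ρ}

/-- The `t`-th slice is a crossing at which `ρ` has a switch.  A crossing of two strands that are
both fixed by `ρ` is not a switch. -/
def IsSwitch (ρ : ℕ → ℕ → ℕ) (t : ℕ) : Prop :=
  ∃ k, F.slice t = Slice.cross k ∧ ρ (t + 1) = ρ t ∧ ¬ (ρ t k = k ∧ ρ t (k + 1) = k + 1)

/-- `j(ρ)`, the number of switches minus the number of right cusps. -/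
noncomputable def jIndex (ρ : ℕ → ℕ → ℕ) : ℤ :=
  (Set.ncard {t | t < F.length ∧ F.IsSwitch ρ t} : ℤ) -
    (Set.ncard {t | t < F.length ∧ ∃ k, F.slice t = Slice.rcusp k} : ℤ)

/-- `ρ` is graded with respect to `μ`: the upper one of two paired strands has potential one
larger than the lower one. -/
def IsGraded {p : ℕ} (μ : ℕ → ℕ → ZMod p) (ρ : ℕ → ℕ → ℕ) : Prop :=
  ∀ t ≤ F.length, ∀ i j, i < j → ρ t i = j → μ t i = μ t j + 1

/-- The front `L^τ` formed by the strands that are fixed by `τ`.  It has a slice for each slice of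
`L`, and its crossings are the crossings of `L` at which two fixed strands meet. -/
def fixedPart (τ : ℕ → ℕ → ℕ) : Front where
  left := Nat.count (fun i => τ 0 i = i) F.left
  word := (List.range F.length).map fun t =>
    match F.slice t with
    | Slice.cross k =>
        if τ t k = k ∧ τ t (k + 1) = k + 1 then
          Slice.cross (Nat.count (fun i => τ t i = i) k) else Slice.triv
    | _ => Slice.triv

/-- The restriction of a Maslov potential to `L^τ`. -/
noncomputable def fixedPotential {A : Type*} (τ : ℕ → ℕ → ℕ) (η : ℕ → ℕ → A) : ℕ → ℕ → A :=
  fun t i => η t (Nat.nth (fun q => q < F.width t ∧ τ t q = q) i)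

/-- The reflection of a front across a vertical axis. -/
def reflect : Front where
  left := F.width F.length
  word := F.word.reverse.map Slice.mirror

end Front

/-- Where a slice of the satellite comes from: from the `t`-th slice of the companion (in the case
of cusps it involves the `i`-th cusp, counted from the top, or the strands of that cusp), or from
the `t`-th slice of the inserted copy of the pattern. -/
inductive Origin where
  | companion (t i : ℕ) : Origin
  | pattern (t : ℕ) : Origin

/-- The `n`-copy of a left cusp of the strands `k` and `k + 1`.  The `j`-th of the `n` cusps is
created below the branches of the previous ones, and then its upper branch crosses the lower
branches of the previous cusps.  (This fixes the horizontal order of the `n` cusps and the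
`n (n - 1) / 2` crossings by a planar isotopy.)  Each slice comes with the index `j`. -/
def leftCuspCopy (n k : ℕ) : List (Slice × ℕ) :=
  (List.range n).flatMap fun j =>
    (Slice.lcusp (n * k + 2 * j), j) ::
      (List.range j).map fun r => (Slice.cross (n * k + (2 * j - 1 - r)), j)

/-- The `n`-copy of a slice.  The copies of the strand `i` are numbered `n * i, …, n * i + n - 1`.
Each of the `n` copies of the upper strand of a crossing crosses each of the `n` copies of the
lower one. -/
def Slice.copy (n : ℕ) : Slice → List (Slice × ℕ)
  | Slice.triv => []
  | Slice.cross k => (List.range n).reverse.flatMap fun i =>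
      (List.range n).map fun j => (Slice.cross (n * k + (i + j)), i)
  | Slice.lcusp k => leftCuspCopy n k
  | Slice.rcusp k => (leftCuspCopy n k).reverse.map fun x => (x.1.mirror, x.2)

/-- An oriented Legendrian knot in `ℝ³` with base point, given by its front in general position.
The base point is the `baseStrand`-th strand at the vertical line `baseTime`, and `rightward` says
whether the knot is oriented to the right there (which determines the orientation, as the knot is
connected). -/
structure BasedKnot where
  front : Front
  planar : front.IsPlanar
  connected : front.Connected
  baseTime : ℕ
  baseStrand : ℕ
  base_isPoint : front.IsPoint (baseTime, baseStrand)
  rightward : Bool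

namespace BasedKnot

variable (K : BasedKnot) (L : Front)

/-- The front that is inserted at the base point: `L` or its reflection. -/
def inserted : Front := if K.rightward then L else L.reflect

/-- The slices of the `n`-copy of `K` that come from its `t`-th slice. -/
def copySlices (n t : ℕ) : List (Slice × Origin) :=
  ((K.front.slice t).copy n).map fun x => (x.1, Origin.companion t x.2)

/-- The slices of the satellite, each with its origin: the `n`-copy of `K`, where `n` is the number
of strands of `L` at the line `0`, with `L` or its reflection inserted at the base point. -/
def satelliteSlices : List (Slice × Origin) :=
  (List.range K.baseTime).flatMap (K.copySlices L.left) ++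
    (List.range (K.inserted L).length).map
      (fun t => (((K.inserted L).slice t).shift (L.left * K.baseStrand), Origin.pattern t)) ++
    (List.range' K.baseTime (K.front.length - K.baseTime)).flatMap (K.copySlices L.left)

/-- The front of the satellite `S(K, L)` in the plane. -/
def satellite : Front where
  left := 0
  word := (K.satelliteSlices L).map Prod.fst

/-- The Maslov potential of `L`, transported to the inserted copy of `L`. -/
def insertedPotential {A : Type*} (η : ℕ → ℕ → A) : ℕ → ℕ → A :=
  fun t i => if K.rightward then η t i else η (L.length - t) i

/-- The value of the potential of `S(K, L)` on the upper branch of a left cusp: it is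
`μ + η_i` at the `i`-th copy of a left cusp of `K`, where `η_i` is the value of `η` on the `i`-th
strand of `L` at the line `0`, and `μ(*) + η` on the inserted copy of `L`. -/
def cuspLabel {A : Type*} [AddGroupWithOne A] (μ η : ℕ → ℕ → A) : Origin → A
  | Origin.companion t i =>
      match K.front.slice t with
      | Slice.lcusp k => μ (t + 1) k + η 0 i
      | _ => 0
  | Origin.pattern t =>
      match (K.inserted L).slice t with
      | Slice.lcusp k => μ K.baseTime K.baseStrand + K.insertedPotential L η (t + 1) k
      | _ => 0

/-- The Maslov potential of `S(K, L)` that is determined by the Maslov potentials `μ` of `K` and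
`η` of `L`: its value on each strand is carried along from the left cusp where the strand begins. -/
def satellitePotential {A : Type*} [AddGroupWithOne A] (μ η : ℕ → ℕ → A) : ℕ → ℕ → A :=
  fun t => ((K.satelliteSlices L).take t).foldl
    (fun f x => x.1.carry (K.cuspLabel L μ η x.2) f) (fun _ => 0)

/-- The `t`-th slice of `S(K, L)` belongs to the `n`-copy of a left cusp of `K`. -/
def FromLeftCusp (t : ℕ) : Prop :=
  ∃ x s i k, (K.satelliteSlices L)[t]? = some (x, Origin.companion s i) ∧
    K.front.slice s = Slice.lcusp k

/-- A ruling of `S(K, L)` is reduced if `L` is empty, or if `L` intersects the line `0` and there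
are no switches at the crossings that arise from left cusps of `K`. -/
def IsReduced (ρ : ℕ → ℕ → ℕ) : Prop :=
  L.IsEmpty ∨ (0 < L.left ∧ ∀ t, K.FromLeftCusp L t → ¬ (K.satellite L).IsSwitch ρ t)

/-- The set of reduced normal rulings of `S(K, L)`. -/
def ReducedRuling : Type :=
  {ρ : ℕ → ℕ → ℕ // (K.satellite L).IsNormalRuling ρ ∧ K.IsReduced L ρ}

end BasedKnot

namespace Front

theorem width_le (F : Front) (t : ℕ) : F.width t ≤ F.left + 2 * F.length := by
  have key : ∀ (l : List Slice) (w : ℕ),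
      l.foldl (fun w e => e.out w) w ≤ w + 2 * l.length := by
    intro l
    induction l with
    | nil => intro w; simp
    | cons e l ih =>
      intro w
      have h1 := ih (e.out w)
      have h2 : e.out w ≤ w + 2 := by cases e <;> simp only [Slice.out] <;> omega
      simp only [List.foldl_cons, List.length_cons]
      omega
  have h1 := key (F.word.take t) F.left
  have h2 : (F.word.take t).length ≤ F.word.length := List.length_take_le' t F.word
  unfold width length
  omega

/-- A front has finitely many (generalized) normal rulings, so that the sum in the ruling
polynomial is finite. -/
theorem finite_isGenRuling (F : Front) : {ρ : ℕ → ℕ → ℕ | F.IsGenRuling ρ}.Finite := by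
  let B := F.left + 2 * F.length
  let r : (ℕ → ℕ → ℕ) → (Fin (F.length + 1) → Fin B → ℕ) := fun ρ t i => ρ t i
  have hfin : (Set.univ.pi fun _ : Fin (F.length + 1) =>
      Set.univ.pi fun _ : Fin B => Set.Iio B).Finite :=
    Set.Finite.pi fun _ => Set.Finite.pi fun _ => Set.finite_Iio B
  refine Set.Finite.of_finite_image (f := r) (hfin.subset ?_) ?_
  · rintro _ ⟨ρ, hρ, rfl⟩ t - i -
    show ρ t i < B
    by_contra! h
    have h1 := hρ.support t (ρ t i) ((F.width_le t).trans h)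
    rw [hρ.involutive t] at h1
    exact absurd i.2 (by omega)
  · intro ρ hρ ρ' hρ' h
    have hc : ∀ ρ, F.IsGenRuling ρ → ∀ d, ρ (F.length + d) = ρ F.length := by
      intro ρ hρ d
      induction d with
      | zero => rfl
      | succ d ih =>
        have h1 := hρ.rules (F.length + d)
        have h2 : F.slice (F.length + d) = Slice.triv :=
          List.getD_eq_default _ _ (by unfold length; omega)
        rw [h2] at h1
        exact h1.trans ih
    have hs : ∀ t ≤ F.length, ρ t = ρ' t := by
      intro t ht
      funext i
      by_cases hi : i < B
      · exact congrFun (congrFun h ⟨t, by omega⟩) ⟨i, hi⟩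
      · have hw : F.width t ≤ i := (F.width_le t).trans (not_lt.mp hi)
        rw [hρ.support t i hw, hρ'.support t i hw]
    funext t
    rcases le_total t F.length with ht | ht
    · exact hs t ht
    · obtain ⟨d, rfl⟩ := Nat.exists_eq_add_of_le ht
      rw [hc ρ hρ, hc ρ' hρ', hs _ le_rfl]

instance finite_gradedRuling (F : Front) {p : ℕ} (μ : ℕ → ℕ → ZMod p) :
    Finite {ρ : ℕ → ℕ → ℕ // F.IsNormalRuling ρ ∧ F.IsGraded μ ρ} :=
  (F.finite_isGenRuling.subset fun _ h => h.1.toIsGenRuling).to_subtype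

/-- The `p`-graded ruling polynomial `∑ z ^ j(ρ)`, the sum being over all normal rulings that are
graded with respect to `μ`. -/
noncomputable def rulingPolynomial (F : Front) {p : ℕ} (μ : ℕ → ℕ → ZMod p) :
    LaurentPolynomial ℤ :=
  ∑ᶠ ρ : {ρ : ℕ → ℕ → ℕ // F.IsNormalRuling ρ ∧ F.IsGraded μ ρ},
    LaurentPolynomial.T (F.jIndex ρ.1)

end Front

/-! Call a pair of a ruling of S(K, L) thin if both of its strands lie over the same strand of K, or
both lie in the inserted copy of L. The bijection separates the thin pairs from the others: the thin
pairs of a ruling ρ make up τ, and the remaining strands, with their pairing, make up S(K, L^τ) and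
σ.

The main point is the rigidity of thin pairs. In the n-copy of a crossing of K, no strand of the
upper block is paired with one of the lower block, neither before nor after the crossing
(`grid_start`, `grid_end`), and normality then keeps thinly paired strands from switching
(`grid_switchOutside`). In the n-copy of a left cusp, the upper branch of each cusp switches at most
once (`rowUp_switch`), so that the ruling there is described by an involution π of the copies
(`exists_cuspState`): the copies j and π j are paired on both branches, with one switch where they
cross, and a copy with π j = j has its two branches paired with each other. Right cusps are
reflected left cusps. Hence the thin pairing of the n copies is carried along K (`thinAt_step`). It
could change only at the base point. At each vertical line, however, the number of strands of K with
a given thin pairing is even, so it does not change there either, and by connectedness it is the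
same everywhere (`labels_const`, `thinAt_const`). Therefore the thin pairs in the inserted copy of L
close up to a generalized ruling of L (`isGenRuling_patternRuling`).

Conversely, a generalized ruling τ of L prescribes flags on S(K, L), namely switches and paired
cusps, and thereby a partial ruling whose fixed strands form the front of S(K, L^τ)
(`run_flaggedSatellite`). Slice by slice, an extension of the partial ruling is a ruling if and only
if its restriction to the fixed strands is one (`rules_lift_iff`). The only additional condition is
normality at a switch between a moved and a fixed strand, which also involves σ. It is automatic
when σ has no thin pairs, because the companion of the fixed strand is then outside the inserted
pattern (`normality_of_window`). To have no thin pairs means to be reduced (`patternRuling_id_iff`,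
`isReduced_iff`), and it is also the condition that the thin pairs of the joined ruling are exactly
those of τ (`patternRuling_eq_iff`).

For j, a pair of copies of K contributes one switch at a left cusp, and one switch and two right
cusps at a right cusp; since K has as many left as right cusps, only j(τ) is left over
(`flagSum_flaggedSatellite`). For gradings, the potential is μ + η_i on the i-th copy, so the thin
pairs are graded exactly when τ is. At flagged switches the two strands then have equal potentials,
so the potential of S(K, L) restricts to that of S(K, L^τ) (`satellitePotential_kept`). A knot
oriented to the left at the base point is handled by reflecting L. A normal ruling τ of L leaves L^τ
empty, and pairing it with the empty ruling gives the inequality of coefficients. -/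

namespace Slice

/-! ### Slices: renumbering of strands, and normality as inequalities -/

theorem swap_val (k i : ℕ) :
    Equiv.swap k (k + 1) i = if i = k then k + 1 else if i = k + 1 then k else i :=
  Equiv.swap_apply_def ..

theorem swap_inj {k i j : ℕ} :
    Equiv.swap k (k + 1) i = Equiv.swap k (k + 1) j ↔ i = j :=
  (Equiv.swap k (k + 1)).injective.eq_iff

theorem disjoint_uIcc_iff (a b c d : ℕ) :
    Disjoint (Set.uIcc a b) (Set.uIcc c d) ↔ max a b < min c d ∨ max c d < min a b := by
  rw [Set.disjoint_left]
  constructor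
  · intro h
    by_contra hn
    -- The larger of the two lower ends lies in both intervals when neither interval is entirely
    -- below the other.
    have h1 := @h (max (min a b) (min c d)) (by rw [Set.mem_uIcc]; omega)
    apply h1
    rw [Set.mem_uIcc]; omega
  · intro h x hx hy
    rw [Set.mem_uIcc] at hx hy
    omega

theorem uIcc_subset_iff (a b c d : ℕ) :
    Set.uIcc a b ⊆ Set.uIcc c d ↔ min c d ≤ min a b ∧ max a b ≤ max c d := by
  rw [Set.uIcc_subset_uIcc_iff_le]

/-- In this form normality is a Boolean combination of linear inequalities, which `omega` can use.
-/
theorem normality_iff (k : ℕ) (f : ℕ → ℕ) : Normality k f ↔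
    (max k (f k) < min (k + 1) (f (k + 1)) ∨ max (k + 1) (f (k + 1)) < min k (f k)) ∨
    (f k ≠ k ∧ f (k + 1) ≠ k + 1 ∧
      ((min (k + 1) (f (k + 1)) ≤ min k (f k) ∧ max k (f k) ≤ max (k + 1) (f (k + 1))) ∨
       (min k (f k) ≤ min (k + 1) (f (k + 1)) ∧ max (k + 1) (f (k + 1)) ≤ max k (f k)))) := by
  unfold Normality
  rw [disjoint_uIcc_iff, uIcc_subset_iff, uIcc_subset_iff]

/-- Left inverse of `skip k`. -/
def unskip (k i : ℕ) : ℕ := if i < k then i else i - 2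

@[simp] theorem unskip_skip (k i : ℕ) : unskip k (skip k i) = i := by
  unfold unskip skip; split_ifs <;> omega

theorem skip_unskip {k i : ℕ} (h : i ≠ k) (h' : i ≠ k + 1) : skip k (unskip k i) = i := by
  unfold unskip skip; split_ifs <;> omega

theorem skip_ne (k i : ℕ) : skip k i ≠ k := by unfold skip; split_ifs <;> omega

theorem skip_ne' (k i : ℕ) : skip k i ≠ k + 1 := by unfold skip; split_ifs <;> omega

theorem skip_strictMono (k : ℕ) : StrictMono (skip k) := by
  intro i j h; unfold skip; split_ifs <;> omega

theorem skip_inj {k i j : ℕ} : skip k i = skip k j ↔ i = j :=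
  (skip_strictMono k).injective.eq_iff

/-- Insert two new strands `k`, `k + 1` into an involution, paired if `d` holds and fixed
otherwise. -/
def insertPair (k : ℕ) (d : Bool) (f : ℕ → ℕ) : ℕ → ℕ := fun i =>
  if i = k then (if d then k + 1 else k)
  else if i = k + 1 then (if d then k else k + 1) else skip k (f (unskip k i))

@[simp] theorem insertPair_skip (k : ℕ) (d : Bool) (f : ℕ → ℕ) (i : ℕ) :
    insertPair k d f (skip k i) = skip k (f i) := by
  simp [insertPair, skip_ne, skip_ne']

theorem insertPair_self (k : ℕ) (d : Bool) (f : ℕ → ℕ) :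
    insertPair k d f k = if d then k + 1 else k := by simp [insertPair]

theorem insertPair_succ (k : ℕ) (d : Bool) (f : ℕ → ℕ) :
    insertPair k d f (k + 1) = if d then k else k + 1 := by simp [insertPair]

theorem skip_cases (k i : ℕ) : i = k ∨ i = k + 1 ∨ ∃ j, i = skip k j := by
  by_cases h : i = k
  · exact Or.inl h
  by_cases h' : i = k + 1
  · exact Or.inr (Or.inl h')
  exact Or.inr (Or.inr ⟨unskip k i, (skip_unskip h h').symm⟩)

theorem insertPair_injective (k : ℕ) (d : Bool) : Function.Injective (insertPair k d) := by
  intro f g h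
  funext i
  have := congrFun h (skip k i)
  simpa [skip_inj] using this

end Slice

/-! ### Fixed points of an involution, and the involutions that extend it -/

/-- An involution of the strands `0, …, w - 1`, extended by the identity. -/
structure Pairing (w : ℕ) (f : ℕ → ℕ) : Prop where
  inv : Function.Involutive f
  supp : ∀ i, w ≤ i → f i = i

/-- The number of fixed points of `f` below `i`. -/
def fixCount (f : ℕ → ℕ) (i : ℕ) : ℕ := Nat.count (fun q => f q = q) i

/-- The `i`-th fixed point of `f`. -/
noncomputable def fixNth (f : ℕ → ℕ) (i : ℕ) : ℕ := Nat.nth (fun q => f q = q) i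

theorem fixCount_succ (f : ℕ → ℕ) (i : ℕ) :
    fixCount f (i + 1) = fixCount f i + if f i = i then 1 else 0 := Nat.count_succ _ _

theorem fixCount_mono (f : ℕ → ℕ) : Monotone (fixCount f) := Nat.count_monotone _

namespace Pairing

variable {w : ℕ} {f : ℕ → ℕ} (hf : Pairing w f)
include hf

theorem infinite : ({q | f q = q} : Set ℕ).Infinite :=
  (Set.Ici_infinite w).mono fun i hi => hf.supp i hi

theorem injective : Function.Injective f := hf.inv.injective

theorem lt_of_lt {i : ℕ} (h : i < w) : f i < w := by
  by_contra h'
  have := hf.supp (f i) (by omega)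
  rw [hf.inv i] at this
  omega

theorem fixNth_fixed (i : ℕ) : f (fixNth f i) = fixNth f i :=
  Nat.nth_mem_of_infinite hf.infinite i

theorem fixCount_fixNth (i : ℕ) : fixCount f (fixNth f i) = i :=
  Nat.count_nth_of_infinite hf.infinite i

theorem fixNth_strictMono : StrictMono (fixNth f) := Nat.nth_strictMono hf.infinite

theorem fixNth_inj {i j : ℕ} : fixNth f i = fixNth f j ↔ i = j :=
  hf.fixNth_strictMono.injective.eq_iff

theorem fixNth_lt {i j : ℕ} : fixNth f i < fixNth f j ↔ i < j :=
  hf.fixNth_strictMono.lt_iff_lt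

end Pairing

theorem fixNth_fixCount {f : ℕ → ℕ} {i : ℕ} (h : f i = i) : fixNth f (fixCount f i) = i :=
  Nat.nth_count h

theorem fixNth_fixCount_succ {f : ℕ → ℕ} {i : ℕ} (h : f i = i) (h' : f (i + 1) = i + 1) :
    fixNth f (fixCount f i + 1) = i + 1 := by
  have := fixNth_fixCount h'
  rwa [fixCount_succ, if_pos h] at this

/-- An increasing enumeration is determined by its range. The numbering of the fixed strands after a
slice is found by writing down a candidate and checking this criterion. -/
theorem fixNth_unique {w : ℕ} {g : ℕ → ℕ} (hg : Pairing w g) {s : ℕ → ℕ} (hs : StrictMono s)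
    (h1 : ∀ i, g (s i) = s i) (h2 : ∀ x, g x = x → ∃ i, s i = x) : fixNth g = s := by
  apply (hg.fixNth_strictMono.range_inj hs).1
  ext x
  constructor
  · rintro ⟨i, rfl⟩
    exact h2 _ (hg.fixNth_fixed i)
  · rintro ⟨i, rfl⟩
    exact ⟨_, fixNth_fixCount (h1 i)⟩

/-- `r` extends `f`, and on the fixed points of `f` it is given by `h`. -/
structure Lift (f h r : ℕ → ℕ) : Prop where
  fixed : ∀ i, r (fixNth f i) = fixNth f (h i)
  moved : ∀ x, f x ≠ x → r x = f x

/-- Extend `f` to its fixed points by `h`. -/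
noncomputable def join (f h : ℕ → ℕ) : ℕ → ℕ := fun i =>
  if f i = i then fixNth f (h (fixCount f i)) else f i

/-- The restriction of `r` to the fixed points of `f`. -/
noncomputable def restrict (f r : ℕ → ℕ) : ℕ → ℕ := fun j => fixCount f (r (fixNth f j))

theorem fixed_cases {f : ℕ → ℕ} (x : ℕ) : f x ≠ x ∨ ∃ i, x = fixNth f i := by
  by_cases h : f x = x
  · exact Or.inr ⟨_, (fixNth_fixCount h).symm⟩
  · exact Or.inl h

theorem Lift.ext_right {f h r r' : ℕ → ℕ} (h1 : Lift f h r) (h2 : Lift f h r') : r = r' := by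
  funext x
  rcases fixed_cases (f := f) x with hx | ⟨i, rfl⟩
  · rw [h1.moved x hx, h2.moved x hx]
  · rw [h1.fixed, h2.fixed]

section Lift

variable {w : ℕ} {f : ℕ → ℕ} (hf : Pairing w f)
include hf

theorem lift_join (h : ℕ → ℕ) : Lift f h (join f h) where
  fixed i := by rw [join, if_pos (hf.fixNth_fixed i), hf.fixCount_fixNth]
  moved x hx := by rw [join, if_neg hx]

/-- If `f` moved `r x`, then `r` would agree with `f` there, so that `f (r x) = r (r x) = x`, and
`f` would move `x` as well. -/
theorem fixed_of_extends {r : ℕ → ℕ} (hr : Function.Involutive r)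
    (h : ∀ x, f x ≠ x → r x = f x) {x : ℕ} (hx : f x = x) : f (r x) = r x := by
  by_contra hn
  have h1 := h _ hn
  rw [hr x] at h1
  have h2 := hf.inv (r x)
  rw [← h1, hx] at h2
  exact hn (by rw [← h2, hx])

theorem lift_restrict {r : ℕ → ℕ} (hr : Function.Involutive r)
    (h : ∀ x, f x ≠ x → r x = f x) : Lift f (restrict f r) r where
  fixed i := by
    rw [restrict, fixNth_fixCount (fixed_of_extends hf hr h (hf.fixNth_fixed i))]
  moved := h

theorem Lift.ext_left {h h' r : ℕ → ℕ} (h1 : Lift f h r) (h2 : Lift f h' r) : h = h' := by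
  funext i
  apply hf.fixNth_inj.1
  rw [← h1.fixed, h2.fixed]

theorem Lift.involutive {h r : ℕ → ℕ} (h1 : Lift f h r) (hh : Function.Involutive h) :
    Function.Involutive r := by
  intro x
  rcases fixed_cases (f := f) x with hx | ⟨i, rfl⟩
  · rw [h1.moved x hx, h1.moved _ (by rw [hf.inv]; exact hx.symm), hf.inv]
  · rw [h1.fixed, h1.fixed, hh]

theorem Lift.involutive_left {h r : ℕ → ℕ} (h1 : Lift f h r) (hr : Function.Involutive r) :
    Function.Involutive h := by
  intro i
  apply hf.fixNth_inj.1
  rw [← h1.fixed, ← h1.fixed, hr]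

theorem Lift.pairing {h r : ℕ → ℕ} (h1 : Lift f h r) (hh : Pairing (fixCount f w) h) :
    Pairing w r where
  inv := h1.involutive hf hh.inv
  supp i hi := by
    have h2 := fixNth_fixCount (hf.supp i hi)
    rw [← h2, h1.fixed, hh.supp _ (fixCount_mono f hi)]

theorem Lift.pairing_left {h r : ℕ → ℕ} (h1 : Lift f h r) (hr : Pairing w r) :
    Pairing (fixCount f w) h where
  inv := h1.involutive_left hf hr.inv
  supp i hi := by
    apply hf.fixNth_inj.1
    rw [← h1.fixed]
    apply hr.supp
    rw [← fixNth_fixCount (hf.supp w le_rfl)]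
    exact hf.fixNth_strictMono.monotone hi

/-- The place `w` is beyond the support and hence fixed; it is the fixed point with number `fixCount
f w`. -/
theorem fixNth_lt_width {i : ℕ} : fixNth f i < w ↔ i < fixCount f w := by
  conv_lhs => rw [← fixNth_fixCount (hf.supp w le_rfl)]
  exact hf.fixNth_lt

theorem Lift.fixedPointFree_iff {h r : ℕ → ℕ} (h1 : Lift f h r) :
    (∀ i < w, r i ≠ i) ↔ ∀ i < fixCount f w, h i ≠ i := by
  constructor
  · intro H i hi h2
    apply H (fixNth f i) ((fixNth_lt_width hf).2 hi)
    rw [h1.fixed, h2]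
  · intro H x hx
    rcases fixed_cases (f := f) x with h2 | ⟨i, rfl⟩
    · rwa [h1.moved _ h2]
    · rw [h1.fixed, Ne, hf.fixNth_inj]
      exact H i ((fixNth_lt_width hf).1 hx)

end Lift

/-! ### Partial rulings in one slice -/

namespace Slice

/-- A step of a partial ruling with involutions `f` and `g` at the two ends of the slice: the
strands fixed by `f` and `g` are disregarded, except that they have to be normal with respect to the
other strands.  The flag `d` says whether there is a switch at a crossing, and whether the branches
of a cusp are paired. -/
def PartialRules : Slice → Bool → (ℕ → ℕ) → (ℕ → ℕ) → Prop
  | triv, _, f, g => g = f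
  | cross k, d, f, g => f k ≠ k + 1 ∧
      ((d = false ∧ ∀ i, g (Equiv.swap k (k + 1) i) = Equiv.swap k (k + 1) (f i)) ∨
        (d = true ∧ g = f ∧ Normality k f ∧ ¬ (f k = k ∧ f (k + 1) = k + 1)))
  | lcusp k, d, f, g => g = insertPair k d f
  | rcusp k, d, f, g => f = insertPair k d g

/-- The part of a slice that consists of the fixed strands. -/
def restriction : Slice → Bool → (ℕ → ℕ) → Option Slice
  | triv, _, _ => none
  | cross k, _, f => if f k = k ∧ f (k + 1) = k + 1 then some (cross (fixCount f k)) else none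
  | lcusp k, d, f => if d then none else some (lcusp (fixCount f k))
  | rcusp k, d, f => if d then none else some (rcusp (fixCount f k))

/-- An adjacent transposition reverses the order of that one pair only. -/
theorem strictMono_swap_comp {k : ℕ} {e : ℕ → ℕ} (he : StrictMono e)
    (h : ∀ i j, ¬ (e i = k ∧ e j = k + 1)) :
    StrictMono fun i => Equiv.swap k (k + 1) (e i) := by
  intro i j hij
  have h1 := he hij
  have h2 := h i j
  simp only [swap_val]
  split_ifs <;> omega

/-- At most one of the two crossing strands is fixed, so the fixed strands keep their order, and the
crossing leaves no trace in their front. -/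
theorem fixNth_conj {w k : ℕ} {f g : ℕ → ℕ} (hf : Pairing w f) (hg : Pairing w g)
    (h : ∀ i, g (Equiv.swap k (k + 1) i) = Equiv.swap k (k + 1) (f i))
    (hn : ¬ (f k = k ∧ f (k + 1) = k + 1)) (i : ℕ) :
    fixNth g i = Equiv.swap k (k + 1) (fixNth f i) := by
  refine congrFun (fixNth_unique hg (strictMono_swap_comp hf.fixNth_strictMono ?_) ?_ ?_) i
  · rintro i j ⟨hi, hj⟩
    exact hn ⟨by rw [← hi, hf.fixNth_fixed], by rw [← hj, hf.fixNth_fixed]⟩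
  · intro i
    rw [h, hf.fixNth_fixed]
  · intro x hx
    have h1 := h (Equiv.swap k (k + 1) x)
    rw [Equiv.swap_apply_self, hx] at h1
    have h2 : f (Equiv.swap k (k + 1) x) = Equiv.swap k (k + 1) x := by
      conv_rhs => rw [h1, Equiv.swap_apply_self]
    exact ⟨_, by rw [fixNth_fixCount h2, Equiv.swap_apply_self]⟩

/-- At a crossing of two fixed strands, following the diagram and keeping the involution amount to
the same. This is why such a crossing never carries a flag. -/
theorem conj_eq_of_fixed {k : ℕ} {f g : ℕ → ℕ} (hf : Function.Involutive f)
    (h : ∀ i, g (Equiv.swap k (k + 1) i) = Equiv.swap k (k + 1) (f i))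
    (hk : f k = k) (hk' : f (k + 1) = k + 1) : g = f := by
  funext i
  have h1 := h (Equiv.swap k (k + 1) i)
  rw [Equiv.swap_apply_self] at h1
  rw [h1]
  by_cases h2 : i = k
  · subst h2; simp [hk, hk']
  by_cases h3 : i = k + 1
  · subst h3; simp [hk, hk']
  rw [Equiv.swap_apply_of_ne_of_ne h2 h3, Equiv.swap_apply_of_ne_of_ne]
  · intro h4; apply h2; rw [← hf i, h4, hk]
  · intro h4; apply h3; rw [← hf i, h4, hk']

theorem fixNth_swap {w k : ℕ} {f : ℕ → ℕ} (hf : Pairing w f)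
    (hk : f k = k) (hk' : f (k + 1) = k + 1) (i : ℕ) :
    fixNth f (Equiv.swap (fixCount f k) (fixCount f k + 1) i) =
      Equiv.swap k (k + 1) (fixNth f i) := by
  have h1 := fixNth_fixCount hk
  have h2 := fixNth_fixCount_succ hk hk'
  rw [hf.fixNth_strictMono.injective.map_swap, h1, h2]

theorem insertPair_pairing {w k : ℕ} {d : Bool} {f : ℕ → ℕ} (hf : Pairing w f) (hk : k ≤ w) :
    Pairing (w + 2) (insertPair k d f) where
  inv i := by
    rcases skip_cases k i with rfl | rfl | ⟨j, rfl⟩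
    · cases d <;> simp [insertPair_self, insertPair_succ]
    · cases d <;> simp [insertPair_self, insertPair_succ]
    · simp [hf.inv j]
  supp i hi := by
    rcases skip_cases k i with rfl | rfl | ⟨j, rfl⟩
    · omega
    · omega
    · rw [insertPair_skip, hf.supp]
      unfold skip at hi; split_ifs at hi <;> omega

theorem insertPair_fixed_skip {k i : ℕ} {d : Bool} {f : ℕ → ℕ} :
    insertPair k d f (skip k i) = skip k i ↔ f i = i := by
  rw [insertPair_skip, skip_inj]

theorem fixNth_insertPair_true {w k : ℕ} {f : ℕ → ℕ} (hf : Pairing w f) (hk : k ≤ w) (i : ℕ) :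
    fixNth (insertPair k true f) i = skip k (fixNth f i) := by
  refine congrFun (fixNth_unique (insertPair_pairing hf hk)
    ((skip_strictMono k).comp hf.fixNth_strictMono) ?_ ?_) i
  · intro i
    simp [hf.fixNth_fixed]
  · intro x hx
    rcases skip_cases k x with rfl | rfl | ⟨j, rfl⟩
    · simp [insertPair_self] at hx
    · simp [insertPair_succ] at hx
    · rw [insertPair_fixed_skip] at hx
      exact ⟨fixCount f j, congrArg (skip k) (fixNth_fixCount hx)⟩

theorem fixCount_insertPair (k : ℕ) (d : Bool) (f : ℕ → ℕ) :
    fixCount (insertPair k d f) k = fixCount f k := by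
  unfold fixCount
  rw [Nat.count_eq_card_filter_range, Nat.count_eq_card_filter_range]
  congr 1
  apply Finset.filter_congr
  intro x hx
  rw [Finset.mem_range] at hx
  have : x = skip k x := by simp [skip, hx]
  conv_lhs => rw [this]
  rw [insertPair_fixed_skip]

theorem fixNth_lt_iff {w k : ℕ} {f : ℕ → ℕ} (hf : Pairing w f) (i : ℕ) :
    fixNth f i < k ↔ i < fixCount f k := by
  rw [← not_le, ← not_le]
  exact (Nat.count_le_iff_le_nth hf.infinite).symm.not

/-- The two new fixed strands come directly after the fixed strands above place `k`. In the
numbering of the fixed strands the cusp is therefore at place `fixCount f k`. -/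
theorem fixNth_insertPair_false {w k : ℕ} {f : ℕ → ℕ} (hf : Pairing w f) (hk : k ≤ w) :
    fixNth (insertPair k false f) (fixCount f k) = k ∧
    fixNth (insertPair k false f) (fixCount f k + 1) = k + 1 ∧
    ∀ i, fixNth (insertPair k false f) (skip (fixCount f k) i) = skip k (fixNth f i) := by
  have hg := insertPair_pairing (d := false) hf hk
  have h0 : insertPair k false f k = k := by simp [insertPair_self]
  have h0' : insertPair k false f (k + 1) = k + 1 := by simp [insertPair_succ]
  generalize hc : fixCount f k = c
  have hlt : ∀ i, i < c → fixNth f i < k := fun i h => (fixNth_lt_iff hf i).2 (by omega)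
  have hge : ∀ i, c ≤ i → k ≤ fixNth f i := fun i h => by
    have := (fixNth_lt_iff (k := k) hf i).not; omega
  have hmono : ∀ i j, i < j → fixNth f i < fixNth f j := fun i j h => hf.fixNth_strictMono h
  have key : fixNth (insertPair k false f) = fun j => if j < c then fixNth f j
      else if j = c then k else if j = c + 1 then k + 1 else skip k (fixNth f (j - 2)) := by
    apply fixNth_unique hg
    · intro i j hij
      have h1 := hlt i
      have h2 := hlt j
      have h3 := hge (i - 2)
      have h4 := hge (j - 2)
      have h5 := hmono i j
      have h6 := hmono (i - 2) (j - 2)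
      simp only [skip]
      split_ifs <;> omega
    · intro i
      split_ifs with h1 h2 h3
      · have : fixNth f i = skip k (fixNth f i) := by simp [skip, hlt i h1]
        rw [this, insertPair_fixed_skip, hf.fixNth_fixed]
      · exact h0
      · exact h0'
      · rw [insertPair_fixed_skip, hf.fixNth_fixed]
    · intro x hx
      rcases skip_cases k x with rfl | rfl | ⟨j, rfl⟩
      · exact ⟨c, by simp⟩
      · exact ⟨c + 1, by simp⟩
      · rw [insertPair_fixed_skip] at hx
        by_cases h : fixCount f j < c
        · refine ⟨fixCount f j, ?_⟩
          have := hlt _ h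
          rw [fixNth_fixCount hx] at this
          simp [h, fixNth_fixCount hx, skip, this]
        · refine ⟨fixCount f j + 2, ?_⟩
          have h1 : ¬ fixCount f j + 2 < c := by omega
          have h2 : ¬ fixCount f j + 2 = c := by omega
          have h3 : ¬ fixCount f j + 2 = c + 1 := by omega
          simp only [h1, h2, h3, if_false, Nat.add_sub_cancel, fixNth_fixCount hx]
  rw [key]
  refine ⟨by simp, by simp, fun i => ?_⟩
  have h1 := hlt i
  unfold skip
  by_cases h : i < c
  · simp [h, h1 h]
  · have h2 : ¬ i + 2 < c := by omega
    have h3 : ¬ i + 2 = c := by omega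
    have h4 : ¬ i + 2 = c + 1 := by omega
    have h5 := hge i (by omega)
    simp only [h, h2, h3, h4, if_false, Nat.add_sub_cancel]

/-- Reversing a crossing at which the involution is conjugated. -/
theorem conj_symm {k : ℕ} {f g : ℕ → ℕ} (hf : Function.Involutive f) (h1 : f k ≠ k + 1)
    (h2 : ∀ i, g (Equiv.swap k (k + 1) i) = Equiv.swap k (k + 1) (f i)) :
    g k ≠ k + 1 ∧ ∀ i, f (Equiv.swap k (k + 1) i) = Equiv.swap k (k + 1) (g i) := by
  refine ⟨fun h3 => h1 ?_, fun i => ?_⟩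
  · have h4 := h2 (k + 1)
    rw [Equiv.swap_apply_right, h3] at h4
    have h5 := congrArg (Equiv.swap k (k + 1)) h4
    rw [Equiv.swap_apply_self, Equiv.swap_apply_right] at h5
    have h6 := hf (k + 1)
    rw [← h5] at h6
    exact h6
  · have h4 := h2 (Equiv.swap k (k + 1) i)
    rw [Equiv.swap_apply_self] at h4
    rw [h4, Equiv.swap_apply_self]

/-- The conditions are symmetric in the two ends of the slice, with left and right cusps
interchanged. In this way right cusps are reduced to left cusps throughout. -/
theorem PartialRules.mirror {s : Slice} {d : Bool} {f g : ℕ → ℕ} (hf : Function.Involutive f)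
    (h : s.PartialRules d f g) : s.mirror.PartialRules d g f := by
  cases s with
  | triv => exact Eq.symm h
  | cross k =>
    obtain ⟨h1, ⟨rfl, h2⟩ | ⟨rfl, rfl, h2⟩⟩ := h
    · exact ⟨(conj_symm hf h1 h2).1, Or.inl ⟨rfl, (conj_symm hf h1 h2).2⟩⟩
    · exact ⟨h1, Or.inr ⟨rfl, rfl, h2⟩⟩
  | lcusp k => exact h
  | rcusp k => exact h

theorem Rules.mirror {s : Slice} {f g : ℕ → ℕ} (hf : Function.Involutive f)
    (h : s.Rules f g) : s.mirror.Rules g f := by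
  cases s with
  | triv => exact Eq.symm h
  | cross k =>
    obtain ⟨h1, h2 | ⟨rfl, h2⟩⟩ := h
    · exact ⟨(conj_symm hf h1 h2).1, Or.inl (conj_symm hf h1 h2).2⟩
    · exact ⟨h1, Or.inr ⟨rfl, h2⟩⟩
  | lcusp k => exact h
  | rcusp k => exact h

end Slice

/-! ### Lifting and restricting the ruling conditions in one slice -/

namespace Slice

variable {w w' : ℕ} {f g h h' r r' : ℕ → ℕ}

/-- Either the strand `k` is moved and keeps its companion under `f`, or it is fixed and `r` sends
it to a fixed strand, which `k + 1` is not. -/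
theorem lift_cross_ne {k : ℕ} (hf : Pairing w f) (hl : Lift f h r) (h1 : f k ≠ k + 1)
    (hn : ¬ (f k = k ∧ f (k + 1) = k + 1)) : r k ≠ k + 1 := by
  rcases fixed_cases (f := f) k with hx | ⟨i, hi⟩
  · rwa [hl.moved _ hx]
  · intro h2
    have h3 : r k = fixNth f (h i) := by rw [← hl.fixed, ← hi]
    apply hn
    rw [← h2, h3, hf.fixNth_fixed, hi, hf.fixNth_fixed]
    exact ⟨rfl, rfl⟩

/-- At a crossing that involves a moved strand, `r` has no switch if `f` has none. -/
theorem lift_ne_of_conj {k : ℕ} (hf : Pairing w f) (hr : Function.Injective r)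
    (hl : Lift f h r) (hl' : Lift g h' r') (h1 : f k ≠ k + 1)
    (h2 : ∀ i, g (Equiv.swap k (k + 1) i) = Equiv.swap k (k + 1) (f i))
    (hn : ¬ (f k = k ∧ f (k + 1) = k + 1)) : r' ≠ r := by
  -- A moved strand at the crossing has its companion away from the crossing. It changes places and
  -- keeps the companion, so a single map in the role of both extensions would take the same value
  -- at `k` and at `k + 1`.
  rintro rfl
  have h1' : f (k + 1) ≠ k := fun h3 => h1 (by conv_lhs => rw [← h3, hf.inv])
  by_cases hk : f k = k
  · have hk' : f (k + 1) ≠ k + 1 := fun h3 => hn ⟨hk, h3⟩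
    have h3 := h2 (k + 1)
    rw [Equiv.swap_apply_right, Equiv.swap_apply_of_ne_of_ne h1' hk'] at h3
    have h4 := hl.moved _ hk'
    have h5 := hl'.moved k (by rw [h3]; exact h1')
    rw [h3, ← h4] at h5
    have := hr h5
    omega
  · have h3 := h2 k
    rw [Equiv.swap_apply_left, Equiv.swap_apply_of_ne_of_ne hk h1] at h3
    have h4 := hl.moved _ hk
    have h5 := hl'.moved (k + 1) (by rw [h3]; exact h1)
    rw [h3, ← h4] at h5
    have := hr h5
    omega

/-- At a crossing that involves a moved strand, `r` has a switch if `f` has one. -/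
theorem lift_not_conj {k : ℕ} (hf : Pairing w f) (hr : Function.Injective r')
    (hl : Lift f h r) (hl' : Lift f h' r') (h1 : f k ≠ k + 1)
    (hn : ¬ (f k = k ∧ f (k + 1) = k + 1)) :
    ¬ ∀ i, r' (Equiv.swap k (k + 1) i) = Equiv.swap k (k + 1) (r i) := by
  -- Dually, a moved place of the crossing keeps its companion under both extensions, while
  -- following the diagram would hand this companion to the other place, against injectivity.
  intro h2
  have h1' : f (k + 1) ≠ k := fun h3 => h1 (by conv_lhs => rw [← h3, hf.inv])
  by_cases hk : f k = k
  · have hk' : f (k + 1) ≠ k + 1 := fun h3 => hn ⟨hk, h3⟩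
    have h3 := h2 (k + 1)
    rw [hl.moved _ hk', Equiv.swap_apply_right, Equiv.swap_apply_of_ne_of_ne h1' hk',
      ← hl'.moved _ hk'] at h3
    have := hr h3
    omega
  · have h3 := h2 k
    rw [hl.moved _ hk, Equiv.swap_apply_left, Equiv.swap_apply_of_ne_of_ne hk h1,
      ← hl'.moved _ hk] at h3
    have := hr h3
    omega

/-- Moved strands follow the partial ruling, and fixed strands keep their numbers through the
crossing, so the common `h` pairs the same strands on both sides. -/
theorem lift_conj {k : ℕ} (hf : Pairing w f) (hg : Pairing w g)
    (hl : Lift f h r) (hl' : Lift g h r')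
    (h2 : ∀ i, g (Equiv.swap k (k + 1) i) = Equiv.swap k (k + 1) (f i))
    (hn : ¬ (f k = k ∧ f (k + 1) = k + 1)) (i : ℕ) :
    r' (Equiv.swap k (k + 1) i) = Equiv.swap k (k + 1) (r i) := by
  rcases fixed_cases (f := f) i with hx | ⟨i, rfl⟩
  · rw [hl.moved _ hx, hl'.moved, h2]
    rw [h2, Ne, swap_inj]; exact hx
  · rw [hl.fixed, ← fixNth_conj hf hg h2 hn, ← fixNth_conj hf hg h2 hn, hl'.fixed]

/-- Normality only compares places, and the numbering of the fixed strands preserves their order. -/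
theorem normality_lift_iff {c : ℕ} {k : ℕ} (hf : Pairing w f) (hl : Lift f h r)
    (hk : f k = k) (hk' : f (k + 1) = k + 1) (hc : fixCount f k = c) :
    Normality k r ↔ Normality c h := by
  have e1 : fixNth f c = k := by rw [← hc, fixNth_fixCount hk]
  have e2 : fixNth f (c + 1) = k + 1 := by rw [← hc, fixNth_fixCount_succ hk hk']
  have r1 : r k = fixNth f (h c) := by rw [← e1, hl.fixed]
  have r2 : r (k + 1) = fixNth f (h (c + 1)) := by rw [← e2, hl.fixed]
  rw [normality_iff, normality_iff, r1, r2]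
  have m1 := hf.fixNth_lt (i := h c) (j := c)
  have m2 := hf.fixNth_lt (i := h c) (j := c + 1)
  have m3 := hf.fixNth_lt (i := h (c + 1)) (j := c)
  have m4 := hf.fixNth_lt (i := h (c + 1)) (j := c + 1)
  have m5 := hf.fixNth_lt (i := h (c + 1)) (j := h c)
  have m6 := hf.fixNth_lt (i := h c) (j := h (c + 1))
  have m7 := hf.fixNth_inj (i := h c) (j := c)
  have m8 := hf.fixNth_inj (i := h (c + 1)) (j := c + 1)
  have m9 := hf.fixNth_inj (i := h c) (j := c + 1)
  have m10 := hf.fixNth_inj (i := h (c + 1)) (j := c)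
  rw [e1] at m1 m3 m7 m10
  rw [e2] at m2 m4 m8 m9
  generalize fixNth f (h c) = A at *
  generalize fixNth f (h (c + 1)) = B at *
  omega

/-- A cusp whose branches are paired by the partial ruling is invisible to the fixed strands.
Otherwise its branches are two adjacent fixed strands, and a left cusp remains. -/
theorem lift_lcusp_rules {k : ℕ} {d : Bool} (hf : Pairing w f) (hk : k ≤ w)
    (hl : Lift f h r) (hl' : Lift (insertPair k d f) h' r') :
    (lcusp k).Rules r r' ↔ (((lcusp k).restriction d f).getD triv).Rules h h' := by
  have hg := insertPair_pairing (d := d) hf hk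
  cases d with
  | true =>
    show r' k = k + 1 ∧ (∀ i, r' (skip k i) = skip k (r i)) ↔ h' = h
    have h1 : r' k = k + 1 := by
      rw [hl'.moved, insertPair_self] <;> simp [insertPair_self]
    have e := fixNth_insertPair_true hf hk
    constructor
    · rintro ⟨-, h2⟩
      funext i
      rw [← hg.fixNth_inj, ← hl'.fixed, e, h2, hl.fixed, e]
    · rintro rfl
      refine ⟨h1, fun i => ?_⟩
      rcases fixed_cases (f := f) i with hx | ⟨i, rfl⟩
      · rw [hl.moved _ hx, hl'.moved, insertPair_skip]
        rw [Ne, insertPair_fixed_skip]; exact hx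
      · rw [hl.fixed, ← e, ← e, hl'.fixed]
  | false =>
    obtain ⟨e1, e2, e3⟩ := fixNth_insertPair_false hf hk
    show r' k = k + 1 ∧ (∀ i, r' (skip k i) = skip k (r i)) ↔
      h' (fixCount f k) = fixCount f k + 1 ∧
        ∀ i, h' (skip (fixCount f k) i) = skip (fixCount f k) (h i)
    apply and_congr
    · rw [← hg.fixNth_inj (i := h' _), ← hl'.fixed, e1, e2]
    · constructor
      · intro h2 i
        rw [← hg.fixNth_inj, ← hl'.fixed, e3, h2, hl.fixed, e3]
      · intro h2 i
        rcases fixed_cases (f := f) i with hx | ⟨i, rfl⟩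
        · rw [hl.moved _ hx, hl'.moved, insertPair_skip]
          rw [Ne, insertPair_fixed_skip]; exact hx
        · rw [hl.fixed, ← e3, ← e3, hl'.fixed, h2]

theorem Lift.eq_iff (hf : Pairing w f) (hl : Lift f h r) (hl' : Lift f h' r') :
    r' = r ↔ h' = h := by
  constructor
  · rintro rfl; exact hl'.ext_left hf hl
  · rintro rfl; exact hl'.ext_right hl

theorem PartialRules.eq_of_fixed {k : ℕ} {d : Bool} (hf : Pairing w f)
    (hp : (cross k).PartialRules d f g) (hn : f k = k ∧ f (k + 1) = k + 1) : g = f ∧ d = false := by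
  obtain ⟨h1, h2 | h2⟩ := hp
  · exact ⟨conj_eq_of_fixed hf.inv h2.2 hn.1 hn.2, h2.1⟩
  · exact absurd hn h2.2.2.2

/-- The involutions `r` and `r'` that are composed of `f`, `h` and `g`, `h'` satisfy the conditions
of a normal ruling in a slice if and only if `h` and `h'` do so in its restriction to the fixed
strands. -/
theorem rules_lift_iff {s : Slice} {d : Bool} (hf : Pairing w f) (hok : s.Ok w)
    (hg : Pairing (s.out w) g) (hp : s.PartialRules d f g)
    (hr : Function.Involutive r) (hr' : Function.Involutive r')
    (hl : Lift f h r) (hl' : Lift g h' r')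
    (hside : ∀ k, s = cross k → d = true → (f k = k ∨ f (k + 1) = k + 1) →
      h' = h → Normality k r) :
    s.Rules r r' ↔ ((s.restriction d f).getD triv).Rules h h' := by
  cases s with
  | triv =>
    obtain rfl : g = f := hp
    exact Lift.eq_iff hf hl hl'
  | cross k =>
    by_cases hn : f k = k ∧ f (k + 1) = k + 1
    · obtain ⟨rfl, -⟩ := hp.eq_of_fixed hf hn
      obtain ⟨hk, hk'⟩ := hn
      simp only [restriction, hk, hk', and_self, if_true, Option.getD_some]
      have e1 : fixNth g (fixCount g k) = k := fixNth_fixCount hk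
      have e2 : fixNth g (fixCount g k + 1) = k + 1 := fixNth_fixCount_succ hk hk'
      have hne : r k ≠ k + 1 ↔ h (fixCount g k) ≠ fixCount g k + 1 := by
        rw [Ne, Ne, ← hf.fixNth_inj (i := h _), ← hl.fixed, e1, e2]
      have hsw : (∀ i, r' (Equiv.swap k (k + 1) i) = Equiv.swap k (k + 1) (r i)) ↔
          ∀ i, h' (Equiv.swap (fixCount g k) (fixCount g k + 1) i) =
            Equiv.swap (fixCount g k) (fixCount g k + 1) (h i) := by
        constructor
        · intro h3 i
          rw [← hf.fixNth_inj, ← hl'.fixed, fixNth_swap hf hk hk', h3, hl.fixed,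
            fixNth_swap hf hk hk']
        · intro h3 i
          rcases fixed_cases (f := g) i with hx | ⟨i, rfl⟩
          · have n1 : i ≠ k := by rintro rfl; exact hx hk
            have n2 : i ≠ k + 1 := by rintro rfl; exact hx hk'
            have n3 : g i ≠ k := by intro h4; apply n1; rw [← hf.inv i, h4, hk]
            have n4 : g i ≠ k + 1 := by intro h4; apply n2; rw [← hf.inv i, h4, hk']
            rw [Equiv.swap_apply_of_ne_of_ne n1 n2, hl.moved _ hx, hl'.moved _ hx,
              Equiv.swap_apply_of_ne_of_ne n3 n4]
          · rw [hl.fixed, ← fixNth_swap hf hk hk', ← fixNth_swap hf hk hk', hl'.fixed, h3]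
      show r k ≠ k + 1 ∧ _ ↔ h _ ≠ _ ∧ _
      rw [hne, hsw, Lift.eq_iff hf hl hl', normality_lift_iff hf hl hk hk' rfl]
    · have h1 := hp.1
      have h2 := hp.2
      have hne := lift_cross_ne hf hl h1 hn
      simp only [restriction, hn, if_false, Option.getD_none]
      show r k ≠ k + 1 ∧ _ ↔ h' = h
      rcases h2 with ⟨rfl, h2⟩ | ⟨rfl, rfl, h2, -⟩
      · constructor
        · rintro ⟨-, h3 | ⟨h3, -⟩⟩
          · funext i
            rw [← hg.fixNth_inj, ← hl'.fixed]
            refine Eq.trans ?_ (fixNth_conj hf hg h2 hn _).symm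
            rw [fixNth_conj hf hg h2 hn, h3, hl.fixed]
          · exact absurd h3 (lift_ne_of_conj hf hr.injective hl hl' h1 h2 hn)
        · rintro rfl
          exact ⟨hne, Or.inl (lift_conj hf hg hl hl' h2 hn)⟩
      · constructor
        · rintro ⟨-, h3 | ⟨rfl, -⟩⟩
          · exact absurd h3 (lift_not_conj hf hr'.injective hl hl' h1 hn)
          · exact hl'.ext_left hf hl
        · rintro rfl
          refine ⟨hne, Or.inr ⟨hl'.ext_right hl, ?_⟩⟩
          -- At a switch between two moved strands, normality only concerns the partial ruling. If
          -- one of the strands is fixed, its companion is known to `r` alone, and `hside` has to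
          -- supply normality.
          by_cases h3 : g k = k ∨ g (k + 1) = k + 1
          · exact hside k rfl rfl h3 rfl
          · push Not at h3
            unfold Normality at *
            rwa [hl.moved _ h3.1, hl.moved _ h3.2]
  | lcusp k =>
    obtain rfl : g = insertPair k d f := hp
    exact lift_lcusp_rules hf hok hl hl'
  | rcusp k =>
    obtain rfl : f = insertPair k d g := hp
    have h1 : k ≤ w - 2 := by simp only [Ok] at hok; omega
    have := lift_lcusp_rules hg h1 hl' hl
    cases d with
    | true => exact this.trans ⟨Eq.symm, Eq.symm⟩
    | false =>
      simp only [restriction, fixCount_insertPair] at this ⊢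
      exact this

/-- The contribution of a slice to `j`. -/
noncomputable def jTerm : Slice → (ℕ → ℕ) → (ℕ → ℕ) → ℤ
  | cross k, f, g => open Classical in if g = f ∧ ¬ (f k = k ∧ f (k + 1) = k + 1) then 1 else 0
  | rcusp _, _, _ => -1
  | _, _, _ => 0

/-- The contribution of a slice of a partial ruling to `j`. -/
def partialJTerm : Slice → Bool → ℤ
  | cross _, d => if d then 1 else 0
  | rcusp _, d => if d then -1 else 0
  | _, _ => 0

open Classical in
theorem jTerm_cross_of_ne {k : ℕ} (h : f k ≠ k) :
    (cross k).jTerm f g = if g = f then 1 else 0 :=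
  if_congr (and_iff_left fun h' => h h'.1) rfl rfl

/-- A moved strand at the crossing forces every extension to switch exactly where the partial ruling
does. -/
theorem switch_iff_of_not_fixed {k : ℕ} {d : Bool} (hf : Pairing w f)
    (hp : (cross k).PartialRules d f g) (hru : (cross k).Rules r r')
    (hr : Function.Involutive r) (hr' : Function.Involutive r')
    (hl : Lift f h r) (hl' : Lift g h' r') (hn : ¬ (f k = k ∧ f (k + 1) = k + 1)) :
    r' = r ↔ d = true := by
  obtain ⟨h1, ⟨rfl, h2⟩ | ⟨rfl, rfl, h2, -⟩⟩ := hp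
  · simp [lift_ne_of_conj hf hr.injective hl hl' h1 h2 hn]
  · have := lift_not_conj hf hr'.injective hl hl' h1 hn
    simp only [iff_true]
    exact (hru.2.resolve_left this).1

/-- Every switch or right cusp is either seen by the partial ruling and counted by its flag, or it
remains in the front of the fixed strands. -/
theorem jTerm_lift {s : Slice} {d : Bool} (hf : Pairing w f) (hp : s.PartialRules d f g)
    (hru : s.Rules r r') (hr : Function.Involutive r) (hr' : Function.Involutive r')
    (hl : Lift f h r) (hl' : Lift g h' r') (hff : ∀ k, s = cross k → r k ≠ k) :
    s.jTerm r r' = s.partialJTerm d + ((s.restriction d f).getD triv).jTerm h h' := by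
  cases s with
  | triv => rfl
  | lcusp k => cases d <;> rfl
  | rcusp k => cases d <;> rfl
  | cross k =>
    have hff := hff k rfl
    rw [jTerm_cross_of_ne hff]
    simp only [partialJTerm, restriction]
    by_cases hn : f k = k ∧ f (k + 1) = k + 1
    · obtain ⟨rfl, rfl⟩ := hp.eq_of_fixed hf hn
      have h3 : h (fixCount g k) ≠ fixCount g k := by
        rw [Ne, ← hf.fixNth_inj, ← hl.fixed, fixNth_fixCount hn.1]; exact hff
      simp only [hn, and_self, if_true, Option.getD_some, jTerm_cross_of_ne h3,
        Bool.false_eq_true, if_false, zero_add]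
      classical
      exact if_congr (Lift.eq_iff hf hl hl') rfl rfl
    · simp [hn, jTerm, switch_iff_of_not_fixed hf hp hru hr hr' hl hl' hn]

theorem fixCount_lcusp {k : ℕ} {d : Bool} (hf : Pairing w f) (hk : k ≤ w) :
    fixCount (insertPair k d f) (w + 2) =
      (((lcusp k).restriction d f).getD triv).out (fixCount f w) := by
  have hg := insertPair_pairing (d := d) hf hk
  have hw : skip k w = w + 2 := by simp [skip, not_lt.2 hk]
  have h0 := fixNth_fixCount (hf.supp w le_rfl)
  cases d with
  | true =>
    have := fixNth_insertPair_true hf hk (fixCount f w)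
    rw [h0, hw] at this
    rw [← this, hg.fixCount_fixNth]; rfl
  | false =>
    have := (fixNth_insertPair_false hf hk).2.2 (fixCount f w)
    rw [h0, hw] at this
    rw [← this, hg.fixCount_fixNth]
    simp [restriction, out, skip, not_lt.2 (fixCount_mono f hk)]

theorem fixCount_cross {k : ℕ} (hf : Pairing w f) (hg : Pairing w g) (hk : k + 1 < w)
    (hn : ¬ (f k = k ∧ f (k + 1) = k + 1))
    (h : ∀ i, g (Equiv.swap k (k + 1) i) = Equiv.swap k (k + 1) (f i)) :
    fixCount g w = fixCount f w := by
  have h1 := fixNth_conj hf hg h hn (fixCount f w)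
  rw [fixNth_fixCount (hf.supp w le_rfl),
    Equiv.swap_apply_of_ne_of_ne (by omega) (by omega)] at h1
  conv_lhs => rw [← h1, hg.fixCount_fixNth]

theorem fixCount_out {s : Slice} {d : Bool} (hf : Pairing w f) (hok : s.Ok w)
    (hg : Pairing (s.out w) g) (hp : s.PartialRules d f g) :
    fixCount g (s.out w) = ((s.restriction d f).getD triv).out (fixCount f w) := by
  cases s with
  | triv => obtain rfl : g = f := hp; rfl
  | cross k =>
    have h3 : ((restriction (cross k) d f).getD triv).out (fixCount f w) = fixCount f w := by
      simp only [restriction]; split_ifs <;> rfl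
    rw [h3]
    by_cases hn : f k = k ∧ f (k + 1) = k + 1
    · rw [(hp.eq_of_fixed hf hn).1]; rfl
    · obtain ⟨h1, ⟨rfl, h2⟩ | ⟨rfl, rfl, h2, -⟩⟩ := hp
      · exact fixCount_cross hf hg hok hn h2
      · rfl
  | lcusp k =>
    obtain rfl : g = insertPair k d f := hp
    exact fixCount_lcusp hf hok
  | rcusp k =>
    obtain rfl : f = insertPair k d g := hp
    simp only [Ok] at hok
    have h1 : k ≤ w - 2 := by omega
    obtain ⟨v, rfl⟩ : ∃ v, w = v + 2 := ⟨w - 2, by omega⟩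
    have h2 : fixCount _ (v + 2) = _ := fixCount_lcusp (d := d) hg h1
    rw [h2]
    cases d <;> simp [restriction, out]

/-- At a switch with one fixed strand, that strand stays at its place, whereas labels travel along
the diagram. Carrying commutes with restriction there because `hμ` makes the two labels equal. -/
theorem carry_restriction {A : Type*} [AddGroupWithOne A] {s : Slice} {d : Bool}
    (hf : Pairing w f) (hok : s.Ok w)
    (hg : Pairing (s.out w) g) (hp : s.PartialRules d f g) (a : A) (μ : ℕ → A)
    (hμ : ∀ k, s = cross k → d = true → μ k = μ (k + 1)) (i : ℕ) :
    s.carry a μ (fixNth g i) =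
      ((s.restriction d f).getD triv).carry a (fun j => μ (fixNth f j)) i := by
  have skip_carry : ∀ (k x : ℕ) (μ : ℕ → A), (lcusp k).carry a μ (skip k x) = μ x := by
    intro k x μ
    simp only [carry, skip]
    split_ifs <;> first | omega | rfl
  cases s with
  | triv => obtain rfl : g = f := hp; rfl
  | cross k =>
    by_cases hn : f k = k ∧ f (k + 1) = k + 1
    · obtain ⟨rfl, rfl⟩ := hp.eq_of_fixed hf hn
      simp only [restriction, hn.1, hn.2, and_self, if_true, Option.getD_some, carry]
      rw [fixNth_swap hf hn.1 hn.2]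
    · simp only [restriction, hn, if_false, Option.getD_none, carry]
      obtain ⟨h1, ⟨rfl, h2⟩ | ⟨rfl, rfl, h2, -⟩⟩ := hp
      · rw [fixNth_conj hf hg h2 hn, Equiv.swap_apply_self]
      · rw [swap_val]
        have := hμ k rfl rfl
        split_ifs with h3 h4
        · rw [h3, this]
        · rw [h4, this]
        · rfl
  | lcusp k =>
    obtain rfl : g = insertPair k d f := hp
    cases d with
    | true =>
      rw [fixNth_insertPair_true hf hok, skip_carry]
      rfl
    | false =>
      obtain ⟨e1, e2, e3⟩ := fixNth_insertPair_false hf hok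
      show _ = (lcusp (fixCount f k)).carry a _ i
      rcases skip_cases (fixCount f k) i with rfl | rfl | ⟨j, rfl⟩
      · rw [e1]; simp [carry]
      · rw [e2]; simp [carry]
      · rw [e3, skip_carry, skip_carry]
  | rcusp k =>
    obtain rfl : f = insertPair k d g := hp
    have h1 : k ≤ w - 2 := by simp only [Ok] at hok; omega
    cases d with
    | true =>
      show μ (skip k (fixNth g i)) = μ (fixNth (insertPair k true g) i)
      rw [fixNth_insertPair_true hg h1]
    | false =>
      simp only [restriction, fixCount_insertPair, carry]
      show _ = μ (fixNth (insertPair k false g) (skip (fixCount g k) i))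
      rw [(fixNth_insertPair_false hg h1).2.2]

end Slice

/-! ### Partial rulings of a front, and the normal rulings that extend them -/

namespace Front

theorem slice_of_le (F : Front) {t : ℕ} (h : F.length ≤ t) : F.slice t = Slice.triv :=
  List.getD_eq_default _ _ h

theorem slice_of_lt (F : Front) {t : ℕ} (h : t < F.length) : F.slice t = F.word[t]'h :=
  List.getD_eq_getElem _ _ h

theorem width_zero (F : Front) : F.width 0 = F.left := rfl

theorem width_succ (F : Front) (t : ℕ) : F.width (t + 1) = (F.slice t).out (F.width t) := by
  unfold width
  by_cases h : t < F.length
  · rw [List.take_add_one, F.slice_of_lt h, List.getElem?_eq_getElem h, List.foldl_append]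
    rfl
  · rw [F.slice_of_le (by omega), List.take_of_length_le (by unfold length at h; omega),
      List.take_of_length_le (by unfold length at h; omega)]
    rfl

theorem width_of_le (F : Front) {t : ℕ} (h : F.length ≤ t) : F.width t = F.width F.length := by
  induction t, h using Nat.le_induction with
  | base => rfl
  | succ t h ih => rw [width_succ, F.slice_of_le h, ← ih]; rfl

theorem IsGenRuling.pairing {F : Front} {ρ : ℕ → ℕ → ℕ} (h : F.IsGenRuling ρ) (t : ℕ) :
    Pairing (F.width t) (ρ t) :=
  ⟨h.involutive t, h.support t⟩

theorem IsGenRuling.of_le {F : Front} {ρ : ℕ → ℕ → ℕ} (h : F.IsGenRuling ρ) {t : ℕ}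
    (ht : F.length ≤ t) : ρ t = ρ F.length := by
  induction t, ht using Nat.le_induction with
  | base => rfl
  | succ t ht ih =>
    have := h.rules t
    rw [F.slice_of_le ht] at this
    exact Eq.trans this ih

theorem pairing_zero {f : ℕ → ℕ} (h : Pairing 0 f) : f = id := funext fun i => h.supp i i.zero_le

open Classical in
theorem ncard_lt_eq_sum (n : ℕ) (P : ℕ → Prop) :
    (Set.ncard {t | t < n ∧ P t} : ℤ) = ∑ t ∈ Finset.range n, if P t then 1 else 0 := by
  have h : {t | t < n ∧ P t} = ↑((Finset.range n).filter P) := by ext; simp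
  rw [h, Set.ncard_coe_finset, Finset.card_filter]
  push_cast
  rfl

theorem jIndex_eq_sum (F : Front) (ρ : ℕ → ℕ → ℕ) :
    F.jIndex ρ = ∑ t ∈ Finset.range F.length, (F.slice t).jTerm (ρ t) (ρ (t + 1)) := by
  classical
  unfold jIndex
  rw [ncard_lt_eq_sum, ncard_lt_eq_sum, ← Finset.sum_sub_distrib]
  refine Finset.sum_congr rfl fun t _ => ?_
  unfold IsSwitch
  cases F.slice t with
  | triv => simp [Slice.jTerm]
  | lcusp k => simp [Slice.jTerm]
  | rcusp k => simp [Slice.jTerm]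
  | cross k =>
    simp only [Slice.cross.injEq, exists_eq_left', reduceCtorEq, exists_false, if_false, sub_zero]
    rfl

/-- `Θ` is a partial ruling of `F` with flags `d`, and the strands fixed by `Θ` form the front `G`
up to the insertion of trivial slices: the line `t` of `F` corresponds to the line `φ t` of `G`. -/
structure PartialRuling (F G : Front) (Θ : ℕ → ℕ → ℕ) (d : ℕ → Bool) (φ : ℕ → ℕ) : Prop where
  ok : ∀ t, (F.slice t).Ok (F.width t)
  pairing : ∀ t, Pairing (F.width t) (Θ t)
  step : ∀ t, (F.slice t).PartialRules (d t) (Θ t) (Θ (t + 1))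
  zero : φ 0 = 0
  last : ∀ t, F.length ≤ t → φ t = G.length
  time : ∀ t, (φ (t + 1) = φ t ∧ ((F.slice t).restriction (d t) (Θ t)).getD Slice.triv = Slice.triv) ∨
    (φ (t + 1) = φ t + 1 ∧
      ((F.slice t).restriction (d t) (Θ t)).getD Slice.triv = G.slice (φ t))
  left : F.left = 0
  right : F.width F.length = 0
  left' : G.left = 0

namespace PartialRuling

variable {F G : Front} {Θ : ℕ → ℕ → ℕ} {d : ℕ → Bool} {φ : ℕ → ℕ}
  (H : F.PartialRuling G Θ d φ)
include H

theorem pairing_succ (t : ℕ) : Pairing ((F.slice t).out (F.width t)) (Θ (t + 1)) := by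
  rw [← F.width_succ]; exact H.pairing _

theorem width_eq (t : ℕ) : G.width (φ t) = fixCount (Θ t) (F.width t) := by
  induction t with
  | zero => rw [H.zero, width_zero, width_zero, H.left, H.left']; rfl
  | succ t ih =>
    rw [F.width_succ, Slice.fixCount_out (H.pairing t) (H.ok t) (H.pairing_succ t) (H.step t), ← ih]
    rcases H.time t with ⟨h1, h2⟩ | ⟨h1, h2⟩
    · rw [h1, h2]; rfl
    · rw [h1, h2, width_succ]

/-- `φ` starts at `0`, ends at the length of `G`, and never jumps by more than one. -/
theorem exists_time (s : ℕ) (hs : s ≤ G.length) : ∃ t ≤ F.length, φ t = s := by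
  have key : ∀ n, ∀ s ≤ φ n, ∃ t ≤ n, φ t = s := by
    intro n
    induction n with
    | zero => intro s hs; rw [H.zero] at hs; exact ⟨0, le_rfl, by rw [H.zero]; omega⟩
    | succ n ih =>
      intro s hs
      by_cases h : s ≤ φ n
      · obtain ⟨t, ht, h⟩ := ih s h
        exact ⟨t, by omega, h⟩
      · exact ⟨n + 1, le_rfl, by rcases H.time n with h1 | h1 <;> omega⟩
  apply key
  rw [H.last _ le_rfl]; exact hs

theorem le_length (t : ℕ) : φ t ≤ G.length := by
  have hmono : Monotone φ :=
    monotone_nat_of_le_succ fun t => by rcases H.time t with h | h <;> omega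
  rcases le_total t F.length with h | h
  · rw [← H.last _ le_rfl]; exact hmono h
  · rw [H.last _ h]

theorem right' : G.width G.length = 0 := by
  rw [← H.last _ le_rfl, H.width_eq, H.right]; rfl

/-- Each `ρ t` preserves the fixed strands of `Θ t`. The restriction depends only on the
corresponding line of `G`, and it satisfies the ruling conditions there by `Slice.rules_lift_iff`.
-/
theorem exists_restrict {ρ : ℕ → ℕ → ℕ} (hρ : F.IsNormalRuling ρ)
    (hext : ∀ t x, Θ t x ≠ x → ρ t x = Θ t x) :
    ∃ σ, G.IsNormalRuling σ ∧ ∀ t, Lift (Θ t) (σ (φ t)) (ρ t) := by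
  let r : ℕ → ℕ → ℕ := fun t => restrict (Θ t) (ρ t)
  have hl : ∀ t, Lift (Θ t) (r t) (ρ t) := fun t =>
    lift_restrict (H.pairing t) (hρ.involutive t) (hext t)
  have hru : ∀ t, (((F.slice t).restriction (d t) (Θ t)).getD Slice.triv).Rules (r t) (r (t + 1)) := by
    intro t
    refine (Slice.rules_lift_iff (H.pairing t) (H.ok t) (H.pairing_succ t) (H.step t)
      (hρ.involutive t) (hρ.involutive (t + 1)) (hl t) (hl (t + 1)) ?_).1 (hρ.rules t)
    -- A flagged crossing has a moved strand, so it must be a switch of `ρ`, and the normality of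
    -- `ρ` settles the side condition.
    intro k hk hd hfix hh
    have h1 := H.step t
    have h2 := hρ.rules t
    rw [hk] at h1 h2
    have h3 : Θ (t + 1) = Θ t := by
      obtain ⟨-, h4 | h4⟩ := h1
      · rw [hd] at h4; simp at h4
      · exact h4.2.1
    have hl' := hl (t + 1)
    rw [h3] at hl'
    have hn : ¬ (Θ t k = k ∧ Θ t (k + 1) = k + 1) := by
      obtain ⟨-, h4 | h4⟩ := h1
      · rw [hd] at h4; simp at h4
      · exact h4.2.2.2
    exact (h2.2.resolve_left (Slice.lift_not_conj (H.pairing t) (hρ.involutive (t + 1)).injective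
      (hl t) hl' h1.1 hn)).2
  -- Where `φ` stands still, the restricted slice is trivial, and the restriction does not change.
  have hconst : ∀ t t', φ t = φ t' → t ≤ t' → r t = r t' := by
    intro t t' h htt
    induction t', htt using Nat.le_induction with
    | base => rfl
    | succ t' htt ih =>
      have hmono : Monotone φ :=
        monotone_nat_of_le_succ fun t => by rcases H.time t with h | h <;> omega
      have h1 := hmono htt
      rcases H.time t' with ⟨h2, h3⟩ | ⟨h2, -⟩
      · have h4 := hru t'
        rw [h3] at h4
        exact (ih (by omega)).trans (Eq.symm h4)
      · omega
  have hconst' : ∀ t t', φ t = φ t' → r t = r t' := fun t t' h =>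
    (le_total t t').elim (hconst t t' h) fun h' => (hconst t' t h.symm h').symm
  choose! ψ hψ using H.exists_time
  -- Any line of `F` over `s` will do; the minimum makes `σ` constant beyond the end of `G`.
  let σ : ℕ → ℕ → ℕ := fun s => r (ψ (min s G.length))
  have hσ : ∀ t, σ (φ t) = r t := fun t => by
    apply hconst'
    rw [(hψ _ (min_le_right _ _)).2, min_eq_left (H.le_length t)]
  have hσl : ∀ t, Lift (Θ t) (σ (φ t)) (ρ t) := fun t => by rw [hσ]; exact hl t
  have hpair : ∀ s, Pairing (G.width s) (σ s) := by
    have h0 : ∀ t, Pairing (G.width (φ t)) (σ (φ t)) := fun t => by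
      rw [H.width_eq]
      exact (hσl t).pairing_left (H.pairing t) (hρ.pairing t)
    intro s
    rcases le_total s G.length with hs | hs
    · rw [← (hψ s hs).2]; exact h0 _
    · have h1 : σ s = σ (φ F.length) := by
        show r _ = r _
        rw [H.last _ le_rfl, min_self, min_eq_right hs]
      rw [h1, G.width_of_le hs, ← H.last _ le_rfl]
      exact h0 _
  have hσ1 : ∀ s, G.length ≤ s → σ s = σ G.length := by
    intro s hs
    show r _ = r _
    rw [min_self, min_eq_right hs]
  refine ⟨σ, ⟨⟨fun s => (hpair s).inv, fun s => (hpair s).supp, ?_, ?_⟩, ?_⟩, hσl⟩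
  · intro s
    rcases lt_or_ge s G.length with hs | hs
    -- `φ` reaches the length of `G`, so at some line it steps from `s` to `s + 1`.
    · have : ∃ t, φ t = s ∧ φ (t + 1) = s + 1 := by
        by_contra hn
        push Not at hn
        have : ∀ t, φ t ≤ s := by
          intro t
          induction t with
          | zero => rw [H.zero]; omega
          | succ t ih =>
            have := hn t
            rcases H.time t with h | h <;> omega
        have h1 := this F.length
        rw [H.last _ le_rfl] at h1
        omega
      obtain ⟨t, rfl, ht'⟩ := this
      have h1 := hru t
      rcases H.time t with ⟨h2, -⟩ | ⟨h2, h3⟩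
      · omega
      · rw [h3, ← hσ, ← hσ, h2] at h1
        exact h1
    · rw [G.slice_of_le hs]
      show σ (s + 1) = σ s
      rw [hσ1 _ hs, hσ1 _ (by omega)]
  · have h1 := hpair G.length
    have h2 := hpair 0
    rw [H.right'] at h1
    rw [width_zero, H.left'] at h2
    rw [pairing_zero h1, pairing_zero h2]
  · intro s
    rcases le_total s G.length with hs | hs
    · rw [← (hψ s hs).2, H.width_eq]
      exact ((hσl _).fixedPointFree_iff (H.pairing _)).1 (hρ.fixedPointFree _)
    · rw [G.width_of_le hs, H.right']
      intro i hi; omega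

/-- The join of the partial ruling with a ruling of its fixed strands can fail to be normal only at
a flagged crossing with a fixed strand, and `hside` covers these. -/
theorem isNormalRuling_join {σ : ℕ → ℕ → ℕ} (hσ : G.IsNormalRuling σ)
    (hside : ∀ t k, F.slice t = Slice.cross k → d t = true →
      (Θ t k = k ∨ Θ t (k + 1) = k + 1) → Slice.Normality k (join (Θ t) (σ (φ t)))) :
    F.IsNormalRuling fun t => join (Θ t) (σ (φ t)) := by
  have hl : ∀ t, Lift (Θ t) (σ (φ t)) (join (Θ t) (σ (φ t))) := fun t =>
    lift_join (H.pairing t) _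
  have hpair : ∀ t, Pairing (F.width t) (join (Θ t) (σ (φ t))) := fun t => by
    apply (hl t).pairing (H.pairing t)
    rw [← H.width_eq]
    exact hσ.pairing _
  refine ⟨⟨fun t => (hpair t).inv, fun t => (hpair t).supp, ?_, ?_⟩, ?_⟩
  · intro t
    refine (Slice.rules_lift_iff (H.pairing t) (H.ok t) (H.pairing_succ t) (H.step t)
      (hpair t).inv (hpair (t + 1)).inv (hl t) (hl (t + 1)) ?_).2 ?_
    · exact fun k hk hd hfix _ => hside t k hk hd hfix
    · rcases H.time t with ⟨h1, h2⟩ | ⟨h1, h2⟩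
      · rw [h1, h2]; rfl
      · rw [h1, h2]; exact hσ.rules _
  · have h1 := hpair F.length
    have h2 := hpair 0
    rw [H.right] at h1
    rw [width_zero, H.left] at h2
    exact (pairing_zero h1).trans (pairing_zero h2).symm
  · intro t
    refine ((hl t).fixedPointFree_iff (H.pairing t)).2 ?_
    rw [← H.width_eq]
    exact hσ.fixedPointFree _

theorem eq_of_lift {σ σ' ρ : ℕ → ℕ → ℕ} (hσ : G.IsGenRuling σ) (hσ' : G.IsGenRuling σ')
    (h : ∀ t, Lift (Θ t) (σ (φ t)) (ρ t)) (h' : ∀ t, Lift (Θ t) (σ' (φ t)) (ρ t)) : σ = σ' := by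
  have key : ∀ s ≤ G.length, σ s = σ' s := by
    intro s hs
    obtain ⟨t, -, rfl⟩ := H.exists_time s hs
    exact (h t).ext_left (H.pairing t) (h' t)
  funext s
  rcases le_total s G.length with hs | hs
  · exact key s hs
  · rw [hσ.of_le hs, hσ'.of_le hs, key _ le_rfl]

theorem rules_ff {ρ : ℕ → ℕ → ℕ} (hρ : F.IsNormalRuling ρ) (t k : ℕ)
    (hk : F.slice t = Slice.cross k) : ρ t k ≠ k ∧ ρ t (k + 1) ≠ k + 1 := by
  have h1 := H.ok t
  rw [hk] at h1
  simp only [Slice.Ok] at h1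
  exact ⟨hρ.fixedPointFree t k (by omega), hρ.fixedPointFree t _ h1⟩

theorem jIndex_lift {σ ρ : ℕ → ℕ → ℕ} (hρ : F.IsNormalRuling ρ)
    (h : ∀ t, Lift (Θ t) (σ (φ t)) (ρ t)) :
    F.jIndex ρ = (∑ t ∈ Finset.range F.length, (F.slice t).partialJTerm (d t)) + G.jIndex σ := by
  rw [jIndex_eq_sum, jIndex_eq_sum]
  have key : ∀ n, ∑ t ∈ Finset.range n, (F.slice t).jTerm (ρ t) (ρ (t + 1)) =
      (∑ t ∈ Finset.range n, (F.slice t).partialJTerm (d t)) +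
        ∑ s ∈ Finset.range (φ n), (G.slice s).jTerm (σ s) (σ (s + 1)) := by
    intro n
    induction n with
    | zero => simp [H.zero]
    | succ n ih =>
      rw [Finset.sum_range_succ, ih, Finset.sum_range_succ,
        Slice.jTerm_lift (H.pairing n) (H.step n) (hρ.rules n) (hρ.involutive n)
          (hρ.involutive (n + 1)) (h n) (h (n + 1)) fun k hk => (H.rules_ff hρ n k hk).1]
      rcases H.time n with ⟨h1, h2⟩ | ⟨h1, h2⟩
      · rw [h1, h2]; simp only [Slice.jTerm]; ring
      · rw [h1, h2, Finset.sum_range_succ]; ring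
  rw [key, H.last _ le_rfl]

/-- A pair of `ρ` is either a pair of `Θ` or a pair of fixed strands, and the numbering of fixed
strands respects upper and lower. The potential `ν` has to be the restriction of `μ` only once `Θ`
is known to be graded. -/
theorem isGraded_lift_iff {p : ℕ} {σ ρ : ℕ → ℕ → ℕ} {μ ν : ℕ → ℕ → ZMod p}
    (h : ∀ t, Lift (Θ t) (σ (φ t)) (ρ t))
    (hν : F.IsGraded μ Θ → ∀ t ≤ F.length, ∀ i, ν (φ t) i = μ t (fixNth (Θ t) i)) :
    F.IsGraded μ ρ ↔ F.IsGraded μ Θ ∧ G.IsGraded ν σ := by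
  have h0 : F.IsGraded μ ρ → F.IsGraded μ Θ := by
    intro hg t ht i j hij hi
    refine hg t ht i j hij ?_
    rw [(h t).moved i (by omega), hi]
  constructor
  · intro hg
    refine ⟨h0 hg, ?_⟩
    intro s hs i j hij hi
    obtain ⟨t, ht, rfl⟩ := H.exists_time s hs
    rw [hν (h0 hg) t ht, hν (h0 hg) t ht]
    refine hg t ht _ _ ((H.pairing t).fixNth_strictMono hij) ?_
    rw [(h t).fixed, hi]
  · rintro ⟨hg, hg'⟩ t ht i j hij hi
    rcases fixed_cases (f := Θ t) i with hx | ⟨i, rfl⟩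
    · exact hg t ht i j hij (by rw [← hi, (h t).moved i hx])
    · rw [(h t).fixed] at hi
      subst hi
      rw [← hν hg t ht, ← hν hg t ht]
      exact hg' _ (H.le_length t) _ _ ((H.pairing t).fixNth_lt.1 hij) rfl

end PartialRuling

end Front

/-! ### Rulings in the copy of a crossing -/

/-- The involution `g` arises from `f` by following the diagram at a crossing. -/
def ConjAt (k : ℕ) (f g : ℕ → ℕ) : Prop :=
  ∀ i, g (Equiv.swap k (k + 1) i) = Equiv.swap k (k + 1) (f i)

namespace Slice

theorem Rules.cross_cases {k : ℕ} {f g : ℕ → ℕ} (h : (cross k).Rules f g) :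
    f k ≠ k + 1 ∧ (ConjAt k f g ∨ (g = f ∧ Normality k f)) := h

end Slice

theorem ConjAt.left {k : ℕ} {f g : ℕ → ℕ} (h : ConjAt k f g) :
    g (k + 1) = Equiv.swap k (k + 1) (f k) := by
  have := h k; rwa [Equiv.swap_apply_left] at this

theorem ConjAt.of_ne {k x : ℕ} {f g : ℕ → ℕ} (h : ConjAt k f g) (h1 : x ≠ k) (h2 : x ≠ k + 1) :
    g x = Equiv.swap k (k + 1) (f x) := by
  have := h x; rwa [Equiv.swap_apply_of_ne_of_ne h1 h2] at this

/-- The slices of the word `w` obey the conditions of a ruling. -/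
def Seg (w : List Slice) (ρ : ℕ → ℕ → ℕ) : Prop :=
  ∀ t (h : t < w.length), (w[t]).Rules (ρ t) (ρ (t + 1))

theorem seg_append {w₁ w₂ : List Slice} {ρ : ℕ → ℕ → ℕ} :
    Seg (w₁ ++ w₂) ρ ↔ Seg w₁ ρ ∧ Seg w₂ fun t => ρ (w₁.length + t) := by
  constructor
  · intro h
    refine ⟨fun t ht => ?_, fun t ht => ?_⟩
    · have := h t (by rw [List.length_append]; omega)
      rwa [List.getElem_append_left ht] at this
    · have := h (w₁.length + t) (by rw [List.length_append]; omega)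
      rw [List.getElem_append_right (by omega)] at this
      simpa [add_assoc] using this
  · rintro ⟨h1, h2⟩ t ht
    rcases lt_or_ge t w₁.length with h | h
    · rw [List.getElem_append_left h]; exact h1 t h
    · rw [List.getElem_append_right h]
      rw [List.length_append] at ht
      have := h2 (t - w₁.length) (by omega)
      simp only [show w₁.length + (t - w₁.length) = t by omega,
        show w₁.length + (t - w₁.length + 1) = t + 1 by omega] at this
      exact this

/-- A strand starting at place `p` crosses the `m` strands below it. -/
def rowDown (p m : ℕ) : List Slice := (List.range m).map fun j => Slice.cross (p + j)

/-- `m` strands starting at place `b` cross the `n` strands below them, the lowest one first. -/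
def grid (b m n : ℕ) : List Slice := (List.range m).reverse.flatMap fun i => rowDown (b + i) n

@[simp] theorem length_rowDown (p m : ℕ) : (rowDown p m).length = m := by simp [rowDown]

theorem grid_succ (b m n : ℕ) : grid b (m + 1) n = rowDown (b + m) n ++ grid b m n := by
  simp [grid, List.range_succ]

theorem grid_add (b i k n : ℕ) : grid b (i + k) n = grid (b + i) k n ++ grid b i n := by
  induction k with
  | zero => simp [grid]
  | succ k ih => rw [← add_assoc, grid_succ, ih, grid_succ, ← add_assoc, List.append_assoc]

theorem grid_one (b n : ℕ) : grid b 1 n = rowDown b n := by simp [grid]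

theorem grid_succ' (b m n : ℕ) : grid b (m + 1) n = grid (b + 1) m n ++ rowDown b n := by
  rw [add_comm m 1, grid_add, grid_one]

theorem Seg.rowDown {ρ : ℕ → ℕ → ℕ} {p m : ℕ} (h : Seg (rowDown p m) ρ) (j : ℕ) (hj : j < m) :
    (Slice.cross (p + j)).Rules (ρ j) (ρ (j + 1)) := by
  have := h j (by simpa using hj)
  simpa [_root_.rowDown] using this

section Row

variable {ρ : ℕ → ℕ → ℕ} {p m : ℕ} (hi : ∀ t, Function.Involutive (ρ t))

theorem involutive_ne {f : ℕ → ℕ} (hf : Function.Involutive f) {x y : ℕ} (h : f x ≠ y) :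
    f y ≠ x := fun h' => h (by rw [← h', hf])

include hi

/-- The traveller is not paired with the strands that it has crossed. -/
theorem row_above (h : Seg (rowDown p m) ρ) (j : ℕ) (hj : j ≤ m) :
    ¬ (p ≤ ρ j (p + j) ∧ ρ j (p + j) < p + j) := by
  induction j with
  | zero => omega
  | succ j ih =>
    have ih := ih (by omega)
    obtain ⟨h1, h2 | ⟨h2, h3⟩⟩ := (h.rowDown j (by omega)).cross_cases
    · have h4 := h2.left
      rw [← add_assoc, h4, Slice.swap_val]
      split_ifs <;> omega
    -- At a switch the traveller takes over the companion of the strand below. If that were a strand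
    -- already crossed, normality would nest the old interval of the traveller in the new one, and
    -- the old companion would be such a strand too.
    · have h4 := involutive_ne (hi j) h1
      rw [← add_assoc, h2]
      rw [Slice.normality_iff] at h3
      omega

/-- The traveller is not paired with the strands that it is going to cross. -/
theorem row_below (h : Seg (rowDown p m) ρ) (j : ℕ) (hj : j ≤ m) :
    ¬ (p + j < ρ j (p + j) ∧ ρ j (p + j) ≤ p + m) := by
  induction hj using Nat.decreasingInduction with
  | self => omega
  -- The same argument as for `row_above`, backwards in time.
  | of_succ j hj ih =>
    obtain ⟨h1, h2 | ⟨h2, h3⟩⟩ := (h.rowDown j (by omega)).cross_cases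
    · have h4 := h2.left
      rw [← add_assoc, h4, Slice.swap_val] at ih
      split_ifs at ih <;> omega
    · have h4 := involutive_ne (hi j) h1
      rw [← add_assoc, h2] at ih
      rw [Slice.normality_iff] at h3
      omega

/-- At a switch, the traveller and the strand that it meets are paired with strands that do not
take part in the row. -/
theorem row_switch (h : Seg (rowDown p m) ρ) (j : ℕ) (hj : j < m) (hs : ρ (j + 1) = ρ j) :
    (ρ j (p + j) = p + j ∨ ¬ (p ≤ ρ j (p + j) ∧ ρ j (p + j) ≤ p + m)) ∧
    (ρ j (p + j + 1) = p + j + 1 ∨ ¬ (p ≤ ρ j (p + j + 1) ∧ ρ j (p + j + 1) ≤ p + m)) := by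
  have h1 := row_above hi h j hj.le
  have h2 := row_below hi h j hj.le
  have h3 := row_above hi h (j + 1) hj
  have h4 := row_below hi h (j + 1) hj
  rw [hs, ← add_assoc] at h3 h4
  omega

/-- A strand above the row that is paired with a strand to be crossed can lose it only at a switch.
There, normality nests the interval of the traveller in that of the pair, so that the strand just
crossed is now paired with some strand between `x` and the row. -/
theorem row_persist (h : Seg (rowDown p m) ρ) {b : ℕ}
    (h0 : ∃ x, b ≤ x ∧ x < p ∧ p < ρ 0 x ∧ ρ 0 x ≤ p + m) :
    ∃ x, b ≤ x ∧ x < p ∧ p ≤ ρ m x ∧ ρ m x < p + m := by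
  -- The last condition says that the companion of `x` is one of the crossed strands and not the
  -- traveller.
  have key : ∀ j ≤ m, ∃ x, b ≤ x ∧ x < p ∧ p ≤ ρ j x ∧ ρ j x ≤ p + m ∧ ρ j x ≠ p + j := by
    intro j
    induction j with
    | zero => obtain ⟨x, hx⟩ := h0; exact fun _ => ⟨x, by omega⟩
    | succ j ih =>
      intro hj
      obtain ⟨x, hbx, hxp, h5, h6, h7⟩ := ih (by omega)
      obtain ⟨h1, h2 | ⟨h2, h3⟩⟩ := (h.rowDown j (by omega)).cross_cases
      · refine ⟨x, hbx, hxp, ?_⟩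
        rw [h2.of_ne (by omega) (by omega), Slice.swap_val]
        split_ifs <;> omega
      · rw [h2]
        by_cases h8 : ρ j x = p + (j + 1)
        · refine ⟨ρ j (p + j), ?_⟩
          rw [hi j]
          have h9 := row_above hi h j (by omega)
          have h10 : ρ j (p + j + 1) = x := by rw [add_assoc, ← h8, hi j]
          rw [Slice.normality_iff, h10] at h3
          have h11 : ρ j (p + j) ≠ x := fun h => by rw [← h, hi j] at h8; omega
          omega
        · exact ⟨x, by omega⟩
  obtain ⟨x, hx⟩ := key m le_rfl
  exact ⟨x, by omega⟩

/-- The analogue for pairs with strands below the row, which are traced from its end back to its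
start. -/
theorem row_persist_back (h : Seg (rowDown p m) ρ) {u : ℕ}
    (h0 : ∃ x, p + m < x ∧ x < u ∧ p ≤ ρ m x ∧ ρ m x < p + m) :
    ∃ x, p + m < x ∧ x < u ∧ p < ρ 0 x ∧ ρ 0 x ≤ p + m := by
  have key : ∀ j ≤ m, ∃ x, p + m < x ∧ x < u ∧ p ≤ ρ j x ∧ ρ j x ≤ p + m ∧ ρ j x ≠ p + j := by
    intro j hj
    induction hj using Nat.decreasingInduction with
    | self => obtain ⟨x, hx⟩ := h0; exact ⟨x, by omega⟩
    | of_succ j hj ih =>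
      obtain ⟨x, hbx, hxp, h5, h6, h7⟩ := ih
      obtain ⟨h1, h2 | ⟨h2, h3⟩⟩ := (h.rowDown j (by omega)).cross_cases
      · refine ⟨x, hbx, hxp, ?_⟩
        rw [h2.of_ne (by omega) (by omega), Slice.swap_val] at h5 h6 h7
        split_ifs at h5 h6 h7 <;> omega
      · rw [h2] at h5 h6 h7
        by_cases h8 : ρ j x = p + j
        · refine ⟨ρ j (p + j + 1), ?_⟩
          rw [hi j]
          have h9 := row_below hi h (j + 1) (by omega)
          rw [h2, ← add_assoc] at h9
          have h10 : ρ j (p + j) = x := by rw [← h8, hi j]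
          rw [Slice.normality_iff, h10] at h3
          have h12 := involutive_ne (hi j) h1
          have h11 : ρ j (p + j + 1) ≠ x := fun h => by rw [← h, hi j] at h8; omega
          omega
        · exact ⟨x, by omega⟩
  obtain ⟨x, hx⟩ := key 0 (by omega)
  exact ⟨x, by omega⟩

/-- The lowest of the upper strands travels first. It is not paired with a strand that it is going
to cross, and a pair of another upper strand with a lower one would persist through its row and show
up at the start of the remaining grid. -/
theorem grid_start {b m n : ℕ} (h : Seg (grid b m n) ρ) {x y : ℕ} (h1 : b ≤ x) (h2 : x < b + m)
    (h3 : b + m ≤ y) (h4 : y < b + m + n) : ρ 0 x ≠ y := by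
  induction m generalizing x y ρ with
  | zero => omega
  | succ m ih =>
    rw [grid_succ, seg_append, length_rowDown] at h
    rintro rfl
    by_cases hx : x = b + m
    · have := row_below hi h.1 0 (by omega)
      simp only [add_zero, ← hx] at this
      omega
    · obtain ⟨x', h5, h6, h7, h8⟩ :=
        row_persist hi h.1 (b := b) ⟨x, by omega⟩
      exact ih (fun t => hi _) h.2 h5 h6 h7 h8 rfl

/-- The uppermost strand travels last. It is not paired with a strand that it has crossed, and any
other forbidden pair can be traced back through its row. -/
theorem grid_end {b m n : ℕ} (h : Seg (grid b m n) ρ) {x y : ℕ} (h1 : b + n ≤ x)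
    (h2 : x < b + n + m) (h3 : b ≤ y) (h4 : y < b + n) : ρ (grid b m n).length x ≠ y := by
  induction m generalizing b x y with
  | zero => omega
  | succ m ih =>
    rw [grid_succ', seg_append] at h
    rw [grid_succ', List.length_append, length_rowDown]
    rintro rfl
    by_cases hx : x = b + n
    · have := row_above (fun t => hi _) h.2 n le_rfl
      simp only [← hx] at this
      omega
    · obtain ⟨x', h5, h6, h7, h8⟩ :=
        row_persist_back (fun t => hi _) h.2 (u := b + n + (m + 1)) ⟨x, by omega⟩
      rw [add_zero] at h7 h8
      exact ih h.1 (x := x') (y := ρ (grid (b + 1) m n).length x') (by omega) (by omega)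
        (by omega) (by omega) rfl

end Row

/-- At every switch in the word `w`, both strands are paired outside the region `R`. -/
def SwitchOutside (R : ℕ → Prop) (w : List Slice) (ρ : ℕ → ℕ → ℕ) : Prop :=
  ∀ t (h : t < w.length) k, w[t] = Slice.cross k → ¬ ConjAt k (ρ t) (ρ (t + 1)) →
    (ρ t k = k ∨ ¬ R (ρ t k)) ∧ (ρ t (k + 1) = k + 1 ∨ ¬ R (ρ t (k + 1)))

theorem switchOutside_append {R : ℕ → Prop} {w₁ w₂ : List Slice} {ρ : ℕ → ℕ → ℕ}
    (h1 : SwitchOutside R w₁ ρ) (h2 : SwitchOutside R w₂ fun t => ρ (w₁.length + t)) :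
    SwitchOutside R (w₁ ++ w₂) ρ := by
  intro t ht k hk
  rcases lt_or_ge t w₁.length with h | h
  · rw [List.getElem_append_left h] at hk
    exact h1 t h k hk
  · rw [List.getElem_append_right h] at hk
    rw [List.length_append] at ht
    have := h2 (t - w₁.length) (by omega) k hk
    simp only [show w₁.length + (t - w₁.length) = t by omega,
      show w₁.length + (t - w₁.length + 1) = t + 1 by omega] at this
    exact this

/-- Following the diagram and switching both leave the pairs away from the crossing alone. -/
theorem pair_untouched {k x y : ℕ} {f g : ℕ → ℕ} (h : (Slice.cross k).Rules f g) (hx : x ≠ k)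
    (hx' : x ≠ k + 1) (hy : y ≠ k) (hy' : y ≠ k + 1) : g x = y ↔ f x = y := by
  obtain ⟨-, h2 | ⟨h2, -⟩⟩ := h.cross_cases
  · rw [h2.of_ne hx hx', Slice.swap_val]; split_ifs <;> omega
  · rw [h2]

theorem row_untouched {ρ : ℕ → ℕ → ℕ} {p m x y : ℕ} (h : Seg (rowDown p m) ρ) {j j' : ℕ}
    (hj : j ≤ j') (hj' : j' ≤ m) (hx : x < p + j ∨ p + j' < x) (hy : y < p + j ∨ p + j' < y) :
    ρ j' x = y ↔ ρ j x = y := by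
  induction j', hj using Nat.le_induction with
  | base => rfl
  | succ j' hj ih =>
    rw [pair_untouched (h.rowDown j' (by omega)) (by omega) (by omega) (by omega) (by omega)]
    exact ih (by omega) (by omega) (by omega)

/-- By `row_switch`, a companion inside the grid would lie outside the current row. Such a pair is
not touched on one side of the switch, and so it would be present at the start or at the end of the
row. There it would join an upper strand to a lower one, which `grid_start` and `grid_end` exclude.
-/
theorem grid_switchOutside {ρ : ℕ → ℕ → ℕ} (hi : ∀ t, Function.Involutive (ρ t)) {b m n : ℕ}
    (h : Seg (grid b m n) ρ) :
    SwitchOutside (fun x => b ≤ x ∧ x < b + m + n) (grid b m n) ρ := by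
  have key : ∀ i k, i + k = m → SwitchOutside (fun x => b ≤ x ∧ x < b + m + n) (grid b i n)
      fun t => ρ ((grid (b + i) k n).length + t) := by
    intro i
    induction i with
    | zero => intro k _ t ht; simp [grid] at ht
    | succ i ih =>
      intro k hk
      have ih := ih (k + 1) (by omega)
      have hL : (grid (b + i) (k + 1) n).length = (grid (b + (i + 1)) k n).length + n := by
        rw [grid_succ', List.length_append, length_rowDown, add_assoc]
      rw [grid_succ]
      have e1 : m = i + 1 + k := by omega
      rw [e1, grid_add, seg_append, grid_succ, seg_append, length_rowDown] at h
      obtain ⟨ha, hb, hc⟩ := h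
      have hpre : Seg (grid (b + i) (k + 1) n) ρ := by
        rw [grid_succ', seg_append]; exact ⟨ha, hb⟩
      -- The grid splits at the current row, which takes the times from `T` to `T + n`. No pair
      -- joins an upper strand to a lower one: for the rows before it and from it on at time `T`
      -- (`s1`, `s3`), and for the rows up to it and after it at time `T + n` (`s2`, `s4`).
      have s1 := @grid_end ρ hi (b + (i + 1)) k n ha
      have s2 := @grid_end ρ hi (b + i) (k + 1) n hpre
      rw [hL] at s2 ih
      generalize (grid (b + (i + 1)) k n).length = T at *
      have s3 := @grid_start (fun t => ρ (T + t)) (fun t => hi _) b (i + 1) n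
        (by rw [grid_succ, seg_append, length_rowDown]; exact ⟨hb, hc⟩)
      have s4 := @grid_start (fun t => ρ (T + (n + t))) (fun t => hi _) b i n hc
      simp only [add_zero] at s3 s4
      refine switchOutside_append ?_ ?_
      · intro j hj k' hk' hcj
        rw [length_rowDown] at hj
        simp only [rowDown, List.getElem_map, List.getElem_range, Slice.cross.injEq] at hk'
        subst hk'
        have hru := hb.rowDown j hj
        obtain ⟨h1, h2 | ⟨h2, h3⟩⟩ := hru.cross_cases
        · exact absurd h2 hcj
        have hsw := row_switch (fun t => hi _) hb j hj h2
        have hinv := hi (T + j)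
        beta_reduce
        have u0 : ∀ d, d < b + i ∨ b + i + n < d →
            (ρ (T + j) (b + i + j + 1) = d ↔ ρ T (b + i + j + 1) = d) := fun d hd =>
          row_untouched hb (j := 0) (j' := j) (by omega) (by omega) (by omega) (by omega)
        have u1 : ∀ c, c < b + i ∨ b + i + n < c →
            (ρ (T + n) (b + i + j) = c ↔ ρ (T + (j + 1)) (b + i + j) = c) := fun d hd =>
          row_untouched hb (j := j + 1) (j' := n) (by omega) (by omega) (by omega) (by omega)
        have iT := hi T
        have iTn := hi (T + n)
        constructor
        · rcases hsw.1 with h4 | h4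
          · exact Or.inl h4
          · right
            -- After the switch the place `b + i + j` belongs to the strand just crossed, a lower
            -- one, which is not touched until the end of the row.
            rintro ⟨h5, h6⟩
            have h7 : ρ (T + n) (b + i + j) = ρ (T + j) (b + i + j) :=
              (u1 _ (by omega)).2 (by rw [h2])
            have h8 : ρ (T + n) (ρ (T + j) (b + i + j)) = b + i + j := by
              rw [← h7, iTn]
            rcases lt_or_ge (ρ (T + j) (b + i + j)) (b + i) with h9 | h9
            · exact s4 h5 h9 (by omega) (by omega) h8
            · exact s2 (by omega) (by omega) (by omega) (by omega) h8
        · rcases hsw.2 with h4 | h4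
          · exact Or.inl h4
          · right
            -- Before the switch the place `b + i + j + 1` belongs to a lower strand that has not
            -- been touched since the start of the row.
            rintro ⟨h5, h6⟩
            have h7 : ρ T (b + i + j + 1) = ρ (T + j) (b + i + j + 1) :=
              (u0 _ (by omega)).1 rfl
            have h8 : ρ T (ρ (T + j) (b + i + j + 1)) = b + i + j + 1 := by
              rw [← h7, iT]
            rcases lt_or_ge (ρ (T + j) (b + i + j + 1)) (b + i) with h9 | h9
            · exact s3 h5 (by omega) (by omega) (by omega) h8
            · exact s1 (by omega) (by omega) (by omega) (by omega) h8
      · rw [length_rowDown]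
        simpa only [add_assoc] using ih
  simpa [grid] using key m 0 (by omega)

/-! ### Rulings in the copy of a left cusp -/

/-- A strand starting at place `p` crosses the `m` strands above it. -/
def rowUp (p m : ℕ) : List Slice := (List.range m).map fun r => Slice.cross (p - 1 - r)

@[simp] theorem length_rowUp (p m : ℕ) : (rowUp p m).length = m := by simp [rowUp]

/-- The `n`-copy of a left cusp with uppermost place `b`. -/
def cuspWord (b n : ℕ) : List Slice :=
  (List.range n).flatMap fun j => Slice.lcusp (b + 2 * j) :: rowUp (b + 2 * j) j

theorem cuspWord_succ (b n : ℕ) :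
    cuspWord b (n + 1) = cuspWord b n ++ (Slice.lcusp (b + 2 * n) :: rowUp (b + 2 * n) n) := by
  simp [cuspWord, List.range_succ]

theorem Seg.rowUp {ρ : ℕ → ℕ → ℕ} {p m : ℕ} (h : Seg (rowUp p m) ρ) (j : ℕ) (hj : j < m) :
    (Slice.cross (p - 1 - j)).Rules (ρ j) (ρ (j + 1)) := by
  have := h j (by simpa using hj)
  simpa [_root_.rowUp] using this

theorem Seg.rowUp_reverse {ρ : ℕ → ℕ → ℕ} (hi : ∀ t, Function.Involutive (ρ t)) {p m : ℕ}
    (hm : m ≤ p) (h : Seg (_root_.rowUp p m) ρ) :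
    Seg (_root_.rowDown (p - m) m) fun t => ρ (m - t) := by
  intro t ht
  rw [length_rowDown] at ht
  have h1 := (h.rowUp (m - 1 - t) (by omega)).mirror (hi _)
  rw [show m - 1 - t + 1 = m - t by omega, show p - 1 - (m - 1 - t) = p - m + t by omega,
    show m - 1 - t = m - (t + 1) by omega] at h1
  simpa [_root_.rowDown, Slice.mirror] using h1

/-- Read backwards, a row going up is a row going down, to which `row_above` and `row_below` apply.
-/
theorem rowUp_not_mem {ρ : ℕ → ℕ → ℕ} (hi : ∀ t, Function.Involutive (ρ t)) {p m : ℕ}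
    (hm : m ≤ p) (h : Seg (rowUp p m) ρ) (t : ℕ) (ht : t ≤ m) :
    ¬ (p - m ≤ ρ t (p - t) ∧ ρ t (p - t) ≤ p ∧ ρ t (p - t) ≠ p - t) := by
  have h1 := row_above (fun t => hi _) (h.rowUp_reverse hi hm) (m - t) (by omega)
  have h2 := row_below (fun t => hi _) (h.rowUp_reverse hi hm) (m - t) (by omega)
  rw [show m - (m - t) = t by omega, show p - m + (m - t) = p - t by omega] at h1 h2
  omega

/-- The strand at place `x` is at place `upPos p t x` after the first `t` crossings of
`rowUp p m`. -/
def upPos (p t x : ℕ) : ℕ := if x = p then p - t else if p - t ≤ x ∧ x < p then x + 1 else x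

/-- The transposition of `a` and `b`. -/
def exchange (a b x : ℕ) : ℕ := if x = a then b else if x = b then a else x

/-- The involutions along a row with at most one switch, which is at the crossing number `r`. -/
theorem rowUp_track {f : ℕ → ℕ → ℕ} {p r m : ℕ} (hm : m ≤ p)
    (h : ∀ t < m, t ≠ r → ConjAt (p - 1 - t) (f t) (f (t + 1)))
    (hr : r < m → f (r + 1) = f r) (t : ℕ) (ht : t ≤ m) (x : ℕ) :
    f t (upPos p t x) = upPos p t
      (if r < t then exchange p (p - 1 - r) (f 0 (exchange p (p - 1 - r) x)) else f 0 x) := by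
  induction t generalizing x with
  | zero =>
    have h0 : ∀ x, upPos p 0 x = x := fun x => by unfold upPos; split_ifs <;> omega
    simp [h0]
  | succ t ih =>
    have ih := ih (by omega)
    by_cases htr : t = r
    -- Keeping the involution while the traveller changes places amounts to exchanging the
    -- companions of the traveller and of the strand that it meets.
    · subst htr
      have e1 : ∀ x, upPos p (t + 1) x = upPos p t (exchange p (p - 1 - t) x) := by
        intro x; unfold upPos exchange; split_ifs <;> omega
      have e2 : ∀ x, exchange p (p - 1 - t) (exchange p (p - 1 - t) x) = x := by
        intro x; unfold exchange; split_ifs <;> omega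
      rw [hr (by omega), if_pos (by omega), e1, e1, e2, ih, if_neg (by omega)]
    · have e1 : ∀ x, upPos p (t + 1) x =
          Equiv.swap (p - 1 - t) (p - 1 - t + 1) (upPos p t x) := by
        intro x; rw [Slice.swap_val]; unfold upPos; split_ifs <;> omega
      rw [e1, h t (by omega) htr, ih, ← e1]
      congr 1
      by_cases hrt : r < t
      · rw [if_pos hrt, if_pos (by omega)]
      · rw [if_neg hrt, if_neg (by omega)]

/-- The involution after the first `j` cusps of a copy of a left cusp: the copies `i` and `π i` of
the upper and of the lower branch are paired if both are present and distinct.  The other copies of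
the branches are fixed if `fx` holds, and otherwise the branches of the cusp are paired. -/
def CuspState (b j : ℕ) (π : ℕ → ℕ) (fx : ℕ → Bool) (f : ℕ → ℕ) : Prop :=
  ∀ i < j,
    f (b + i) = (if fx i then b + i else if π i ≠ i ∧ π i < j then b + π i else b + j + i) ∧
    f (b + j + i) = (if fx i then b + j + i else if π i ≠ i ∧ π i < j then b + j + π i else b + i)

theorem CuspState.lt {b j : ℕ} {π : ℕ → ℕ} {fx : ℕ → Bool} {f : ℕ → ℕ}
    (h : CuspState b j π fx f) {x : ℕ} (h1 : b ≤ x) (h2 : x < b + 2 * j) :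
    b ≤ f x ∧ f x < b + 2 * j := by
  rcases lt_or_ge x (b + j) with h3 | h3
  · have := (h (x - b) (by omega)).1
    rw [show b + (x - b) = x by omega] at this
    rw [this]; split_ifs <;> omega
  · have := (h (x - b - j) (by omega)).2
    rw [show b + j + (x - b - j) = x by omega] at this
    rw [this]; split_ifs <;> omega

/-- The upper branch of the cusp `j` rises past the lower branches of the earlier cusps. If it
switches with the lower branch of the copy `π j`, the two exchange companions: the upper branches of
`j` and `π j` become a pair, and so do the lower ones. Without a switch the two branches stay paired
with each other, or fixed. The flags `fx` are all false for full rulings and mark the fixed copies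
for partial rulings. -/
theorem cuspState_succ {b j : ℕ} {π : ℕ → ℕ} {fx : ℕ → Bool} {f f' g : ℕ → ℕ}
    (hπ : Function.Involutive π) (hfx : ∀ i, fx i = true → π i = i) (h : CuspState b j π fx f)
    (h1 : ∀ x, b ≤ x → x < b + 2 * j → f' x = f x)
    (h2 : f' (b + 2 * j) = if fx j then b + 2 * j else b + 2 * j + 1)
    (h3 : f' (b + 2 * j + 1) = if fx j then b + 2 * j + 1 else b + 2 * j)
    (hg : ∀ x, g (upPos (b + 2 * j) j x) = upPos (b + 2 * j) j
      (if π j < j then exchange (b + 2 * j) (b + j + π j) (f' (exchange (b + 2 * j) (b + j + π j) x))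
        else f' x)) :
    CuspState b (j + 1) π fx g := by
  intro i hi
  have hj := hπ j
  have hfj := hfx j
  rcases Nat.lt_succ_iff_lt_or_eq.1 hi with hi | rfl
  · obtain ⟨ha, hb⟩ := h i hi
    have hi' := hπ i
    have hfi := hfx i
    have g1 := hg (b + i)
    have g2 := hg (b + j + i)
    have e1 : upPos (b + 2 * j) j (b + i) = b + i := by unfold upPos; split_ifs <;> omega
    have e2 : upPos (b + 2 * j) j (b + j + i) = b + (j + 1) + i := by
      unfold upPos; split_ifs <;> omega
    have e3 : exchange (b + 2 * j) (b + j + π j) (b + i) = b + i := by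
      unfold exchange; split_ifs <;> omega
    rw [e1, e3, h1 _ (by omega) (by omega), ha] at g1
    rw [e2] at g2
    by_cases hij : π i = j
    · have hij' : π j = i := by rw [← hij, hi']
      have e4 : exchange (b + 2 * j) (b + j + π j) (b + j + i) = b + 2 * j := by
        unfold exchange; rw [hij']; split_ifs <;> omega
      have hne : fx i = false := by
        by_contra hc
        have := hfi (by simpa using hc)
        omega
      have hnj : fx j = false := by
        by_contra hc
        have := hfj (by simpa using hc)
        omega
      rw [e4, h2, hij', hnj] at g2
      rw [hij', hij, hne] at g1
      rw [hij, hne]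
      rw [g1, g2]
      simp only [Bool.false_eq_true, if_false, if_pos hi]
      unfold exchange upPos
      constructor
      · split_ifs <;> omega
      · split_ifs <;> omega
    · have hij' : π j ≠ i := fun hc => hij (by rw [← hc, hj])
      have e4 : exchange (b + 2 * j) (b + j + π j) (b + j + i) = b + j + i := by
        unfold exchange; split_ifs <;> omega
      have key : ∀ v, b ≤ v → v < b + 2 * j → v ≠ b + j + π j →
          upPos (b + 2 * j) j (if π j < j then exchange (b + 2 * j) (b + j + π j) v else v) =
            if v < b + j then v else v + 1 := by
        intro v hv hv' hv2
        unfold exchange upPos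
        split_ifs <;> omega
      rw [e4, h1 _ (by omega) (by omega), hb] at g2
      have hne : π i ≠ π j := fun hc => by have := hπ.injective hc; omega
      rw [key _ (by split_ifs <;> omega) (by split_ifs <;> omega) (by split_ifs <;> omega)] at g1 g2
      rw [g1, g2]
      constructor
      · split_ifs <;> omega
      · split_ifs <;> omega
  · have g1 := hg (b + 2 * i)
    have g2 := hg (b + 2 * i + 1)
    have e1 : upPos (b + 2 * i) i (b + 2 * i) = b + i := by unfold upPos; split_ifs <;> omega
    have e2 : upPos (b + 2 * i) i (b + 2 * i + 1) = b + (i + 1) + i := by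
      unfold upPos; split_ifs <;> omega
    have e3 : exchange (b + 2 * i) (b + i + π i) (b + 2 * i) = b + i + π i := by
      unfold exchange; split_ifs <;> omega
    have e4 : π i < i → exchange (b + 2 * i) (b + i + π i) (b + 2 * i + 1) = b + 2 * i + 1 := by
      unfold exchange; intro; split_ifs <;> omega
    rw [e1, e3] at g1
    rw [e2] at g2
    by_cases hq : π i < i
    · have hni : fx i = false := by
        by_contra hc
        have := hfj (by simpa using hc)
        omega
      have hnq : fx (π i) = false := by
        by_contra hc
        have := hfx _ (by simpa using hc)
        omega
      obtain ⟨-, hb⟩ := h _ hq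
      rw [hj, hnq] at hb
      simp only [Bool.false_eq_true, if_false, lt_irrefl, and_false] at hb
      rw [if_pos hq, h1 _ (by omega) (by omega), hb] at g1
      rw [if_pos hq, e4 hq, h3, hni] at g2
      rw [g1, g2, hni]
      simp only [Bool.false_eq_true, if_false]
      unfold exchange upPos
      constructor
      · split_ifs <;> omega
      · split_ifs <;> omega
    · rw [if_neg hq, h2] at g1
      rw [if_neg hq, h3] at g2
      rw [g1, g2]
      unfold upPos
      constructor
      · split_ifs <;> omega
      · split_ifs <;> omega

set_option maxHeartbeats 800000 in
/-- In a copy of a cusp, the strand that goes up has at most one switch; this happens at a strand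
that is paired with the other branch of its cusp. -/
theorem rowUp_switch {b j : ℕ} {π : ℕ → ℕ} (hπ : Function.Involutive π)
    (hsupp : ∀ i, j ≤ i → π i = i) {ρ : ℕ → ℕ → ℕ} (hi : ∀ t, Function.Involutive (ρ t))
    (h0 : ∀ i < j, ρ 0 (b + i) = (if π i ≠ i then b + π i else b + j + i) ∧
      ρ 0 (b + j + i) = if π i ≠ i then b + j + π i else b + i)
    (h : Seg (rowUp (b + 2 * j) j) ρ) :
    ∃ r, (∀ t < j, t ≠ r → ConjAt (b + 2 * j - 1 - t) (ρ t) (ρ (t + 1))) ∧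
      (r < j → ρ (r + 1) = ρ r ∧ π (j - 1 - r) = j - 1 - r) := by
  have hlt : ∀ i < j, π i < j := fun i hij => by
    by_contra hc
    have := hsupp _ (not_lt.1 hc)
    rw [hπ i] at this
    omega
  -- At a switch the involution is unchanged, while the traveller moves to the place of the strand
  -- that it meets. So `rowUp_not_mem`, applied after the crossing, gives information about that
  -- strand.
  have hmem : ∀ t < j, ρ (t + 1) = ρ t →
      ¬ (b + j ≤ ρ t (b + 2 * j - 1 - t) ∧ ρ t (b + 2 * j - 1 - t) ≤ b + 2 * j ∧
        ρ t (b + 2 * j - 1 - t) ≠ b + 2 * j - 1 - t) := by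
    intro t ht hs
    have := rowUp_not_mem hi (by omega) h (t + 1) (by omega)
    rw [hs, show b + 2 * j - (t + 1) = b + 2 * j - 1 - t by omega,
      show b + 2 * j - j = b + j by omega] at this
    exact this
  -- The value `r = j` stands for a row without switches.
  by_cases hall : ∀ t < j, ConjAt (b + 2 * j - 1 - t) (ρ t) (ρ (t + 1))
  · exact ⟨j, fun t ht _ => hall t ht, fun hc => absurd hc (lt_irrefl _)⟩
  classical
  push Not at hall
  have hex : ∃ t, t < j ∧ ¬ ConjAt (b + 2 * j - 1 - t) (ρ t) (ρ (t + 1)) := hall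
  obtain ⟨hr1, hr2⟩ := Nat.find_spec hex
  have hmin : ∀ t < Nat.find hex, ConjAt (b + 2 * j - 1 - t) (ρ t) (ρ (t + 1)) := fun t ht => by
    have := Nat.find_min hex ht
    push Not at this
    exact this (by omega)
  generalize Nat.find hex = r at hr1 hr2 hmin
  have hrs : ρ (r + 1) = ρ r := ((h.rowUp r hr1).cross_cases.2.resolve_left hr2).1
  -- Up to the first switch, the strand met at the crossing number `r` is the lower branch of the
  -- copy `j - 1 - r`. If `π` moved this copy, its companion would be another lower branch in the
  -- row, which `hmem` excludes at a switch.
  have hthick : π (j - 1 - r) = j - 1 - r := by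
    by_contra hc
    have h1 := rowUp_track (f := ρ) (p := b + 2 * j) (r := j) (m := r) (by omega)
      (fun t ht _ => hmin t ht) (by omega) r le_rfl (b + j + (j - 1 - r))
    rw [if_neg (by omega), (h0 (j - 1 - r) (by omega)).2, if_pos hc] at h1
    have h2 : upPos (b + 2 * j) r (b + j + (j - 1 - r)) = b + 2 * j - 1 - r := by
      unfold upPos; split_ifs <;> omega
    have h3 := hmem r hr1 hrs
    have h4 := hlt (j - 1 - r) (by omega)
    rw [h2] at h1
    rw [h1] at h3
    unfold upPos at h3
    split_ifs at h3 <;> omega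
  refine ⟨r, ?_, fun _ => ⟨hrs, hthick⟩⟩
  -- After its switch the traveller is paired with the upper branch of the copy `j - 1 - r`. A
  -- second switch, with a lower branch paired with its own upper branch, would have two intervals
  -- that overlap without being nested. A lower branch whose copy is moved by `π` is excluded as
  -- before.
  have key : ∀ t, r < t → t < j → ConjAt (b + 2 * j - 1 - t) (ρ t) (ρ (t + 1)) := by
    intro t
    induction t using Nat.strong_induction_on with
    | _ t ih =>
      intro hrt htj
      by_contra hc
      obtain ⟨hs, hno⟩ := (h.rowUp t htj).cross_cases.2.resolve_left hc
      have track := rowUp_track (f := ρ) (p := b + 2 * j) (r := r) (m := t) (by omega)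
        (fun s hst hsr => (lt_or_gt_of_ne hsr).elim (hmin s) fun h' => ih s hst h' (by omega))
        (fun _ => hrs) t le_rfl
      have t1 := track (b + 2 * j)
      have t2 := track (b + j + (j - 1 - t))
      have x1 : exchange (b + 2 * j) (b + 2 * j - 1 - r) (b + 2 * j) = b + j + (j - 1 - r) := by
        unfold exchange; split_ifs <;> omega
      have x2 : exchange (b + 2 * j) (b + 2 * j - 1 - r) (b + j + (j - 1 - t)) =
          b + j + (j - 1 - t) := by
        unfold exchange; split_ifs <;> omega
      have x3 : upPos (b + 2 * j) t (b + 2 * j) = b + 2 * j - 1 - t + 1 := by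
        unfold upPos; split_ifs <;> omega
      have x4 : upPos (b + 2 * j) t (b + j + (j - 1 - t)) = b + 2 * j - 1 - t := by
        unfold upPos; split_ifs <;> omega
      rw [if_pos hrt, x1, (h0 _ (by omega)).2, if_neg (not_not.2 hthick), x3] at t1
      rw [if_pos hrt, x2, (h0 _ (by omega)).2, x4] at t2
      have x5 : upPos (b + 2 * j) t (exchange (b + 2 * j) (b + 2 * j - 1 - r)
          (b + (j - 1 - r))) = b + (j - 1 - r) := by
        unfold upPos exchange; split_ifs <;> omega
      rw [x5] at t1
      have hm := hmem t htj hs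
      by_cases hq : π (j - 1 - t) = j - 1 - t
      · rw [if_neg (not_not.2 hq)] at t2
        have x6 : upPos (b + 2 * j) t (exchange (b + 2 * j) (b + 2 * j - 1 - r)
            (b + (j - 1 - t))) = b + (j - 1 - t) := by
          unfold upPos exchange; split_ifs <;> omega
        rw [x6] at t2
        rw [Slice.normality_iff, t1, t2] at hno
        omega
      · rw [if_pos hq] at t2
        have h4 := hlt (j - 1 - t) (by omega)
        have h5 : π (j - 1 - t) ≠ j - 1 - r := fun hc => by
          have := hπ (j - 1 - t)
          rw [hc, hthick] at this
          omega
        rw [t2] at hm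
        unfold upPos exchange at hm
        split_ifs at hm <;> omega
  intro t ht htr
  exact (lt_or_gt_of_ne htr).elim (hmin t) fun h' => key t h' ht

theorem lcusp_rules {k : ℕ} {f g : ℕ → ℕ} (h : (Slice.lcusp k).Rules f g)
    (hg : Function.Involutive g) : g = Slice.insertPair k true f := by
  funext x
  obtain ⟨h1, h2⟩ := h
  rcases Slice.skip_cases k x with rfl | rfl | ⟨y, rfl⟩
  · simpa [Slice.insertPair_self] using h1
  · rw [← h1, hg, h1]; simp [Slice.insertPair_succ]
  · rw [h2, Slice.insertPair_skip]

theorem insertPair_of_lt {k x : ℕ} {d : Bool} {f : ℕ → ℕ} (hx : x < k) (hf : f x < k) :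
    Slice.insertPair k d f x = f x := by
  have h1 : x = Slice.skip k x := by simp [Slice.skip, hx]
  conv_lhs => rw [h1, Slice.insertPair_skip]
  simp [Slice.skip, hf]

theorem CuspState.insertPair {b j : ℕ} {π : ℕ → ℕ} {fx : ℕ → Bool} {f : ℕ → ℕ}
    (h : CuspState b j π fx f) (d : Bool) (x : ℕ) (h1 : b ≤ x) (h2 : x < b + 2 * j) :
    Slice.insertPair (b + 2 * j) d f x = f x :=
  insertPair_of_lt h2 (h.lt h1 h2).2

theorem Seg.cons {s : Slice} {w : List Slice} {ρ : ℕ → ℕ → ℕ} (h : Seg (s :: w) ρ) :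
    s.Rules (ρ 0) (ρ 1) ∧ Seg w fun t => ρ (t + 1) := by
  refine ⟨h 0 (by simp), fun t ht => ?_⟩
  exact h (t + 1) (by simpa using ht)

theorem cuspState_zero (b : ℕ) (π : ℕ → ℕ) (fx : ℕ → Bool) (f : ℕ → ℕ) : CuspState b 0 π fx f := by
  intro i hi; omega

/-- The structure of a ruling near a copy of a left cusp. -/
theorem exists_cuspState {b n : ℕ} {ρ : ℕ → ℕ → ℕ} (hi : ∀ t, Function.Involutive (ρ t))
    (h : Seg (cuspWord b n) ρ) :
    ∃ π : ℕ → ℕ, Function.Involutive π ∧ (∀ i, n ≤ i → π i = i) ∧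
      ∀ j ≤ n, CuspState b j π (fun _ => false) (ρ (cuspWord b j).length) := by
  induction n with
  | zero =>
    refine ⟨id, fun _ => rfl, fun _ _ => rfl, fun j hj => ?_⟩
    obtain rfl : j = 0 := by omega
    exact cuspState_zero b _ _ _
  | succ n ih =>
    rw [cuspWord_succ, seg_append] at h
    obtain ⟨h1, h2⟩ := h
    obtain ⟨hl, hrow⟩ := h2.cons
    obtain ⟨π, hπ, hs, hst⟩ := ih h1
    have hn := hst n le_rfl
    have hlen : (cuspWord b (n + 1)).length = (cuspWord b n).length + (n + 1) := by
      rw [cuspWord_succ]; simp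
    generalize (cuspWord b n).length = T at *
    have hins := lcusp_rules hl (hi _)
    simp only [add_zero] at hins
    have hpn : ∀ i < n, π i < n := fun i hij => by
      by_contra hc
      have := hs _ (not_lt.1 hc)
      rw [hπ i] at this
      omega
    have hlow : ∀ x, b ≤ x → x < b + 2 * n → ρ (T + 1) x = ρ T x := fun x hx hx' => by
      rw [hins]; exact hn.insertPair _ x hx hx'
    obtain ⟨r, hr1, hr2⟩ := rowUp_switch (b := b) (j := n) (π := π) hπ hs
      (ρ := fun t => ρ (T + (t + 1))) (fun _ => hi _) (by
        intro i hin
        obtain ⟨ha, hb⟩ := hn i hin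
        have := hpn i hin
        simp only [zero_add]
        rw [hlow _ (by omega) (by omega), hlow _ (by omega) (by omega), ha, hb]
        simp [this]) hrow
    have track := rowUp_track (f := fun t => ρ (T + (t + 1))) (p := b + 2 * n) (r := r) (m := n)
      (by omega) hr1 (fun h => (hr2 h).1) n le_rfl
    simp only [zero_add] at track
    have e2 : ρ (T + 1) (b + 2 * n) = b + 2 * n + 1 := by
      rw [hins]; simp [Slice.insertPair_self]
    have e3 : ρ (T + 1) (b + 2 * n + 1) = b + 2 * n := by
      rw [hins]; simp [Slice.insertPair_succ]
    by_cases hrn : r < n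
    · have hq := (hr2 hrn).2
      -- A switch at the crossing number `r` pairs the new copy `n` with the copy `n - 1 - r`, which
      -- `π` fixed so far.
      let π' : ℕ → ℕ := exchange n (n - 1 - r) ∘ π
      have hπ'0 : ∀ i, π' i = if i = n then n - 1 - r else if i = n - 1 - r then n else π i := by
        intro i
        have h1 := hπ i
        have h2 := hs n le_rfl
        have h3 : π i = n ↔ i = n := ⟨fun h => by rw [← h1, h, h2], fun h => by rw [h, h2]⟩
        have h4 : π i = n - 1 - r ↔ i = n - 1 - r :=
          ⟨fun h => by rw [← h1, h, hq], fun h => by rw [h, hq]⟩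
        show exchange _ _ _ = _
        unfold exchange
        simp only [h3, h4]
      have hπ' : Function.Involutive π' := by
        intro i
        have h1 := hπ i
        have h2 := hs n le_rfl
        have h3 : π i = n ↔ i = n := ⟨fun h => by rw [← h1, h, h2], fun h => by rw [h, h2]⟩
        have h4 : π i = n - 1 - r ↔ i = n - 1 - r :=
          ⟨fun h => by rw [← h1, h, hq], fun h => by rw [h, hq]⟩
        rw [hπ'0, hπ'0]
        split_ifs <;> omega
      -- The earlier states ignore pairs with a copy that is not yet present, so passing from `π` to
      -- `π'` does not affect them.
      have hst' : ∀ j ≤ n, CuspState b j π' (fun _ => false) (ρ (cuspWord b j).length) := by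
        intro j hj i hij
        obtain ⟨ha, hb⟩ := hst j hj i hij
        have hqi : i = n - 1 - r → π i = i := by rintro rfl; exact hq
        rw [ha, hb, hπ'0]
        simp only [Bool.false_eq_true, if_false]
        constructor <;> split_ifs <;> omega
      refine ⟨π', hπ', fun i hin => ?_, fun j hj => ?_⟩
      · rw [hπ'0, if_neg (by omega), if_neg (by omega), hs i (by omega)]
      · rcases Nat.lt_or_ge j (n + 1) with hj | hj
        · exact hst' j (by omega)
        · obtain rfl : j = n + 1 := by omega
          rw [hlen]
          have hTlen := hst' n le_rfl
          refine cuspState_succ hπ' (by simp) (f := ρ T) (f' := ρ (T + 1)) ?_ hlow (by simpa using e2)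
            (by simpa using e3) fun x => ?_
          · intro i hin
            obtain ⟨ha, hb⟩ := hn i hin
            have hqi : i = n - 1 - r → π i = i := by rintro rfl; exact hq
            rw [ha, hb, hπ'0]
            simp only [Bool.false_eq_true, if_false]
            constructor <;> split_ifs <;> omega
          · have h4 : π' n = n - 1 - r := by rw [hπ'0, if_pos rfl]
            rw [track, if_pos hrn, h4, if_pos (by omega),
              show b + n + (n - 1 - r) = b + 2 * n - 1 - r by omega]
    · refine ⟨π, hπ, fun i hin => hs i (by omega), fun j hj => ?_⟩
      rcases Nat.lt_or_ge j (n + 1) with hj | hj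
      · exact hst j (by omega)
      · obtain rfl : j = n + 1 := by omega
        rw [hlen]
        refine cuspState_succ hπ (by simp) (f := ρ T) (f' := ρ (T + 1)) hn hlow (by simpa using e2)
          (by simpa using e3) fun x => ?_
        rw [track, if_neg (by omega), if_neg (by rw [hs n le_rfl]; omega)]

/-! ### Thin pairs along the strands of the companion -/

/-- The place after the word `w` of the strand that starts at place `x`, in a word of crossings. -/
def posAfter : List Slice → ℕ → ℕ
  | [], x => x
  | Slice.cross k :: w, x => posAfter w (Equiv.swap k (k + 1) x)
  | _ :: w, x => posAfter w x

theorem posAfter_append (w₁ w₂ : List Slice) (x : ℕ) :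
    posAfter (w₁ ++ w₂) x = posAfter w₂ (posAfter w₁ x) := by
  induction w₁ generalizing x with
  | nil => rfl
  | cons s w ih => cases s <;> exact ih _

theorem rowDown_succ (p m : ℕ) : rowDown p (m + 1) = rowDown p m ++ [Slice.cross (p + m)] := by
  simp [rowDown, List.range_succ]

theorem posAfter_rowDown (p m x : ℕ) : posAfter (rowDown p m) x =
    if x = p then p + m else if p < x ∧ x ≤ p + m then x - 1 else x := by
  induction m with
  | zero => simp only [rowDown, List.range_zero, List.map_nil, posAfter]; split_ifs <;> omega
  | succ m ih =>
    rw [rowDown_succ, posAfter_append, ih]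
    simp only [posAfter, Slice.swap_val]
    split_ifs <;> omega

theorem posAfter_grid (b m n x : ℕ) : posAfter (grid b m n) x =
    if b ≤ x ∧ x < b + m then x + n else if b + m ≤ x ∧ x < b + m + n then x - m else x := by
  induction m generalizing x with
  | zero => simp only [grid, List.range_zero, List.reverse_nil, List.flatMap_nil, posAfter]
            split_ifs <;> omega
  | succ m ih =>
    rw [grid_succ, posAfter_append, ih, posAfter_rowDown]
    split_ifs <;> omega

/-- A word of crossings between the places `b` and `b + N`. -/
def CrossingsIn (b N : ℕ) (w : List Slice) : Prop :=
  ∀ s ∈ w, ∃ k, s = Slice.cross k ∧ b ≤ k ∧ k + 1 < b + N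

theorem crossingsIn_rowDown {b N p m : ℕ} (h1 : b ≤ p) (h2 : p + m < b + N) :
    CrossingsIn b N (rowDown p m) := by
  intro s hs
  simp only [rowDown, List.mem_map, List.mem_range] at hs
  obtain ⟨j, hj, rfl⟩ := hs
  exact ⟨_, rfl, by omega, by omega⟩

theorem crossingsIn_rowUp {b N p m : ℕ} (h1 : b + m ≤ p) (h2 : p < b + N) :
    CrossingsIn b N (rowUp p m) := by
  intro s hs
  simp only [rowUp, List.mem_map, List.mem_range] at hs
  obtain ⟨j, hj, rfl⟩ := hs
  exact ⟨_, rfl, by omega, by omega⟩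

theorem crossingsIn_append {b N : ℕ} {w₁ w₂ : List Slice} (h1 : CrossingsIn b N w₁)
    (h2 : CrossingsIn b N w₂) : CrossingsIn b N (w₁ ++ w₂) := by
  intro s hs
  rcases List.mem_append.1 hs with h | h
  · exact h1 s h
  · exact h2 s h

theorem crossingsIn_grid {b N m n : ℕ} (h : m + n ≤ N) : CrossingsIn b N (grid b m n) := by
  induction m with
  | zero => intro s hs; simp [grid] at hs
  | succ m ih =>
    rw [grid_succ]
    exact crossingsIn_append (crossingsIn_rowDown (by omega) (by omega)) (ih (by omega))

theorem SwitchOutside.cons {R : ℕ → Prop} {s : Slice} {w : List Slice} {ρ : ℕ → ℕ → ℕ}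
    (h : SwitchOutside R (s :: w) ρ) : SwitchOutside R w fun t => ρ (t + 1) := by
  intro t ht k hk
  exact h (t + 1) (by simpa using ht) k (by simpa using hk)

/-- A switch could disturb a pair inside the region only if one of the switching strands belonged to
it, but these strands are fixed or paired outside the region. -/
theorem pair_transport {b N : ℕ} {w : List Slice} (hw : CrossingsIn b N w) {ρ : ℕ → ℕ → ℕ}
    (hi : ∀ t, Function.Involutive (ρ t))
    (h : Seg w ρ) (hs : SwitchOutside (fun x => b ≤ x ∧ x < b + N) w ρ) {x y : ℕ}
    (hx : b ≤ x ∧ x < b + N) (hy : b ≤ y ∧ y < b + N) (hxy : x ≠ y) :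
    ρ w.length (posAfter w x) = posAfter w y ↔ ρ 0 x = y := by
  induction w generalizing ρ x y with
  | nil => rfl
  | cons s w ih =>
    obtain ⟨k, rfl, hk1, hk2⟩ := hw s (by simp)
    obtain ⟨h1, h2⟩ := h.cons
    have hx' : b ≤ Equiv.swap k (k + 1) x ∧ Equiv.swap k (k + 1) x < b + N := by
      rw [Slice.swap_val]; split_ifs <;> omega
    have hy' : b ≤ Equiv.swap k (k + 1) y ∧ Equiv.swap k (k + 1) y < b + N := by
      rw [Slice.swap_val]; split_ifs <;> omega
    refine (ih (fun s hs => hw s (by simp [hs])) (fun t => hi _) h2 hs.cons hx' hy'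
      (by rwa [Ne, Slice.swap_inj])).trans ?_
    obtain ⟨-, h3⟩ := h1.cross_cases
    by_cases h4 : ConjAt k (ρ 0) (ρ 1)
    · simp only [zero_add]
      rw [h4, Slice.swap_inj]
    · have h5 := (h3.resolve_left h4).1
      obtain ⟨h6, h7⟩ := hs 0 (by simp) k rfl h4
      simp only [zero_add]
      rw [h5]
      by_cases hxk : x = k
      · subst hxk
        rw [Equiv.swap_apply_left, Slice.swap_val]
        split_ifs <;> omega
      by_cases hxk' : x = k + 1
      · subst hxk'
        rw [Equiv.swap_apply_right, Slice.swap_val]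
        split_ifs <;> omega
      rw [Equiv.swap_apply_of_ne_of_ne hxk hxk']
      have h8 := hi 0 x
      have h9 : ∀ z, ρ 0 x = z → ρ 0 z = x := fun z hz => by rw [← hz, h8]
      by_cases hyk : y = k
      · subst hyk
        rw [Equiv.swap_apply_left]
        have := h9 y
        have := h9 (y + 1)
        omega
      by_cases hyk' : y = k + 1
      · subst hyk'
        rw [Equiv.swap_apply_right]
        have := h9 k
        have := h9 (k + 1)
        omega
      rw [Equiv.swap_apply_of_ne_of_ne hyk hyk']

theorem pair_outer {b N : ℕ} {w : List Slice} (hw : CrossingsIn b N w) {ρ : ℕ → ℕ → ℕ}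
    (h : Seg w ρ) {x y : ℕ} (hx : x < b ∨ b + N ≤ x) (hy : y < b ∨ b + N ≤ y) :
    ρ w.length x = y ↔ ρ 0 x = y := by
  induction w generalizing ρ with
  | nil => rfl
  | cons s w ih =>
    obtain ⟨k, rfl, hk1, hk2⟩ := hw s (by simp)
    obtain ⟨h1, h2⟩ := h.cons
    refine (ih (fun s hs => hw s (by simp [hs])) h2).trans ?_
    exact pair_untouched h1 (by omega) (by omega) (by omega) (by omega)

/-- The place after the insertion of `2 m` strands at the place `b`. -/
def skipN (b m x : ℕ) : ℕ := if x < b then x else x + 2 * m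

/-- The crossings in the copy of a cusp involve only strands born at its cusps. -/
theorem cuspWord_outer {b n : ℕ} {ρ : ℕ → ℕ → ℕ} (h : Seg (cuspWord b n) ρ) (x y : ℕ) :
    ρ (cuspWord b n).length (skipN b n x) = skipN b n y ↔ ρ 0 x = y := by
  induction n generalizing x y with
  | zero => 
    have : ∀ x, skipN b 0 x = x := by intro x; simp [skipN]
    rw [this, this]; rfl
  | succ n ih =>
    rw [cuspWord_succ, seg_append] at h
    obtain ⟨h1, h2⟩ := h
    obtain ⟨hl, hrow⟩ := h2.cons
    have e1 : ∀ x, skipN b (n + 1) x = Slice.skip (b + 2 * n) (skipN b n x) := by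
      intro x; unfold skipN Slice.skip; split_ifs <;> omega
    have e2 : ∀ x, skipN b (n + 1) x < b ∨ b + (2 * n + 2) ≤ skipN b (n + 1) x := by
      intro x; unfold skipN; split_ifs <;> omega
    have h3 := pair_outer (b := b) (N := 2 * n + 2)
      (crossingsIn_rowUp (by omega) (by omega)) hrow (e2 x) (e2 y)
    rw [cuspWord_succ, List.length_append, List.length_cons]
    refine h3.trans (Iff.trans ?_ (ih h1 x y))
    simp only [zero_add, e1]
    rw [show (cuspWord b n).length + 1 = (cuspWord b n).length + 0 + 1 by omega]
    have h4 := hl.2 (skipN b n x)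
    simp only [add_zero] at h4 ⊢
    rw [h4, Slice.skip_inj]

theorem Seg.reverse {w : List Slice} {ρ : ℕ → ℕ → ℕ} (hi : ∀ t, Function.Involutive (ρ t))
    (h : Seg w ρ) : Seg (w.reverse.map Slice.mirror) fun t => ρ (w.length - t) := by
  intro t ht
  rw [List.length_map, List.length_reverse] at ht
  have h1 := (h (w.length - 1 - t) (by omega)).mirror (hi _)
  simp only [List.getElem_map, List.getElem_reverse]
  convert h1 using 2 <;> omega

theorem Slice.mirror_mirror (s : Slice) : s.mirror.mirror = s := by cases s <;> rfl

theorem map_mirror_reverse (w : List Slice) :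
    ((w.reverse.map Slice.mirror).reverse.map Slice.mirror) = w := by
  rw [← List.map_reverse, List.reverse_reverse, List.map_map]
  conv_rhs => rw [← List.map_id w]
  exact List.map_congr_left fun s _ => s.mirror_mirror

/-- The pairing among the `n` copies of the strand `s`, extended by the identity. -/
def thinAt (f : ℕ → ℕ) (n s : ℕ) : ℕ → ℕ := fun i =>
  if i < n ∧ n * s ≤ f (n * s + i) ∧ f (n * s + i) < n * s + n then f (n * s + i) - n * s else i

/-- A fixed copy and a copy paired outside the block are both recorded as fixed, so only pairs of
distinct copies have to be compared. -/
theorem thinAt_congr {f g : ℕ → ℕ} {n s s' : ℕ}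
    (h : ∀ i < n, ∀ j < n, i ≠ j → (f (n * s + i) = n * s + j ↔ g (n * s' + i) = n * s' + j)) :
    thinAt f n s = thinAt g n s' := by
  funext i
  unfold thinAt
  by_cases hi : i < n
  · by_cases h1 : n * s ≤ f (n * s + i) ∧ f (n * s + i) < n * s + n
    · by_cases h2 : f (n * s + i) - n * s = i
      · rw [if_pos ⟨hi, h1⟩, h2]
        by_cases h3 : n * s' ≤ g (n * s' + i) ∧ g (n * s' + i) < n * s' + n
        · by_cases h4 : g (n * s' + i) - n * s' = i
          · rw [if_pos ⟨hi, h3⟩, h4]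
          · have := (h i hi (g (n * s' + i) - n * s') (by omega) (by omega)).2 (by omega)
            omega
        · rw [if_neg (by tauto)]
      · have := (h i hi (f (n * s + i) - n * s) (by omega) (by omega)).1 (by omega)
        rw [if_pos ⟨hi, h1⟩, if_pos ⟨hi, by omega, by omega⟩, this]
        omega
    · rw [if_neg (by tauto)]
      by_cases h3 : n * s' ≤ g (n * s' + i) ∧ g (n * s' + i) < n * s' + n
      · by_cases h4 : g (n * s' + i) - n * s' = i
        · rw [if_pos ⟨hi, h3⟩, h4]
        · have := (h i hi (g (n * s' + i) - n * s') (by omega) (by omega)).2 (by omega)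
          omega
      · rw [if_neg (by tauto)]
  · rw [if_neg (by tauto), if_neg (by tauto)]

/-- A copy fixed by `π` is paired across the cusp, between the two blocks, and therefore counts as
fixed in each of them. -/
theorem CuspState.thinAt {b n : ℕ} {π : ℕ → ℕ} {f : ℕ → ℕ}
    (hπ : Function.Involutive π) (hs : ∀ i, n ≤ i → π i = i) {k : ℕ} (hb : b = n * k)
    (h : CuspState b n π (fun _ => false) f) :
    _root_.thinAt f n k = π ∧ _root_.thinAt f n (k + 1) = π := by
  have hlt : ∀ i < n, π i < n := fun i hij => by
    by_contra hc
    have := hs _ (not_lt.1 hc)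
    rw [hπ i] at this
    omega
  subst hb
  constructor
  · funext i
    unfold _root_.thinAt
    by_cases hi : i < n
    · have := hlt i hi
      rw [(h i hi).1]
      simp only [Bool.false_eq_true, if_false]
      split_ifs <;> omega
    · rw [if_neg (by tauto), hs i (by omega)]
  · funext i
    unfold _root_.thinAt
    by_cases hi : i < n
    · have := hlt i hi
      rw [show n * (k + 1) = n * k + n by ring, (h i hi).2]
      simp only [Bool.false_eq_true, if_false]
      split_ifs <;> omega
    · rw [if_neg (by tauto), hs i (by omega)]


theorem copy_cross (n k : ℕ) : ((Slice.cross k).copy n).map Prod.fst = grid (n * k) n n := by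
  simp only [Slice.copy, grid, List.map_flatMap, List.map_map, rowDown]
  refine List.flatMap_congr fun i _ => List.map_congr_left fun j _ => ?_
  simp [add_assoc]

theorem leftCuspCopy_fst (n k : ℕ) : (leftCuspCopy n k).map Prod.fst = cuspWord (n * k) n := by
  simp only [leftCuspCopy, cuspWord, List.map_flatMap, List.map_map, List.map_cons, rowUp]
  refine List.flatMap_congr fun j _ => ?_
  congr 1
  refine List.map_congr_left fun r hr => ?_
  rw [List.mem_range] at hr
  simp only [Function.comp_apply, Slice.cross.injEq]
  omega

theorem copy_lcusp (n k : ℕ) : ((Slice.lcusp k).copy n).map Prod.fst = cuspWord (n * k) n :=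
  leftCuspCopy_fst n k

theorem copy_rcusp (n k : ℕ) :
    ((Slice.rcusp k).copy n).map Prod.fst = (cuspWord (n * k) n).reverse.map Slice.mirror := by
  rw [← leftCuspCopy_fst, Slice.copy, List.map_map, ← List.map_reverse, List.map_map]
  rfl

theorem block_lt {n i k : ℕ} (h : i < k) : n * i + n ≤ n * k := by
  calc n * i + n = n * (i + 1) := by ring
    _ ≤ n * k := Nat.mul_le_mul_left n h

theorem thinAt_lcusp {n k : ℕ} {ρ : ℕ → ℕ → ℕ} (hi : ∀ t, Function.Involutive (ρ t))
    (h : Seg (cuspWord (n * k) n) ρ) :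
    (∀ i, thinAt (ρ (cuspWord (n * k) n).length) n (Slice.skip k i) = thinAt (ρ 0) n i) ∧
    thinAt (ρ (cuspWord (n * k) n).length) n k = thinAt (ρ (cuspWord (n * k) n).length) n (k + 1) := by
  constructor
  · intro i
    refine thinAt_congr fun x hx y hy _ => ?_
    have e : ∀ x < n, n * Slice.skip k i + x = skipN (n * k) n (n * i + x) := by
      intro x hx
      unfold Slice.skip skipN
      rcases lt_or_ge i k with h | h
      · have := block_lt (n := n) h
        rw [if_pos h, if_pos (by omega)]
      · have := Nat.mul_le_mul_left n h
        rw [if_neg (by omega), if_neg (by omega)]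
        ring
    rw [e x hx, e y hy, cuspWord_outer h]
  · obtain ⟨π, hπ, hs, hst⟩ := exists_cuspState hi h
    have := (hst n le_rfl).thinAt hπ hs rfl
    rw [this.1, this.2]

/-- Thin pairs of the two crossing blocks lie inside the grid. By `grid_switchOutside` no switch
touches them, so they follow the diagram. -/
theorem thinAt_cross {n k : ℕ} {ρ : ℕ → ℕ → ℕ} (hi : ∀ t, Function.Involutive (ρ t))
    (h : Seg (grid (n * k) n n) ρ) (i : ℕ) :
    thinAt (ρ (grid (n * k) n n).length) n (Equiv.swap k (k + 1) i) = thinAt (ρ 0) n i := by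
  refine thinAt_congr fun x hx y hy hxy => ?_
  have hk : n * (k + 1) = n * k + n := by ring
  have hso := grid_switchOutside hi h
  simp only [add_assoc] at hso
  have hcr : CrossingsIn (n * k) (n + n) (grid (n * k) n n) := crossingsIn_grid le_rfl
  by_cases hik : i = k ∨ i = k + 1
  · have e : ∀ x < n, n * Equiv.swap k (k + 1) i + x = posAfter (grid (n * k) n n) (n * i + x) := by
      intro x hx
      rw [posAfter_grid]
      rcases hik with rfl | rfl
      · rw [Equiv.swap_apply_left, hk]; split_ifs <;> omega
      · rw [Equiv.swap_apply_right, hk]; split_ifs <;> omega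
    rw [e x hx, e y hy]
    refine pair_transport hcr hi h hso ?_ ?_ (by omega)
    · rcases hik with rfl | rfl <;> omega
    · rcases hik with rfl | rfl <;> omega
  · push Not at hik
    rw [Equiv.swap_apply_of_ne_of_ne hik.1 hik.2]
    have hb : n * i + n ≤ n * k ∨ n * k + (n + n) ≤ n * i := by
      rcases lt_or_gt_of_ne hik.1 with h | h
      · exact Or.inl (block_lt h)
      · have := Nat.mul_le_mul_left n (show k + 2 ≤ i by omega)
        right; calc _ = n * (k + 2) := by ring
          _ ≤ _ := this
    exact pair_outer hcr h (by omega) (by omega)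

/-- The pairing among the copies of a strand is carried along the strand. -/
theorem thinAt_step {n : ℕ} {s : Slice} {ρ : ℕ → ℕ → ℕ} (hi : ∀ t, Function.Involutive (ρ t))
    (h : Seg ((s.copy n).map Prod.fst) ρ) :
    (∀ i j, s.Continues i j → thinAt (ρ (s.copy n).length) n j = thinAt (ρ 0) n i) ∧
    (∀ k, s = Slice.lcusp k →
      thinAt (ρ (s.copy n).length) n k = thinAt (ρ (s.copy n).length) n (k + 1)) ∧
    (∀ k, s = Slice.rcusp k → thinAt (ρ 0) n k = thinAt (ρ 0) n (k + 1)) := by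
  rw [← List.length_map (f := Prod.fst)]
  cases s with
  | triv => exact ⟨by rintro i j rfl; rfl, by simp, by simp⟩
  | cross k =>
    rw [copy_cross] at *
    exact ⟨by rintro i j rfl; exact thinAt_cross hi h i, by simp, by simp⟩
  | lcusp k =>
    rw [copy_lcusp] at *
    have := thinAt_lcusp hi h
    refine ⟨by rintro i j rfl; exact this.1 i, ?_, by simp⟩
    rintro k' hk; cases hk; exact this.2
  | rcusp k =>
    rw [copy_rcusp] at *
    have h' := h.reverse hi
    rw [map_mirror_reverse] at h'
    have := thinAt_lcusp (fun t => hi _) h'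
    rw [List.length_map, List.length_reverse] at *
    simp only [Nat.sub_self, Nat.sub_zero] at this
    refine ⟨by rintro i j rfl; exact (this.1 j).symm, by simp, ?_⟩
    rintro k' hk; cases hk; exact this.2

/-! ### Parity and connectedness of the companion -/

open Finset in
theorem sum_skip (h : ℕ → ℕ) {k w : ℕ} (hk : k ≤ w) :
    ∑ i ∈ range (w + 2), h i = ∑ i ∈ range w, h (Slice.skip k i) + h k + h (k + 1) := by
  induction w, hk using Nat.le_induction with
  | base =>
    rw [sum_range_succ, sum_range_succ]
    congr 2
    refine sum_congr rfl fun i hi => ?_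
    rw [mem_range] at hi
    simp [Slice.skip, hi]
  | succ w hk ih =>
    rw [show w + 1 + 2 = w + 2 + 1 by omega, sum_range_succ, ih, sum_range_succ,
      show Slice.skip k w = w + 2 by simp [Slice.skip, not_lt.2 hk]]
    ring

open Finset in
theorem sum_swap (h : ℕ → ℕ) {k w : ℕ} (hk : k + 1 < w) :
    ∑ i ∈ range w, h (Equiv.swap k (k + 1) i) = ∑ i ∈ range w, h i := by
  refine sum_bij (fun i _ => Equiv.swap k (k + 1) i) ?_ ?_ ?_ ?_
  · intro i hi
    rw [mem_range] at *
    rw [Slice.swap_val]; split_ifs <;> omega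
  · exact fun _ _ _ _ h => Slice.swap_inj.1 h
  · intro i hi
    refine ⟨Equiv.swap k (k + 1) i, ?_, Equiv.swap_apply_self ..⟩
    rw [mem_range] at *
    rw [Slice.swap_val]; split_ifs <;> omega
  · intros; rfl

namespace Slice

/-- Labels `f` and `g` of the strands at the two ends of a slice that are constant along strands
and agree on the two branches of a cusp. -/
structure Labels {A : Type*} (s : Slice) (f g : ℕ → A) : Prop where
  strand : ∀ i j, s.Continues i j → g j = f i
  lcusp : ∀ k, s = lcusp k → g k = g (k + 1)
  rcusp : ∀ k, s = rcusp k → f k = f (k + 1)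

-- A crossing permutes the strands, and a cusp creates or removes two strands with the same label.
open Finset Classical in
theorem Labels.even_iff {A : Type*} {s : Slice} {f g : ℕ → A} (h : s.Labels f g) {w : ℕ}
    (hw : s.Ok w) (v : A) :
    Even (∑ i ∈ range (s.out w), if g i = v then 1 else 0) ↔
      Even (∑ i ∈ range w, if f i = v then 1 else 0) := by
  cases s with
  | triv =>
    have : g = f := funext fun i => h.strand i i rfl
    rw [this]; rfl
  | cross k =>
    show Even (∑ i ∈ range w, _) ↔ _
    rw [← sum_swap _ hw]
    refine iff_of_eq (congrArg _ (sum_congr rfl fun i _ => ?_))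
    rw [h.strand i _ rfl]
  | lcusp k =>
    show Even (∑ i ∈ range (w + 2), _) ↔ _
    rw [sum_skip _ hw, ← h.lcusp k rfl, add_assoc, Nat.even_add]
    simp only [Even.add_self, iff_true]
    refine iff_of_eq (congrArg _ (sum_congr rfl fun i _ => ?_))
    rw [h.strand i _ rfl]
  | rcusp k =>
    simp only [Ok] at hw
    obtain ⟨w, rfl⟩ : ∃ w', w = w' + 2 := ⟨w - 2, by omega⟩
    show Even (∑ i ∈ range (w + 2 - 2), _) ↔ _
    rw [Nat.add_sub_cancel, sum_skip _ (show k ≤ w by omega), ← h.rcusp k rfl, add_assoc,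
      Nat.even_add]
    simp only [Even.add_self, iff_true]
    refine iff_of_eq (congrArg _ (sum_congr rfl fun i _ => ?_))
    rw [h.strand _ i rfl]

end Slice

namespace Front

open Finset in
/-- Labels of the strands of a connected planar front, which are given to the left and to the right
of a vertical line and agree on this line except possibly at one strand, are constant. -/
theorem labels_const {A : Type*} {F : Front} (hF : F.IsPlanar) (hc : F.Connected) {t₀ s₀ : ℕ}
    (hb : F.IsPoint (t₀, s₀)) {x y : ℕ → ℕ → A}
    (hx : ∀ t < t₀, (F.slice t).Labels (x t) (x (t + 1)))
    (hy : ∀ t, t₀ ≤ t → t < F.length → (F.slice t).Labels (y t) (y (t + 1)))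
    (hxy : ∀ i < F.width t₀, i ≠ s₀ → x t₀ i = y t₀ i) :
    (∀ t ≤ t₀, ∀ i < F.width t, x t i = x t₀ s₀) ∧
    ∀ t, t₀ ≤ t → t ≤ F.length → ∀ i < F.width t, y t i = x t₀ s₀ := by
  classical
  obtain ⟨hb1, hb2⟩ := hb
  simp only at hb1 hb2
  -- There are no strands at the left end, so every label occurs an even number of times at each
  -- line; likewise, for `ey`, starting from the right end.
  have ex : ∀ v, ∀ t ≤ t₀, Even (∑ i ∈ range (F.width t), if x t i = v then 1 else 0) := by
    intro v t
    induction t with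
    | zero => intro _; rw [F.width_zero, hF.left_eq]; simp
    | succ t ih =>
      intro ht
      rw [F.width_succ, (hx t (by omega)).even_iff (hF.ok t (by omega))]
      exact ih (by omega)
  have ey : ∀ v, ∀ t ≤ F.length, t₀ ≤ t →
      Even (∑ i ∈ range (F.width t), if y t i = v then 1 else 0) := by
    intro v t ht
    induction ht using Nat.decreasingInduction with
    | self => intro _; rw [hF.right_eq]; simp
    | of_succ t ht ih =>
      intro ht'
      rw [← (hy t ht' (by omega)).even_iff (hF.ok t (by omega)), ← F.width_succ]
      exact ih (by omega)
  -- On the base line the two labellings differ at most at `s₀`. In each of them the label `x t₀ s₀`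
  -- occurs an even number of times, which forces agreement at `s₀` too.
  have hbase : x t₀ s₀ = y t₀ s₀ := by
    have h1 := ex (x t₀ s₀) t₀ le_rfl
    have h2 := ey (x t₀ s₀) t₀ hb1 le_rfl
    rw [← Finset.add_sum_erase _ _ (mem_range.2 hb2)] at h1 h2
    by_contra hne
    rw [if_neg (fun h => hne h.symm), zero_add] at h2
    rw [if_pos rfl, Nat.even_add] at h1
    have h3 : ∑ i ∈ (range (F.width t₀)).erase s₀, (if x t₀ i = x t₀ s₀ then 1 else 0) =
        ∑ i ∈ (range (F.width t₀)).erase s₀, if y t₀ i = x t₀ s₀ then 1 else 0 := by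
      refine sum_congr rfl fun i hi => ?_
      rw [mem_erase, mem_range] at hi
      rw [hxy i hi.2 hi.1]
    rw [h3] at h1
    have := h1.2 h2
    simp at this
  have hxy' : ∀ i < F.width t₀, x t₀ i = y t₀ i := fun i hi => by
    by_cases h : i = s₀
    · rw [h, hbase]
    · exact hxy i hi h
  -- Since they agree on the base line, the labellings combine to a function that is constant on
  -- adjacent points, and connectedness applies.
  let z : ℕ × ℕ → A := fun P => if P.1 ≤ t₀ then x P.1 P.2 else y P.1 P.2
  have zx : ∀ t ≤ t₀, ∀ i, z (t, i) = x t i := fun t ht i => if_pos ht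
  have zy : ∀ t, t₀ ≤ t → ∀ i < F.width t, z (t, i) = y t i := by
    intro t ht i hi
    rcases ht.eq_or_lt with rfl | ht
    · rw [zx _ le_rfl, hxy' i hi]
    · exact if_neg (by simpa using ht)
  have hz : ∀ P Q, F.Adj P Q → z P = z Q := by
    rintro _ _ (⟨t, i, j, ht, hi, hj, h⟩ | ⟨t, k, ht, h⟩ | ⟨t, k, ht, h⟩)
    · rcases lt_or_ge t t₀ with h1 | h1
      · rw [zx _ h1.le, zx _ h1, (hx t h1).strand i j h]
      · rw [zy _ h1 _ hi, zy _ (by omega) _ hj, (hy t h1 ht).strand i j h]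
    · have hok := hF.ok t ht
      have hw := F.width_succ t
      rw [h] at hok hw
      simp only [Slice.Ok, Slice.out] at hok hw
      rcases lt_or_ge t t₀ with h1 | h1
      · rw [zx _ h1, zx _ h1, (hx t h1).lcusp k h]
      · rw [zy _ (by omega) _ (by omega), zy _ (by omega) _ (by omega), (hy t h1 ht).lcusp k h]
    · have hok := hF.ok t ht
      rw [h] at hok
      simp only [Slice.Ok] at hok
      rcases lt_or_ge t t₀ with h1 | h1
      · rw [zx _ h1.le, zx _ h1.le, (hx t h1).rcusp k h]
      · rw [zy _ h1 _ (by omega), zy _ h1 _ (by omega), (hy t h1 ht).rcusp k h]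
  have hconst : ∀ P, F.IsPoint P → z P = x t₀ s₀ := by
    intro P hP
    have h1 : ∀ P Q, Relation.EqvGen F.Adj P Q → z P = z Q := by
      intro P Q h
      induction h with
      | rel _ _ h => exact hz _ _ h
      | refl => rfl
      | symm _ _ _ ih => exact ih.symm
      | trans _ _ _ _ _ ih ih' => exact ih.trans ih'
    rw [← zx t₀ le_rfl]
    exact h1 _ _ (hc P (t₀, s₀) hP ⟨hb1, hb2⟩)
  refine ⟨fun t ht i hi => ?_, fun t ht ht' i hi => ?_⟩
  · rw [← zx t ht]; exact hconst (t, i) ⟨by show t ≤ _; omega, hi⟩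
  · rw [← zy t ht i hi]; exact hconst (t, i) ⟨ht', hi⟩

end Front

/-! ### Rulings that extend a partial ruling -/

/-- In a copy of a left cusp, the switches are determined by the pairing `π` of the copies. -/
theorem rowUp_switch_iff {b j : ℕ} {π : ℕ → ℕ} (hπ : Function.Involutive π) {ρ : ℕ → ℕ → ℕ}
    (hi : ∀ t, Function.Involutive (ρ t)) (h0 : CuspState b j π (fun _ => false) (ρ 0))
    (h1 : CuspState b (j + 1) π (fun _ => false) (ρ j))
    (htop : ρ 0 (b + 2 * j) = b + 2 * j + 1) (h : Seg (rowUp (b + 2 * j) j) ρ) (t : ℕ) (ht : t < j) :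
    (π j = j - 1 - t → ρ (t + 1) = ρ t) ∧
      (π j ≠ j - 1 - t → ConjAt (b + 2 * j - 1 - t) (ρ t) (ρ (t + 1))) := by
  -- Before the row only the pairs among the first `j` copies are present, and `rowUp_switch` needs
  -- an involution supported there.
  let π' : ℕ → ℕ := fun i => if i < j ∧ π i < j then π i else i
  have hπ' : Function.Involutive π' := by
    intro i
    have := hπ i
    simp only [π']
    by_cases h : i < j ∧ π i < j
    · rw [if_pos h, this, if_pos (by omega)]
    · rw [if_neg h, if_neg h]
  obtain ⟨r, hr1, hr2⟩ := rowUp_switch (b := b) (j := j) hπ' (fun i hij => if_neg (by omega)) hi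
    (by
      intro i hij
      obtain ⟨ha, hb⟩ := h0 i hij
      rw [ha, hb]
      simp only [π', hij, true_and, Bool.false_eq_true, if_false]
      constructor <;> split_ifs <;> omega) h
  -- The companion of the upper branch at the end of the row reveals the switch. After a switch at
  -- the crossing `r` it is the upper branch of the copy `j - 1 - r`; without a switch it is the
  -- lower branch of the same cusp.
  have track := rowUp_track (f := ρ) (p := b + 2 * j) (r := r) (m := j) (by omega) hr1
    (fun h => (hr2 h).1) j le_rfl (b + 2 * j)
  have e1 : upPos (b + 2 * j) j (b + 2 * j) = b + j := by unfold upPos; split_ifs <;> omega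
  have h2 := (h1 j (by omega)).1
  rw [e1] at track
  rw [track] at h2
  simp only [Bool.false_eq_true, if_false] at h2
  by_cases hrj : r < j
  · have hfix := (hr2 hrj).2
    have e2 : exchange (b + 2 * j) (b + 2 * j - 1 - r) (b + 2 * j) = b + j + (j - 1 - r) := by
      unfold exchange; split_ifs <;> omega
    have h3 := (h0 (j - 1 - r) (by omega)).2
    simp only [Bool.false_eq_true, if_false] at h3
    have h4 : ¬ (π (j - 1 - r) ≠ j - 1 - r ∧ π (j - 1 - r) < j) := by
      rintro ⟨h5, h6⟩
      simp only [π'] at hfix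
      rw [if_pos (by omega)] at hfix
      exact h5 hfix
    rw [if_neg h4] at h3
    have e3 : upPos (b + 2 * j) j (exchange (b + 2 * j) (b + 2 * j - 1 - r) (b + (j - 1 - r))) =
        b + (j - 1 - r) := by
      unfold exchange upPos; split_ifs <;> omega
    rw [if_pos hrj, e2, h3, e3] at h2
    have h5 : π j = j - 1 - r := by split_ifs at h2 <;> omega
    refine ⟨fun h6 => ?_, fun h6 => hr1 t ht fun h7 => h6 (by rw [h5, h7])⟩
    obtain rfl : t = r := by omega
    exact (hr2 hrj).1
  · refine ⟨fun h6 => ?_, fun _ => hr1 t ht (by omega)⟩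
    have e2 : upPos (b + 2 * j) j (b + 2 * j + 1) = b + 2 * j + 1 := by
      unfold upPos; split_ifs <;> omega
    rw [if_neg hrj, htop, e2] at h2
    split_ifs at h2 <;> omega

/-- The involution `r` extends `f`. -/
def Extends (f r : ℕ → ℕ) : Prop := ∀ x, f x ≠ x → r x = f x

/-- At a crossing it suffices that the ruling switches where there is a flag and follows the diagram
at an unflagged crossing with a moved strand. Cusps need no assumption, since the ruling pairs their
branches anyway. -/
theorem Slice.PartialRules.extends {s : Slice} {d : Bool} {f g r r' : ℕ → ℕ}
    (hp : s.PartialRules d f g) (hru : s.Rules r r') (hf : Function.Involutive f)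
    (hr' : Function.Involutive r') (h : Extends f r)
    (hk : ∀ k, s = cross k → (d = true → r' = r) ∧
      (d = false → ¬ (f k = k ∧ f (k + 1) = k + 1) → ConjAt k r r')) : Extends g r' := by
  cases s with
  | triv =>
    obtain rfl : g = f := hp
    obtain rfl : r' = r := hru
    exact h
  | cross k =>
    obtain ⟨hk1, hk2⟩ := hk k rfl
    obtain ⟨h1, ⟨rfl, h2⟩ | ⟨rfl, rfl, -⟩⟩ := hp
    · by_cases hn : f k = k ∧ f (k + 1) = k + 1
      · have hgf := conj_eq_of_fixed hf h2 hn.1 hn.2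
        rcases hru.2 with h3 | ⟨h3, -⟩
        · intro x hx
          rw [hgf] at hx ⊢
          have hxk : x ≠ k ∧ x ≠ k + 1 := by
            constructor
            · rintro rfl; exact hx hn.1
            · rintro rfl; exact hx hn.2
          have := h3 x
          rw [Equiv.swap_apply_of_ne_of_ne hxk.1 hxk.2, h x hx, Equiv.swap_apply_of_ne_of_ne] at this
          · exact this
          · intro h4; apply hxk.1; rw [← hf x, h4, hn.1]
          · intro h4; apply hxk.2; rw [← hf x, h4, hn.2]
        · rw [hgf, h3]; exact h
      · intro x hx
        have h3 := hk2 rfl hn (Equiv.swap k (k + 1) x)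
        have h4 := h2 (Equiv.swap k (k + 1) x)
        rw [Equiv.swap_apply_self] at h3 h4
        rw [h3, h4, h]
        intro h5
        rw [h5, Equiv.swap_apply_self] at h4
        exact hx h4
    · rw [hk1 rfl]; exact h
  | lcusp k =>
    obtain rfl : g = insertPair k d f := hp
    rw [lcusp_rules hru hr']
    intro x hx
    rcases skip_cases k x with rfl | rfl | ⟨y, rfl⟩
    · rw [insertPair_self] at hx ⊢; rw [insertPair_self]; cases d <;> simp at *
    · rw [insertPair_succ] at hx ⊢; rw [insertPair_succ]; cases d <;> simp at *
    · rw [insertPair_skip] at *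
      rw [insertPair_skip, h]
      intro h5; exact hx (by rw [h5])
  | rcusp k =>
    obtain rfl : f = insertPair k d g := hp
    intro x hx
    have h1 := h (skip k x)
    rw [insertPair_skip, hru.2, skip_inj] at h1
    exact h1 fun h2 => hx (skip_inj.1 h2)

/-! ### Partial rulings of words, and the words formed by their fixed strands -/

/-- A slice with its origin and with a flag for partial rulings. -/
abbrev Entry : Type := (Slice × Origin) × Bool

/-- The slices that remain of a restricted slice: a slice of the pattern is kept even when it is
trivial. -/
def keep (c : ℕ → ℕ) : Origin → Option Slice → List (Slice × Origin)
  | Origin.companion t i, r => r.toList.map fun s => (s, Origin.companion t (c i))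
  | Origin.pattern t, r => [(r.getD Slice.triv, Origin.pattern t)]

/-- A partial ruling on a word, from the involution `f` of `w` strands to the involution `g` of `w'`
strands; its fixed strands form the word `v`. -/
inductive Run (c : ℕ → ℕ) : List Entry → ℕ → (ℕ → ℕ) → ℕ → (ℕ → ℕ) → List (Slice × Origin) → Prop
  | nil (w : ℕ) (f : ℕ → ℕ) : Run c [] w f w f []
  | cons {s : Slice} {o : Origin} {d : Bool} {l : List Entry} {w w' : ℕ} {f g h : ℕ → ℕ}
      {v : List (Slice × Origin)} (hok : s.Ok w) (hp : s.PartialRules d f g)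
      (hr : Run c l (s.out w) g w' h v) :
      Run c (((s, o), d) :: l) w f w' h (keep c o (s.restriction d f) ++ v)

theorem Slice.PartialRules.pairing {s : Slice} {d : Bool} {w : ℕ} {f g : ℕ → ℕ} (hok : s.Ok w)
    (hp : s.PartialRules d f g) (hf : Pairing w f) : Pairing (s.out w) g := by
  cases s with
  | triv => obtain rfl : g = f := hp; exact hf
  | cross k =>
    obtain ⟨-, ⟨-, h2⟩ | ⟨-, rfl, -⟩⟩ := hp
    · have h3 : ∀ x, g x = Equiv.swap k (k + 1) (f (Equiv.swap k (k + 1) x)) := fun x => by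
        rw [← h2, Equiv.swap_apply_self]
      refine ⟨fun x => by rw [h3, h3, Equiv.swap_apply_self, hf.inv, Equiv.swap_apply_self], ?_⟩
      intro x hx
      simp only [Ok, out] at hok hx
      have e : Equiv.swap k (k + 1) x = x := Equiv.swap_apply_of_ne_of_ne (by omega) (by omega)
      rw [h3, e, hf.supp x hx, e]
    · exact hf
  | lcusp k => obtain rfl : g = insertPair k d f := hp; exact insertPair_pairing hf hok
  | rcusp k =>
    obtain rfl : f = insertPair k d g := hp
    simp only [Ok, out] at hok ⊢
    refine ⟨fun x => ?_, fun x hx => ?_⟩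
    · have := hf.inv (skip k x)
      rwa [insertPair_skip, insertPair_skip, skip_inj] at this
    · have := hf.supp (skip k x) (by unfold skip; split_ifs <;> omega)
      rwa [insertPair_skip, skip_inj] at this

namespace Run

variable {c : ℕ → ℕ} {l l' : List Entry} {w w' w'' : ℕ} {f g h : ℕ → ℕ}
  {v v' : List (Slice × Origin)}

theorem append (h1 : Run c l w f w' g v) (h2 : Run c l' w' g w'' h v') :
    Run c (l ++ l') w f w'' h (v ++ v') := by
  induction h1 with
  | nil => exact h2
  | cons hok hp _ ih => rw [List.append_assoc]; exact cons hok hp (ih h2)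

theorem single {s : Slice} {o : Origin} {d : Bool} (hok : s.Ok w) (hp : s.PartialRules d f g) :
    Run c [((s, o), d)] w f (s.out w) g (keep c o (s.restriction d f)) := by
  have := cons (c := c) (o := o) hok hp (nil _ _)
  rwa [List.append_nil] at this

theorem of_eq (h1 : Run c l w f w' g v) (hl : l' = l) (hv : v' = v) : Run c l' w f w' g v' := by
  subst hl hv; exact h1

theorem pairing (h1 : Run c l w f w' g v) (hf : Pairing w f) : Pairing w' g := by
  induction h1 with
  | nil => exact hf
  | cons hok hp _ ih => exact ih (hp.pairing hok hf)

end Run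

theorem Slice.Ok.mirror {s : Slice} {w : ℕ} (h : s.Ok w) :
    s.mirror.Ok (s.out w) ∧ s.mirror.out (s.out w) = w := by
  cases s with
  | triv => exact ⟨trivial, rfl⟩
  | cross k => exact ⟨h, rfl⟩
  | lcusp k => exact ⟨by simp only [Slice.Ok, Slice.mirror, Slice.out] at *; omega, rfl⟩
  | rcusp k => constructor <;> simp only [Slice.Ok, Slice.mirror, Slice.out] at * <;> omega

theorem Slice.PartialRules.restriction_mirror {s : Slice} {d : Bool} {f g : ℕ → ℕ} {w : ℕ}
    (hok : s.Ok w) (hp : s.PartialRules d f g) (hf : Pairing w f) :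
    s.mirror.restriction d g = (s.restriction d f).map Slice.mirror := by
  cases s with
  | triv => rfl
  | cross k =>
    have hg := hp.pairing hok hf
    have hm := hp.mirror hf.inv
    simp only [Slice.mirror, Slice.restriction]
    by_cases h1 : f k = k ∧ f (k + 1) = k + 1
    · rw [(hp.eq_of_fixed hf h1).1, if_pos h1]; rfl
    · rw [if_neg h1, if_neg]
      · rfl
      · intro h2
        apply h1
        rw [(hm.eq_of_fixed hg h2).1]
        exact h2
  | lcusp k =>
    obtain rfl : g = insertPair k d f := hp
    simp only [Slice.mirror, Slice.restriction, fixCount_insertPair]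
    cases d <;> rfl
  | rcusp k =>
    obtain rfl : f = insertPair k d g := hp
    simp only [Slice.mirror, Slice.restriction, fixCount_insertPair]
    cases d <;> rfl

/-- The reflection of an entry across a vertical axis. -/
def Entry.mirror (e : Entry) : Entry := ((e.1.1.mirror, e.1.2), e.2)

/-- The reflection of a word with origins across a vertical axis. -/
def reflectWord (v : List (Slice × Origin)) : List (Slice × Origin) :=
  v.reverse.map fun x => (x.1.mirror, x.2)

theorem reflectWord_append (v v' : List (Slice × Origin)) :
    reflectWord (v ++ v') = reflectWord v' ++ reflectWord v := by
  simp [reflectWord]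

theorem keep_mirror (c : ℕ → ℕ) (o : Origin) (r : Option Slice) :
    keep c o (r.map Slice.mirror) = reflectWord (keep c o r) := by
  cases o <;> cases r <;> rfl

/-- Runs can be read backwards, which makes a separate treatment of right cusps unnecessary. -/
theorem Run.reflect {c : ℕ → ℕ} {l : List Entry} {w w' : ℕ} {f g : ℕ → ℕ}
    {v : List (Slice × Origin)} (h : Run c l w f w' g v) (hf : Pairing w f) :
    Run c (l.reverse.map Entry.mirror) w' g w f (reflectWord v) := by
  induction h with
  | nil => exact Run.nil _ _
  | @cons s o d l w w' f g h v hok hp _ ih =>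
    have ih := ih (hp.pairing hok hf)
    rw [List.reverse_cons, List.map_append, reflectWord_append]
    refine ih.append ?_
    have h1 := Run.single (c := c) (o := o) hok.mirror.1 (hp.mirror hf.inv)
    rw [hok.mirror.2, hp.restriction_mirror hok hf, keep_mirror] at h1
    exact h1

/-- A word with a common origin. -/
def withOrigin (o : Origin) (w : List Slice) : List (Slice × Origin) := w.map fun s => (s, o)

theorem withOrigin_append (o : Origin) (w w' : List Slice) :
    withOrigin o (w ++ w') = withOrigin o w ++ withOrigin o w' := List.map_append

/-- An entry without a flag. -/
def unflagged (x : Slice × Origin) : Entry := (x, false)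

theorem fixCount_congr {f g : ℕ → ℕ} {a : ℕ} (h : ∀ x < a, f x = x ↔ g x = x) :
    fixCount f a = fixCount g a := by
  induction a with
  | zero => rfl
  | succ a ih =>
    rw [fixCount_succ, fixCount_succ, ih fun x hx => h x (by omega)]
    congr 1
    exact if_congr (h a (by omega)) rfl rfl

/-- Two intervals that contain equally many fixed points. -/
theorem fixCount_shift {f g : ℕ → ℕ} {a b m M : ℕ} (h : ∀ x < m, g (a + x) = a + x ↔ f (b + x) = b + x)
    (hf : fixCount f (b + m) = fixCount f b + M) : fixCount g (a + m) = fixCount g a + M := by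
  have key : ∀ m' ≤ m, fixCount g (a + m') + fixCount f b = fixCount f (b + m') + fixCount g a := by
    intro m'
    induction m' with
    | zero => intro _; simp only [add_zero]; omega
    | succ m' ih =>
      intro hm
      have := ih (by omega)
      rw [← add_assoc, ← add_assoc, fixCount_succ, fixCount_succ]
      have h1 := h m' (by omega)
      by_cases h2 : f (b + m') = b + m'
      · rw [if_pos h2, if_pos (h1.2 h2)]; omega
      · rw [if_neg h2, if_neg (fun h3 => h2 (h1.1 h3))]; omega
  have := key m le_rfl
  omega

theorem conj_exists (k : ℕ) (f : ℕ → ℕ) : ∃ g : ℕ → ℕ, ConjAt k f g :=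
  ⟨fun x => Equiv.swap k (k + 1) (f (Equiv.swap k (k + 1) x)), fun x => by
    beta_reduce; rw [Equiv.swap_apply_self]⟩

theorem posAfter_injective (w : List Slice) : Function.Injective (posAfter w) := by
  induction w with
  | nil => exact fun _ _ h => h
  | cons s w ih =>
    cases s with
    | cross k => exact fun _ _ h => Slice.swap_inj.1 (ih h)
    | _ => exact ih

/-- Without flags the involution follows the diagram. A crossing remains exactly if the traveller
and the strand that it meets are fixed. So a fixed traveller leaves a row as long as the number `M`
of fixed strands that it crosses, and a moved one leaves nothing. -/
theorem run_rowDown {c : ℕ → ℕ} {t i p m M w : ℕ} {f : ℕ → ℕ} (hw : p + m < w)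
    (h0 : ∀ x, p < x → x ≤ p + m → f p ≠ x)
    (hM : fixCount f (p + 1 + m) = fixCount f (p + 1) + M) :
    ∃ g, Run c ((withOrigin (Origin.companion t i) (rowDown p m)).map unflagged) w f w g
        (if f p = p then withOrigin (Origin.companion t (c i)) (rowDown (fixCount f p) M) else []) ∧
      ∀ x, g (posAfter (rowDown p m) x) = posAfter (rowDown p m) (f x) := by
  induction m generalizing M with
  | zero =>
    obtain rfl : M = 0 := by simp only [add_zero] at hM; omega
    refine ⟨f, ?_, fun x => rfl⟩
    refine (Run.nil w f).of_eq rfl ?_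
    split_ifs <;> rfl
  | succ m ih =>
    obtain ⟨M', hM'⟩ : ∃ M', fixCount f (p + 1 + m) = fixCount f (p + 1) + M' :=
      Nat.exists_eq_add_of_le (fixCount_mono f (by omega))
    obtain ⟨g, hg, hg'⟩ := ih (by omega) (fun x h1 h2 => h0 x h1 (by omega)) hM'
    have e1 : posAfter (rowDown p m) p = p + m := by rw [posAfter_rowDown, if_pos rfl]
    have e2 : posAfter (rowDown p m) (p + 1 + m) = p + m + 1 := by
      rw [posAfter_rowDown]; split_ifs <;> omega
    have g1 : g (p + m) = p + m + 1 ↔ f p = p + 1 + m := by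
      rw [← e2, ← e1, hg', (posAfter_injective _).eq_iff]
    have g2 : g (p + m) = p + m ↔ f p = p := by
      rw [← e1, hg', (posAfter_injective _).eq_iff]
    have g3 : g (p + m + 1) = p + m + 1 ↔ f (p + 1 + m) = p + 1 + m := by
      rw [← e2, hg', (posAfter_injective _).eq_iff]
    obtain ⟨g', hgg⟩ := conj_exists (p + m) g
    have hp : (Slice.cross (p + m)).PartialRules false g g' :=
      ⟨fun h => h0 _ (by omega) (by omega) (g1.1 h), Or.inl ⟨rfl, hgg⟩⟩
    refine ⟨g', ?_, fun x => ?_⟩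
    · have h1 := hg.append (Run.single (o := Origin.companion t i)
        (show (Slice.cross (p + m)).Ok w by simp only [Slice.Ok]; omega) hp)
      rw [rowDown_succ, withOrigin_append, List.map_append]
      refine h1.of_eq rfl ?_
      simp only [Slice.restriction, g2, g3, keep]
      rw [← add_assoc, fixCount_succ, hM'] at hM
      by_cases h2 : f p = p
      · by_cases h3 : f (p + 1 + m) = p + 1 + m
        · obtain rfl : M = M' + 1 := by rw [if_pos h3] at hM; omega
          -- The strands above the row are unchanged, and the `M'` fixed strands crossed so far have
          -- moved up by one place.
          have h4 : fixCount g (p + m) = fixCount f p + M' := by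
            rw [fixCount_shift (f := f) (b := p + 1) (M := M') (a := p) ?_ hM']
            · congr 1
              refine fixCount_congr fun x hx => ?_
              have e3 : posAfter (rowDown p m) x = x := by
                rw [posAfter_rowDown]; split_ifs <;> omega
              conv_lhs => rw [← e3, hg', (posAfter_injective _).eq_iff]
            · intro x hx
              have e3 : posAfter (rowDown p m) (p + 1 + x) = p + x := by
                rw [posAfter_rowDown]; split_ifs <;> omega
              rw [← e3, hg', (posAfter_injective _).eq_iff]
          rw [if_pos h2, if_pos h2, if_pos ⟨h2, h3⟩, h4, rowDown_succ, withOrigin_append]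
          rfl
        · obtain rfl : M = M' := by rw [if_neg h3] at hM; omega
          rw [if_pos h2, if_neg (by tauto)]; simp
      · simp [h2]
    · rw [rowDown_succ, posAfter_append, posAfter_append, ← hg']
      simp only [posAfter]
      rw [hgg]

/-- A grid of crossings with the indices of its rows. -/
def gridWord (t b m n : ℕ) : List (Slice × Origin) :=
  (List.range m).reverse.flatMap fun i => withOrigin (Origin.companion t i) (rowDown (b + i) n)

theorem gridWord_succ (t b m n : ℕ) : gridWord t b (m + 1) n =
    withOrigin (Origin.companion t m) (rowDown (b + m) n) ++ gridWord t b m n := by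
  simp [gridWord, List.range_succ]

/-- The absence of pairs between upper and lower strands passes on to the remaining rows, and the
row of a fixed upper strand `i` becomes the row number `c i` of the smaller grid. -/
theorem run_gridWord {c : ℕ → ℕ} {t b m n N w : ℕ} {f : ℕ → ℕ} (hf : Pairing w f)
    (hw : b + m + n ≤ w)
    (h0 : ∀ x y, b ≤ x → x < b + m → b + m ≤ y → y < b + m + n → f x ≠ y)
    (hc : ∀ i ≤ m, fixCount f (b + i) = fixCount f b + c i)
    (hN : fixCount f (b + m + n) = fixCount f (b + m) + N) :
    ∃ g, Run c ((gridWord t b m n).map unflagged) w f w g (gridWord t (fixCount f b) (c m) N) ∧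
      ∀ x, g (posAfter (grid b m n) x) = posAfter (grid b m n) (f x) := by
  induction m generalizing f with
  | zero =>
    have : c 0 = 0 := by have := hc 0 le_rfl; simp only [add_zero] at this; omega
    rw [this]
    exact ⟨f, Run.nil _ _, fun x => rfl⟩
  | succ m ih =>
    obtain ⟨g, hg, hg'⟩ := run_rowDown (c := c) (t := t) (i := m) (p := b + m) (m := n) (M := N)
      (w := w) (by omega) (fun x h1 h2 => h0 _ _ (by omega) (by omega) (by omega) (by omega))
      (by rw [← add_assoc] at hN; rw [hN])
    have hpos : ∀ x, posAfter (rowDown (b + m) n) x = if x = b + m then b + m + n else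
        if b + m < x ∧ x ≤ b + m + n then x - 1 else x := posAfter_rowDown _ _
    have hfix : ∀ x < b + m, g x = x ↔ f x = x := by
      intro x hx
      have e3 : posAfter (rowDown (b + m) n) x = x := by rw [hpos]; split_ifs <;> omega
      conv_lhs => rw [← e3, hg', (posAfter_injective _).eq_iff]
    have hcb : ∀ i ≤ m, fixCount g (b + i) = fixCount f (b + i) := fun i hi =>
      fixCount_congr fun x hx => hfix x (by omega)
    obtain ⟨g', hg1, hg2⟩ := ih (f := g) (hg.pairing hf) (by omega) (by
        intro x y h1 h2 h3 h4
        have e1 : posAfter (rowDown (b + m) n) x = x := by rw [hpos]; split_ifs <;> omega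
        have e2 : posAfter (rowDown (b + m) n) (y + 1) = y := by rw [hpos]; split_ifs <;> omega
        rw [← e1, ← e2, hg', Ne, (posAfter_injective _).eq_iff]
        exact h0 _ _ h1 (by omega) (by omega) (by omega))
      (fun i hi => by
        have h1 := hcb 0 (by omega)
        rw [add_zero] at h1
        rw [hcb i hi, h1, hc i (by omega)]) (by
        refine fixCount_shift (f := f) (b := b + (m + 1)) ?_ hN
        intro x hx
        have e3 : posAfter (rowDown (b + m) n) (b + (m + 1) + x) = b + m + x := by
          rw [hpos]; split_ifs <;> omega
        rw [← e3, hg', (posAfter_injective _).eq_iff])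
    refine ⟨g', ?_, fun x => ?_⟩
    · rw [gridWord_succ, List.map_append]
      refine (hg.append hg1).of_eq rfl ?_
      have h1 := hcb 0 (by omega)
      rw [add_zero] at h1
      have h2 := hc (m + 1) le_rfl
      have h3 := hc m (by omega)
      rw [← add_assoc, fixCount_succ, h3] at h2
      by_cases h4 : f (b + m) = b + m
      · rw [if_pos h4] at h2 ⊢
        rw [show c (m + 1) = c m + 1 by omega, gridWord_succ, h1, h3]
      · rw [if_neg h4] at h2 ⊢
        rw [show c (m + 1) = c m by omega, h1]; rfl
    · rw [grid_succ, posAfter_append, posAfter_append, hg2, hg']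

theorem rowUp_succ (p m : ℕ) : rowUp p (m + 1) = rowUp p m ++ [Slice.cross (p - 1 - m)] := by
  simp [rowUp, List.range_succ]

/-- A row going up, with a flag at the crossing number `r`. -/
def flaggedRow (o : Origin) (p m r : ℕ) : List Entry :=
  (List.range m).map fun t => ((Slice.cross (p - 1 - t), o), decide (t = r))

theorem flaggedRow_succ (o : Origin) (p m r : ℕ) : flaggedRow o p (m + 1) r =
    flaggedRow o p m r ++ [((Slice.cross (p - 1 - m), o), decide (m = r))] := by
  simp [flaggedRow, List.range_succ]

theorem upPos_injective (p t : ℕ) : Function.Injective (upPos p t) := by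
  intro x y h
  unfold upPos at h
  split_ifs at h <;> omega

theorem exchange_exchange (a b x : ℕ) : exchange a b (exchange a b x) = x := by
  unfold exchange; split_ifs <;> omega

/-- The involution in a row going up that has a switch at the crossing number `r`. -/
def rowState (p r t : ℕ) (f : ℕ → ℕ) (x : ℕ) : ℕ :=
  if r < t then exchange p (p - 1 - r) (f (exchange p (p - 1 - r) x)) else f x

theorem rowState_upPos {p r m : ℕ} {f g : ℕ → ℕ} (hm : m + 1 ≤ p)
    (hg : ∀ x, g (upPos p m x) = upPos p m (rowState p r m f x)) {g' : ℕ → ℕ}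
    (h : if m = r then g' = g else ConjAt (p - 1 - m) g g') (x : ℕ) :
    g' (upPos p (m + 1) x) = upPos p (m + 1) (rowState p r (m + 1) f x) := by
  by_cases hmr : m = r
  · subst hmr
    rw [if_pos rfl] at h
    subst h
    have e1 : ∀ x, upPos p (m + 1) x = upPos p m (exchange p (p - 1 - m) x) := by
      intro x; unfold upPos exchange; split_ifs <;> omega
    rw [e1, e1, hg]
    unfold rowState
    rw [if_neg (by omega), if_pos (by omega), exchange_exchange]
  · rw [if_neg hmr] at h
    have e1 : ∀ x, upPos p (m + 1) x =
        Equiv.swap (p - 1 - m) (p - 1 - m + 1) (upPos p m x) := by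
      intro x; rw [Slice.swap_val]; unfold upPos; split_ifs <;> omega
    rw [e1, e1, h, hg]
    congr 2
    unfold rowState
    by_cases hrm : r < m
    · rw [if_pos hrm, if_pos (by omega)]
    · rw [if_neg hrm, if_neg (by omega)]

/-- At the flagged crossing the traveller is paired below its starting place and the strand that it
meets is paired above the row, so the two intervals are disjoint and the switch is normal. For `m ≤
r` there is no flag. -/
theorem run_flaggedRow {c : ℕ → ℕ} {t i p m r w : ℕ} {f : ℕ → ℕ} (hf : Function.Involutive f)
    (hw : p < w) (hm : m ≤ p) (h0 : f p = p ∨ p < f p)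
    (hr : r < m → p < f p ∧ f (p - 1 - r) < p - m) :
    ∃ g, Run c (flaggedRow (Origin.companion t i) p m r) w f w g
        (if f p = p then withOrigin (Origin.companion t (c i))
          (rowUp (fixCount f p) (fixCount f p - fixCount f (p - m))) else []) ∧
      ∀ x, g (upPos p m x) = upPos p m (rowState p r m f x) := by
  induction m with
  | zero =>
    refine ⟨f, (Run.nil w f).of_eq rfl ?_, fun x => ?_⟩
    · rw [Nat.sub_zero, Nat.sub_self]; split_ifs <;> rfl
    · have : ∀ x, upPos p 0 x = x := fun x => by unfold upPos; split_ifs <;> omega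
      rw [this, this]; rfl
  | succ m ih =>
    obtain ⟨g, hg, hg'⟩ := ih (by omega) (fun h => by have := hr (by omega); omega)
    have e1 : upPos p m p = p - 1 - m + 1 := by unfold upPos; split_ifs <;> omega
    have e2 : upPos p m (p - 1 - m) = p - 1 - m := by unfold upPos; split_ifs <;> omega
    have g1 : ∀ y, g (p - 1 - m) = upPos p m y ↔ rowState p r m f (p - 1 - m) = y := fun y => by
      conv_lhs => rw [← e2, hg', (upPos_injective _ _).eq_iff]
    have g2 : ∀ y, g (p - 1 - m + 1) = upPos p m y ↔ rowState p r m f p = y := fun y => by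
      conv_lhs => rw [← e1, hg', (upPos_injective _ _).eq_iff]
    have i1 := hf p
    have i2 := hf (p - 1 - m)
    have i3 : r < m → f (p - 1 - m) ≠ p - 1 - r := by
      intro h h'
      rw [h'] at i2
      have := hr (by omega)
      omega
    -- The traveller is not paired with the strand that it meets next, whether or not the flagged
    -- switch has already taken place.
    have s1 : rowState p r m f (p - 1 - m) ≠ p := by
      intro h
      unfold rowState at h
      split_ifs at h with hrm
      · have hr' := hr (by omega)
        have h3 := i3 (by omega)
        have h4 : exchange p (p - 1 - r) (p - 1 - m) = p - 1 - m := by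
          unfold exchange; split_ifs <;> omega
        rw [h4] at h
        unfold exchange at h
        split_ifs at h <;> omega
      · rw [h] at i2; omega
    have s2 : rowState p r m f p = p ↔ f p = p := by
      unfold rowState
      split_ifs with hrm
      · have hr' := hr (by omega)
        have h4 : exchange p (p - 1 - r) p = p - 1 - r := by unfold exchange; split_ifs <;> omega
        rw [h4]
        unfold exchange
        split_ifs <;> omega
      · rfl
    have hne : g (p - 1 - m) ≠ p - 1 - m + 1 := by rw [← e1, Ne, g1]; exact s1
    have hex : ∃ g', (Slice.cross (p - 1 - m)).PartialRules (decide (m = r)) g g' ∧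
        if m = r then g' = g else ConjAt (p - 1 - m) g g' := by
      by_cases hmr : m = r
      · subst hmr
        have hr' := hr (by omega)
        have v1 : g (p - 1 - m) = f (p - 1 - m) := by
          conv_lhs => rw [← e2, hg']
          unfold rowState
          rw [if_neg (by omega)]
          unfold upPos; split_ifs <;> omega
        have v2 : g (p - 1 - m + 1) = f p := by
          conv_lhs => rw [← e1, hg']
          unfold rowState
          rw [if_neg (by omega)]
          unfold upPos; split_ifs <;> omega
        refine ⟨g, ⟨hne, Or.inr ⟨by simp, rfl, ?_, ?_⟩⟩, by rw [if_pos rfl]⟩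
        · rw [Slice.normality_iff, v1, v2]; omega
        · rw [v1]; omega
      · obtain ⟨g', h⟩ := conj_exists (p - 1 - m) g
        exact ⟨g', ⟨hne, Or.inl ⟨by simpa using hmr, h⟩⟩, by rwa [if_neg hmr]⟩
    obtain ⟨g', hp, hgg⟩ := hex
    refine ⟨g', ?_, rowState_upPos hm hg' hgg⟩
    have h1 := hg.append (Run.single (c := c) (o := Origin.companion t i)
      (show (Slice.cross (p - 1 - m)).Ok w by simp only [Slice.Ok]; omega) hp)
    rw [flaggedRow_succ]
    refine h1.of_eq rfl ?_
    have g3 : g (p - 1 - m + 1) = p - 1 - m + 1 ↔ f p = p := by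
      rw [← s2, ← g2 p, e1]
    simp only [Slice.restriction, g3]
    by_cases h2 : f p = p
    · have hmr : ¬ r < m := fun h => by have := hr (by omega); omega
      have hst : ∀ x, rowState p r m f x = f x := fun x => by unfold rowState; rw [if_neg hmr]
      have hg0 : ∀ x < p - m, g x = x ↔ f x = x := by
        intro x hx
        have e3 : upPos p m x = x := by unfold upPos; split_ifs <;> omega
        conv_lhs => rw [← e3, hg', (upPos_injective _ _).eq_iff, hst]
      have h3 : fixCount g (p - 1 - m) = fixCount f (p - 1 - m) :=
        fixCount_congr fun x hx => hg0 x (by omega)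
      have h4 := fixCount_succ f (p - 1 - m)
      have h5 := hg0 (p - 1 - m) (by omega)
      have h6 := fixCount_mono f (show p - 1 - m + 1 ≤ p by omega)
      rw [show p - 1 - m + 1 = p - m by omega] at h4 h6
      rw [if_pos h2, if_pos h2, show p - (m + 1) = p - 1 - m by omega]
      by_cases h7 : f (p - 1 - m) = p - 1 - m
      · rw [if_pos h7] at h4
        rw [if_pos ⟨h5.2 h7, h2⟩, show fixCount f p - fixCount f (p - 1 - m) =
          fixCount f p - fixCount f (p - m) + 1 by omega, rowUp_succ, withOrigin_append]
        congr 1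
        simp only [keep, Option.toList, List.map_cons, List.map_nil, withOrigin, h3]
        congr 3
        omega
      · rw [if_neg h7] at h4
        rw [if_neg (fun h => h7 (h5.1 h.1)), h4]
        simp [keep]
    · simp [h2, keep]

/-- The copy of a left cusp, with the indices of the cusps. -/
def cuspEntries (t b n : ℕ) : List (Slice × Origin) :=
  (List.range n).flatMap fun j =>
    withOrigin (Origin.companion t j) (Slice.lcusp (b + 2 * j) :: rowUp (b + 2 * j) j)

/-- The copy of a left cusp, with flags for the pairing `π` of the copies. -/
def flaggedCusp (π : ℕ → ℕ) (t b n : ℕ) : List Entry :=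
  (List.range n).flatMap fun j =>
    ((Slice.lcusp (b + 2 * j), Origin.companion t j), decide (π j ≠ j)) ::
      flaggedRow (Origin.companion t j) (b + 2 * j) j (if π j < j then j - 1 - π j else j)

theorem cuspEntries_succ (t b n : ℕ) : cuspEntries t b (n + 1) = cuspEntries t b n ++
    withOrigin (Origin.companion t n) (Slice.lcusp (b + 2 * n) :: rowUp (b + 2 * n) n) := by
  simp [cuspEntries, List.range_succ]

theorem flaggedCusp_succ (π : ℕ → ℕ) (t b n : ℕ) : flaggedCusp π t b (n + 1) =
    flaggedCusp π t b n ++ ((Slice.lcusp (b + 2 * n), Origin.companion t n), decide (π n ≠ n)) ::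
      flaggedRow (Origin.companion t n) (b + 2 * n) n (if π n < n then n - 1 - π n else n) := by
  simp [flaggedCusp, List.range_succ]

theorem CuspState.fixCount_eq {b j : ℕ} {π : ℕ → ℕ} {f : ℕ → ℕ}
    (h : CuspState b j π (fun i => decide (π i = i)) f) {i : ℕ} (hi : i ≤ j) :
    fixCount f (b + i) = fixCount f b + fixCount π i ∧
      fixCount f (b + j + i) = fixCount f (b + j) + fixCount π i := by
  have h0 : fixCount π (0 + i) = fixCount π 0 + fixCount π i := by
    simp [fixCount]
  constructor
  · refine fixCount_shift (f := π) (b := 0) ?_ h0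
    intro x hx
    rw [(h x (by omega)).1, zero_add]
    simp only [decide_eq_true_eq]
    split_ifs <;> omega
  · refine fixCount_shift (f := π) (b := 0) ?_ h0
    intro x hx
    rw [(h x (by omega)).2, zero_add]
    simp only [decide_eq_true_eq]
    split_ifs <;> omega

/-- If `π n < n`, the upper branch of the copy `n` switches with the lower branch of the copy `π n`,
which it meets at the crossing number `n - 1 - π n`. The fixed strands are the branches of the
copies fixed by `π`, and these again form the copy of a cusp. -/
theorem run_flaggedCusp {π : ℕ → ℕ} (hπ : Function.Involutive π) {t b n w : ℕ} {f : ℕ → ℕ}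
    (hf : Pairing w f) (hb : b ≤ w) :
    ∃ g, Run (fixCount π) (flaggedCusp π t b n) w f (w + 2 * n) g
        (cuspEntries t (fixCount f b) (fixCount π n)) ∧
      CuspState b n π (fun i => decide (π i = i)) g ∧
      ∀ x, g (skipN b n x) = skipN b n (f x) := by
  induction n with
  | zero =>
    refine ⟨f, Run.nil _ _, cuspState_zero _ _ _ _, fun x => ?_⟩
    have : ∀ x, skipN b 0 x = x := fun x => by simp [skipN]
    rw [this, this]
  | succ n ih =>
    obtain ⟨g, hg, hst, hout⟩ := ih
    have hgp := hg.pairing hf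
    set d : Bool := decide (π n ≠ n) with hd
    set g1 := Slice.insertPair (b + 2 * n) d g with hg1
    have hp1 : (Slice.lcusp (b + 2 * n)).PartialRules d g g1 := rfl
    have hok1 : (Slice.lcusp (b + 2 * n)).Ok (w + 2 * n) := by simp only [Slice.Ok]; omega
    have hgp1 : Pairing (w + 2 * n + 2) g1 := hp1.pairing hok1 hgp
    have a1 : g1 (b + 2 * n) = if decide (π n = n) = true then b + 2 * n else b + 2 * n + 1 := by
      rw [hg1, Slice.insertPair_self, hd]; by_cases h : π n = n <;> simp [h]
    have a2 : g1 (b + 2 * n + 1) =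
        if decide (π n = n) = true then b + 2 * n + 1 else b + 2 * n := by
      rw [hg1, Slice.insertPair_succ, hd]; by_cases h : π n = n <;> simp [h]
    have hlow : ∀ x, b ≤ x → x < b + 2 * n → g1 x = g x := fun x => hst.insertPair d x
    have hπn := hπ n
    set r := if π n < n then n - 1 - π n else n with hr
    obtain ⟨g2, hg2, hg2'⟩ := run_flaggedRow (c := fixCount π) (t := t) (i := n) (p := b + 2 * n)
      (m := n) (r := r) (w := w + 2 * n + 2) (f := g1) hgp1.inv (by omega) (by omega) (by
        rw [a1]; simp only [decide_eq_true_eq]; split_ifs <;> omega) (by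
        -- Until the copy `n` arrives, the lower branch of the copy `π n` is paired with its own
        -- upper branch, which is above the row.
        intro hrn
        have h1 : π n < n := by by_contra h; rw [hr, if_neg h] at hrn; omega
        rw [hr, if_pos h1]
        rw [a1, if_neg (by simp; omega)]
        refine ⟨by omega, ?_⟩
        rw [show b + 2 * n - 1 - (n - 1 - π n) = b + n + π n by omega,
          hlow _ (by omega) (by omega), (hst _ h1).2, hπn]
        simp only [decide_eq_true_eq]
        split_ifs <;> omega)
    refine ⟨g2, ?_, ?_, ?_⟩
    · rw [flaggedCusp_succ]
      refine (hg.append (Run.cons hok1 hp1 hg2)).of_eq rfl ?_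
      have hc : fixCount g (b + 2 * n) = fixCount f b + 2 * fixCount π n := by
        rw [show b + 2 * n = b + n + n by omega, (hst.fixCount_eq le_rfl).2,
          (hst.fixCount_eq le_rfl).1]
        have : fixCount g b = fixCount f b := by
          refine fixCount_congr fun x hx => ?_
          have e : skipN b n x = x := by simp [skipN, hx]
          have hinj : ∀ x y, skipN b n x = skipN b n y ↔ x = y := by
            intro x y; unfold skipN; split_ifs <;> omega
          conv_lhs => rw [← e, hout, hinj]
        omega
      have hc1 : fixCount g1 (b + 2 * n) = fixCount f b + 2 * fixCount π n := by
        rw [← hc]; exact Slice.fixCount_insertPair _ _ _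
      by_cases h : π n = n
      · have hd0 : d = false := by simp [hd, h]
        have hfp : g1 (b + 2 * n) = b + 2 * n := by rw [a1]; simp [h]
        have hc2 : fixCount g1 (b + 2 * n - n) = fixCount f b + fixCount π n := by
          have h1 : fixCount g1 (b + n) = fixCount g (b + n) := by
            refine fixCount_congr fun x hx => ?_
            rcases lt_or_ge x b with h2 | h2
            · have e : x = Slice.skip (b + 2 * n) x := by
                unfold Slice.skip; rw [if_pos (by omega)]
              conv_lhs => rw [e, hg1, Slice.insertPair_fixed_skip]
            · rw [hlow x h2 (by omega)]
          have h2 := (hst.fixCount_eq le_rfl).1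
          have h3 := (hst.fixCount_eq le_rfl).2
          rw [show b + n + n = b + 2 * n by omega, hc] at h3
          rw [show b + 2 * n - n = b + n by omega, h1]
          omega
        rw [if_pos hfp, hd0, fixCount_succ, if_pos h, cuspEntries_succ]
        simp only [Slice.restriction, Bool.false_eq_true, if_false, keep, Option.toList,
          List.map_cons, List.map_nil, hc, hc1, hc2, withOrigin, List.singleton_append]
        rw [show fixCount f b + 2 * fixCount π n - (fixCount f b + fixCount π n) = fixCount π n by
          omega]
      · have hd0 : d = true := by simp [hd, h]
        rw [if_neg (by rw [a1]; simp [h]), hd0, fixCount_succ, if_neg h]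
        simp [Slice.restriction, keep]
    · refine cuspState_succ hπ (by simp) hst hlow a1 a2 fun x => ?_
      rw [hg2']
      congr 1
      unfold rowState
      by_cases h : π n < n
      · have hr' : r = n - 1 - π n := by rw [hr, if_pos h]
        rw [if_pos (by omega), if_pos h, show b + 2 * n - 1 - r = b + n + π n by omega]
      · have hr' : r = n := by rw [hr, if_neg h]
        rw [if_neg (by omega), if_neg h]
    · intro x
      have e1 : ∀ x, skipN b (n + 1) x = Slice.skip (b + 2 * n) (skipN b n x) := by
        intro x; unfold skipN Slice.skip; split_ifs <;> omega
      have e2 : ∀ x, upPos (b + 2 * n) n (skipN b (n + 1) x) = skipN b (n + 1) x := by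
        intro x; unfold upPos skipN; split_ifs <;> omega
      -- The exchange matters only for `r < n`, and then it moves nothing but new strands.
      have e3 : ∀ x, exchange (b + 2 * n) (b + 2 * n - 1 - r) (skipN b (n + 1) x) =
          skipN b (n + 1) x ∨ n ≤ r := by
        intro x; unfold exchange skipN; split_ifs <;> omega
      have e4 : g1 (skipN b (n + 1) x) = skipN b (n + 1) (f x) := by
        rw [e1, hg1, Slice.insertPair_skip, hout, ← e1]
      conv_lhs => rw [← e2 x, hg2']
      unfold rowState
      split_ifs with h
      · rw [(e3 x).resolve_right (by omega), e4, (e3 (f x)).resolve_right (by omega), e2]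
      · rw [e4, e2]

/-! ### The partial ruling in the copies of the slices of the companion -/

/-- The involution of `w` blocks of `n` strands that is given by `π` in each block. -/
def blocks (n : ℕ) (π : ℕ → ℕ) (w x : ℕ) : ℕ := if x < n * w then n * (x / n) + π (x % n) else x

theorem block_add_lt {n s i w : ℕ} (hs : s < w) (hi : i < n) : n * s + i < n * w := by
  have := block_lt (n := n) hs; omega

theorem blocks_apply {n s i w : ℕ} (π : ℕ → ℕ) (hs : s < w) (hi : i < n) :
    blocks n π w (n * s + i) = n * s + π i := by
  unfold blocks
  rw [if_pos (block_add_lt hs hi), Nat.mul_add_div (by omega), Nat.mul_add_mod,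
    Nat.div_eq_of_lt hi, Nat.mod_eq_of_lt hi, add_zero]

theorem blocks_of_le {n w x : ℕ} (π : ℕ → ℕ) (h : n * w ≤ x) : blocks n π w x = x :=
  if_neg (by omega)

theorem block_cases {n w x : ℕ} (h : x < n * w) : ∃ s i, s < w ∧ i < n ∧ x = n * s + i := by
  have hn : 0 < n := Nat.pos_of_ne_zero (by rintro rfl; simp at h)
  exact ⟨x / n, x % n, (Nat.div_lt_iff_lt_mul hn).2 (by rwa [mul_comm]), Nat.mod_lt _ hn,
    (Nat.div_add_mod x n).symm⟩

theorem blocks_ext {n w : ℕ} {π g : ℕ → ℕ} (h1 : ∀ s < w, ∀ i < n, g (n * s + i) = n * s + π i)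
    (h2 : ∀ x, n * w ≤ x → g x = x) : g = blocks n π w := by
  funext x
  rcases lt_or_ge x (n * w) with h | h
  · obtain ⟨s, i, hs, hi, rfl⟩ := block_cases h
    rw [h1 s hs i hi, blocks_apply π hs hi]
  · rw [h2 x h, blocks_of_le π h]

theorem blocks_pairing {n : ℕ} {π : ℕ → ℕ} (hπ : Pairing n π) (w : ℕ) :
    Pairing (n * w) (blocks n π w) where
  inv x := by
    rcases lt_or_ge x (n * w) with h | h
    · obtain ⟨s, i, hs, hi, rfl⟩ := block_cases h
      rw [blocks_apply π hs hi, blocks_apply π hs (hπ.lt_of_lt hi), hπ.inv]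
    · rw [blocks_of_le π h, blocks_of_le π h]
  supp x h := blocks_of_le π h

theorem fixCount_blocks_add {n : ℕ} (π : ℕ → ℕ) {w k i : ℕ} (hk : k < w) (hi : i ≤ n) :
    fixCount (blocks n π w) (n * k + i) = fixCount (blocks n π w) (n * k) + fixCount π i := by
  refine fixCount_shift (f := π) (b := 0) (fun x hx => ?_) (by simp [fixCount])
  rw [blocks_apply π hk (by omega), zero_add]
  omega

theorem fixCount_blocks {n : ℕ} (π : ℕ → ℕ) {w k : ℕ} (hk : k ≤ w) :
    fixCount (blocks n π w) (n * k) = fixCount π n * k := by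
  induction k with
  | zero => simp [fixCount]
  | succ k ih =>
    have := fixCount_blocks_add π (show k < w by omega) (le_refl n)
    rw [show n * (k + 1) = n * k + n by ring, this, ih (by omega)]
    ring

/-- The slices of the `n`-copy of a slice, with their origins. -/
def Slice.copyEntries (n t : ℕ) (s : Slice) : List (Slice × Origin) :=
  (s.copy n).map fun x => (x.1, Origin.companion t x.2)

/-- The slices of the `n`-copy of a slice, with flags for the pairing `π` of the copies. -/
def Slice.flaggedCopy (n : ℕ) (π : ℕ → ℕ) (t : ℕ) : Slice → List Entry
  | triv => []
  | cross k => (gridWord t (n * k) n n).map unflagged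
  | lcusp k => flaggedCusp π t (n * k) n
  | rcusp k => (flaggedCusp π t (n * k) n).reverse.map Entry.mirror

theorem copyEntries_cross (n t k : ℕ) :
    (Slice.cross k).copyEntries n t = gridWord t (n * k) n n := by
  simp only [Slice.copyEntries, Slice.copy, gridWord, withOrigin, rowDown, List.map_flatMap,
    List.map_map]
  refine List.flatMap_congr fun i _ => List.map_congr_left fun j _ => ?_
  simp [add_assoc]

theorem copyEntries_lcusp (n t k : ℕ) :
    (Slice.lcusp k).copyEntries n t = cuspEntries t (n * k) n := by
  simp only [Slice.copyEntries, Slice.copy, leftCuspCopy, cuspEntries, withOrigin, rowUp,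
    List.map_flatMap, List.map_map, List.map_cons]
  refine List.flatMap_congr fun j _ => ?_
  congr 1
  refine List.map_congr_left fun r hr => ?_
  rw [List.mem_range] at hr
  simp only [Function.comp_apply]
  congr 2
  omega

theorem copyEntries_rcusp (n t k : ℕ) :
    (Slice.rcusp k).copyEntries n t = reflectWord (cuspEntries t (n * k) n) := by
  rw [← copyEntries_lcusp]
  simp only [reflectWord, Slice.copyEntries, Slice.copy, List.map_map, ← List.map_reverse]
  rfl

theorem flaggedCusp_fst (π : ℕ → ℕ) (t b n : ℕ) :
    (flaggedCusp π t b n).map Prod.fst = cuspEntries t b n := by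
  simp only [flaggedCusp, cuspEntries, List.map_flatMap, List.map_cons, withOrigin, flaggedRow,
    List.map_map, rowUp]
  rfl

theorem flaggedCopy_fst (n : ℕ) (π : ℕ → ℕ) (t : ℕ) (s : Slice) :
    (s.flaggedCopy n π t).map Prod.fst = s.copyEntries n t := by
  cases s with
  | triv => rfl
  | cross k =>
    rw [copyEntries_cross]
    simp only [Slice.flaggedCopy, List.map_map]
    exact List.map_id _
  | lcusp k => rw [copyEntries_lcusp]; exact flaggedCusp_fst _ _ _ _
  | rcusp k =>
    rw [copyEntries_rcusp, ← flaggedCusp_fst π]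
    simp only [Slice.flaggedCopy, reflectWord, List.map_map, ← List.map_reverse]
    rfl

theorem posAfter_grid_block {n k s i : ℕ} (hi : i < n) :
    posAfter (grid (n * k) n n) (n * s + i) = n * Equiv.swap k (k + 1) s + i := by
  have hk : n * (k + 1) = n * k + n := by ring
  rw [posAfter_grid, Slice.swap_val]
  by_cases h : s = k
  · subst h; rw [if_pos rfl, hk]; split_ifs <;> omega
  by_cases h' : s = k + 1
  · subst h'; rw [if_neg (by omega), if_pos rfl]; split_ifs <;> omega
  rw [if_neg h, if_neg h']
  rcases lt_or_gt_of_ne h with h1 | h1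
  · have := block_lt (n := n) h1
    split_ifs <;> omega
  · have h2 := Nat.mul_le_mul_left n (show k + 2 ≤ s by omega)
    have h3 : n * (k + 2) = n * k + (n + n) := by ring
    split_ifs <;> omega

theorem skipN_block {n k s i : ℕ} (hi : i < n) :
    skipN (n * k) n (n * s + i) = n * Slice.skip k s + i := by
  unfold Slice.skip skipN
  rcases lt_or_ge s k with h | h
  · have := block_lt (n := n) h
    rw [if_pos h, if_pos (by omega)]
  · have := Nat.mul_le_mul_left n h
    rw [if_neg (by omega), if_neg (by omega)]
    ring

theorem run_copy_lcusp {n : ℕ} {π : ℕ → ℕ} (hπ : Pairing n π) (t : ℕ) {w k : ℕ} (hok : k ≤ w) :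
    Run (fixCount π) (flaggedCusp π t (n * k) n) (n * w) (blocks n π w) (n * (w + 2))
      (blocks n π (w + 2)) (cuspEntries t (fixCount π n * k) (fixCount π n)) := by
  have hkw := Nat.mul_le_mul_left n hok
  obtain ⟨g, hg, hst, hout⟩ := run_flaggedCusp hπ.inv (t := t) (n := n) (blocks_pairing hπ w) hkw
  rw [fixCount_blocks π hok, show n * w + 2 * n = n * (w + 2) by ring] at hg
  convert hg using 1
  refine (blocks_ext ?_ ?_).symm
  · intro s hs i hi
    have hπi := hπ.lt_of_lt hi
    rcases Slice.skip_cases k s with rfl | rfl | ⟨s, rfl⟩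
    · rw [(hst i hi).1]
      simp only [decide_eq_true_eq]
      split_ifs <;> omega
    · rw [show n * (k + 1) = n * k + n by ring, (hst i hi).2]
      simp only [decide_eq_true_eq]
      split_ifs <;> omega
    · have hs' : s < w := by unfold Slice.skip at hs; split_ifs at hs <;> omega
      rw [← skipN_block hi, hout, blocks_apply π hs' hi, skipN_block hπi]
  · intro x hx
    rw [show n * (w + 2) = n * w + 2 * n by ring] at hx
    have e : skipN (n * k) n (x - 2 * n) = x := by unfold skipN; split_ifs <;> omega
    rw [← e, hout, blocks_of_le π (by omega)]

/-- One and the same `π` serves in every block on both sides of the slice. This makes the fixed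
strands a copy of the slice again, with `fixCount π n` strands in place of `n`. -/
theorem run_copy {n : ℕ} {π : ℕ → ℕ} (hπ : Pairing n π) (t : ℕ) {s : Slice} {w : ℕ} (hok : s.Ok w) :
    Run (fixCount π) (s.flaggedCopy n π t) (n * w) (blocks n π w) (n * s.out w)
      (blocks n π (s.out w)) (s.copyEntries (fixCount π n) t) := by
  cases s with
  | triv => exact Run.nil _ _
  | lcusp k =>
    rw [copyEntries_lcusp]
    exact run_copy_lcusp hπ t hok
  | rcusp k =>
    simp only [Slice.Ok] at hok
    obtain ⟨w, rfl⟩ : ∃ w', w = w' + 2 := ⟨w - 2, by omega⟩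
    rw [copyEntries_rcusp]
    exact (run_copy_lcusp hπ t (show k ≤ w by omega)).reflect (blocks_pairing hπ w)
  | cross k =>
    simp only [Slice.Ok] at hok
    have hk : n * (k + 1) = n * k + n := by ring
    have hkw := block_lt (n := n) hok
    obtain ⟨g, hg, hg'⟩ := run_gridWord (c := fixCount π) (t := t) (b := n * k) (m := n) (n := n)
      (N := fixCount π n) (blocks_pairing hπ w) (by omega) (by
        intro x y h1 h2 h3 h4
        obtain ⟨i, rfl⟩ := Nat.exists_eq_add_of_le h1
        have := hπ.lt_of_lt (i := i) (by omega)
        rw [blocks_apply π (by omega) (by omega)]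
        omega)
      (fun i hi => fixCount_blocks_add π (by omega) hi) (by
        rw [← hk]; exact fixCount_blocks_add π hok le_rfl)
    rw [fixCount_blocks π (by omega)] at hg
    rw [copyEntries_cross]
    have e : g = blocks n π w := blocks_ext ?_ ?_
    · rw [e] at hg; exact hg
    · intro s hs i hi
      have hs' : Equiv.swap k (k + 1) s < w := by
        rw [Slice.swap_val]; split_ifs <;> omega
      have e := posAfter_grid_block (k := k) (s := Equiv.swap k (k + 1) s) hi
      rw [Equiv.swap_apply_self] at e
      rw [← e, hg', blocks_apply π hs' hi, posAfter_grid_block (hπ.lt_of_lt hi),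
        Equiv.swap_apply_self]
    · intro x hx
      have e : posAfter (grid (n * k) n n) x = x := by rw [posAfter_grid]; split_ifs <;> omega
      rw [← e, hg', blocks_of_le π hx]

/-! ### The partial ruling in the inserted pattern -/

/-- The involutions `α` of the strands above, `τ` of `w` strands at the place `m` and `β` of the
strands below. -/
def stack (m w : ℕ) (α τ β : ℕ → ℕ) (x : ℕ) : ℕ :=
  if x < m then α x else if x < m + w then m + τ (x - m) else m + w + β (x - m - w)

theorem stack_of_lt {m w x : ℕ} {α τ β : ℕ → ℕ} (h : x < m) : stack m w α τ β x = α x := if_pos h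

theorem stack_mid {m w x : ℕ} {α τ β : ℕ → ℕ} (h : x < w) :
    stack m w α τ β (m + x) = m + τ x := by
  unfold stack
  rw [if_neg (by omega), if_pos (by omega), Nat.add_sub_cancel_left]

theorem stack_add {m w : ℕ} (x : ℕ) {α τ β : ℕ → ℕ} :
    stack m w α τ β (m + w + x) = m + w + β x := by
  unfold stack
  rw [if_neg (by omega), if_neg (by omega), show m + w + x - m - w = x by omega]

theorem stack_cases (m w x : ℕ) :
    x < m ∨ (∃ i, i < w ∧ x = m + i) ∨ ∃ y, x = m + w + y := by
  by_cases h : x < m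
  · exact Or.inl h
  by_cases h' : x < m + w
  · exact Or.inr (Or.inl ⟨x - m, by omega, by omega⟩)
  · exact Or.inr (Or.inr ⟨x - m - w, by omega⟩)

/-- Singles out the block of the base strand, into which the pattern is inserted. -/
theorem blocks_eq_stack {n : ℕ} {π : ℕ → ℕ} {w s : ℕ} (hs : s < w) :
    blocks n π w = stack (n * s) n (blocks n π s) π (blocks n π (w - s - 1)) := by
  obtain ⟨r, rfl⟩ : ∃ r, w = s + 1 + r := Nat.exists_eq_add_of_le hs
  rw [show s + 1 + r - s - 1 = r by omega]
  symm
  have e : n * (s + 1 + r) = n * s + n + n * r := by ring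
  refine blocks_ext ?_ ?_
  · intro q hq i hi
    rcases lt_trichotomy q s with h | rfl | h
    · rw [stack_of_lt (block_add_lt h hi), blocks_apply π h hi]
    · rw [stack_mid hi]
    · obtain ⟨q, rfl⟩ := Nat.exists_eq_add_of_lt h
      rw [show n * (s + q + 1) + i = n * s + n + (n * q + i) by ring, stack_add,
        blocks_apply π (by omega) hi]
      ring
  · intro x hx
    obtain ⟨y, rfl⟩ := Nat.exists_eq_add_of_le (show n * s + n ≤ x by omega)
    rw [stack_add, blocks_of_le π (by omega)]

theorem fixCount_stack {m w k : ℕ} {α τ β : ℕ → ℕ} (hk : k ≤ w) :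
    fixCount (stack m w α τ β) (m + k) = fixCount α m + fixCount τ k := by
  rw [fixCount_shift (f := τ) (b := 0) (M := fixCount τ k) (fun x hx => ?_) (by simp [fixCount]),
    fixCount_congr (g := α) fun x hx => by rw [stack_of_lt hx]]
  rw [stack_mid (by omega), zero_add]
  omega

theorem stack_insertPair {m w k : ℕ} {d : Bool} {α τ β : ℕ → ℕ} (hα : ∀ x < m, α x < m) (hk : k ≤ w) :
    stack m (w + 2) α (Slice.insertPair k d τ) β =
      Slice.insertPair (m + k) d (stack m w α τ β) := by
  funext x
  rcases Slice.skip_cases (m + k) x with rfl | rfl | ⟨x, rfl⟩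
  · rw [Slice.insertPair_self, stack_mid (by omega), Slice.insertPair_self]
    cases d <;> simp
    omega
  · rw [Slice.insertPair_succ, add_assoc, stack_mid (by omega), Slice.insertPair_succ]
    cases d <;> simp
  · rw [Slice.insertPair_skip]
    rcases stack_cases m w x with h | ⟨i, hi, rfl⟩ | ⟨y, rfl⟩
    · have := hα x h
      have e : ∀ z < m, Slice.skip (m + k) z = z := fun z hz => by
        unfold Slice.skip; rw [if_pos (by omega)]
      rw [e x h, stack_of_lt h, stack_of_lt h, e _ this]
    · have e : ∀ z, Slice.skip (m + k) (m + z) = m + Slice.skip k z := fun z => by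
        unfold Slice.skip; split_ifs <;> omega
      rw [stack_mid hi, e, e, stack_mid (by unfold Slice.skip; split_ifs <;> omega),
        Slice.insertPair_skip]
    · have e : ∀ z, Slice.skip (m + k) (m + w + z) = m + (w + 2) + z := fun z => by
        unfold Slice.skip; split_ifs <;> omega
      rw [stack_add, e, e, stack_add]

theorem stack_swap {m w k : ℕ} {α τ τ' β : ℕ → ℕ} (hα : ∀ x < m, α x < m)
    (hk : k + 1 < w) (h : ConjAt k τ τ') :
    ConjAt (m + k) (stack m w α τ β) (stack m w α τ' β) := by
  intro x
  rcases stack_cases m w x with h' | ⟨i, hi, rfl⟩ | ⟨y, rfl⟩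
  · have := hα x h'
    rw [Equiv.swap_apply_of_ne_of_ne (by omega) (by omega), stack_of_lt h', stack_of_lt h',
      Equiv.swap_apply_of_ne_of_ne (by omega) (by omega)]
  · have e : ∀ z, Equiv.swap (m + k) (m + k + 1) (m + z) = m + Equiv.swap k (k + 1) z := fun z => by
      rw [Slice.swap_val, Slice.swap_val]; split_ifs <;> omega
    rw [stack_mid hi, e, e, stack_mid, h]
    rw [Slice.swap_val]; split_ifs <;> omega
  · rw [Equiv.swap_apply_of_ne_of_ne (by omega) (by omega), stack_add, stack_add,
      Equiv.swap_apply_of_ne_of_ne (by omega) (by omega)]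

namespace Slice

theorem Ok.shift {s : Slice} {w : ℕ} (h : s.Ok w) (m r : ℕ) :
    (s.shift m).Ok (m + w + r) ∧ (s.shift m).out (m + w + r) = m + s.out w + r := by
  cases s with
  | triv => exact ⟨trivial, rfl⟩
  | cross k => exact ⟨by simp only [Slice.shift, Ok] at *; omega, rfl⟩
  | lcusp k => exact ⟨by simp only [Slice.shift, Ok] at *; omega, by simp only [Slice.shift, out]; omega⟩
  | rcusp k =>
    simp only [Ok] at h
    exact ⟨by simp only [Slice.shift, Ok]; omega, by simp only [Slice.shift, out]; omega⟩

open Classical in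
/-- The flag of a slice in which a generalized normal ruling induces the involutions `f` and `g`:
cusps are paired, and flagged crossings are switches. -/
noncomputable def rulingFlag : Slice → (ℕ → ℕ) → (ℕ → ℕ) → Bool
  | triv, _, _ => false
  | cross k, f, g => decide (g = f ∧ ¬ (f k = k ∧ f (k + 1) = k + 1))
  | _, _, _ => true

/-- The slice formed by the strands that are fixed by `f`, when no cusps are fixed. -/
def fixedSlice : Slice → (ℕ → ℕ) → Slice
  | cross k, f => if f k = k ∧ f (k + 1) = k + 1 then cross (fixCount f k) else triv
  | _, _ => triv

/-- If the unchanged involution also followed the diagram, `k` and `k + 1` would both be fixed or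
have the same companion. So the switch alternative holds, which includes normality. -/
theorem Rules.normality_of_eq {k : ℕ} {f : ℕ → ℕ} (h : (cross k).Rules f f)
    (hf : Function.Injective f) (hn : ¬ (f k = k ∧ f (k + 1) = k + 1)) : Normality k f := by
  obtain ⟨h1, h2 | h2⟩ := h.cross_cases
  · exfalso
    have h3 := h2.left
    by_cases h4 : f k = k
    · rw [h4, Equiv.swap_apply_left] at h3
      exact hn ⟨h4, h3⟩
    · rw [Equiv.swap_apply_of_ne_of_ne h4 h1] at h3
      have := hf h3
      omega
  · exact h2.2

/-- The strands above and below the pattern are not involved, and normality is invariant under a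
shift of all places. -/
theorem Rules.partialRules_stack {s : Slice} {m w : ℕ} {α τ τ' β : ℕ → ℕ} (h : s.Rules τ τ')
    (hok : s.Ok w) (hτ : Pairing w τ) (hτ' : Pairing (s.out w) τ') (hα : ∀ x < m, α x < m) :
    (s.shift m).PartialRules (s.rulingFlag τ τ') (stack m w α τ β) (stack m (s.out w) α τ' β) := by
  cases s with
  | triv => obtain rfl : τ' = τ := h; rfl
  | cross k =>
    simp only [Ok, Slice.shift, rulingFlag] at *
    have v1 : stack m w α τ β (m + k) = m + τ k := stack_mid (by omega)
    have v2 : stack m w α τ β (m + k + 1) = m + τ (k + 1) := stack_mid (x := k + 1) hok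
    have h1 := h.1
    refine ⟨by omega, ?_⟩
    by_cases hsw : τ' = τ ∧ ¬ (τ k = k ∧ τ (k + 1) = k + 1)
    · obtain ⟨rfl, hn⟩ := hsw
      refine Or.inr ⟨by simp [hn], rfl, ?_, by omega⟩
      have h2 := h.normality_of_eq hτ.injective hn
      rw [normality_iff] at h2 ⊢
      omega
    · refine Or.inl ⟨by simpa using hsw, stack_swap hα hok ?_⟩
      rcases h.2 with h2 | ⟨rfl, -⟩
      · exact h2
      -- An unflagged crossing at which the involution does not change is a crossing of two fixed
      -- strands, where this also counts as following the diagram.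
      · have hn : τ' k = k ∧ τ' (k + 1) = k + 1 := by tauto
        intro x
        have := hτ.injective.eq_iff (a := x) (b := k)
        have := hτ.injective.eq_iff (a := x) (b := k + 1)
        by_cases hx : x = k
        · subst hx; simp [hn]
        by_cases hx' : x = k + 1
        · subst hx'; simp [hn]
        rw [Equiv.swap_apply_of_ne_of_ne hx hx', Equiv.swap_apply_of_ne_of_ne] <;> omega
  | lcusp k =>
    rw [lcusp_rules h hτ'.inv]
    exact stack_insertPair hα hok
  | rcusp k =>
    have h1 := lcusp_rules (h.mirror hτ.inv : (lcusp k).Rules τ' τ) hτ.inv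
    simp only [Ok, out] at *
    obtain ⟨w, rfl⟩ : ∃ w', w = w' + 2 := ⟨w - 2, by omega⟩
    rw [h1]
    exact stack_insertPair hα (by omega)

/-- The cusps of the pattern are always flagged, since a ruling pairs their branches. Only crossings
of two fixed strands remain. -/
theorem restriction_stack {s : Slice} {m w : ℕ} {α τ τ' β : ℕ → ℕ} (hok : s.Ok w) :
    ((s.shift m).restriction (s.rulingFlag τ τ') (stack m w α τ β)).getD triv =
      (s.fixedSlice τ).shift (fixCount α m) := by
  cases s with
  | triv => rfl
  | cross k =>
    simp only [Ok] at hok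
    have v1 : stack m w α τ β (m + k) = m + τ k := stack_mid (by omega)
    have v2 : stack m w α τ β (m + (k + 1)) = m + τ (k + 1) := stack_mid (x := k + 1) hok
    simp only [Slice.shift, restriction, fixedSlice, v1, v2, add_assoc, Nat.add_left_cancel_iff,
      fixCount_stack (show k ≤ w by omega)]
    split_ifs <;> rfl
  | lcusp k => rfl
  | rcusp k => rfl

end Slice

namespace Front

theorem fixedPart_length (F : Front) (τ : ℕ → ℕ → ℕ) : (F.fixedPart τ).length = F.length := by
  simp [length, fixedPart]

theorem fixedPart_slice (F : Front) (τ : ℕ → ℕ → ℕ) (t : ℕ) :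
    (F.fixedPart τ).slice t = (F.slice t).fixedSlice (τ t) := by
  rcases lt_or_ge t F.length with h | h
  · rw [slice_of_lt _ (by rwa [fixedPart_length])]
    simp only [fixedPart, List.getElem_map, List.getElem_range, Slice.fixedSlice]
    cases F.slice t <;> rfl
  · rw [slice_of_le _ (by rwa [fixedPart_length]), slice_of_le _ h]; rfl

theorem fixedPart_left (F : Front) (τ : ℕ → ℕ → ℕ) :
    (F.fixedPart τ).left = fixCount (τ 0) F.left := rfl

/-- The slices of a front below `m` strands. -/
def patternEntries (F : Front) (m : ℕ) : List (Slice × Origin) :=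
  (List.range F.length).map fun t => ((F.slice t).shift m, Origin.pattern t)

/-- The slices of a front below `m` strands, with flags for a generalized normal ruling. -/
noncomputable def flaggedPattern (F : Front) (m : ℕ) (τ : ℕ → ℕ → ℕ) (T : ℕ) : List Entry :=
  (List.range T).map fun t =>
    (((F.slice t).shift m, Origin.pattern t), (F.slice t).rulingFlag (τ t) (τ (t + 1)))

theorem run_flaggedPattern {F : Front} (hF : ∀ t < F.length, (F.slice t).Ok (F.width t))
    {τ : ℕ → ℕ → ℕ} (hτ : F.IsGenRuling τ) {c : ℕ → ℕ} {m r : ℕ} {α β : ℕ → ℕ}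
    (hα : ∀ x < m, α x < m) {T : ℕ} (hT : T ≤ F.length) :
    Run c (F.flaggedPattern m τ T) (m + F.left + r) (stack m F.left α (τ 0) β)
      (m + F.width T + r) (stack m (F.width T) α (τ T) β)
      ((List.range T).map fun t =>
        (((F.fixedPart τ).slice t).shift (fixCount α m), Origin.pattern t)) := by
  induction T with
  | zero => exact Run.nil _ _
  | succ T ih =>
    have hok := hF T (by omega)
    have hp := (hτ.rules T).partialRules_stack (m := m) (α := α) (β := β) hok (hτ.pairing T)
      (by rw [← F.width_succ]; exact hτ.pairing _) hα
    have h1 := (ih (by omega)).append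
      (Run.single (c := c) (o := Origin.pattern T) (hok.shift m r).1 hp)
    rw [(hok.shift m r).2, ← F.width_succ] at h1
    refine h1.of_eq ?_ ?_
    · simp [flaggedPattern, List.range_succ]
    · rw [List.range_succ, List.map_append]
      simp only [keep, Slice.restriction_stack hok, List.map_cons, List.map_nil, fixedPart_slice]

end Front

theorem run_copies {F : Front} (hF : ∀ t < F.length, (F.slice t).Ok (F.width t)) {n : ℕ}
    {π : ℕ → ℕ} (hπ : Pairing n π) {a T : ℕ} (hT : a + T ≤ F.length) :
    Run (fixCount π) ((List.range' a T).flatMap fun t => (F.slice t).flaggedCopy n π t)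
      (n * F.width a) (blocks n π (F.width a)) (n * F.width (a + T)) (blocks n π (F.width (a + T)))
      ((List.range' a T).flatMap fun t => (F.slice t).copyEntries (fixCount π n) t) := by
  induction T with
  | zero => exact Run.nil _ _
  | succ T ih =>
    have h1 := (ih (by omega)).append (run_copy hπ (a + T) (hF (a + T) (by omega)))
    rw [← F.width_succ] at h1
    refine h1.of_eq ?_ ?_
    · rw [List.range'_concat]; simp
    · rw [List.range'_concat]; simp

namespace BasedKnot

variable {K : BasedKnot} {L : Front}

/-- The slices of the satellite, with flags for a generalized normal ruling of the pattern. -/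
noncomputable def flaggedSatellite (K : BasedKnot) (L : Front) (τ : ℕ → ℕ → ℕ) : List Entry :=
  ((List.range' 0 K.baseTime).flatMap fun t =>
      (K.front.slice t).flaggedCopy L.left (τ 0) t) ++
    L.flaggedPattern (L.left * K.baseStrand) τ L.length ++
    (List.range' K.baseTime (K.front.length - K.baseTime)).flatMap fun t =>
      (K.front.slice t).flaggedCopy L.left (τ 0) t

theorem satelliteSlices_eq (hK : K.rightward = true) (L : Front) : K.satelliteSlices L =
    ((List.range' 0 K.baseTime).flatMap fun t => (K.front.slice t).copyEntries L.left t) ++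
    L.patternEntries (L.left * K.baseStrand) ++
    (List.range' K.baseTime (K.front.length - K.baseTime)).flatMap fun t =>
      (K.front.slice t).copyEntries L.left t := by
  simp only [satelliteSlices, inserted, hK, if_true, Front.patternEntries, List.range_eq_range']
  rfl

theorem flaggedSatellite_fst (hK : K.rightward = true) (L : Front) (τ : ℕ → ℕ → ℕ) :
    (K.flaggedSatellite L τ).map Prod.fst = K.satelliteSlices L := by
  rw [satelliteSlices_eq hK]
  simp only [flaggedSatellite, List.map_append, List.map_flatMap, flaggedCopy_fst,
    Front.flaggedPattern, List.map_map]
  rfl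

theorem blocks_zero (n : ℕ) (π : ℕ → ℕ) : blocks n π 0 = id :=
  (blocks_ext (by intro s hs; omega) fun _ _ => rfl).symm

theorem base_lt (K : BasedKnot) : K.baseStrand < K.front.width K.baseTime := K.base_isPoint.2

theorem base_le (K : BasedKnot) : K.baseTime ≤ K.front.length := K.base_isPoint.1

/-- The width at the base line, with the place of the inserted pattern. -/
theorem width_base (K : BasedKnot) (n : ℕ) : n * K.front.width K.baseTime =
    n * K.baseStrand + n + n * (K.front.width K.baseTime - K.baseStrand - 1) := by
  obtain ⟨r, hr⟩ := Nat.exists_eq_add_of_le (show K.baseStrand + 1 ≤ _ from K.base_lt)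
  rw [hr, show K.baseStrand + 1 + r - K.baseStrand - 1 = r by omega]
  ring

/-- The runs through the two parts of the companion and through the pattern fit together because `τ`
closes up: at both ends of the pattern the state is `τ 0` in every block. -/
theorem run_flaggedSatellite (hK : K.rightward = true) (hL : L.IsAnnular) {τ : ℕ → ℕ → ℕ}
    (hτ : L.IsGenRuling τ) :
    Run (fixCount (τ 0)) (K.flaggedSatellite L τ) 0 id 0 id
      (K.satelliteSlices (L.fixedPart τ)) := by
  have hπ : Pairing L.left (τ 0) := hτ.pairing 0
  have h1 := run_copies K.planar.ok hπ (a := 0) (T := K.baseTime) (by have := K.base_le; omega)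
  have h3 := run_copies K.planar.ok hπ (a := K.baseTime) (T := K.front.length - K.baseTime)
    (by have := K.base_le; omega)
  have h2 := Front.run_flaggedPattern hL.ok hτ (c := fixCount (τ 0)) (m := L.left * K.baseStrand)
    (r := L.left * (K.front.width K.baseTime - K.baseStrand - 1))
    (α := blocks L.left (τ 0) K.baseStrand)
    (β := blocks L.left (τ 0) (K.front.width K.baseTime - K.baseStrand - 1))
    (fun x => (blocks_pairing hπ _).lt_of_lt) le_rfl
  rw [hτ.closed, hL.closed, ← width_base, ← blocks_eq_stack K.base_lt,
    fixCount_blocks _ le_rfl] at h2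
  rw [zero_add, K.front.width_zero, K.planar.left_eq, blocks_zero, mul_zero] at h1
  rw [Nat.add_sub_cancel' K.base_le, K.planar.right_eq, blocks_zero, mul_zero] at h3
  refine ((h1.append h2).append h3).of_eq rfl ?_
  rw [satelliteSlices_eq hK, L.fixedPart_left, Front.patternEntries, L.fixedPart_length]

end BasedKnot

/-! ### From words to fronts -/

/-- The involutions `Θ` form a partial ruling on a word with flags. -/
def Steps (l : List Entry) (Θ : ℕ → ℕ → ℕ) : Prop :=
  ∀ t (h : t < l.length), (l[t].1.1).PartialRules l[t].2 (Θ t) (Θ (t + 1))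

theorem Steps.cons {e : Entry} {l : List Entry} {Θ : ℕ → ℕ → ℕ} (h : Steps (e :: l) Θ) :
    e.1.1.PartialRules e.2 (Θ 0) (Θ 1) ∧ Steps l fun t => Θ (t + 1) :=
  ⟨h 0 (by simp), fun t ht => h (t + 1) (by simpa using ht)⟩

theorem steps_append {l₁ l₂ : List Entry} {Θ : ℕ → ℕ → ℕ} (h : Steps (l₁ ++ l₂) Θ) :
    Steps l₁ Θ ∧ Steps l₂ fun t => Θ (l₁.length + t) := by
  refine ⟨fun t ht => ?_, fun t ht => ?_⟩
  · have := h t (by rw [List.length_append]; omega)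
    rwa [List.getElem_append_left ht] at this
  · have := h (l₁.length + t) (by rw [List.length_append]; omega)
    rw [List.getElem_append_right (by omega)] at this
    simpa [add_assoc] using this

/-- The slices of the small word that arise from the slice number `t`. -/
def keepAt (c : ℕ → ℕ) (l : List Entry) (Θ : ℕ → ℕ → ℕ) (t : ℕ) : List (Slice × Origin) :=
  match l[t]? with
  | some e => keep c e.1.2 (e.1.1.restriction e.2 (Θ t))
  | none => []

/-- The line of the small word that corresponds to the line `t`. -/
def keepTime (c : ℕ → ℕ) (l : List Entry) (Θ : ℕ → ℕ → ℕ) (t : ℕ) : ℕ :=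
  ∑ s ∈ Finset.range t, (keepAt c l Θ s).length

/-- The flags determine a partial ruling from left to right, so any sequence of steps passes through
the states computed by a run. -/
theorem Slice.PartialRules.unique {s : Slice} {d : Bool} {f g g' : ℕ → ℕ}
    (h : s.PartialRules d f g) (h' : s.PartialRules d f g') : g = g' := by
  cases s with
  | triv => exact Eq.trans h (Eq.symm h')
  | cross k =>
    obtain ⟨-, ⟨rfl, h1⟩ | ⟨rfl, rfl, -⟩⟩ := h
    · obtain ⟨-, ⟨-, h2⟩ | ⟨h2, -⟩⟩ := h'
      · funext x
        have e := Equiv.swap_apply_self k (k + 1) x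
        rw [← e, h1, h2]
      · simp at h2
    · obtain ⟨-, ⟨h2, -⟩ | ⟨-, h2, -⟩⟩ := h'
      · simp at h2
      · exact h2.symm
  | lcusp k => exact Eq.trans h (Eq.symm h')
  | rcusp k => exact insertPair_injective k d (Eq.trans (Eq.symm h) h')

theorem keepTime_append (c : ℕ → ℕ) (l₁ l₂ : List Entry) (Θ : ℕ → ℕ → ℕ) (t : ℕ) :
    keepTime c (l₁ ++ l₂) Θ (l₁.length + t) =
      keepTime c l₁ Θ l₁.length + keepTime c l₂ (fun t => Θ (l₁.length + t)) t := by
  unfold keepTime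
  rw [Finset.sum_range_add]
  congr 1
  · refine Finset.sum_congr rfl fun s hs => ?_
    rw [Finset.mem_range] at hs
    unfold keepAt
    rw [List.getElem?_append_left hs]
  · refine Finset.sum_congr rfl fun s _ => ?_
    unfold keepAt
    rw [List.getElem?_append_right (by omega), Nat.add_sub_cancel_left]

theorem keepTime_append_left (c : ℕ → ℕ) (l₁ l₂ : List Entry) (Θ : ℕ → ℕ → ℕ) {t : ℕ}
    (ht : t ≤ l₁.length) : keepTime c (l₁ ++ l₂) Θ t = keepTime c l₁ Θ t := by
  unfold keepTime
  refine Finset.sum_congr rfl fun s hs => ?_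
  rw [Finset.mem_range] at hs
  unfold keepAt
  rw [List.getElem?_append_left (by omega)]

namespace Run

variable {c : ℕ → ℕ} {l : List Entry} {w w' : ℕ} {f g : ℕ → ℕ} {v : List (Slice × Origin)}

theorem exists_steps (h : Run c l w f w' g v) :
    ∃ Θ : ℕ → ℕ → ℕ, Θ 0 = f ∧ Steps l Θ ∧ ∀ t, l.length ≤ t → Θ t = g := by
  induction h with
  | nil w f => exact ⟨fun _ => f, rfl, fun t ht => absurd ht (by simp), fun _ _ => rfl⟩
  | @cons s o d l w w' f g h v hok hp _ ih =>
    obtain ⟨Θ, h0, hs, hl⟩ := ih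
    refine ⟨fun t => t.casesOn f Θ, rfl, fun t ht => ?_, fun t ht => ?_⟩
    · cases t with
      | zero => simpa [h0] using hp
      | succ t => simpa using hs t (by simpa using ht)
    · cases t with
      | zero => simp at ht
      | succ t => exact hl t (by simpa using ht)

theorem ok (h : Run c l w f w' g v) :
    (∀ t (ht : t < l.length), (l[t].1.1).Ok
      (((l.map fun e => e.1.1).take t).foldl (fun w e => e.out w) w)) ∧
    (l.map fun e => e.1.1).foldl (fun w e => e.out w) w = w' := by
  induction h with
  | nil => exact ⟨fun t ht => absurd ht (by simp), rfl⟩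
  | cons hok hp _ ih =>
    refine ⟨fun t ht => ?_, ih.2⟩
    cases t with
    | zero => exact hok
    | succ t => exact ih.1 t (by simpa using ht)

theorem last_eq (h : Run c l w f w' g v) {Θ : ℕ → ℕ → ℕ} (hΘ : Steps l Θ) (h0 : Θ 0 = f) :
    Θ l.length = g := by
  induction h generalizing Θ with
  | nil => exact h0
  | cons hok hp _ ih =>
    obtain ⟨h1, h2⟩ := hΘ.cons
    rw [h0] at h1
    exact ih h2 (h1.unique hp)

theorem keepAt_eq (h : Run c l w f w' g v) {Θ : ℕ → ℕ → ℕ} (hΘ : Steps l Θ) (h0 : Θ 0 = f) :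
    keepTime c l Θ l.length = v.length ∧
    ∀ t < l.length, ∀ x, keepAt c l Θ t = [x] → v[keepTime c l Θ t]? = some x := by
  induction h generalizing Θ with
  | nil => exact ⟨rfl, fun t ht => absurd ht (by simp)⟩
  | @cons s o d l w w' f g h v hok hp _ ih =>
    obtain ⟨h1, h2⟩ := hΘ.cons
    rw [h0] at h1
    obtain ⟨ih1, ih2⟩ := ih h2 (h1.unique hp)
    have e0 : keepAt c (((s, o), d) :: l) Θ 0 = keep c o (s.restriction d f) := by
      rw [← h0]; rfl
    have e1 : ∀ t, keepAt c (((s, o), d) :: l) Θ (t + 1) = keepAt c l (fun t => Θ (t + 1)) t :=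
      fun t => rfl
    have e2 : ∀ t, keepTime c (((s, o), d) :: l) Θ (t + 1) =
        (keep c o (s.restriction d f)).length + keepTime c l (fun t => Θ (t + 1)) t := by
      intro t
      unfold keepTime
      rw [Finset.sum_range_succ', e0, add_comm]
      rfl
    refine ⟨by rw [List.length_cons, e2, ih1, List.length_append], fun t ht x hx => ?_⟩
    cases t with
    | zero =>
      rw [e0] at hx
      rw [hx]; rfl
    | succ t =>
      rw [e2, List.getElem?_append_right (by omega), Nat.add_sub_cancel_left]
      exact ih2 t (by simpa using ht) x hx

end Run

/-- The flags of a word. -/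
def flagAt (l : List Entry) (t : ℕ) : Bool := match l[t]? with
  | some e => e.2
  | none => false

theorem front_slice_of_lt {l : List Entry} {t : ℕ} (h : t < l.length) :
    (Front.mk 0 (l.map fun e => e.1.1)).slice t = l[t].1.1 := by
  rw [Front.slice_of_lt _ (by simpa [Front.length] using h)]
  exact List.getElem_map _

theorem flagAt_of_lt {l : List Entry} {t : ℕ} (h : t < l.length) : flagAt l t = l[t].2 := by
  unfold flagAt; rw [List.getElem?_eq_getElem h]

theorem keepAt_of_lt {l : List Entry} {t : ℕ} (h : t < l.length) (c : ℕ → ℕ) (Θ : ℕ → ℕ → ℕ) :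
    keepAt c l Θ t = keep c l[t].1.2 (l[t].1.1.restriction l[t].2 (Θ t)) := by
  unfold keepAt; rw [List.getElem?_eq_getElem h]

/-- A complete run gives rise to a partial ruling of its front. -/
theorem Run.partialRuling {c : ℕ → ℕ} {l : List Entry} {v : List (Slice × Origin)}
    (h : Run c l 0 id 0 id v) {Θ : ℕ → ℕ → ℕ} (h0 : Θ 0 = id) (hΘ : Steps l Θ)
    (hl : ∀ t, l.length ≤ t → Θ t = id) :
    Front.PartialRuling ⟨0, l.map fun e => e.1.1⟩ ⟨0, v.map Prod.fst⟩ Θ (flagAt l)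
      fun t => keepTime c l Θ (min t l.length) := by
  set F : Front := ⟨0, l.map fun e => e.1.1⟩ with hF
  have hlen : F.length = l.length := by simp [F, Front.length]
  have hok : ∀ t, (F.slice t).Ok (F.width t) := by
    intro t
    by_cases ht : t < l.length
    · rw [front_slice_of_lt ht]; exact h.ok.1 t ht
    · rw [F.slice_of_le (by omega)]; trivial
  have hstep : ∀ t, (F.slice t).PartialRules (flagAt l t) (Θ t) (Θ (t + 1)) := by
    intro t
    by_cases ht : t < l.length
    · rw [front_slice_of_lt ht, flagAt_of_lt ht]; exact hΘ t ht
    · rw [F.slice_of_le (by omega)]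
      show Θ (t + 1) = Θ t
      rw [hl _ (by omega), hl _ (by omega)]
  obtain ⟨hk1, hk2⟩ := h.keepAt_eq hΘ h0
  refine ⟨hok, ?_, hstep, rfl, ?_, ?_, rfl, ?_, rfl⟩
  · intro t
    induction t with
    | zero => rw [h0]; exact ⟨fun _ => rfl, fun _ _ => rfl⟩
    | succ t ih => rw [F.width_succ]; exact (hstep t).pairing (hok t) ih
  · intro t ht
    show keepTime c l Θ (min t l.length) = _
    rw [min_eq_right (by omega), hk1]; simp [Front.length]
  · intro t
    show (keepTime c l Θ (min (t + 1) l.length) = keepTime c l Θ (min t l.length) ∧ _) ∨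
      (keepTime c l Θ (min (t + 1) l.length) = keepTime c l Θ (min t l.length) + 1 ∧ _)
    by_cases ht : t < l.length
    · rw [min_eq_left (by omega), min_eq_left (by omega), front_slice_of_lt ht, flagAt_of_lt ht]
      have e : keepTime c l Θ (t + 1) = keepTime c l Θ t + (keepAt c l Θ t).length :=
        Finset.sum_range_succ _ _
      have h1 := hk2 t ht
      rw [e]
      rw [keepAt_of_lt ht] at *
      generalize l[t].1.1.restriction l[t].2 (Θ t) = r at *
      generalize l[t].1.2 = o at *
      have key : ∀ s, v[keepTime c l Θ t]? = some s →
          s.1 = Front.slice ⟨0, v.map Prod.fst⟩ (keepTime c l Θ t) := by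
        intro s hs
        simp [Front.slice, List.getD_eq_getElem?_getD, hs]
      cases o with
      | companion i j =>
        cases r with
        | none => left; exact ⟨rfl, rfl⟩
        | some s => right; exact ⟨rfl, key _ (h1 _ rfl)⟩
      | pattern i => right; exact ⟨rfl, key _ (h1 _ rfl)⟩
    · left
      rw [min_eq_right (by omega), min_eq_right (by omega), F.slice_of_le (by omega)]
      exact ⟨rfl, rfl⟩
  · rw [hlen]
    show ((l.map _).take l.length).foldl _ _ = 0
    rw [List.take_of_length_le (by simp)]
    exact h.ok.2

/-! ### Positions in concatenated words -/

theorem length_flatMap_range' {α : Type*} (g : ℕ → List α) (a T : ℕ) :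
    ((List.range' a T).flatMap g).length = ∑ q ∈ Finset.range T, (g (a + q)).length := by
  induction T with
  | zero => rfl
  | succ T ih => rw [List.range'_concat, Finset.sum_range_succ, ← ih]; simp

/-- The position of an element in a concatenation of words. -/
theorem exists_of_lt_flatMap {α : Type*} {g : ℕ → List α} {a T t : ℕ}
    (h : t < ((List.range' a T).flatMap g).length) :
    ∃ s < T, ∃ r < (g (a + s)).length, t = (∑ q ∈ Finset.range s, (g (a + q)).length) + r ∧
      ((List.range' a T).flatMap g)[t]? = (g (a + s))[r]? := by
  induction T with
  | zero => simp at h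
  | succ T ih =>
    rw [List.range'_concat, List.flatMap_append, List.length_append] at h
    rw [List.range'_concat, List.flatMap_append]
    rcases lt_or_ge t ((List.range' a T).flatMap g).length with h1 | h1
    · obtain ⟨s, hs, r, hr, h2, h3⟩ := ih h1
      exact ⟨s, by omega, r, hr, h2, by rw [List.getElem?_append_left h1, h3]⟩
    · simp only [one_mul, List.flatMap_cons, List.flatMap_nil, List.append_nil] at h
      refine ⟨T, by omega, t - ((List.range' a T).flatMap g).length, by omega, ?_, ?_⟩
      · rw [← length_flatMap_range']; omega
      · rw [List.getElem?_append_right h1]; simp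

theorem getElem?_flatMap {α : Type*} {g : ℕ → List α} {a T s r : ℕ} (hs : s < T)
    (hr : r < (g (a + s)).length) :
    ((List.range' a T).flatMap g)[(∑ q ∈ Finset.range s, (g (a + q)).length) + r]? =
      (g (a + s))[r]? := by
  obtain ⟨d, rfl⟩ := Nat.exists_eq_add_of_lt hs
  rw [← length_flatMap_range', show s + d + 1 = s + (d + 1) by omega, ← List.range'_append,
    List.flatMap_append, List.getElem?_append_right (by omega), Nat.add_sub_cancel_left,
    List.range'_succ, List.flatMap_cons, one_mul, List.getElem?_append_left hr]

theorem steps_flatMap {g : ℕ → List Entry} {a T : ℕ} {Θ : ℕ → ℕ → ℕ}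
    (h : Steps ((List.range' a T).flatMap g) Θ) {s : ℕ} (hs : s < T) :
    Steps (g (a + s)) fun r => Θ ((∑ q ∈ Finset.range s, (g (a + q)).length) + r) := by
  obtain ⟨d, rfl⟩ := Nat.exists_eq_add_of_lt hs
  rw [show s + d + 1 = s + (d + 1) by omega, ← List.range'_append, List.flatMap_append] at h
  have h1 := (steps_append h).2
  rw [List.range'_succ, List.flatMap_cons, one_mul] at h1
  have h2 := (steps_append h1).1
  rwa [length_flatMap_range'] at h2

theorem seg_flatMap {g : ℕ → List Slice} {a T : ℕ} {ρ : ℕ → ℕ → ℕ} (h : Seg ((List.range' a T).flatMap g) ρ) {s : ℕ}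
    (hs : s < T) : Seg (g (a + s)) fun r => ρ ((∑ q ∈ Finset.range s, (g (a + q)).length) + r) := by
  obtain ⟨d, rfl⟩ := Nat.exists_eq_add_of_lt hs
  rw [show s + d + 1 = s + (d + 1) by omega, ← List.range'_append, List.flatMap_append,
    seg_append, List.range'_succ, List.flatMap_cons, one_mul, seg_append] at h
  have h2 := h.2.1
  rwa [length_flatMap_range'] at h2

/-! ### Restricting a ruling to a window -/

/-- The restriction of `f` to the places `m, …, m + w - 1`, extended by the identity. -/
def windowAt (f : ℕ → ℕ) (m w : ℕ) : ℕ → ℕ := fun i =>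
  if i < w ∧ m ≤ f (m + i) ∧ f (m + i) < m + w then f (m + i) - m else i

theorem thinAt_eq_windowAt (f : ℕ → ℕ) (n s : ℕ) : thinAt f n s = windowAt f (n * s) n := rfl

theorem windowAt_cases (f : ℕ → ℕ) (m w i : ℕ) :
    (i < w ∧ windowAt f m w i < w ∧ f (m + i) = m + windowAt f m w i) ∨
      (windowAt f m w i = i ∧ (w ≤ i ∨ f (m + i) < m ∨ m + w ≤ f (m + i))) := by
  unfold windowAt
  split_ifs <;> omega

theorem windowAt_eq_iff {f : ℕ → ℕ} {m w i j : ℕ} (hi : i < w) (hj : j < w) (hij : i ≠ j) :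
    windowAt f m w i = j ↔ f (m + i) = m + j := by
  have := windowAt_cases f m w i
  omega

theorem windowAt_pairing {f : ℕ → ℕ} (hf : Function.Involutive f) (m w : ℕ) :
    Pairing w (windowAt f m w) where
  inv i := by
    rcases windowAt_cases f m w i with ⟨h1, h2, h3⟩ | ⟨h1, -⟩
    · have h4 := hf (m + i)
      rw [h3] at h4
      have := windowAt_cases f m w (windowAt f m w i)
      omega
    · rw [h1, h1]
  supp i hi := by
    have := windowAt_cases f m w i
    omega

/-- The conditions for a ruling in a slice restrict to a window that contains the slice. -/
theorem Slice.Rules.windowAt {s : Slice} {m w : ℕ} {r r' : ℕ → ℕ} (h : (s.shift m).Rules r r')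
    (hok : s.Ok w) (hr : Function.Involutive r) (hr' : Function.Involutive r')
    (hff : ∀ i < w, r (m + i) ≠ m + i) :
    s.Rules (windowAt r m w) (_root_.windowAt r' m (s.out w)) := by
  have hlc : ∀ {k w : ℕ} {r r' : ℕ → ℕ}, (lcusp (m + k)).Rules r r' → k ≤ w →
      Function.Involutive r' →
      (lcusp k).Rules (_root_.windowAt r m w) (_root_.windowAt r' m (w + 2)) := by
    intro k w r r' h hk hr'
    obtain ⟨h1, h2⟩ := h
    constructor
    · have := windowAt_cases r' m (w + 2) k
      omega
    · intro i
      have h3 := h2 (m + i)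
      have e : ∀ z, Slice.skip (m + k) (m + z) = m + Slice.skip k z := fun z => by
        unfold Slice.skip; split_ifs <;> omega
      rw [e] at h3
      have h4 := windowAt_cases r' m (w + 2) (Slice.skip k i)
      have h5 := windowAt_cases r m w i
      rw [h3] at h4
      have h6 : Slice.skip k i < w + 2 ↔ i < w := by unfold Slice.skip; split_ifs <;> omega
      rcases h5 with ⟨h5, h7, h8⟩ | ⟨h5, h7⟩
      · rw [h8, e] at h4
        have : Slice.skip k (_root_.windowAt r m w i) < w + 2 := by
          unfold Slice.skip; split_ifs <;> omega
        omega
      · rw [h5]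
        have h9 : Slice.skip (m + k) (r (m + i)) < m ∨ m + (w + 2) ≤ Slice.skip (m + k) (r (m + i)) ∨
            w ≤ i := by
          unfold Slice.skip; split_ifs <;> omega
        omega
  cases s with
  | triv => obtain rfl : r' = r := h; rfl
  | cross k =>
    simp only [Ok, out] at *
    obtain ⟨h1, h2⟩ := h.cross_cases
    have c1 := windowAt_cases r m w k
    refine ⟨by rw [add_assoc] at h1; omega, ?_⟩
    rcases h2 with h2 | ⟨rfl, h2⟩
    · left
      intro i
      have h3 := h2 (m + i)
      have e : ∀ z, Equiv.swap (m + k) (m + k + 1) (m + z) = m + Equiv.swap k (k + 1) z :=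
        fun z => by rw [Slice.swap_val, Slice.swap_val]; split_ifs <;> omega
      rw [e] at h3
      have h4 := windowAt_cases r' m w (Equiv.swap k (k + 1) i)
      have h5 := windowAt_cases r m w i
      rw [h3] at h4
      have h6 : Equiv.swap k (k + 1) i < w ↔ i < w := by rw [Slice.swap_val]; split_ifs <;> omega
      rcases h5 with ⟨h5, h7, h8⟩ | ⟨h5, h7⟩
      · rw [h8, e] at h4
        have : Equiv.swap k (k + 1) (_root_.windowAt r m w i) < w := by
          rw [Slice.swap_val]; split_ifs <;> omega
        omega
      · rw [h5]
        have h9 : Equiv.swap (m + k) (m + k + 1) (r (m + i)) < m ∨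
            m + w ≤ Equiv.swap (m + k) (m + k + 1) (r (m + i)) ∨ w ≤ i := by
          rw [Slice.swap_val]; split_ifs <;> omega
        omega
    · right
      refine ⟨rfl, ?_⟩
      have c2 := windowAt_cases r' m w (k + 1)
      -- A strand whose companion is outside the window becomes fixed. Its interval for the original
      -- ruling reaches over the edge of the window, so it is disjoint from the interval of a strand
      -- paired inside, or contains it. In both cases the latter interval avoids the fixed strand.
      have f1 := hff k (by omega)
      have f2 := hff (k + 1) hok
      have h3 := involutive_ne hr h1
      rw [normality_iff] at h2 ⊢
      simp only [add_assoc] at *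
      omega
  | lcusp k => exact hlc h hok hr'
  | rcusp k =>
    simp only [Ok, out] at *
    obtain ⟨w, rfl⟩ : ∃ w', w = w' + 2 := ⟨w - 2, by omega⟩
    have h1 := hlc (h.mirror hr : (lcusp (m + k)).Rules r' r) (show k ≤ w by omega) hr
    exact h1.mirror (windowAt_pairing hr' _ _).inv

/-- The places outside a window of width `w`. -/
def outer (m w x : ℕ) : ℕ := if x < m then x else x + w

/-- The pairs outside the window of a slice. -/
theorem Slice.Rules.outer {s : Slice} {m w : ℕ} {r r' : ℕ → ℕ} (h : (s.shift m).Rules r r')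
    (hok : s.Ok w) (x y : ℕ) :
    r' (_root_.outer m (s.out w) x) = _root_.outer m (s.out w) y ↔
      r (_root_.outer m w x) = _root_.outer m w y := by
  have hlc : ∀ {k w : ℕ} {r r' : ℕ → ℕ}, (lcusp (m + k)).Rules r r' → k ≤ w →
      (r' (_root_.outer m (w + 2) x) = _root_.outer m (w + 2) y ↔
        r (_root_.outer m w x) = _root_.outer m w y) := by
    intro k w r r' h hk
    have e : ∀ z, _root_.outer m (w + 2) z = Slice.skip (m + k) (_root_.outer m w z) := fun z => by
      unfold _root_.outer Slice.skip; split_ifs <;> omega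
    rw [e, e, h.2, skip_inj]
  cases s with
  | triv => obtain rfl : r' = r := h; rfl
  | cross k =>
    simp only [Ok, out] at *
    have e : ∀ z, _root_.outer m w z < m ∨ m + w ≤ _root_.outer m w z := fun z => by
      unfold _root_.outer; split_ifs <;> omega
    have := e x
    have := e y
    exact pair_untouched h (by omega) (by omega) (by omega) (by omega)
  | lcusp k => exact hlc h hok
  | rcusp k =>
    simp only [Ok, out] at *
    obtain ⟨w, rfl⟩ : ∃ w', w = w' + 2 := ⟨w - 2, by omega⟩
    have e : ∀ z, _root_.outer m (w + 2) z = Slice.skip (m + k) (_root_.outer m w z) := fun z => by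
      unfold _root_.outer Slice.skip; split_ifs <;> omega
    rw [e, e, h.2, skip_inj]; rfl

/-! ### The generalized ruling of the pattern that is induced by a ruling of the satellite -/

namespace BasedKnot

variable {K : BasedKnot} {L : Front}

/-- The line of the satellite that corresponds to the line `t` of `K`, to the left of the base
point. -/
def leftTime (K : BasedKnot) (n t : ℕ) : ℕ :=
  ∑ q ∈ Finset.range t, ((K.front.slice q).copy n).length

/-- The line of the satellite that corresponds to the line `K.baseTime + t` of `K`, to the right of
the base point. -/
def rightTime (K : BasedKnot) (L : Front) (t : ℕ) : ℕ :=
  K.leftTime L.left K.baseTime + L.length +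
    ∑ q ∈ Finset.range t, ((K.front.slice (K.baseTime + q)).copy L.left).length

theorem length_copyEntries (n t : ℕ) (s : Slice) :
    (s.copyEntries n t).length = (s.copy n).length := by simp [Slice.copyEntries]

theorem copyEntries_fst (n t : ℕ) (s : Slice) :
    (s.copyEntries n t).map Prod.fst = (s.copy n).map Prod.fst := by
  simp [Slice.copyEntries]

theorem length_left (K : BasedKnot) (n T : ℕ) :
    ((List.range' 0 T).flatMap fun t => (K.front.slice t).copyEntries n t).length =
      K.leftTime n T := by
  rw [length_flatMap_range']
  simp [leftTime, length_copyEntries]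

theorem length_patternEntries (F : Front) (m : ℕ) : (F.patternEntries m).length = F.length := by
  simp [Front.patternEntries]

/-- A ruling of the satellite in the copies of the slices of `K` and in the pattern. -/
theorem seg_satellite (hK : K.rightward = true) {ρ : ℕ → ℕ → ℕ}
    (h : (K.satellite L).IsGenRuling ρ) :
    (∀ s < K.baseTime, Seg (((K.front.slice s).copy L.left).map Prod.fst)
      fun r => ρ (K.leftTime L.left s + r)) ∧
    (∀ t < L.length, ((L.slice t).shift (L.left * K.baseStrand)).Rules
      (ρ (K.leftTime L.left K.baseTime + t)) (ρ (K.leftTime L.left K.baseTime + (t + 1)))) ∧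
    ∀ s < K.front.length - K.baseTime,
      Seg (((K.front.slice (K.baseTime + s)).copy L.left).map Prod.fst)
        fun r => ρ (K.rightTime L s + r) := by
  have h1 : Seg (K.satellite L).word ρ := by
    intro t ht
    have := h.rules t
    rwa [Front.slice_of_lt _ (show t < (K.satellite L).length from ht)] at this
  rw [satellite, satelliteSlices_eq hK] at h1
  simp only [List.map_append, seg_append, List.length_append, List.length_map] at h1
  obtain ⟨⟨h2, h3⟩, h4⟩ := h1
  rw [length_left] at h3 h4
  rw [length_patternEntries] at h4
  refine ⟨fun s hs => ?_, fun t ht => ?_, fun s hs => ?_⟩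
  · rw [List.map_flatMap] at h2
    have := seg_flatMap h2 hs
    simpa only [zero_add, copyEntries_fst, List.length_map, leftTime] using this
  · have := h3 t (by simpa [Front.patternEntries] using ht)
    simpa [Front.patternEntries] using this
  · rw [List.map_flatMap] at h4
    have := seg_flatMap h4 hs
    simpa only [copyEntries_fst, List.length_map, rightTime, add_assoc] using this

theorem leftTime_succ (K : BasedKnot) (n t : ℕ) :
    K.leftTime n (t + 1) = K.leftTime n t + ((K.front.slice t).copy n).length :=
  Finset.sum_range_succ _ _

theorem rightTime_succ (K : BasedKnot) (L : Front) (t : ℕ) : K.rightTime L (t + 1) =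
    K.rightTime L t + ((K.front.slice (K.baseTime + t)).copy L.left).length := by
  unfold rightTime
  rw [Finset.sum_range_succ, ← add_assoc]

theorem rightTime_zero (K : BasedKnot) (L : Front) :
    K.rightTime L 0 = K.leftTime L.left K.baseTime + L.length := rfl

/-- The ruling of the pattern that is induced by a ruling of the satellite: the pairs within the
inserted copy of the pattern. -/
def patternRuling (K : BasedKnot) (L : Front) (ρ : ℕ → ℕ → ℕ) (t : ℕ) : ℕ → ℕ :=
  windowAt (ρ (K.leftTime L.left K.baseTime + min t L.length)) (L.left * K.baseStrand)
    (L.width (min t L.length))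

theorem patternRuling_zero (K : BasedKnot) (L : Front) (ρ : ℕ → ℕ → ℕ) :
    K.patternRuling L ρ 0 = thinAt (ρ (K.leftTime L.left K.baseTime)) L.left K.baseStrand := by
  simp only [patternRuling, Nat.zero_min, add_zero, L.width_zero]
  rfl

/-- The slices of the pattern act only inside the window. -/
theorem outer_pattern (hK : K.rightward = true) (hL : L.IsAnnular) {ρ : ℕ → ℕ → ℕ}
    (h : (K.satellite L).IsGenRuling ρ) (x y : ℕ) {t : ℕ} (ht : t ≤ L.length) :
    ρ (K.leftTime L.left K.baseTime + t) (outer (L.left * K.baseStrand) (L.width t) x) =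
        outer (L.left * K.baseStrand) (L.width t) y ↔
      ρ (K.leftTime L.left K.baseTime) (outer (L.left * K.baseStrand) L.left x) =
        outer (L.left * K.baseStrand) L.left y := by
  induction t with
  | zero => rfl
  | succ t ih =>
    rw [L.width_succ, (((seg_satellite hK h).2.1 t (by omega)).outer (hL.ok t (by omega)) x y)]
    exact ih (by omega)

/-- The pairing among the copies of a strand of `K` is the same everywhere. -/
theorem thinAt_const (hK : K.rightward = true) (hL : L.IsAnnular) {ρ : ℕ → ℕ → ℕ}
    (h : (K.satellite L).IsGenRuling ρ) :
    (∀ t ≤ K.baseTime, ∀ i < K.front.width t,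
      thinAt (ρ (K.leftTime L.left t)) L.left i = K.patternRuling L ρ 0) ∧
    ∀ t, K.baseTime + t ≤ K.front.length → ∀ i < K.front.width (K.baseTime + t),
      thinAt (ρ (K.rightTime L t)) L.left i = K.patternRuling L ρ 0 := by
  obtain ⟨h1, h2, h3⟩ := seg_satellite hK h
  -- The labels are the thin pairings of the blocks. By `thinAt_step` they are constant along the
  -- strands of the companion, and on the base line only the block of the base strand could differ
  -- before and after the pattern.
  have key := Front.labels_const K.planar K.connected K.base_isPoint
    (x := fun t => thinAt (ρ (K.leftTime L.left t)) L.left)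
    (y := fun t => thinAt (ρ (K.rightTime L (t - K.baseTime))) L.left)
    (fun t ht => by
      obtain ⟨a, b, c⟩ := thinAt_step (fun t => h.involutive _) (h1 t ht)
      simp only [add_zero, ← leftTime_succ] at a b c
      exact ⟨a, b, c⟩)
    (fun t ht ht' => by
      obtain ⟨s, rfl⟩ := Nat.exists_eq_add_of_le ht
      obtain ⟨a, b, c⟩ := thinAt_step (fun t => h.involutive _) (h3 s (by omega))
      simp only [add_zero, ← rightTime_succ] at a b c
      rw [show K.baseTime + s + 1 - K.baseTime = s + 1 by omega,
        show K.baseTime + s - K.baseTime = s by omega]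
      exact ⟨a, b, c⟩)
    -- Any other block lies wholly above or wholly below the window; `b` is its position in the
    -- numbering of the places outside the window.
    (fun i hi hne => by
      rw [Nat.sub_self]
      refine thinAt_congr fun x hx y hy _ => ?_
      obtain ⟨b, hb⟩ : ∃ b, ∀ x < L.left,
          L.left * i + x = outer (L.left * K.baseStrand) L.left (b + x) := by
        rcases lt_or_gt_of_ne hne with h | h
        · have := block_lt (n := L.left) h
          exact ⟨L.left * i, fun x hx => by unfold outer; rw [if_pos (by omega)]⟩
        · have := block_lt (n := L.left) h
          exact ⟨L.left * i - L.left, fun x hx => by unfold outer; rw [if_neg (by omega)]; omega⟩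
      rw [hb x hx, hb y hy]
      have := outer_pattern hK hL h (b + x) (b + y) le_rfl
      rw [hL.closed] at this
      exact this.symm)
  rw [patternRuling_zero]
  refine ⟨key.1, fun t ht i hi => ?_⟩
  have := key.2 (K.baseTime + t) (by omega) ht i hi
  rwa [Nat.add_sub_cancel_left] at this

end BasedKnot

namespace BasedKnot

variable {K : BasedKnot} {L : Front}

theorem width_pattern (hK : K.rightward = true) (hL : L.IsAnnular) {t : ℕ} (ht : t ≤ L.length) :
    (K.satellite L).width (K.leftTime L.left K.baseTime + t) = L.left * K.baseStrand + L.width t +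
      L.left * (K.front.width K.baseTime - K.baseStrand - 1) := by
  -- The widths do not depend on the flags, so the run for the trivial pairing of the copies
  -- computes them.
  have hid : Pairing L.left id := ⟨fun _ => rfl, fun _ _ => rfl⟩
  have h1 := (run_copies K.planar.ok hid (a := 0) (T := K.baseTime)
    (by have := K.base_le; omega)).ok.2
  have e1 : ((List.range' 0 K.baseTime).flatMap fun t =>
      (K.front.slice t).flaggedCopy L.left id t).map (fun e => e.1.1) =
      ((List.range' 0 K.baseTime).flatMap fun t =>
        (K.front.slice t).copyEntries L.left t).map Prod.fst := by
    rw [List.map_flatMap, List.map_flatMap]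
    refine List.flatMap_congr fun t _ => ?_
    rw [← flaggedCopy_fst L.left id, List.map_map]; rfl
  rw [e1, zero_add, K.front.width_zero, K.planar.left_eq, mul_zero, width_base] at h1
  have e2 := K.length_left L.left K.baseTime
  rw [Front.width, satellite, satelliteSlices_eq hK]
  simp only [List.map_append]
  rw [List.append_assoc, List.take_append, List.length_map, e2, List.take_of_length_le
    (by rw [List.length_map, e2]; omega), Nat.add_sub_cancel_left, List.foldl_append, h1,
    List.take_append_of_le_length (by rw [List.length_map, length_patternEntries]; exact ht)]
  clear h1 e1 e2
  induction t with
  | zero => simp [L.width_zero]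
  | succ t ih =>
    rw [List.take_add_one, List.foldl_append, ih (by omega), L.width_succ,
      ← ((hL.ok t (by omega)).shift _ _).2]
    have : ((L.patternEntries (L.left * K.baseStrand)).map Prod.fst)[t]? =
        some ((L.slice t).shift (L.left * K.baseStrand)) := by
      simp [Front.patternEntries, show t < L.length by omega]
    rw [this]; rfl

theorem pattern_ne (hK : K.rightward = true) (hL : L.IsAnnular) {ρ : ℕ → ℕ → ℕ}
    (h : (K.satellite L).IsNormalRuling ρ) {t i : ℕ} (ht : t ≤ L.length) (hi : i < L.width t) :
    ρ (K.leftTime L.left K.baseTime + t) (L.left * K.baseStrand + i) ≠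
      L.left * K.baseStrand + i := by
  apply h.fixedPointFree
  rw [width_pattern hK hL ht]
  omega

/-- The slice conditions restrict to the window of the pattern. That the ruling closes up comes from
`thinAt_const`: the base block carries the same thin pairing before and after the pattern. -/
theorem isGenRuling_patternRuling (hK : K.rightward = true) (hL : L.IsAnnular) {ρ : ℕ → ℕ → ℕ}
    (h : (K.satellite L).IsNormalRuling ρ) : L.IsGenRuling (K.patternRuling L ρ) := by
  refine ⟨fun t => (windowAt_pairing (h.involutive _) _ _).inv, fun t i hi => ?_, fun t => ?_, ?_⟩
  · refine (windowAt_pairing (h.involutive _) _ _).supp i ?_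
    rcases le_total t L.length with h1 | h1
    · rwa [min_eq_left h1]
    · rw [min_eq_right h1]; rwa [L.width_of_le h1] at hi
  · unfold patternRuling
    rcases lt_or_ge t L.length with h1 | h1
    · rw [min_eq_left h1.le, min_eq_left (by omega), L.width_succ]
      exact ((seg_satellite hK h.toIsGenRuling).2.1 t h1).windowAt (hL.ok t h1) (h.involutive _)
        (h.involutive _) fun i hi => pattern_ne hK hL h h1.le hi
    · rw [min_eq_right h1, min_eq_right (by omega), L.slice_of_le h1]; rfl
  · have h1 := (thinAt_const hK hL h.toIsGenRuling).2 0 K.base_le K.baseStrand K.base_lt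
    rw [← h1, rightTime_zero, thinAt_eq_windowAt, patternRuling, min_self, hL.closed]

theorem copy_length_flagged (n : ℕ) (π : ℕ → ℕ) (t : ℕ) (s : Slice) :
    (s.flaggedCopy n π t).length = (s.copy n).length := by
  rw [← length_copyEntries n t, ← flaggedCopy_fst n π, List.length_map]

/-- The partial ruling of the satellite in the copies of the slices of `K` and in the pattern. -/
theorem steps_satellite {τ : ℕ → ℕ → ℕ} {Θ : ℕ → ℕ → ℕ} (h : Steps (K.flaggedSatellite L τ) Θ) :
    (∀ s < K.baseTime, Steps ((K.front.slice s).flaggedCopy L.left (τ 0) s)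
      fun r => Θ (K.leftTime L.left s + r)) ∧
    Steps (L.flaggedPattern (L.left * K.baseStrand) τ L.length)
      (fun t => Θ (K.leftTime L.left K.baseTime + t)) ∧
    ∀ s < K.front.length - K.baseTime,
      Steps ((K.front.slice (K.baseTime + s)).flaggedCopy L.left (τ 0) (K.baseTime + s))
        fun r => Θ (K.rightTime L s + r) := by
  obtain ⟨h2, h4⟩ := steps_append h
  obtain ⟨h2, h3⟩ := steps_append h2
  have e2 : ((List.range' 0 K.baseTime).flatMap fun t =>
      (K.front.slice t).flaggedCopy L.left (τ 0) t).length = K.leftTime L.left K.baseTime := by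
    rw [length_flatMap_range']; simp [copy_length_flagged, leftTime]
  have e3 : (L.flaggedPattern (L.left * K.baseStrand) τ L.length).length = L.length := by
    simp [Front.flaggedPattern]
  rw [List.length_append] at h4
  rw [e2] at h3 h4
  rw [e3] at h4
  refine ⟨fun s hs => ?_, h3, fun s hs => ?_⟩
  · have := steps_flatMap h2 hs
    simpa only [zero_add, copy_length_flagged, leftTime] using this
  · have := steps_flatMap h4 hs
    simpa only [copy_length_flagged, rightTime, add_assoc] using this

/-- The flags force the states, so these are the states of the runs through the copies and through
the pattern. -/
theorem satellite_states (hL : L.IsAnnular) {τ : ℕ → ℕ → ℕ} (hτ : L.IsGenRuling τ)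
    {Θ : ℕ → ℕ → ℕ} (h : Steps (K.flaggedSatellite L τ) Θ) (h0 : Θ 0 = id) :
    (∀ s ≤ K.baseTime, Θ (K.leftTime L.left s) = blocks L.left (τ 0) (K.front.width s)) ∧
    (∀ t ≤ L.length, Θ (K.leftTime L.left K.baseTime + t) =
      stack (L.left * K.baseStrand) (L.width t) (blocks L.left (τ 0) K.baseStrand) (τ t)
        (blocks L.left (τ 0) (K.front.width K.baseTime - K.baseStrand - 1))) ∧
    ∀ s, K.baseTime + s ≤ K.front.length →
      Θ (K.rightTime L s) = blocks L.left (τ 0) (K.front.width (K.baseTime + s)) := by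
  obtain ⟨h1, h2, h3⟩ := steps_satellite h
  have hπ : Pairing L.left (τ 0) := hτ.pairing 0
  have s1 : ∀ s ≤ K.baseTime,
      Θ (K.leftTime L.left s) = blocks L.left (τ 0) (K.front.width s) := by
    intro s
    induction s with
    | zero =>
      intro _
      rw [K.front.width_zero, K.planar.left_eq, blocks_zero, ← h0]; rfl
    | succ s ih =>
      intro hs
      have := (run_copy hπ s (K.planar.ok s (by have := K.base_le; omega))).last_eq (h1 s hs)
        (ih (by omega))
      rwa [copy_length_flagged, ← leftTime_succ, ← K.front.width_succ] at this
  have s2 : ∀ t ≤ L.length, Θ (K.leftTime L.left K.baseTime + t) =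
      stack (L.left * K.baseStrand) (L.width t) (blocks L.left (τ 0) K.baseStrand) (τ t)
        (blocks L.left (τ 0) (K.front.width K.baseTime - K.baseStrand - 1)) := by
    intro t ht
    have hst : Steps (L.flaggedPattern (L.left * K.baseStrand) τ t)
        (fun t => Θ (K.leftTime L.left K.baseTime + t)) := by
      intro r hr
      have h4 : r < t := by simpa [Front.flaggedPattern] using hr
      have := h2 r (by simp [Front.flaggedPattern]; omega)
      simpa [Front.flaggedPattern] using this
    have := (Front.run_flaggedPattern hL.ok hτ (c := id) (r := 0)
      (m := L.left * K.baseStrand) (α := blocks L.left (τ 0) K.baseStrand)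
      (β := blocks L.left (τ 0) (K.front.width K.baseTime - K.baseStrand - 1))
      (fun x => (blocks_pairing hπ _).lt_of_lt) ht).last_eq hst
      (by rw [add_zero, s1 _ le_rfl]; exact blocks_eq_stack K.base_lt)
    rwa [show (L.flaggedPattern (L.left * K.baseStrand) τ t).length = t by
      simp [Front.flaggedPattern]] at this
  refine ⟨s1, s2, fun s => ?_⟩
  induction s with
  | zero =>
    intro _
    rw [rightTime_zero, s2 _ le_rfl, hτ.closed, hL.closed]
    exact (blocks_eq_stack K.base_lt).symm
  | succ s ih =>
    intro hs
    have := (run_copy hπ (K.baseTime + s) (K.planar.ok _ (by omega))).last_eq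
      (h3 s (by omega)) (ih (by omega))
    rwa [copy_length_flagged, ← rightTime_succ, ← K.front.width_succ] at this

end BasedKnot

/-! ### Rulings of the satellite extend the partial ruling -/

theorem extends_of_steps {l : List Entry} {Θ ρ : ℕ → ℕ → ℕ} (hΘ : Steps l Θ)
    (hρ : Seg (l.map fun e => e.1.1) ρ) (hi : ∀ t, Function.Involutive (Θ t))
    (hi' : ∀ t, Function.Involutive (ρ t)) (h0 : Extends (Θ 0) (ρ 0))
    (h : ∀ t (ht : t < l.length), ∀ k, l[t].1.1 = Slice.cross k → Extends (Θ t) (ρ t) →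
      (l[t].2 = true → ρ (t + 1) = ρ t) ∧ (l[t].2 = false →
        ¬ (Θ t k = k ∧ Θ t (k + 1) = k + 1) → ConjAt k (ρ t) (ρ (t + 1)))) :
    ∀ t ≤ l.length, Extends (Θ t) (ρ t) := by
  intro t
  induction t with
  | zero => exact fun _ => h0
  | succ t ih =>
    intro ht
    have ih := ih (by omega)
    have h1 := hρ t (by simpa using ht)
    rw [List.getElem_map] at h1
    exact (hΘ t ht).extends h1 (hi _) (hi' _) ih fun k hk => h t ht k hk ih

theorem gridWord_fst (t b m n : ℕ) : (gridWord t b m n).map Prod.fst = grid b m n := by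
  simp only [gridWord, grid, withOrigin, List.map_flatMap, List.map_map]
  refine List.flatMap_congr fun i _ => ?_
  exact List.map_id _

/-- The partial ruling has no flags in the grid and pairs the strands of the grid among themselves.
A switch of `ρ` at a moved strand would involve such a pair, contrary to `grid_switchOutside`. -/
theorem extends_grid {t b m n : ℕ} {Θ ρ : ℕ → ℕ → ℕ}
    (hΘ : Steps ((gridWord t b m n).map unflagged) Θ) (hρ : Seg (grid b m n) ρ)
    (hi : ∀ t, Function.Involutive (Θ t)) (hi' : ∀ t, Function.Involutive (ρ t))
    (h0 : Extends (Θ 0) (ρ 0)) (hR : ∀ x, b ≤ x → x < b + m + n → b ≤ Θ 0 x ∧ Θ 0 x < b + m + n) :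
    ∀ t ≤ (grid b m n).length, Extends (Θ t) (ρ t) := by
  have e1 : ((gridWord t b m n).map unflagged).map (fun e => e.1.1) = grid b m n := by
    rw [← gridWord_fst t, List.map_map]; rfl
  have e2 : ((gridWord t b m n).map unflagged).length = (grid b m n).length := by
    simpa using congrArg List.length e1
  have hcr : CrossingsIn b (m + n) (grid b m n) := crossingsIn_grid le_rfl
  have hsl : ∀ q (hq : q < ((gridWord t b m n).map unflagged).length),
      (((gridWord t b m n).map unflagged)[q]).1.1 = (grid b m n)[q]'(by omega) ∧
      (((gridWord t b m n).map unflagged)[q]).2 = false := by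
    intro q hq
    constructor
    · simp only [← e1, List.getElem_map]
    · simp only [List.getElem_map, unflagged]
  have hinv : ∀ q ≤ (grid b m n).length,
      ∀ x, b ≤ x → x < b + m + n → b ≤ Θ q x ∧ Θ q x < b + m + n := by
    intro q
    induction q with
    | zero => exact fun _ => hR
    | succ q ih =>
      intro hq x hx hx'
      have h1 := hΘ q (by omega)
      obtain ⟨h2, h3⟩ := hsl q (by omega)
      obtain ⟨k, h4, h5, h6⟩ := hcr _ (List.getElem_mem (show q < (grid b m n).length by omega))
      rw [h2, h3, h4] at h1
      obtain ⟨-, ⟨-, h7⟩ | ⟨h7, -⟩⟩ := h1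
      · have h8 := h7 (Equiv.swap k (k + 1) x)
        rw [Equiv.swap_apply_self] at h8
        have h9 := ih (by omega) (Equiv.swap k (k + 1) x)
          (by rw [Slice.swap_val]; split_ifs <;> omega)
          (by rw [Slice.swap_val]; split_ifs <;> omega)
        rw [h8]
        rw [Slice.swap_val k (Θ q _)]
        split_ifs <;> omega
      · simp at h7
  have hso := grid_switchOutside hi' hρ
  rw [← e2]
  refine extends_of_steps hΘ (by rwa [e1]) hi hi' h0 ?_
  intro q hq k hk hext
  obtain ⟨h2, h3⟩ := hsl q hq
  rw [h3]
  refine ⟨by simp, fun _ hn => ?_⟩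
  by_contra hc
  have hq' : q < (grid b m n).length := by omega
  rw [h2] at hk
  obtain ⟨h5, h6⟩ := hso q hq' k hk hc
  obtain ⟨k', h7, h8, h9⟩ := hcr _ (List.getElem_mem hq')
  rw [hk] at h7
  obtain rfl : k = k' := by injection h7
  have h10 := hinv q hq'.le k (by omega) (by omega)
  have h11 := hinv q hq'.le (k + 1) (by omega) (by omega)
  apply hn
  constructor
  · by_contra h
    have := hext k h
    omega
  · by_contra h
    have := hext (k + 1) h
    omega

theorem cuspWord_eq (b n : ℕ) : cuspWord b n =
    (List.range' 0 n).flatMap fun j => Slice.lcusp (b + 2 * j) :: rowUp (b + 2 * j) j := by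
  rw [cuspWord, List.range_eq_range']

theorem length_cuspWord (b j : ℕ) : (cuspWord b j).length = ∑ q ∈ Finset.range j, (q + 1) := by
  rw [cuspWord_eq, length_flatMap_range']; simp

/-- The switches of a ruling in a copy of a left cusp. -/
theorem cuspWord_switch_iff {b n : ℕ} {π : ℕ → ℕ} {ρ : ℕ → ℕ → ℕ}
    (hi : ∀ t, Function.Involutive (ρ t)) (h : Seg (cuspWord b n) ρ)
    (hπ : Function.Involutive π)
    (hst : ∀ j ≤ n, CuspState b j π (fun _ => false) (ρ (cuspWord b j).length)) {j r : ℕ}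
    (hj : j < n) (hr : r < j) :
    (π j = j - 1 - r →
      ρ ((cuspWord b j).length + (r + 1) + 1) = ρ ((cuspWord b j).length + (r + 1))) ∧
    (π j ≠ j - 1 - r → ConjAt (b + 2 * j - 1 - r) (ρ ((cuspWord b j).length + (r + 1)))
      (ρ ((cuspWord b j).length + (r + 1) + 1))) := by
  have h' := h
  rw [cuspWord_eq] at h'
  have h1 := seg_flatMap h' hj
  simp only [zero_add, List.length_cons, length_rowUp, ← length_cuspWord b] at h1
  obtain ⟨h2, h3⟩ := h1.cons
  have h4 := hst j hj.le
  have h5 := hst (j + 1) hj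
  have hins := lcusp_rules h2 (hi _)
  rw [add_zero] at hins
  have hlen : (cuspWord b (j + 1)).length = (cuspWord b j).length + (j + 1) := by
    rw [cuspWord_succ]; simp
  rw [hlen] at h5
  refine rowUp_switch_iff (ρ := fun t => ρ ((cuspWord b j).length + (t + 1))) hπ (fun _ => hi _)
    ?_ h5 ?_ h3 r hr
  · intro i hij
    rw [zero_add, hins, h4.insertPair _ _ (by omega) (by omega),
      h4.insertPair _ _ (by omega) (by omega)]
    exact h4 i hij
  · rw [zero_add, hins, Slice.insertPair_self]; rfl

theorem flaggedCusp_eq (π : ℕ → ℕ) (t b n : ℕ) : flaggedCusp π t b n =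
    (List.range' 0 n).flatMap fun j =>
      ((Slice.lcusp (b + 2 * j), Origin.companion t j), decide (π j ≠ j)) ::
        flaggedRow (Origin.companion t j) (b + 2 * j) j (if π j < j then j - 1 - π j else j) := by
  rw [flaggedCusp, List.range_eq_range']

theorem cuspEntries_fst (t b n : ℕ) : (cuspEntries t b n).map Prod.fst = cuspWord b n := by
  simp only [cuspEntries, cuspWord, withOrigin, List.map_flatMap, List.map_map]
  refine List.flatMap_congr fun i _ => ?_
  exact List.map_id _

/-- Both rulings switch at the crossing of the upper branch of the copy `j` with the lower branch of
the copy `π j`, for `π j < j`, and nowhere else. -/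
theorem extends_cusp {t b n : ℕ} {π : ℕ → ℕ} {Θ ρ : ℕ → ℕ → ℕ}
    (hΘ : Steps (flaggedCusp π t b n) Θ) (hρ : Seg (cuspWord b n) ρ)
    (hi : ∀ t, Function.Involutive (Θ t)) (hi' : ∀ t, Function.Involutive (ρ t))
    (h0 : Extends (Θ 0) (ρ 0)) (hπ : Function.Involutive π)
    (hst : ∀ j ≤ n, CuspState b j π (fun _ => false) (ρ (cuspWord b j).length)) :
    ∀ t ≤ (cuspWord b n).length, Extends (Θ t) (ρ t) := by
  have e1 : (flaggedCusp π t b n).map (fun e => e.1.1) = cuspWord b n := by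
    rw [← cuspEntries_fst t, ← flaggedCusp_fst π, List.map_map]; rfl
  rw [← e1, List.length_map]
  refine extends_of_steps hΘ (by rwa [e1]) hi hi' h0 ?_
  intro q hq k hk _
  have hq' := hq
  rw [flaggedCusp_eq] at hq'
  obtain ⟨j, hj, r, hr, rfl, h2⟩ := exists_of_lt_flatMap hq'
  rw [← flaggedCusp_eq, List.getElem?_eq_getElem hq] at h2
  simp only [zero_add, List.length_cons, flaggedRow, List.length_map, List.length_range] at h2 hr
  cases r with
  | zero =>
    rw [List.getElem?_cons_zero, Option.some_inj] at h2
    simp only [zero_add, List.length_cons, flaggedRow, List.length_map, List.length_range, h2] at hk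
    simp at hk
  | succ r =>
    rw [List.getElem?_cons_succ, List.getElem?_map, List.getElem?_range (by omega),
      Option.map_some, Option.some_inj] at h2
    simp only [zero_add, List.length_cons, flaggedRow, List.length_map, List.length_range, h2] at hk ⊢
    obtain rfl : b + 2 * j - 1 - r = k := by simpa using hk
    obtain ⟨h3, h4⟩ := cuspWord_switch_iff hi' hρ hπ hst hj (show r < j by omega)
    rw [length_cuspWord] at h3 h4
    simp only [decide_eq_true_eq, decide_eq_false_iff_not]
    refine ⟨fun h5 => h3 ?_, fun h5 _ => h4 ?_⟩
    · split_ifs at h5 <;> omega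
    · split_ifs at h5 <;> omega

theorem Steps.reverse {l : List Entry} {Θ : ℕ → ℕ → ℕ} (hi : ∀ t, Function.Involutive (Θ t))
    (h : Steps l Θ) : Steps (l.reverse.map Entry.mirror) fun t => Θ (l.length - t) := by
  intro t ht
  rw [List.length_map, List.length_reverse] at ht
  have h1 := (h (l.length - 1 - t) (by omega)).mirror (hi _)
  simp only [List.getElem_map, List.getElem_reverse, Entry.mirror]
  convert h1 using 2 <;> omega

theorem mirror_reverse_entries (l : List Entry) :
    ((l.reverse.map Entry.mirror).reverse.map Entry.mirror) = l := by
  rw [← List.map_reverse, List.reverse_reverse, List.map_map]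
  conv_rhs => rw [← List.map_id l]
  refine List.map_congr_left fun e _ => ?_
  simp [Entry.mirror, Slice.mirror_mirror]

theorem extends_blocks {n w : ℕ} {π f : ℕ → ℕ} (h : ∀ s < w, thinAt f n s = π) :
    Extends (blocks n π w) f := by
  intro x hx
  rcases lt_or_ge x (n * w) with h1 | h1
  · obtain ⟨s, i, hs, hi, rfl⟩ := block_cases h1
    rw [blocks_apply π hs hi] at hx ⊢
    have := windowAt_cases f (n * s) n i
    rw [← thinAt_eq_windowAt, h s hs] at this
    omega
  · exact absurd (blocks_of_le π h1) hx

/-- In the copy of a left cusp, the pairing of the copies is the one given by `thinAt`. -/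
theorem cuspState_of_thinAt {n k : ℕ} {ρ : ℕ → ℕ → ℕ} (hi : ∀ t, Function.Involutive (ρ t))
    (h : Seg (cuspWord (n * k) n) ρ) {π : ℕ → ℕ}
    (hπ : thinAt (ρ (cuspWord (n * k) n).length) n k = π) :
    ∀ j ≤ n, CuspState (n * k) j π (fun _ => false) (ρ (cuspWord (n * k) j).length) := by
  obtain ⟨π', h1, h2, h3⟩ := exists_cuspState hi h
  rw [((h3 n le_rfl).thinAt h1 h2 rfl).1] at hπ
  exact hπ ▸ h3

/-- A cusp is treated through the end where its branches are open, which is the right end for a left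
cusp and the left end for a right cusp. This is why the thin pairing is assumed at both ends. -/
theorem extends_copy {n : ℕ} {π : ℕ → ℕ} (hπ : Pairing n π) {t w : ℕ} {s : Slice} (hok : s.Ok w)
    {Θ ρ : ℕ → ℕ → ℕ} (hΘ : Steps (s.flaggedCopy n π t) Θ) (hρ : Seg ((s.copy n).map Prod.fst) ρ)
    (hi : ∀ t, Function.Involutive (Θ t)) (hi' : ∀ t, Function.Involutive (ρ t))
    (h0 : Θ 0 = blocks n π w) (h1 : Θ (s.copy n).length = blocks n π (s.out w))
    (h2 : ∀ s < w, thinAt (ρ 0) n s = π)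
    (h3 : ∀ i < s.out w, thinAt (ρ (s.copy n).length) n i = π) :
    ∀ r ≤ (s.copy n).length, Extends (Θ r) (ρ r) := by
  have e0 : Extends (Θ 0) (ρ 0) := by rw [h0]; exact extends_blocks h2
  have e1 : Extends (Θ (s.copy n).length) (ρ (s.copy n).length) := by
    rw [h1]; exact extends_blocks h3
  rw [← List.length_map (f := Prod.fst)] at *
  cases s with
  | triv => intro r hr; obtain rfl : r = 0 := by simpa [Slice.copy] using hr
            exact e0
  | cross k =>
    simp only [Slice.Ok] at hok
    rw [copy_cross] at *
    refine extends_grid hΘ hρ hi hi' e0 ?_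
    intro x hx hx'
    have hk := block_lt (n := n) hok
    have hk' : n * (k + 1) = n * k + n := by ring
    obtain ⟨q, i, hq, hin, rfl⟩ := block_cases (n := n) (w := w) (x := x) (by omega)
    rw [h0, blocks_apply π hq hin]
    have h4 := hπ.lt_of_lt hin
    have h5 : k ≤ q := by
      by_contra h; have := block_lt (n := n) (show q < k by omega); omega
    have h6 : q ≤ k + 1 := by
      by_contra h; have := block_lt (n := n) (show k + 1 < q by omega); omega
    have h7 := Nat.mul_le_mul_left n h5
    have h8 := Nat.mul_le_mul_left n h6
    omega
  | lcusp k =>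
    simp only [Slice.Ok, Slice.out] at *
    rw [copy_lcusp] at *
    exact extends_cusp hΘ hρ hi hi' e0 hπ.inv (cuspState_of_thinAt hi' hρ (h3 k (by omega)))
  | rcusp k =>
    simp only [Slice.Ok, Slice.out] at *
    rw [copy_rcusp] at *
    have hΘ' := Steps.reverse hi hΘ
    have hlen : (flaggedCusp π t (n * k) n).length = (cuspWord (n * k) n).length := by
      rw [← cuspEntries_fst t, ← flaggedCusp_fst π, List.length_map, List.length_map]
    simp only [Slice.flaggedCopy, mirror_reverse_entries, List.length_map, List.length_reverse,
      hlen] at hΘ'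
    have hρ' := hρ.reverse hi'
    rw [map_mirror_reverse] at hρ'
    simp only [List.length_map, List.length_reverse] at hρ' e1 ⊢
    intro r hr
    have := extends_cusp hΘ' hρ' (fun t => hi _) (fun t => hi' _) (by simpa using e1) hπ.inv
      (cuspState_of_thinAt (fun t => hi' _) hρ' (by
        rw [Nat.sub_self]; exact h2 k (by omega))) ((cuspWord (n * k) n).length - r) (by omega)
    rwa [show (cuspWord (n * k) n).length - ((cuspWord (n * k) n).length - r) = r by omega] at this

namespace BasedKnot

variable {K : BasedKnot} {L : Front}

theorem length_satellite (hK : K.rightward = true) :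
    (K.satellite L).length = K.rightTime L (K.front.length - K.baseTime) := by
  rw [Front.length, satellite, satelliteSlices_eq hK]
  simp only [List.length_map, List.length_append, length_left, length_patternEntries, rightTime]
  rw [length_flatMap_range']
  simp [length_copyEntries]

/-- A line of the satellite lies in the copy of a slice of `K` or in the pattern. -/
theorem satellite_cases (hK : K.rightward = true) {t : ℕ} (ht : t ≤ (K.satellite L).length) :
    (∃ s < K.baseTime, ∃ r < ((K.front.slice s).copy L.left).length,
      t = K.leftTime L.left s + r) ∨
    (∃ r ≤ L.length, t = K.leftTime L.left K.baseTime + r) ∨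
    (∃ s < K.front.length - K.baseTime, ∃ r ≤ ((K.front.slice (K.baseTime + s)).copy L.left).length,
      t = K.rightTime L s + r) := by
  rw [length_satellite hK] at ht
  rcases lt_or_ge t (K.leftTime L.left K.baseTime) with h | h
  · left
    rw [← length_left] at h
    obtain ⟨s, hs, r, hr, h1, -⟩ := exists_of_lt_flatMap h
    simp only [zero_add, length_copyEntries] at hr h1
    exact ⟨s, hs, r, hr, h1⟩
  right
  rcases le_or_gt t (K.leftTime L.left K.baseTime + L.length) with h' | h'
  · left
    exact ⟨t - K.leftTime L.left K.baseTime, by omega, by omega⟩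
  right
  rcases ht.lt_or_eq with h2 | h2
  · have h3 : t - (K.leftTime L.left K.baseTime + L.length) <
        ((List.range' K.baseTime (K.front.length - K.baseTime)).flatMap fun t =>
          (K.front.slice t).copyEntries L.left t).length := by
      rw [length_flatMap_range']
      simp only [length_copyEntries]
      unfold rightTime at h2
      omega
    obtain ⟨s, hs, r, hr, h1, -⟩ := exists_of_lt_flatMap h3
    simp only [length_copyEntries] at hr h1
    refine ⟨s, hs, r, hr.le, ?_⟩
    unfold rightTime
    omega
  · obtain ⟨s, hs⟩ : ∃ s, K.front.length - K.baseTime = s + 1 := by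
      refine ⟨K.front.length - K.baseTime - 1, ?_⟩
      by_contra hc
      rw [show K.front.length - K.baseTime = 0 by omega, rightTime_zero] at h2
      omega
    rw [hs, rightTime_succ] at h2
    exact ⟨s, by omega, _, le_rfl, h2⟩

/-- A normal ruling of the satellite extends the partial ruling that is given by the ruling of the
pattern. -/
theorem extends_satellite (hK : K.rightward = true) (hL : L.IsAnnular) {ρ : ℕ → ℕ → ℕ}
    (h : (K.satellite L).IsNormalRuling ρ) {Θ : ℕ → ℕ → ℕ}
    (hΘ : Steps (K.flaggedSatellite L (K.patternRuling L ρ)) Θ) (h0 : Θ 0 = id)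
    (hi : ∀ t, Function.Involutive (Θ t)) {t : ℕ} (ht : t ≤ (K.satellite L).length) :
    Extends (Θ t) (ρ t) := by
  have hτ := isGenRuling_patternRuling hK hL h
  have hπ : Pairing L.left (K.patternRuling L ρ 0) := hτ.pairing 0
  obtain ⟨m1, m2, m3⟩ := satellite_states hL hτ hΘ h0
  obtain ⟨s1, s2, s3⟩ := steps_satellite hΘ
  obtain ⟨r1, r2, r3⟩ := seg_satellite hK h.toIsGenRuling
  obtain ⟨c1, c2⟩ := thinAt_const hK hL h.toIsGenRuling
  have hb := K.base_le
  rcases satellite_cases hK ht with ⟨s, hs, r, hr, rfl⟩ | ⟨r, hr, rfl⟩ | ⟨s, hs, r, hr, rfl⟩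
  · refine extends_copy hπ (K.planar.ok s (by omega)) (s1 s hs) (r1 s hs) (fun _ => hi _)
      (fun _ => h.involutive _) (m1 s hs.le) ?_ (c1 s hs.le) ?_ r hr.le
    · rw [← leftTime_succ, ← K.front.width_succ]; exact m1 (s + 1) hs
    · rw [← leftTime_succ, ← K.front.width_succ]; exact c1 (s + 1) hs
  · rw [m2 r hr]
    -- Above and below the window the pairs are those of the base line. Inside the window the
    -- pattern ruling is by definition the restriction of `ρ`.
    have hout := fun x y => outer_pattern hK hL h.toIsGenRuling x y hr
    have hbase : Extends (blocks L.left (K.patternRuling L ρ 0) (K.front.width K.baseTime))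
        (ρ (K.leftTime L.left K.baseTime)) := extends_blocks (c1 _ le_rfl)
    rw [blocks_eq_stack K.base_lt] at hbase
    intro x hx
    rcases stack_cases (L.left * K.baseStrand) (L.width r) x with h1 | ⟨i, hiw, rfl⟩ | ⟨y, rfl⟩
    · have h2 := (blocks_pairing hπ K.baseStrand).lt_of_lt h1
      have h3 := hbase x
      rw [stack_of_lt h1] at h3 hx ⊢
      have e : ∀ w, outer (L.left * K.baseStrand) w x = x := fun w => if_pos h1
      have e' : ∀ w, outer (L.left * K.baseStrand) w
        (blocks L.left (K.patternRuling L ρ 0) K.baseStrand x) =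
          blocks L.left (K.patternRuling L ρ 0) K.baseStrand x := fun w => if_pos h2
      have h4 := hout x (blocks L.left (K.patternRuling L ρ 0) K.baseStrand x)
      rw [e, e, e', e'] at h4
      exact h4.2 (h3 hx)
    · rw [stack_mid hiw] at hx ⊢
      have h3 := windowAt_cases (ρ (K.leftTime L.left K.baseTime + r)) (L.left * K.baseStrand)
        (L.width r) i
      have h4 : K.patternRuling L ρ r = windowAt (ρ (K.leftTime L.left K.baseTime + r))
        (L.left * K.baseStrand) (L.width r) := by rw [patternRuling, min_eq_left hr]
      rw [← h4] at h3
      omega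
    · have h3 := hbase (L.left * K.baseStrand + L.left + y)
      rw [stack_add] at h3 hx ⊢
      have e : ∀ w z, outer (L.left * K.baseStrand) w (L.left * K.baseStrand + z) =
          L.left * K.baseStrand + w + z := fun w z => by
        unfold outer; rw [if_neg (by omega)]; ring
      have h4 := hout (L.left * K.baseStrand + y) (L.left * K.baseStrand +
        blocks L.left (K.patternRuling L ρ 0) (K.front.width K.baseTime - K.baseStrand - 1) y)
      rw [e, e, e, e] at h4
      exact h4.2 (h3 (by omega))
  · refine extends_copy hπ (K.planar.ok (K.baseTime + s) (by omega)) (s3 s hs) (r3 s hs)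
      (fun _ => hi _) (fun _ => h.involutive _) (m3 s (by omega)) ?_ (c2 s (by omega)) ?_ r hr
    · rw [← rightTime_succ, ← K.front.width_succ]; exact m3 (s + 1) (by omega)
    · rw [← rightTime_succ, ← K.front.width_succ]; exact c2 (s + 1) (by omega)

end BasedKnot

/-! ### Reduced rulings are those without thin pairs -/

namespace Front

theorem exists_lcusp (F : Front) (h0 : F.left = 0) {T : ℕ} (h : 0 < F.width T) :
    ∃ t < T, ∃ k, F.slice t = Slice.lcusp k := by
  induction T with
  | zero => rw [width_zero, h0] at h; omega
  | succ T ih =>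
    rw [width_succ] at h
    cases hs : F.slice T with
    | lcusp k => exact ⟨T, by omega, k, hs⟩
    | triv | cross k | rcusp k =>
      rw [hs] at h
      simp only [Slice.out] at h
      obtain ⟨t, ht, k, hk⟩ := ih (by omega)
      exact ⟨t, by omega, k, hk⟩

end Front

namespace BasedKnot

variable {K : BasedKnot} {L : Front}

theorem satellite_slice {t : ℕ} {x : Slice × Origin} (h : (K.satelliteSlices L)[t]? = some x) :
    (K.satellite L).slice t = x.1 := by
  simp [Front.slice, satellite, List.getD_eq_getElem?_getD, h]

/-- The number of kept slices among the first `t` slices of the satellite. -/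
noncomputable def keptTime (K : BasedKnot) (L : Front) (τ Θ : ℕ → ℕ → ℕ) (t : ℕ) : ℕ :=
  keepTime (fixCount (τ 0)) (K.flaggedSatellite L τ) Θ (min t (K.flaggedSatellite L τ).length)

theorem exists_partialRuling (hK : K.rightward = true) (hL : L.IsAnnular) {τ : ℕ → ℕ → ℕ}
    (hτ : L.IsGenRuling τ) : ∃ Θ : ℕ → ℕ → ℕ, Θ 0 = id ∧ Steps (K.flaggedSatellite L τ) Θ ∧
      (∀ t, (K.flaggedSatellite L τ).length ≤ t → Θ t = id) ∧
      (K.satellite L).PartialRuling (K.satellite (L.fixedPart τ)) Θ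
        (flagAt (K.flaggedSatellite L τ)) (K.keptTime L τ Θ) := by
  have hrun := run_flaggedSatellite hK hL hτ
  obtain ⟨Θ, h0, hs, hl⟩ := hrun.exists_steps
  refine ⟨Θ, h0, hs, hl, ?_⟩
  have H := hrun.partialRuling h0 hs hl
  have e : K.satellite L = ⟨0, (K.flaggedSatellite L τ).map fun e => e.1.1⟩ := by
    rw [satellite, ← flaggedSatellite_fst hK L τ, List.map_map]
    rfl
  rw [e]
  exact H

theorem satelliteSlices_left (hK : K.rightward = true) {s r : ℕ} (hs : s < K.baseTime)
    (hr : r < ((K.front.slice s).copy L.left).length) :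
    (K.satelliteSlices L)[K.leftTime L.left s + r]? =
      ((K.front.slice s).copyEntries L.left s)[r]? := by
  have h := getElem?_flatMap (g := fun t => (K.front.slice t).copyEntries L.left t) (a := 0) hs
    (r := r) (by rw [Nat.zero_add, length_copyEntries]; exact hr)
  simp only [Nat.zero_add, length_copyEntries] at h
  have hlt : K.leftTime L.left s + r <
      ((List.range' 0 K.baseTime).flatMap fun t =>
        (K.front.slice t).copyEntries L.left t).length := by
    by_contra hc
    rw [← leftTime, List.getElem?_eq_none (not_lt.mp hc)] at h
    rw [eq_comm, List.getElem?_eq_none_iff, length_copyEntries] at h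
    omega
  rw [satelliteSlices_eq hK, List.append_assoc, List.getElem?_append_left hlt]
  exact h

theorem satelliteSlices_cases (hK : K.rightward = true) {t : ℕ} {x : Slice × Origin}
    (h : (K.satelliteSlices L)[t]? = some x) :
    (∃ s < K.baseTime, ∃ r, t = K.leftTime L.left s + r ∧
      ((K.front.slice s).copyEntries L.left s)[r]? = some x) ∨
    (∃ r < L.length, t = K.leftTime L.left K.baseTime + r ∧
      x = ((L.slice r).shift (L.left * K.baseStrand), Origin.pattern r)) ∨
    (∃ s < K.front.length - K.baseTime, ∃ r, t = K.rightTime L s + r ∧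
      ((K.front.slice (K.baseTime + s)).copyEntries L.left (K.baseTime + s))[r]? = some x) := by
  rw [satelliteSlices_eq hK, List.append_assoc] at h
  rcases lt_or_ge t (K.leftTime L.left K.baseTime) with h1 | h1
  · left
    rw [← length_left] at h1
    rw [List.getElem?_append_left h1] at h
    obtain ⟨s, hs, r, hr, ht, he⟩ := exists_of_lt_flatMap h1
    simp only [Nat.zero_add, length_copyEntries] at ht he
    exact ⟨s, hs, r, ht, he ▸ h⟩
  · rw [List.getElem?_append_right (by rw [length_left]; exact h1), length_left] at h
    obtain ⟨u, rfl⟩ := Nat.exists_eq_add_of_le h1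
    rw [Nat.add_sub_cancel_left] at h
    rcases lt_or_ge u L.length with h2 | h2
    · right; left
      rw [List.getElem?_append_left (by rw [length_patternEntries]; exact h2)] at h
      refine ⟨u, h2, rfl, ?_⟩
      simp only [Front.patternEntries, List.getElem?_map, List.getElem?_range h2,
        Option.map_some, Option.some.injEq] at h
      exact h.symm
    · right; right
      rw [List.getElem?_append_right (by rw [length_patternEntries]; exact h2),
        length_patternEntries] at h
      have h3 := (List.getElem?_eq_some_iff.mp h).1
      obtain ⟨s, hs, r, hr, ht, he⟩ := exists_of_lt_flatMap h3
      simp only [length_copyEntries] at ht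
      refine ⟨s, hs, r, ?_, he ▸ h⟩
      have : K.rightTime L s = K.leftTime L.left K.baseTime + L.length +
        ∑ q ∈ Finset.range s, ((K.front.slice (K.baseTime + q)).copy L.left).length := rfl
      omega

end BasedKnot

theorem cuspEntries_eq (t b n : ℕ) : cuspEntries t b n = (List.range' 0 n).flatMap fun j =>
    withOrigin (Origin.companion t j) (Slice.lcusp (b + 2 * j) :: rowUp (b + 2 * j) j) := by
  rw [cuspEntries, List.range_eq_range']

theorem cuspEntries_row {t b n j r : ℕ} (hj : j < n) (hr : r < j) :
    (cuspEntries t b n)[(cuspWord b j).length + (r + 1)]? =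
      some (Slice.cross (b + 2 * j - 1 - r), Origin.companion t j) := by
  have h := getElem?_flatMap (g := fun j => withOrigin (Origin.companion t j)
    (Slice.lcusp (b + 2 * j) :: rowUp (b + 2 * j) j)) (a := 0) hj (r := r + 1)
    (by simp [withOrigin, rowUp]; omega)
  rw [cuspEntries_eq, length_cuspWord]
  have e : ∑ q ∈ Finset.range j, (withOrigin (Origin.companion t (0 + q))
      (Slice.lcusp (b + 2 * (0 + q)) :: rowUp (b + 2 * (0 + q)) (0 + q))).length =
      ∑ q ∈ Finset.range j, (q + 1) := Finset.sum_congr rfl fun q _ => by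
    simp [withOrigin, rowUp]
  rw [e] at h
  rw [h]
  simp [withOrigin, rowUp, List.getElem?_range hr]

theorem cuspEntries_cases {t b n q : ℕ} {x : Slice × Origin}
    (h : (cuspEntries t b n)[q]? = some x) :
    ∃ j < n, x.2 = Origin.companion t j ∧ (x.1 = Slice.lcusp (b + 2 * j) ∨
      ∃ r < j, q = (cuspWord b j).length + (r + 1) ∧ x.1 = Slice.cross (b + 2 * j - 1 - r)) := by
  rw [cuspEntries_eq] at h
  obtain ⟨j, hj, r, hr, ht, he⟩ := exists_of_lt_flatMap (List.getElem?_eq_some_iff.mp h).1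
  rw [he] at h
  simp only [Nat.zero_add] at h ht hr
  refine ⟨j, hj, ?_⟩
  cases r with
  | zero => simp [withOrigin] at h; subst h; exact ⟨rfl, Or.inl rfl⟩
  | succ r =>
    have hr' : r < j := by simpa [withOrigin, rowUp] using hr
    simp [withOrigin, rowUp, List.getElem?_range hr'] at h
    subst h
    refine ⟨rfl, Or.inr ⟨r, hr', ?_, rfl⟩⟩
    rw [ht, length_cuspWord]
    congr 1
    exact Finset.sum_congr rfl fun q _ => by simp [withOrigin, rowUp]

theorem copyEntries_origin {n t q : ℕ} {s : Slice} {x : Slice} {t' i : ℕ}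
    (h : (s.copyEntries n t)[q]? = some (x, Origin.companion t' i)) : t' = t := by
  have := List.mem_of_getElem? h
  simp only [Slice.copyEntries, List.mem_map, Prod.mk.injEq, Origin.companion.injEq] at this
  obtain ⟨a, -, -, h, -⟩ := this
  exact h.symm

theorem ConjAt.ne_self {k : ℕ} {f : ℕ → ℕ} (hf : Function.Injective f) (h1 : f k ≠ k)
    (h2 : f k ≠ k + 1) : ¬ ConjAt k f f := fun h => by
  have := h.left
  rw [Equiv.swap_apply_of_ne_of_ne h1 h2] at this
  exact absurd (hf this) (by omega)

namespace BasedKnot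

variable {K : BasedKnot} {L : Front}

/-- Without thin pairs the ruling follows the diagram at every crossing of the copy, and at a
crossing whose strands are not both fixed this changes the involution. -/
theorem cusp_not_switch {F : Front} {ρ : ℕ → ℕ → ℕ} (h : F.IsNormalRuling ρ) {T t b n q : ℕ}
    {x : Slice × Origin} (hseg : Seg (cuspWord b n) fun r => ρ (T + r))
    (hst : ∀ j ≤ n, CuspState b j id (fun _ => false) (ρ (T + (cuspWord b j).length)))
    (hx : (cuspEntries t b n)[q]? = some x) (hF : F.slice (T + q) = x.1) :
    ¬ F.IsSwitch ρ (T + q) := by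
  rintro ⟨k, hk, he, hnf⟩
  obtain ⟨j, hj, -, hc | ⟨r, hr, rfl, hc⟩⟩ := cuspEntries_cases hx
  · rw [hF, hc] at hk; cases hk
  · have hkk : k = b + 2 * j - 1 - r := by
      rw [hF, hc] at hk
      exact (Slice.cross.inj hk).symm
    have hconj := (cuspWord_switch_iff (fun _ => h.involutive _) hseg
      (π := id) (fun _ => rfl) hst hj hr).2 (by simp only [id]; omega)
    simp only [← add_assoc] at hconj he
    rw [he, ← hkk] at hconj
    simp only [← add_assoc] at hk hnf
    have hru := h.rules (T + (cuspWord b j).length + r + 1)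
    rw [hk] at hru
    by_cases hfix : ρ (T + (cuspWord b j).length + r + 1) k = k
    · have := hconj.left
      rw [hfix, Equiv.swap_apply_left] at this
      exact hnf ⟨hfix, this⟩
    · exact ConjAt.ne_self (h.involutive _).injective hfix hru.cross_cases.1 hconj

/-- A thin pair of copies causes a switch in the copy of every left cusp. There is such a cusp to
the left of the base point, since the base line meets a strand, so the absence of switches excludes
thin pairs. The converse is `cusp_not_switch`. -/
theorem patternRuling_id_iff (hK : K.rightward = true) (hL : L.IsAnnular) {ρ : ℕ → ℕ → ℕ}
    (h : (K.satellite L).IsNormalRuling ρ) :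
    (∀ t, K.FromLeftCusp L t → ¬ (K.satellite L).IsSwitch ρ t) ↔ K.patternRuling L ρ 0 = id := by
  obtain ⟨hseg, -, hseg'⟩ := seg_satellite hK h.toIsGenRuling
  obtain ⟨hc, hc'⟩ := thinAt_const hK hL h.toIsGenRuling
  constructor
  · intro hsw
    obtain ⟨s, hs, k, hk⟩ := K.front.exists_lcusp K.planar.left_eq
      (lt_of_le_of_lt (Nat.zero_le _) K.base_lt)
    have hseg := hseg s hs
    have hle : k ≤ K.front.width s := by
      have := K.planar.ok s (lt_of_lt_of_le hs K.base_le)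
      rwa [hk] at this
    have hth := hc (s + 1) hs k (by rw [Front.width_succ, hk]; simp only [Slice.out]; omega)
    rw [leftTime_succ, hk, ← List.length_map (f := Prod.fst), copy_lcusp] at hth
    rw [hk, copy_lcusp] at hseg
    have hπ : Pairing L.left (K.patternRuling L ρ 0) := by
      rw [patternRuling_zero]; exact windowAt_pairing (h.involutive _) _ _
    have hst := cuspState_of_thinAt (fun _ => h.involutive _) hseg hth
    -- Writing `π` for the thin pairing, if `π j < j` then the copies `j` and `π j` meet at the
    -- crossing number `j - 1 - π j` of the row of `j`, and there is a switch.
    have key : ∀ j, ¬ K.patternRuling L ρ 0 j < j := by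
      intro j hj
      have hjn : j < L.left := by
        by_contra hc
        rw [hπ.supp j (not_lt.mp hc)] at hj
        omega
      have hr : j - 1 - K.patternRuling L ρ 0 j < j := by omega
      have hsame := (cuspWord_switch_iff (fun _ => h.involutive _) hseg hπ.inv hst hjn hr).1
        (by omega)
      have hentry := cuspEntries_row (t := s) (b := L.left * k) hjn hr
      have hlt := (List.getElem?_eq_some_iff.mp hentry).1
      rw [← copyEntries_lcusp, ← hk] at hentry hlt
      rw [length_copyEntries] at hlt
      rw [← satelliteSlices_left hK hs hlt] at hentry
      refine hsw _ ⟨_, s, j, k, hentry, hk⟩ ⟨_, satellite_slice hentry, hsame, ?_⟩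
      -- A partial ruling is used here only because it records that the strands of a crossing lie
      -- within the width, so that `ρ` does not fix them.
      obtain ⟨Θ, -, -, -, H⟩ := exists_partialRuling hK hL (isGenRuling_patternRuling hK hL h)
      exact fun hf => (H.rules_ff h _ _ (satellite_slice hentry)).1 hf.1
    funext j
    show _ = j
    rcases lt_trichotomy (K.patternRuling L ρ 0 j) j with hlt | he | hlt
    · exact absurd hlt (key j)
    · exact he
    · exact absurd (by rw [hπ.inv]; exact hlt) (key (K.patternRuling L ρ 0 j))
  · rintro hid t ⟨x, s, i, k, hx, hk⟩
    have hsl := satellite_slice hx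
    have main : ∀ {s' r T : ℕ}, K.front.slice s' = Slice.lcusp k →
        ((K.front.slice s').copyEntries L.left s')[r]? = some (x, Origin.companion s i) →
        Seg (((K.front.slice s').copy L.left).map Prod.fst) (fun r => ρ (T + r)) →
        thinAt (ρ (T + ((K.front.slice s').copy L.left).length)) L.left k = id → t = T + r →
        ¬ (K.satellite L).IsSwitch ρ t := by
      rintro s' r T hs' he hseg hth rfl
      rw [hs', copyEntries_lcusp] at he
      rw [hs', ← List.length_map (f := Prod.fst), copy_lcusp] at hth
      rw [hs', copy_lcusp] at hseg
      exact cusp_not_switch h hseg (cuspState_of_thinAt (fun _ => h.involutive _) hseg hth) he hsl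
    have hwk : ∀ s < K.front.length, K.front.slice s = Slice.lcusp k → k < K.front.width (s + 1) := by
      intro s hs hk
      have := K.planar.ok s hs
      rw [hk] at this
      rw [Front.width_succ, hk]
      simp only [Slice.out, Slice.Ok] at this ⊢
      omega
    have hb := K.base_le
    rcases satelliteSlices_cases hK hx with ⟨s', hs, r, ht, he⟩ | ⟨r, hr, ht, he⟩ | ⟨s', hs, r, ht, he⟩
    · obtain rfl := copyEntries_origin he
      refine main hk he (hseg _ hs) ?_ ht
      rw [← leftTime_succ, hc _ hs k (hwk _ (by omega) hk), hid]
    · cases he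
    · obtain rfl := copyEntries_origin he
      refine main hk he (hseg' _ hs) ?_ ht
      rw [← rightTime_succ, hc' (s' + 1) (by omega) k
        (hwk _ (Nat.add_lt_of_lt_sub' hs) hk), hid]

end BasedKnot

/-! ### The front of the fixed strands of the pattern -/

namespace Slice

theorem shift_zero (s : Slice) : s.shift 0 = s := by cases s <;> simp [shift]

theorem fixedSlice_out (s : Slice) (f : ℕ → ℕ) (w : ℕ) : (s.fixedSlice f).out w = w := by
  cases s with
  | cross k => simp only [fixedSlice]; split_ifs <;> rfl
  | triv | lcusp k | rcusp k => rfl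

end Slice

theorem stack_zero {w : ℕ} {τ : ℕ → ℕ} (h : Pairing w τ) : stack 0 w id τ id = τ := by
  funext x
  rcases stack_cases 0 w x with hx | ⟨i, hi, rfl⟩ | ⟨y, rfl⟩
  · omega
  · rw [stack_mid hi, zero_add, zero_add]
  · rw [stack_add, h.supp _ (by omega)]
    rfl

namespace Slice

variable {s : Slice} {w : ℕ} {f g : ℕ → ℕ}

/-- The pattern on its own is the case of a stack with no strands above or below. -/
theorem Rules.partialRules (h : s.Rules f g) (hok : s.Ok w) (hf : Pairing w f)
    (hg : Pairing (s.out w) g) : s.PartialRules (s.rulingFlag f g) f g := by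
  have := h.partialRules_stack (m := 0) (α := id) (β := id) hok hf hg (fun x hx => hx)
  rwa [shift_zero, stack_zero hf, stack_zero hg] at this

theorem restriction_rulingFlag (hok : s.Ok w) (hf : Pairing w f) :
    (s.restriction (s.rulingFlag f g) f).getD triv = s.fixedSlice f := by
  have := restriction_stack (s := s) (m := 0) (α := id) (β := id) (τ := f) (τ' := g) hok
  rwa [shift_zero, stack_zero hf, fixCount, Nat.count_zero, shift_zero] at this

/-- A ruling pairs the branches of every cusp, so fixed strands neither begin nor end. -/
theorem Rules.fixCount_eq (h : s.Rules f g) (hok : s.Ok w) (hf : Pairing w f)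
    (hg : Pairing (s.out w) g) : fixCount g (s.out w) = fixCount f w := by
  rw [fixCount_out hf hok hg (h.partialRules hok hf hg), restriction_rulingFlag hok hf,
    fixedSlice_out]

end Slice

namespace Front

variable {L : Front} {τ : ℕ → ℕ → ℕ}

theorem fixedPart_width (L : Front) (τ : ℕ → ℕ → ℕ) (t : ℕ) :
    (L.fixedPart τ).width t = fixCount (τ 0) L.left := by
  induction t with
  | zero => rfl
  | succ t ih => rw [width_succ, fixedPart_slice, Slice.fixedSlice_out, ih]

theorem fixCount_width (hL : L.IsAnnular) (hτ : L.IsGenRuling τ) {t : ℕ} (ht : t ≤ L.length) :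
    fixCount (τ t) (L.width t) = fixCount (τ 0) L.left := by
  induction t with
  | zero => rfl
  | succ t ih =>
    rw [← ih (by omega), width_succ]
    refine (hτ.rules t).fixCount_eq (hL.ok t ht) (hτ.pairing t) ?_
    rw [← width_succ]
    exact hτ.pairing (t + 1)

theorem fixedPart_isAnnular (hL : L.IsAnnular) (hτ : L.IsGenRuling τ) :
    (L.fixedPart τ).IsAnnular where
  ok t ht := by
    rw [fixedPart_length] at ht
    rw [fixedPart_slice, fixedPart_width, ← fixCount_width hL hτ ht.le]
    have hok := hL.ok t ht
    cases hs : L.slice t with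
    | triv | lcusp k | rcusp k => trivial
    | cross k =>
      rw [hs] at hok
      simp only [Slice.fixedSlice, Slice.Ok] at hok ⊢
      split_ifs with h
      · show fixCount (τ t) k + 1 < _
        have := fixCount_mono (τ t) (show k + 1 + 1 ≤ L.width t by omega)
        rw [fixCount_succ, fixCount_succ, if_pos h.1, if_pos h.2] at this
        omega
      · trivial
  closed := by rw [fixedPart_width]; rfl

theorem fixedPart_isEmpty_iff : (L.fixedPart τ).IsEmpty ↔ (L.fixedPart τ).left = 0 :=
  ⟨fun h => h 0 (Nat.zero_le _), fun h t _ => by rw [fixedPart_width]; exact h⟩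

end Front

/-- Inside the window `r` has the pairs of `τ` and those pairs of fixed strands that lie in the
window. The fixed strands of the window are numbered consecutively, starting with the number of
fixed strands above it. -/
theorem Lift.windowAt_eq_iff {m w W : ℕ} {α τ β h r : ℕ → ℕ} (hτ : Pairing w τ)
    (hf : Pairing W (stack m w α τ β))
    (hl : Lift (stack m w α τ β) h r) :
    windowAt r m w = τ ↔ windowAt h (fixCount α m) (fixCount τ w) = id := by
  have hc : ∀ k ≤ w, fixCount (stack m w α τ β) (m + k) = fixCount α m + fixCount τ k :=
    fun k hk => fixCount_stack hk
  have hm : ∀ x, fixNth (stack m w α τ β) x < m ↔ x < fixCount α m := fun x => by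
    have := hc 0 (Nat.zero_le _)
    rw [Slice.fixNth_lt_iff hf, ← add_zero (fixCount _ m)]
    simp only [add_zero] at this ⊢
    rw [this]
    simp [fixCount]
  have hw : ∀ x, fixNth (stack m w α τ β) x < m + w ↔ x < fixCount α m + fixCount τ w :=
    fun x => by rw [Slice.fixNth_lt_iff hf, hc w le_rfl]
  have hnth : ∀ k < w, τ k = k →
      fixNth (stack m w α τ β) (fixCount α m + fixCount τ k) = m + k := fun k hk hk' => by
    rw [← hc k hk.le, fixNth_fixCount]
    rw [stack_mid hk, hk']
  constructor
  -- A pair of fixed strands inside the window would be a pair of `τ`, which fixes both of them.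
  · intro he
    funext i
    rcases windowAt_cases h (fixCount α m) (fixCount τ w) i with ⟨hi, hj, hij⟩ | ⟨h1, -⟩
    swap
    · exact h1
    set j := windowAt h (fixCount α m) (fixCount τ w) i
    have hx : fixNth τ i < w := (fixNth_lt_width hτ).2 hi
    have hy : fixNth τ j < w := (fixNth_lt_width hτ).2 hj
    have hfx := hl.fixed (fixCount α m + i)
    rw [hij] at hfx
    have ex := hnth _ hx (hτ.fixNth_fixed i)
    have ey := hnth _ hy (hτ.fixNth_fixed j)
    rw [hτ.fixCount_fixNth] at ex ey
    rw [ex, ey] at hfx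
    by_contra hne
    have hne : i ≠ j := fun e => hne e.symm
    have := (_root_.windowAt_eq_iff hx hy fun e => hne (hτ.fixNth_inj.mp e)).2 hfx
    rw [he, hτ.fixNth_fixed] at this
    exact hne (hτ.fixNth_inj.mp this)
  · intro he
    funext i
    rcases windowAt_cases r m w i with ⟨hi, hj, hij⟩ | ⟨h1, h2⟩
    · set j := windowAt r m w i
      by_cases hfi : τ i = i
      · rw [hfi]
        have e := hl.fixed (fixCount α m + fixCount τ i)
        rw [hnth i hi hfi, hij] at e
        have hlo := hm (h (fixCount α m + fixCount τ i))
        have hhi := hw (h (fixCount α m + fixCount τ i))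
        rw [← e] at hlo hhi
        have hlt : fixCount τ i < fixCount τ w := by
          have := fixCount_mono τ (show i + 1 ≤ w from hi)
          rw [fixCount_succ, if_pos hfi] at this
          omega
        rcases windowAt_cases h (fixCount α m) (fixCount τ w) (fixCount τ i) with
          ⟨-, -, h4⟩ | ⟨-, h4 | h4 | h4⟩
        · rw [he, id] at h4
          rw [h4, hnth i hi hfi] at e
          omega
        · omega
        · omega
        · omega
      · have := hl.moved (m + i) (by rw [stack_mid hi]; omega)
        rw [stack_mid hi, hij] at this
        omega
    · rcases h2 with h2 | h2
      · rw [h1, hτ.supp i h2]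
      · rcases lt_or_ge i w with hi | hi
        · by_contra hne
          have := hl.moved (m + i) (by rw [stack_mid hi]; omega)
          rw [stack_mid hi] at this
          have := hτ.lt_of_lt hi
          omega
        · rw [h1, hτ.supp i hi]

/-- A strand fixed by `τ` has its companion outside the window. Normality of `τ` keeps the interval
of the other strand on one side of it, so the interval that joins the fixed strand to its companion
either contains that interval or is disjoint from it. -/
theorem normality_of_window {m w k : ℕ} {τ r : ℕ → ℕ} (hτ : Pairing w τ)
    (hr : windowAt r m w = τ) (hk : k + 1 < w) (hn : Slice.Normality k τ)
    (h1 : r (m + k) ≠ m + k) (h2 : r (m + k + 1) ≠ m + k + 1)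
    (hf : ¬ (τ k = k ∧ τ (k + 1) = k + 1)) : Slice.Normality (m + k) r := by
  have hw1 := windowAt_cases r m w k
  have hw2 := windowAt_cases r m w (k + 1)
  rw [hr] at hw1 hw2
  rw [Slice.normality_iff] at hn ⊢
  have e1 := hτ.lt_of_lt (show k < w by omega)
  have e2 := hτ.lt_of_lt hk
  rw [← add_assoc] at hw2
  omega

/-! ### Joining a ruling of the pattern with a reduced ruling -/

namespace BasedKnot

variable {K : BasedKnot} {L : Front}

theorem leftTime_le_length (K : BasedKnot) (L : Front) (τ : ℕ → ℕ → ℕ) {t : ℕ}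
    (hK : K.rightward = true) (ht : t ≤ L.length) :
    K.leftTime L.left K.baseTime + t ≤ (K.flaggedSatellite L τ).length := by
  have h1 : (K.flaggedSatellite L τ).length = (K.satellite L).length := by
    rw [← List.length_map (f := Prod.fst), flaggedSatellite_fst hK, Front.length, satellite,
      List.length_map]
  rw [h1, length_satellite hK, rightTime]
  omega

/-- Slices of the pattern are kept even when they become trivial, so the lines of `L` and `L^τ`
correspond one to one. -/
theorem keptTime_pattern (hK : K.rightward = true) {τ Θ : ℕ → ℕ → ℕ}
    (hτ : L.IsGenRuling τ) (h0 : Θ 0 = id) (h : Steps (K.flaggedSatellite L τ) Θ) {t : ℕ}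
    (ht : t ≤ L.length) : K.keptTime L τ Θ (K.leftTime L.left K.baseTime + t) =
      K.leftTime (L.fixedPart τ).left K.baseTime + t := by
  rw [keptTime, min_eq_left (leftTime_le_length K L τ hK ht)]
  have hrun := run_copies (F := K.front) K.planar.ok (n := L.left) (hτ.pairing 0) (a := 0)
    (T := K.baseTime) (by rw [zero_add]; exact K.base_le)
  have hlen : ((List.range' 0 K.baseTime).flatMap fun t =>
      (K.front.slice t).flaggedCopy L.left (τ 0) t).length = K.leftTime L.left K.baseTime := by
    rw [length_flatMap_range', leftTime]
    exact Finset.sum_congr rfl fun q _ => by rw [copy_length_flagged, zero_add]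
  rw [flaggedSatellite, List.append_assoc] at h ⊢
  have hs := steps_append h
  have hzero : Θ 0 = blocks L.left (τ 0) (K.front.width 0) := by
    rw [h0, Front.width_zero, K.planar.left_eq, blocks_zero]
  have hkeep := (hrun.keepAt_eq hs.1 hzero).1
  rw [length_left] at hkeep
  rw [← hlen, keepTime_append, hkeep, keepTime_append_left]
  · congr 1
    have hone : ∀ s ∈ Finset.range t, (keepAt (fixCount (τ 0))
        (L.flaggedPattern (L.left * K.baseStrand) τ L.length)
        (fun t => Θ (((List.range' 0 K.baseTime).flatMap fun t =>
          (K.front.slice t).flaggedCopy L.left (τ 0) t).length + t)) s).length = 1 := by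
      intro s hs
      have hs' : s < (L.flaggedPattern (L.left * K.baseStrand) τ L.length).length := by
        simp only [Front.flaggedPattern, List.length_map, List.length_range]
        exact lt_of_lt_of_le (Finset.mem_range.mp hs) ht
      rw [keepAt_of_lt hs']
      simp [Front.flaggedPattern, keep]
    rw [keepTime, Finset.sum_congr rfl hone]
    simp
  · simp only [Front.flaggedPattern, List.length_map, List.length_range]
    exact ht

end BasedKnot

/-- A flagged crossing is one of strands of the copies `j` and `π j`, which are both moved. Hence
the side condition on switches with a fixed strand does not arise in the copies of cusps. -/
theorem flaggedCusp_ne {π : ℕ → ℕ} (hπ : Function.Involutive π) {t b n w : ℕ} {Θ : ℕ → ℕ → ℕ}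
    (h : Steps (flaggedCusp π t b n) Θ) (h0 : Pairing w (Θ 0)) (hb : b ≤ w) :
    ∀ q (hq : q < (flaggedCusp π t b n).length), ∀ k, (flaggedCusp π t b n)[q].1.1 = Slice.cross k →
      (flaggedCusp π t b n)[q].2 = true → Θ q k ≠ k ∧ Θ q (k + 1) ≠ k + 1 := by
  induction n with
  | zero => intro q hq; simp [flaggedCusp] at hq
  | succ n ih =>
    intro q hq k
    simp only [flaggedCusp_succ] at h hq ⊢
    obtain ⟨h1, h2⟩ := steps_append h
    rcases lt_or_ge q (flaggedCusp π t b n).length with hlt | hge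
    · rw [List.getElem_append_left hlt]
      exact ih h1 q hlt k
    · obtain ⟨g, hrun, hst, -⟩ := run_flaggedCusp hπ (t := t) (n := n) h0 hb
      have hg := hrun.last_eq h1 rfl
      obtain ⟨u, rfl⟩ := Nat.exists_eq_add_of_le hge
      rw [List.getElem_append_right hge]
      simp only [Nat.add_sub_cancel_left]
      obtain ⟨h3, h4⟩ := h2.cons
      cases u with
      | zero => intro hk; simp at hk
      | succ r =>
        simp only [List.length_append, List.length_cons, flaggedRow, List.length_map,
          List.length_range, Nat.add_lt_add_iff_left, Nat.add_lt_add_iff_right] at hq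
        simp only [List.getElem_cons_succ, flaggedRow, List.getElem_map, List.getElem_range,
          decide_eq_true_eq]
        intro hk hr
        have hk := Slice.cross.inj hk
        have hlt : π n < n := by
          by_contra hc
          rw [if_neg hc] at hr
          omega
        rw [if_pos hlt] at hr
        have h3 : Θ ((flaggedCusp π t b n).length + 1) = _ := h3
        have hne : decide (π n ≠ n) = true := by simp; omega
        rw [add_zero, hg] at h3
        simp only [hne] at h3
        -- Before the flagged crossing the row has no switch, which the value `n` for the position
        -- of the switch expresses.
        have htrack := rowUp_track (f := fun t' => Θ ((flaggedCusp π t b n).length + (t' + 1)))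
          (p := b + 2 * n) (r := n) (m := r) (by omega) (by
            intro t' ht' _
            have := h4 t' (by simp [flaggedRow]; omega)
            simp only [flaggedRow, List.getElem_map, List.getElem_range] at this
            rw [if_pos hlt, decide_eq_false (by omega)] at this
            rcases this.2 with h | h
            · exact h.2
            · exact absurd h.1 (by simp)) (by omega) r le_rfl
        simp only [if_neg (show ¬ n < r by omega), zero_add, h3] at htrack
        constructor
        · have hx := htrack k
          have hup : upPos (b + 2 * n) r k = k := by
            unfold upPos; split_ifs <;> omega
          rw [hup] at hx
          rw [hx]
          intro he
          have he := upPos_injective _ _ (he.trans hup.symm)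
          have hsk : k = Slice.skip (b + 2 * n) k := by
            unfold Slice.skip; split_ifs <;> omega
          rw [hsk, Slice.insertPair_fixed_skip] at he
          have hs := (hst (π n) hlt).2
          simp only [hπ n] at hs
          rw [if_neg (by simp only [decide_eq_true_eq]; omega), if_neg (by omega),
            show b + n + π n = k by omega] at hs
          omega
        · have hx := htrack (b + 2 * n)
          have hup : upPos (b + 2 * n) r (b + 2 * n) = k + 1 := by
            unfold upPos; split_ifs <;> omega
          rw [hup, Slice.insertPair_self] at hx
          rw [hx, if_pos rfl]
          have : upPos (b + 2 * n) r (b + 2 * n + 1) = b + 2 * n + 1 := by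
            unfold upPos; split_ifs <;> omega
          omega

theorem flaggedCopy_ne {n : ℕ} {π : ℕ → ℕ} (hπ : Pairing n π) {t w : ℕ} {s : Slice} (hok : s.Ok w)
    {Θ : ℕ → ℕ → ℕ} (hi : ∀ t, Function.Involutive (Θ t)) (h : Steps (s.flaggedCopy n π t) Θ)
    (h0 : Θ 0 = blocks n π w) (q : ℕ) (hq : q < (s.flaggedCopy n π t).length) (k : ℕ)
    (hk : (s.flaggedCopy n π t)[q].1.1 = Slice.cross k) (hd : (s.flaggedCopy n π t)[q].2 = true) :
    Θ q k ≠ k ∧ Θ q (k + 1) ≠ k + 1 := by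
  have h1 := (run_copy hπ t hok).last_eq h h0
  cases s with
  | triv => simp [Slice.flaggedCopy] at hq
  | cross k => simp [Slice.flaggedCopy, unflagged] at hd
  | lcusp k' =>
    exact flaggedCusp_ne hπ.inv h (by rw [h0]; exact blocks_pairing hπ w)
      (Nat.mul_le_mul_left n hok) q hq k hk hd
  | rcusp k' =>
    have hr := Steps.reverse hi h
    have hlen : (Slice.flaggedCopy n π t (Slice.rcusp k')).length =
      (flaggedCusp π t (n * k') n).length := by simp [Slice.flaggedCopy]
    simp only [hlen] at hr hq h1
    simp only [Slice.flaggedCopy, mirror_reverse_entries] at hr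
    have hk' : k' ≤ Slice.out (Slice.rcusp k') w := by
      simp only [Slice.out, Slice.Ok] at hok ⊢
      omega
    have hp := h q (by rw [hlen]; exact hq)
    rw [hk, hd] at hp
    -- The reflected row sees this crossing from its other end, which makes no difference at a
    -- switch.
    have hsame : Θ (q + 1) = Θ q := by
      rcases hp.2 with hp | hp
      · exact absurd hp.1 (by simp)
      · exact hp.2.1
    simp only [Slice.flaggedCopy, List.getElem_map, List.getElem_reverse, Entry.mirror] at hk hd
    have := flaggedCusp_ne hπ.inv hr
      (by simp only [Nat.sub_zero, h1]; exact blocks_pairing hπ _) (Nat.mul_le_mul_left n hk')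
      ((flaggedCusp π t (n * k') n).length - 1 - q) (by omega) k
      ((Slice.mirror_mirror _).symm.trans (congrArg Slice.mirror hk)) hd
    rw [show (flaggedCusp π t (n * k') n).length - ((flaggedCusp π t (n * k') n).length - 1 - q) =
      q + 1 by omega, hsame] at this
    exact this

namespace BasedKnot

variable {K : BasedKnot} {L : Front} {τ Θ ρ σ : ℕ → ℕ → ℕ}

/-- If `L^τ` is empty, there are no copies to be paired and both sides hold. -/
theorem isReduced_iff (hK : K.rightward = true) (hL : L.IsAnnular) (hτ : L.IsGenRuling τ)
    (hσ : (K.satellite (L.fixedPart τ)).IsNormalRuling σ) :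
    K.IsReduced (L.fixedPart τ) σ ↔ K.patternRuling (L.fixedPart τ) σ 0 = id := by
  have hM := Front.fixedPart_isAnnular hL hτ
  rw [IsReduced, Front.fixedPart_isEmpty_iff, patternRuling_id_iff hK hM hσ]
  constructor
  · rintro (h | h)
    · refine Front.pairing_zero ?_
      rw [patternRuling_zero, ← h]
      exact windowAt_pairing (hσ.involutive _) _ _
    · exact h.2
  · intro h
    rcases Nat.eq_zero_or_pos (L.fixedPart τ).left with h0 | h0
    · exact Or.inl h0
    · exact Or.inr ⟨h0, h⟩

/-- The front `L^τ` has no cusps, and crossings create no pairs. -/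
theorem patternRuling_id (hK : K.rightward = true) (hL : L.IsAnnular) (hτ : L.IsGenRuling τ)
    (hσ : (K.satellite (L.fixedPart τ)).IsNormalRuling σ)
    (h0 : K.patternRuling (L.fixedPart τ) σ 0 = id) (t : ℕ) :
    K.patternRuling (L.fixedPart τ) σ t = id := by
  induction t with
  | zero => exact h0
  | succ t ih =>
    have h := (isGenRuling_patternRuling hK (Front.fixedPart_isAnnular hL hτ) hσ).rules t
    rw [Front.fixedPart_slice, ih] at h
    cases hs : L.slice t with
    | triv | lcusp k | rcusp k => rw [hs] at h; exact h
    | cross k =>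
      rw [hs, Slice.fixedSlice] at h
      split_ifs at h
      · rcases h.cross_cases.2 with h | h
        · funext i
          obtain ⟨j, rfl⟩ := (Equiv.swap (fixCount (τ t) k) (fixCount (τ t) k + 1)).surjective i
          exact h j
        · exact h.1
      · exact h

theorem windowAt_satellite (hL : L.IsAnnular) (hτ : L.IsGenRuling τ)
    (h0 : Θ 0 = id) (hs : Steps (K.flaggedSatellite L τ) Θ)
    (hp : ∀ t, Pairing ((K.satellite L).width t) (Θ t)) {h r : ℕ → ℕ} {t : ℕ} (ht : t ≤ L.length)
    (hl : Lift (Θ (K.leftTime L.left K.baseTime + t)) h r) :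
    windowAt r (L.left * K.baseStrand) (L.width t) = τ t ↔
      windowAt h ((L.fixedPart τ).left * K.baseStrand) (L.fixedPart τ).left = id := by
  have hst := (satellite_states hL hτ hs h0).2.1 t ht
  have hpt := hp (K.leftTime L.left K.baseTime + t)
  rw [hst] at hl hpt
  rw [hl.windowAt_eq_iff (hτ.pairing t) hpt, fixCount_blocks _ le_rfl,
    Front.fixCount_width hL hτ ht, Front.fixedPart_left]

/-- Recovers `τ` from the join. Together with `isReduced_iff` it gives injectivity, and it shows
that what is left of a ruling without its thin pairs is reduced. -/
theorem patternRuling_eq_iff (hK : K.rightward = true) (hL : L.IsAnnular) (hτ : L.IsGenRuling τ)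
    (h0 : Θ 0 = id) (hs : Steps (K.flaggedSatellite L τ) Θ)
    (hp : ∀ t, Pairing ((K.satellite L).width t) (Θ t))
    (hσ : (K.satellite (L.fixedPart τ)).IsNormalRuling σ)
    (hl : ∀ t, Lift (Θ t) (σ (K.keptTime L τ Θ t)) (ρ t)) :
    K.patternRuling L ρ = τ ↔ K.patternRuling (L.fixedPart τ) σ 0 = id := by
  have hw : ∀ t ≤ L.length, windowAt (ρ (K.leftTime L.left K.baseTime + t))
      (L.left * K.baseStrand) (L.width t) = τ t ↔ K.patternRuling (L.fixedPart τ) σ t = id := by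
    intro t ht
    have h := hl (K.leftTime L.left K.baseTime + t)
    rw [keptTime_pattern hK hτ h0 hs ht] at h
    rw [windowAt_satellite hL hτ h0 hs hp ht h, patternRuling, Front.fixedPart_length,
      min_eq_left ht, Front.fixedPart_width, Front.fixedPart_left]
  constructor
  · intro h
    refine (hw 0 (Nat.zero_le _)).1 ?_
    rw [← h]
    rfl
  · intro h
    funext t
    rw [patternRuling, (hw _ (min_le_right _ _)).2 (patternRuling_id hK hL hτ hσ h _)]
    rcases le_total t L.length with ht | ht
    · rw [min_eq_left ht]
    · rw [min_eq_right ht, hτ.of_le ht]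

theorem getElem_flaggedSatellite (hK : K.rightward = true) {t : ℕ}
    (ht : t < (K.flaggedSatellite L τ).length) :
    (K.satellite L).slice t = (K.flaggedSatellite L τ)[t].1.1 := by
  refine satellite_slice (x := (K.flaggedSatellite L τ)[t].1) ?_
  rw [← flaggedSatellite_fst hK L τ, List.getElem?_map, List.getElem?_eq_getElem ht]
  rfl

theorem flaggedSatellite_cases {t : ℕ} (ht : t < (K.flaggedSatellite L τ).length) :
    (∃ s < K.baseTime, ∃ r, t = K.leftTime L.left s + r ∧ (K.flaggedSatellite L τ)[t]? =
      ((K.front.slice s).flaggedCopy L.left (τ 0) s)[r]?) ∨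
    (∃ r < L.length, t = K.leftTime L.left K.baseTime + r ∧ (K.flaggedSatellite L τ)[t]? =
      some (((L.slice r).shift (L.left * K.baseStrand), Origin.pattern r),
        (L.slice r).rulingFlag (τ r) (τ (r + 1)))) ∨
    (∃ s < K.front.length - K.baseTime, ∃ r, t = K.rightTime L s + r ∧
      (K.flaggedSatellite L τ)[t]? =
        ((K.front.slice (K.baseTime + s)).flaggedCopy L.left (τ 0) (K.baseTime + s))[r]?) := by
  have hlen : ((List.range' 0 K.baseTime).flatMap fun t =>
      (K.front.slice t).flaggedCopy L.left (τ 0) t).length = K.leftTime L.left K.baseTime := by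
    rw [length_flatMap_range', leftTime]
    exact Finset.sum_congr rfl fun q _ => by rw [copy_length_flagged, zero_add]
  have hlen' : (L.flaggedPattern (L.left * K.baseStrand) τ L.length).length = L.length := by
    simp [Front.flaggedPattern]
  have hget := List.getElem?_eq_getElem ht
  rw [flaggedSatellite, List.append_assoc] at ht ⊢
  rcases lt_or_ge t (K.leftTime L.left K.baseTime) with h1 | h1
  · left
    rw [← hlen] at h1
    rw [List.getElem?_append_left h1]
    obtain ⟨s, hs, r, hr, ht, he⟩ := exists_of_lt_flatMap h1
    simp only [Nat.zero_add, copy_length_flagged] at ht he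
    exact ⟨s, hs, r, ht, he⟩
  · rw [List.getElem?_append_right (by rw [hlen]; exact h1), hlen]
    rw [List.length_append, hlen] at ht
    obtain ⟨u, rfl⟩ := Nat.exists_eq_add_of_le h1
    rw [Nat.add_sub_cancel_left]
    right
    rcases lt_or_ge u L.length with h2 | h2
    · left
      rw [List.getElem?_append_left (by rw [hlen']; exact h2)]
      refine ⟨u, h2, rfl, ?_⟩
      simp [Front.flaggedPattern, List.getElem?_range h2]
    · right
      rw [List.getElem?_append_right (by rw [hlen']; exact h2), hlen']
      rw [List.length_append, hlen'] at ht
      obtain ⟨s, hs, r, hr, ht, he⟩ := exists_of_lt_flatMap (t := u - L.length)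
        (g := fun t => (K.front.slice t).flaggedCopy L.left (τ 0) t) (a := K.baseTime)
        (T := K.front.length - K.baseTime) (by omega)
      simp only [copy_length_flagged] at ht
      refine ⟨s, hs, r, ?_, he⟩
      have : K.rightTime L s = K.leftTime L.left K.baseTime + L.length +
        ∑ q ∈ Finset.range s, ((K.front.slice (K.baseTime + q)).copy L.left).length := rfl
      omega

/-- Only flagged switches with a fixed strand have to be checked. The copies of the companion
contain none, and in the pattern the companion of the fixed strand is outside the window because `σ`
has no thin pairs. -/
theorem isNormalRuling_join (hK : K.rightward = true) (hL : L.IsAnnular) (hτ : L.IsGenRuling τ)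
    (h0 : Θ 0 = id) (hs : Steps (K.flaggedSatellite L τ) Θ)
    (H : (K.satellite L).PartialRuling (K.satellite (L.fixedPart τ)) Θ
        (flagAt (K.flaggedSatellite L τ)) (K.keptTime L τ Θ))
    (hσ : (K.satellite (L.fixedPart τ)).IsNormalRuling σ)
    (hred : K.patternRuling (L.fixedPart τ) σ 0 = id) :
    (K.satellite L).IsNormalRuling fun t => join (Θ t) (σ (K.keptTime L τ Θ t)) := by
  refine H.isNormalRuling_join hσ fun t k hk hd hfix => ?_
  have ht : t < (K.flaggedSatellite L τ).length := by
    by_contra hc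
    rw [flagAt, List.getElem?_eq_none (not_lt.mp hc)] at hd
    cases hd
  have hget := List.getElem?_eq_getElem ht
  have hsl := getElem_flaggedSatellite hK (τ := τ) ht
  rw [flagAt_of_lt ht] at hd
  rw [hk] at hsl
  obtain ⟨st1, st2, st3⟩ := satellite_states hL hτ hs h0
  obtain ⟨sp1, -, sp3⟩ := steps_satellite hs
  have copy_case : ∀ {s r T : ℕ}, s < K.front.length → t = T + r →
      (K.flaggedSatellite L τ)[t]? = ((K.front.slice s).flaggedCopy L.left (τ 0) s)[r]? →
      Steps ((K.front.slice s).flaggedCopy L.left (τ 0) s) (fun r => Θ (T + r)) →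
      Θ T = blocks L.left (τ 0) (K.front.width s) → False := by
    rintro s r T hs' rfl he hst hT
    rw [hget] at he
    obtain ⟨hr, he⟩ := List.getElem?_eq_some_iff.mp he.symm
    rw [← he] at hd hsl
    have := flaggedCopy_ne (hτ.pairing 0) (K.planar.ok s hs') (fun _ => (H.pairing _).inv) hst hT r hr
      k hsl.symm hd
    omega
  have hb := K.base_le
  rcases flaggedSatellite_cases ht with ⟨s, hs', r, hr, he⟩ | ⟨r, hr, rfl, he⟩ | ⟨s, hs', r, hr, he⟩
  · exact (copy_case (by omega) hr he (sp1 s hs') (st1 s hs'.le)).elim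
  · rw [hget, Option.some.injEq] at he
    rw [he] at hd hsl
    have hsh : ∃ k', L.slice r = Slice.cross k' ∧ k = L.left * K.baseStrand + k' := by
      cases hx : L.slice r <;> rw [hx] at hsl <;> cases hsl
      exact ⟨_, rfl, rfl⟩
    obtain ⟨k', hk', rfl⟩ := hsh
    have hok := hL.ok r hr
    rw [hk'] at hok hd
    simp only [Slice.rulingFlag, decide_eq_true_eq] at hd
    have hru := hτ.rules r
    rw [hk', hd.1] at hru
    have hlift := lift_join (H.pairing (K.leftTime L.left K.baseTime + r))
      (σ (K.keptTime L τ Θ (K.leftTime L.left K.baseTime + r)))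
    have hff := ((hlift.fixedPointFree_iff (H.pairing _)).2 (by
      rw [← H.width_eq]; exact hσ.fixedPointFree _))
    have hwp := width_pattern hK hL hr.le
    have hok' : k' + 1 < L.width r := hok
    refine normality_of_window (hτ.pairing r) ?_ hok
      (hru.normality_of_eq (hτ.involutive r).injective hd.2) (hff _ (by omega)) (hff _ (by omega))
      hd.2
    refine (windowAt_satellite hL hτ h0 hs H.pairing hr.le hlift).2 ?_
    rw [keptTime_pattern hK hτ h0 hs hr.le]
    have := patternRuling_id hK hL hτ hσ hred r
    rwa [patternRuling, Front.fixedPart_length, min_eq_left hr.le, Front.fixedPart_width] at this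
  · refine (copy_case (Nat.add_lt_of_lt_sub' hs') hr he (sp3 s hs') (st3 s ?_)).elim
    omega

end BasedKnot

/-! ### Counting switches and right cusps -/

/-- The contribution of the removed switches and right cusps to `j`. -/
def flagSum (l : List Entry) : ℤ := (l.map fun e => e.1.1.partialJTerm e.2).sum

theorem flagSum_append (l l' : List Entry) : flagSum (l ++ l') = flagSum l + flagSum l' := by
  simp [flagSum]

theorem flagSum_flatMap (g : ℕ → List Entry) (a T : ℕ) :
    flagSum ((List.range' a T).flatMap g) = ∑ q ∈ Finset.range T, flagSum (g (a + q)) := by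
  induction T with
  | zero => rfl
  | succ T ih =>
    rw [List.range'_concat, List.flatMap_append, flagSum_append, ih, Finset.sum_range_succ]
    simp

theorem flagSum_eq_sum (l : List Entry) : flagSum l = ∑ t ∈ Finset.range l.length,
    (l[t]?).elim 0 fun e => e.1.1.partialJTerm e.2 := by
  induction l with
  | nil => rfl
  | cons e l ih =>
    rw [List.length_cons, Finset.sum_range_succ']
    simp only [List.getElem?_cons_succ, ← ih, List.getElem?_cons_zero, Option.elim_some]
    simp [flagSum, add_comm]

theorem flagSum_flaggedRow (o : Origin) (p m r : ℕ) :
    flagSum (flaggedRow o p m r) = if r < m then 1 else 0 := by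
  induction m with
  | zero => rfl
  | succ m ih =>
    rw [flaggedRow_succ, flagSum_append, ih]
    simp only [flagSum, List.map_cons, List.map_nil, List.sum_singleton, Slice.partialJTerm,
      decide_eq_true_eq]
    split_ifs <;> omega

theorem flagSum_mirror_flaggedRow (o : Origin) (p m r : ℕ) :
    flagSum ((flaggedRow o p m r).map Entry.mirror) = flagSum (flaggedRow o p m r) := by
  simp [flagSum, flaggedRow, Entry.mirror, Slice.mirror, Function.comp_def]

theorem flagSum_flaggedCusp (π : ℕ → ℕ) (t b n : ℕ) : flagSum (flaggedCusp π t b n) =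
    ∑ j ∈ Finset.range n, if π j < j then 1 else 0 := by
  induction n with
  | zero => rfl
  | succ n ih =>
    have : ∀ (e : Entry) (l : List Entry), e :: l = [e] ++ l := fun _ _ => rfl
    rw [flaggedCusp_succ, this, flagSum_append, flagSum_append, ih, flagSum_flaggedRow,
      Finset.sum_range_succ]
    simp only [flagSum, List.map_cons, List.map_nil, List.sum_singleton, Slice.partialJTerm,
      zero_add]
    congr 1
    split_ifs <;> omega

/-- A pair of copies closes at two right cusps and makes one switch, hence contributes `-1`; this is
booked on the smaller of the two indices. -/
theorem flagSum_mirror_flaggedCusp (π : ℕ → ℕ) (t b n : ℕ) :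
    flagSum ((flaggedCusp π t b n).reverse.map Entry.mirror) =
      - ∑ j ∈ Finset.range n, if j < π j then 1 else 0 := by
  have hrev : ∀ l : List Entry, flagSum (l.reverse.map Entry.mirror) =
      flagSum (l.map Entry.mirror) := fun l => by
    simp [flagSum, List.map_reverse, List.sum_reverse]
  rw [hrev]
  induction n with
  | zero => rfl
  | succ n ih =>
    have : ∀ (e : Entry) (l : List Entry), e :: l = [e] ++ l := fun _ _ => rfl
    rw [flaggedCusp_succ, this, List.map_append, List.map_append, flagSum_append, flagSum_append,
      ih, flagSum_mirror_flaggedRow, flagSum_flaggedRow, Finset.sum_range_succ]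
    simp only [flagSum, List.map_cons, List.map_nil, List.sum_singleton, Slice.partialJTerm,
      Entry.mirror, Slice.mirror, decide_eq_true_eq, neg_add]
    congr 1
    split_ifs <;> omega

theorem sum_pair {n : ℕ} {π : ℕ → ℕ} (hπ : Pairing n π) :
    (∑ j ∈ Finset.range n, if j < π j then (1 : ℤ) else 0) =
      ∑ j ∈ Finset.range n, if π j < j then 1 else 0 := by
  refine Finset.sum_nbij' π π ?_ ?_ (fun j _ => hπ.inv j) (fun j _ => hπ.inv j) fun j _ => ?_
  · exact fun j hj => Finset.mem_range.2 (hπ.lt_of_lt (Finset.mem_range.1 hj))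
  · exact fun j hj => Finset.mem_range.2 (hπ.lt_of_lt (Finset.mem_range.1 hj))
  · rw [hπ.inv]

/-- Each pair of copies contributes `1` at a left cusp and `-1` at a right cusp, which is half the
change of the width. -/
theorem flagSum_copy {n : ℕ} {π : ℕ → ℕ} (hπ : Pairing n π) {t w : ℕ} {s : Slice} (hok : s.Ok w) :
    2 * flagSum (s.flaggedCopy n π t) =
      (∑ j ∈ Finset.range n, if π j < j then 1 else 0) * ((s.out w : ℤ) - w) := by
  cases s with
  | triv => simp [Slice.flaggedCopy, flagSum, Slice.out]
  | cross k =>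
    have : ∀ v : List (Slice × Origin), flagSum (v.map unflagged) = 0 := fun v => by
      induction v with
      | nil => rfl
      | cons x v ih =>
        rw [List.map_cons, flagSum, List.map_cons, List.sum_cons]
        rw [flagSum] at ih
        rw [ih]
        cases hx : x.1 <;> simp [unflagged, hx, Slice.partialJTerm]
    simp [Slice.flaggedCopy, this, Slice.out]
  | lcusp k =>
    simp only [Slice.flaggedCopy, flagSum_flaggedCusp, Slice.out]
    push_cast
    ring
  | rcusp k =>
    simp only [Slice.flaggedCopy, flagSum_mirror_flaggedCusp, Slice.out, sum_pair hπ]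
    have : 2 ≤ w := by simp only [Slice.Ok] at hok; omega
    push_cast [this]
    ring

theorem flagSum_copies {F : Front} (hF : ∀ t < F.length, (F.slice t).Ok (F.width t)) {n : ℕ}
    {π : ℕ → ℕ} (hπ : Pairing n π) {a T : ℕ} (hT : a + T ≤ F.length) :
    2 * flagSum ((List.range' a T).flatMap fun t => (F.slice t).flaggedCopy n π t) =
      (∑ j ∈ Finset.range n, if π j < j then 1 else 0) * ((F.width (a + T) : ℤ) - F.width a) := by
  rw [flagSum_flatMap, Finset.mul_sum,
    Finset.sum_congr rfl fun q hq => flagSum_copy hπ (hF (a + q) (by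
      have := Finset.mem_range.mp hq
      omega)), ← Finset.mul_sum]
  congr 1
  have := Finset.sum_range_sub (fun q => (F.width (a + q) : ℤ)) T
  rw [add_zero] at this
  rw [← this]
  refine Finset.sum_congr rfl fun q _ => ?_
  rw [← Front.width_succ]
  rfl

theorem Slice.partialJTerm_rulingFlag (s : Slice) (m : ℕ) (f g : ℕ → ℕ) :
    (s.shift m).partialJTerm (s.rulingFlag f g) = s.jTerm f g := by
  cases s with
  | triv | lcusp k | rcusp k => simp [Slice.shift, Slice.partialJTerm, Slice.rulingFlag, Slice.jTerm]
  | cross k =>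
    simp only [Slice.shift, Slice.partialJTerm, Slice.rulingFlag, Slice.jTerm]
    classical
    by_cases h : g = f ∧ ¬ (f k = k ∧ f (k + 1) = k + 1)
    · rw [if_pos h, if_pos]
      rw [decide_eq_true_eq]
      exact h
    · rw [if_neg h, if_neg]
      rw [decide_eq_true_eq]
      exact h

namespace BasedKnot

variable {K : BasedKnot} {L : Front} {τ : ℕ → ℕ → ℕ}

/-- The contributions of the companion telescope to zero, since its width is `0` at both ends. Those
of the pattern add up to `j`. -/
theorem flagSum_flaggedSatellite (hτ : L.IsGenRuling τ) :
    flagSum (K.flaggedSatellite L τ) = L.jIndex τ := by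
  rw [flaggedSatellite, flagSum_append, flagSum_append]
  have h1 := flagSum_copies K.planar.ok (n := L.left) (hτ.pairing 0) (a := 0) (T := K.baseTime)
    (by have := K.base_le; omega)
  have h2 := flagSum_copies K.planar.ok (n := L.left) (hτ.pairing 0) (a := K.baseTime)
    (T := K.front.length - K.baseTime) (by have := K.base_le; omega)
  have h3 : flagSum (L.flaggedPattern (L.left * K.baseStrand) τ L.length) = L.jIndex τ := by
    have hlen : (L.flaggedPattern (L.left * K.baseStrand) τ L.length).length = L.length := by
      simp [Front.flaggedPattern]
    rw [Front.jIndex_eq_sum, flagSum_eq_sum, hlen]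
    refine Finset.sum_congr rfl fun t ht => ?_
    rw [← Slice.partialJTerm_rulingFlag _ (L.left * K.baseStrand)]
    simp [Front.flaggedPattern, List.getElem?_range (Finset.mem_range.mp ht)]
  rw [Nat.add_sub_cancel' K.base_le, K.planar.right_eq] at h2
  rw [zero_add, Front.width_zero, K.planar.left_eq] at h1
  rw [h3]
  push_cast at h1 h2
  linarith

theorem sum_partialJTerm (hK : K.rightward = true) (hτ : L.IsGenRuling τ) :
    ∑ t ∈ Finset.range (K.satellite L).length,
      ((K.satellite L).slice t).partialJTerm (flagAt (K.flaggedSatellite L τ) t) = L.jIndex τ := by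
  rw [← flagSum_flaggedSatellite (K := K) hτ, flagSum_eq_sum]
  have h1 : (K.flaggedSatellite L τ).length = (K.satellite L).length := by
    rw [← List.length_map (f := Prod.fst), flaggedSatellite_fst hK, Front.length, satellite,
      List.length_map]
  rw [h1]
  refine Finset.sum_congr rfl fun t ht => ?_
  have ht := Finset.mem_range.mp ht
  rw [← h1] at ht
  rw [getElem_flaggedSatellite hK ht, flagAt_of_lt ht, List.getElem?_eq_getElem ht]
  rfl

end BasedKnot

/-! ### Gradings -/

/-- `f` agrees with the grading given by the potential `μ`. -/
def GradedBy {A : Type*} [AddGroupWithOne A] (μ : ℕ → A) (f : ℕ → ℕ) : Prop :=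
  ∀ i j, i < j → f i = j → μ i = μ j + 1

namespace Slice

variable {A : Type*} [AddGroupWithOne A] {s : Slice} {d : Bool} {f g : ℕ → ℕ} {μ : ℕ → A} {a : A}

theorem carry_skip (k i : ℕ) : (lcusp k).carry a μ (skip k i) = μ i := by
  simp only [carry, skip]
  split_ifs <;> first | rfl | omega

theorem carry_of_continues {i j : ℕ} (h : s.Continues i j) : s.carry a μ j = μ i := by
  cases s with
  | triv => rw [show j = i from h]; rfl
  | cross k => rw [show j = _ from h]; simp [carry]
  | lcusp k => rw [show j = _ from h]; exact carry_skip k i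
  | rcusp k => rw [show i = _ from h]; rfl

/-- At a switch the labels follow the diagram and the pairs do not, so the two strands are required
to have the same label there. -/
theorem PartialRules.gradedBy (h : s.PartialRules d f g) (hf : Function.Involutive f)
    (hμ : GradedBy μ f) (hk : ∀ k, s = cross k → d = true → μ k = μ (k + 1)) :
    GradedBy (s.carry a μ) g := by
  intro i j hij he
  cases s with
  | triv => rw [show g = f from h] at he; exact hμ i j hij he
  | cross k =>
    rcases h.2 with ⟨-, h2⟩ | ⟨hd, rfl, -, -⟩
    · obtain ⟨x, rfl⟩ := (Equiv.swap k (k + 1)).surjective i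
      obtain ⟨y, rfl⟩ := (Equiv.swap k (k + 1)).surjective j
      rw [h2, swap_inj] at he
      simp only [carry, Equiv.swap_apply_self]
      refine hμ x y ?_ he
      have h1 := h.1
      by_contra hc
      have hy : f y = x := by rw [← he, hf]
      rw [swap_val, swap_val] at hij
      have hx : x ≠ k ∨ y ≠ k + 1 := by by_contra hcc; push Not at hcc; simp_all
      have hy' : y ≠ k ∨ x ≠ k + 1 := by by_contra hcc; push Not at hcc; simp_all
      split_ifs at hij <;> omega
    · have hx := hk k rfl hd
      have : ∀ x, (cross k).carry a μ x = μ x := fun x => by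
        simp only [carry, swap_val]
        split_ifs with h1 h2
        · rw [h1, hx]
        · rw [h2, hx]
        · rfl
      rw [this, this]
      exact hμ i j hij he
  | lcusp k =>
    have h : g = insertPair k d f := h
    rcases skip_cases k i with rfl | rfl | ⟨x, rfl⟩
    · rw [h, insertPair_self] at he
      split_ifs at he
      · subst he; simp [carry]
      · omega
    · rw [h, insertPair_succ] at he
      split_ifs at he <;> omega
    · rcases skip_cases k j with rfl | rfl | ⟨y, rfl⟩
      · rw [h, insertPair_skip] at he
        exact absurd he (skip_ne _ _)
      · rw [h, insertPair_skip] at he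
        exact absurd he (skip_ne' _ _)
      · rw [carry_skip, carry_skip]
        rw [h, insertPair_skip, skip_inj] at he
        exact hμ x y ((skip_strictMono k).lt_iff_lt.mp hij) he
  | rcusp k =>
    have h : f = insertPair k d g := h
    refine hμ (skip k i) (skip k j) (skip_strictMono k hij) ?_
    rw [h, insertPair_skip, he]

/-- At a switch of graded rulings the two strands have the same potential. -/
theorem eq_of_gradedBy {k : ℕ} {ν : ℕ → A} (hf : Function.Involutive f) (h1 : f k ≠ k + 1)
    (hn : ¬ (f k = k ∧ f (k + 1) = k + 1)) (hμ : GradedBy μ f) (hν : GradedBy ν f)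
    (hc : ∀ i, f i ≠ i → ν (Equiv.swap k (k + 1) i) = μ i)
    (hk : ν k = μ (k + 1)) (hk' : ν (k + 1) = μ k) : μ k = μ (k + 1) := by
  -- The companion `y` is away from the crossing and keeps its potential, while the place `x` passes
  -- to the other strand. Comparing the gradings on the two sides of the switch gives the equality.
  have key : ∀ x y, f x = y → x ≠ y → y ≠ k → y ≠ k + 1 → ∀ x', (x = k ∧ x' = k + 1 ∨ x = k + 1 ∧ x' = k) →
      μ x = μ x' := by
    intro x y hxy hne hy hy' x' hx
    have e1 : ν y = μ y := by
      rw [← hc y (fun e => hne (by have := hf x; rw [hxy, e] at this; exact this.symm)), Equiv.swap_apply_of_ne_of_ne hy hy']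
    have e2 : ν x = μ x' := by rcases hx with ⟨rfl, rfl⟩ | ⟨rfl, rfl⟩ <;> assumption
    rcases lt_or_gt_of_ne hne with hlt | hlt
    · have a1 := hμ x y hlt hxy
      have a2 := hν x y hlt hxy
      rw [e1, e2] at a2
      rw [a1, a2]
    · have hyx : f y = x := by rw [← hxy, hf]
      have a1 := hμ y x hlt hyx
      have a2 := hν y x hlt hyx
      rw [e1, e2] at a2
      exact add_right_cancel (a1.symm.trans a2)
  by_cases hk0 : f k = k
  · have hk1 : f (k + 1) ≠ k + 1 := fun e => hn ⟨hk0, e⟩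
    exact (key (k + 1) _ rfl (Ne.symm hk1) (fun e => by rw [← e, hf] at hk0; omega) hk1 k
      (Or.inr ⟨rfl, rfl⟩)).symm
  · exact key k _ rfl (Ne.symm hk0) hk0 h1 (k + 1) (Or.inl ⟨rfl, rfl⟩)

end Slice

theorem Slice.Continues.mirror {s : Slice} {i j : ℕ} (h : s.Continues i j) :
    s.mirror.Continues j i := by
  cases s with
  | triv => exact Eq.symm h
  | cross k =>
    show i = Equiv.swap k (k + 1) j
    rw [show j = _ from h, Equiv.swap_apply_self]
  | lcusp k => exact h
  | rcusp k => exact h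

/-! ### Potentials along the copies of the companion -/

section Transport

variable {A : Type*}

/-- The labels `y` are constant along the strands of a word. -/
def Transport (w : List Slice) (y : ℕ → ℕ → A) : Prop :=
  ∀ t (h : t < w.length) i j, (w[t]).Continues i j → y (t + 1) j = y t i

theorem Transport.append {w₁ w₂ : List Slice} {y : ℕ → ℕ → A} (h : Transport (w₁ ++ w₂) y) :
    Transport w₁ y ∧ Transport w₂ fun t => y (w₁.length + t) := by
  refine ⟨fun t ht i j hc => h t (by simp; omega) i j ?_, fun t ht i j hc =>
    h (w₁.length + t) (by simp; omega) i j ?_⟩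
  · rwa [List.getElem_append_left ht]
  · rw [List.getElem_append_right (by omega)]
    simpa using hc

theorem Transport.reverse {w : List Slice} {y : ℕ → ℕ → A} (h : Transport w y) :
    Transport (w.reverse.map Slice.mirror) fun t => y (w.length - t) := by
  intro t ht i j hc
  simp only [List.length_map, List.length_reverse] at ht
  simp only [List.getElem_map, List.getElem_reverse] at hc
  have hc := hc.mirror
  rw [Slice.mirror_mirror] at hc
  have := h (w.length - 1 - t) (by omega) j i hc
  rw [show w.length - 1 - t + 1 = w.length - t by omega] at this
  show y (w.length - (t + 1)) j = y (w.length - t) i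
  rw [this]
  congr 1
  omega

theorem Transport.posAfter {w : List Slice} (hw : ∀ s ∈ w, ∃ k, s = Slice.cross k) {y : ℕ → ℕ → A}
    (h : Transport w y) (x : ℕ) : y w.length (posAfter w x) = y 0 x := by
  induction w generalizing y x with
  | nil => rfl
  | cons s w ih =>
    obtain ⟨k, rfl⟩ := hw s (by simp)
    have h1 := h 0 (by simp) x _ rfl
    have h2 : y (w.length + 1) (_root_.posAfter w (Equiv.swap k (k + 1) x)) =
        y 1 (Equiv.swap k (k + 1) x) := ih (fun s hs => hw s (by simp [hs])) (y := fun t => y (t + 1))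
      (fun t ht i j hc => h (t + 1) (by simpa using ht) i j (by simpa using hc))
      (Equiv.swap k (k + 1) x)
    rw [List.length_cons, _root_.posAfter, h2]
    exact h1

theorem Transport.rowUp {p m : ℕ} {y : ℕ → ℕ → A} (h : Transport (rowUp p m) y)
    (hm : m ≤ p) (r : ℕ) (hr : r ≤ m) (x : ℕ) : y r (upPos p r x) = y 0 x := by
  induction r with
  | zero =>
    congr 1
    unfold upPos
    split_ifs <;> omega
  | succ r ih =>
    rw [← ih (by omega)]
    refine h r (by simp [_root_.rowUp]; omega) _ _ ?_
    simp only [_root_.rowUp, List.getElem_map, List.getElem_range, Slice.Continues, Slice.swap_val,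
      upPos]
    split_ifs <;> omega

theorem transport_group {b j : ℕ} {y : ℕ → ℕ → A}
    (h : Transport (Slice.lcusp (b + 2 * j) :: rowUp (b + 2 * j) j) y) :
    (∀ x, y 1 (Slice.skip (b + 2 * j) x) = y 0 x) ∧
      ∀ r ≤ j, ∀ x, y (r + 1) (upPos (b + 2 * j) r x) = y 1 x := by
  refine ⟨fun x => h 0 (by simp) x _ rfl, fun r hr x => ?_⟩
  have := Transport.rowUp (p := b + 2 * j) (m := j) (y := fun t => y (t + 1))
    (fun t ht i j hc => h (t + 1) (by simpa using ht) i j (by simpa using hc)) (by omega) r hr x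
  exact this

theorem length_group (b j : ℕ) :
    (Slice.lcusp (b + 2 * j) :: rowUp (b + 2 * j) j).length = j + 1 := by simp [rowUp]

theorem Transport.cusp_outer {b n : ℕ} {y : ℕ → ℕ → A} (h : Transport (cuspWord b n) y) (x : ℕ) :
    y (cuspWord b n).length (skipN b n x) = y 0 x := by
  induction n with
  | zero => congr 1; unfold skipN; split_ifs <;> omega
  | succ n ih =>
    rw [cuspWord_succ] at h ⊢
    obtain ⟨h1, h2⟩ := h.append
    rw [← ih h1, List.length_append, length_group]
    obtain ⟨h3, h4⟩ := transport_group h2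
    have h3 := h3 (skipN b n x)
    have h4 := h4 n le_rfl (Slice.skip (b + 2 * n) (skipN b n x))
    rw [h3] at h4
    rw [add_zero] at h4
    rw [← h4]
    congr 1
    simp only [upPos, Slice.skip, skipN]
    split_ifs <;> omega

variable [AddGroupWithOne A]

/-- The labels of the branches of the first `j` cusps in the `n`-copy of a cusp. -/
def CuspLabel (b j : ℕ) (a : A) (ν : ℕ → A) (x : ℕ → A) : Prop :=
  ∀ i < j, x (b + i) = a + ν i ∧ x (b + j + i) = a + ν i - 1

/-- The row only permutes the labels, so those at its end determine the earlier ones, and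
conversely. -/
theorem cuspLabel_succ_iff {b j : ℕ} {a : A} {ν : ℕ → A} {y : ℕ → ℕ → A}
    (h : Transport (Slice.lcusp (b + 2 * j) :: rowUp (b + 2 * j) j) y) :
    CuspLabel b (j + 1) a ν (y (j + 1)) ↔ CuspLabel b j a ν (y 0) ∧
      y 1 (b + 2 * j) = a + ν j ∧ y 1 (b + 2 * j + 1) = a + ν j - 1 := by
  obtain ⟨h1, h2⟩ := transport_group h
  have h2 := h2 j le_rfl
  have e1 : ∀ i < j, y (j + 1) (b + i) = y 0 (b + i) := fun i hi => by
    rw [← h1, ← h2]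
    congr 1
    simp only [upPos, Slice.skip]
    split_ifs <;> omega
  have e2 : y (j + 1) (b + j) = y 1 (b + 2 * j) := by
    rw [← h2]
    congr 1
    simp only [upPos]
    split_ifs <;> omega
  have e3 : ∀ i < j, y (j + 1) (b + (j + 1) + i) = y 0 (b + j + i) := fun i hi => by
    rw [← h1, ← h2]
    congr 1
    simp only [upPos, Slice.skip]
    split_ifs <;> omega
  have e4 : y (j + 1) (b + (j + 1) + j) = y 1 (b + 2 * j + 1) := by
    rw [← h2]
    congr 1
    simp only [upPos]
    split_ifs <;> omega
  constructor
  · intro hc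
    refine ⟨fun i hi => ?_, ?_⟩
    · rw [← e1 i hi, ← e3 i hi]
      exact hc i (by omega)
    · rw [← e2, ← e4]
      exact hc j (by omega)
  · rintro ⟨hc, hj⟩ i hi
    rcases Nat.lt_succ_iff_lt_or_eq.mp hi with hlt | rfl
    · rw [e1 i hlt, e3 i hlt]
      exact hc i hlt
    · rw [e2, e4]
      exact hj

/-- Only the labels at the open end of the copy enter, so this also applies to right cusps after
reflection. -/
theorem cuspLabel_of_lt {b n : ℕ} {a : A} {ν : ℕ → A} {y : ℕ → ℕ → A}
    (h : Transport (cuspWord b n) y) (hn : CuspLabel b n a ν (y (cuspWord b n).length))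
    {j r : ℕ} (hj : j < n) (hr : r < j) :
    y ((cuspWord b j).length + (r + 1)) (b + 2 * j - 1 - r + 1) = a + ν j ∧
    y ((cuspWord b j).length + (r + 1)) (b + 2 * j - 1 - r) = a + ν (j - 1 - r) - 1 := by
  induction n with
  | zero => omega
  | succ n ih =>
    rw [cuspWord_succ] at h hn
    obtain ⟨h1, h2⟩ := h.append
    rw [List.length_append, length_group] at hn
    obtain ⟨h3, h4⟩ := (cuspLabel_succ_iff h2).1 hn
    rcases Nat.lt_succ_iff_lt_or_eq.mp hj with hlt | rfl
    · exact ih h1 h3 hlt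
    · obtain ⟨h5, h6⟩ := transport_group h2
      have h6 := h6 r hr.le
      constructor
      · rw [← h4.1, ← h6]
        congr 1
        simp only [upPos]
        split_ifs <;> omega
      · rw [← (h3 (j - 1 - r) (by omega)).2, ← h5, ← h6]
        congr 1
        simp only [upPos, Slice.skip]
        split_ifs <;> omega

theorem cuspLabel_of_forall {b n : ℕ} {a : A} {ν : ℕ → A} {y : ℕ → ℕ → A}
    (h : Transport (cuspWord b n) y)
    (hn : ∀ j < n, y ((cuspWord b j).length + 1) (b + 2 * j) = a + ν j ∧
      y ((cuspWord b j).length + 1) (b + 2 * j + 1) = a + ν j - 1) :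
    CuspLabel b n a ν (y (cuspWord b n).length) := by
  induction n with
  | zero => intro i hi; omega
  | succ n ih =>
    rw [cuspWord_succ] at h ⊢
    obtain ⟨h1, h2⟩ := h.append
    rw [List.length_append, length_group]
    exact (cuspLabel_succ_iff h2).2 ⟨ih h1 fun j hj => hn j (by omega), hn n (by omega)⟩

end Transport

section Carried

variable {A : Type*} [CommRing A]

/-- The labels `y` are carried along a word whose left cusps have labels prescribed by `lab`. -/
def Carried (lab : Origin → A) (l : List (Slice × Origin)) (y : ℕ → ℕ → A) : Prop :=
  ∀ t (h : t < l.length), y (t + 1) = l[t].1.carry (lab l[t].2) (y t)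

variable {lab : Origin → A} {y : ℕ → ℕ → A}

theorem Carried.transport {l : List (Slice × Origin)} (h : Carried lab l y) :
    Transport (l.map Prod.fst) y := by
  intro t ht i j hc
  rw [List.length_map] at ht
  rw [List.getElem_map] at hc
  rw [h t ht, Slice.carry_of_continues hc]

theorem Carried.append {l₁ l₂ : List (Slice × Origin)} (h : Carried lab (l₁ ++ l₂) y) :
    Carried lab l₁ y ∧ Carried lab l₂ fun t => y (l₁.length + t) := by
  constructor
  · intro t ht
    have := h t (by simp; omega)
    rwa [List.getElem_append_left ht] at this
  · intro t ht
    have := h (l₁.length + t) (by simp; omega)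
    rw [List.getElem_append_right (by omega)] at this
    simpa [add_assoc] using this

theorem carried_flatMap {g : ℕ → List (Slice × Origin)} {a T : ℕ}
    (h : Carried lab ((List.range' a T).flatMap g) y) {s : ℕ} (hs : s < T) :
    Carried lab (g (a + s)) fun r => y ((∑ q ∈ Finset.range s, (g (a + q)).length) + r) := by
  intro r hr
  have hg := getElem?_flatMap (a := a) hs hr
  obtain ⟨hlt, hg⟩ := List.getElem?_eq_some_iff.mp (hg.trans (List.getElem?_eq_getElem hr))
  have := h _ hlt
  rwa [hg] at this

theorem cuspEntries_head {t b n j : ℕ} (hj : j < n) :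
    (cuspEntries t b n)[(cuspWord b j).length]? =
      some (Slice.lcusp (b + 2 * j), Origin.companion t j) := by
  have h := getElem?_flatMap (g := fun j => withOrigin (Origin.companion t j)
    (Slice.lcusp (b + 2 * j) :: rowUp (b + 2 * j) j)) (a := 0) hj (r := 0) (by simp [withOrigin])
  rw [cuspEntries_eq, length_cuspWord]
  have e : ∑ q ∈ Finset.range j, (withOrigin (Origin.companion t (0 + q))
      (Slice.lcusp (b + 2 * (0 + q)) :: rowUp (b + 2 * (0 + q)) (0 + q))).length =
      ∑ q ∈ Finset.range j, (q + 1) := Finset.sum_congr rfl fun q _ => by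
    simp [withOrigin, rowUp]
  rw [e, add_zero] at h
  rw [h]
  simp [withOrigin]

theorem carried_copy {n t w : ℕ} {s : Slice} (h : Carried lab (s.copyEntries n t) y) {α β ν : ℕ → A}
    (hok : s.Ok w) (hs : ∀ i < w, ∀ j < s.out w, s.Continues i j → β j = α i)
    (hl : ∀ k, s = Slice.lcusp k → β k = β (k + 1) + 1 ∧
      ∀ i, lab (Origin.companion t i) = β k + ν i)
    (h0 : ∀ a < w, ∀ i < n, y 0 (n * a + i) = α a + ν i) :
    ∀ a < s.out w, ∀ i < n, y (s.copyEntries n t).length (n * a + i) = β a + ν i := by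
  intro a ha i hi
  have ht := h.transport
  cases s with
  | triv =>
    rw [hs a ha a ha rfl, ← h0 a ha i hi]
    rfl
  | cross k =>
    simp only [Slice.out, Slice.Ok] at ha hok
    rw [← List.length_map (f := Prod.fst)]
    rw [BasedKnot.copyEntries_fst, copy_cross] at ht ⊢
    have := ht.posAfter (fun s hs => (crossingsIn_grid (b := n * k) (N := n + n) le_rfl s hs).imp
      fun k hk => hk.1) (n * Equiv.swap k (k + 1) a + i)
    have hlt : Equiv.swap k (k + 1) a < w := by rw [Slice.swap_val]; split_ifs <;> omega
    rw [posAfter_grid_block hi, Equiv.swap_apply_self, h0 _ hlt i hi] at this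
    rw [this, hs _ hlt a ha (Equiv.swap_apply_self _ _ _).symm]
  | lcusp k =>
    simp only [Slice.out, Slice.Ok] at ha hok
    obtain ⟨hβ, hlab⟩ := hl k rfl
    have hcusp : CuspLabel (n * k) n (β k) ν (y (cuspWord (n * k) n).length) := by
      rw [BasedKnot.copyEntries_fst, copy_lcusp] at ht
      refine cuspLabel_of_forall ht fun j hj => ?_
      rw [copyEntries_lcusp] at h
      obtain ⟨hlt, he⟩ := List.getElem?_eq_some_iff.mp (cuspEntries_head (t := t) (b := n * k) hj)
      have := h _ hlt
      rw [he] at this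
      simp only [hlab] at this
      rw [this]
      simp [Slice.carry]
    rw [← List.length_map (f := Prod.fst), BasedKnot.copyEntries_fst, copy_lcusp]
    rw [BasedKnot.copyEntries_fst, copy_lcusp] at ht
    rcases Slice.skip_cases k a with rfl | rfl | ⟨b, rfl⟩
    · exact (hcusp i hi).1
    · have := (hcusp i hi).2
      rw [hβ] at this
      rw [show n * (k + 1) + i = n * k + n + i by ring, this]
      ring
    · have hb : b < w := by
        unfold Slice.skip at ha
        split_ifs at ha <;> omega
      rw [← skipN_block hi, ht.cusp_outer, h0 b hb i hi, hs b hb _ ha rfl]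
  | rcusp k =>
    simp only [Slice.out, Slice.Ok] at ha hok
    rw [← List.length_map (f := Prod.fst), BasedKnot.copyEntries_fst, copy_rcusp, List.length_map,
      List.length_reverse]
    rw [BasedKnot.copyEntries_fst, copy_rcusp] at ht
    have := ht.reverse
    rw [map_mirror_reverse, List.length_map, List.length_reverse] at this
    have := this.cusp_outer (n * a + i)
    simp only [Nat.sub_self, Nat.sub_zero] at this
    have hb : Slice.skip k a < w := by unfold Slice.skip; split_ifs <;> omega
    rw [← this, skipN_block hi, h0 _ hb i hi, hs _ hb a ha rfl]

theorem flaggedCusp_cases {π : ℕ → ℕ} {t b n q k : ℕ} {e : Entry}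
    (h : (flaggedCusp π t b n)[q]? = some e) (hk : e.1.1 = Slice.cross k) (hd : e.2 = true) :
    ∃ j < n, ∃ r < j, q = (cuspWord b j).length + (r + 1) ∧ k = b + 2 * j - 1 - r ∧
      π j < j ∧ r = j - 1 - π j := by
  rw [flaggedCusp_eq] at h
  obtain ⟨j, hj, r, hr, ht, he⟩ := exists_of_lt_flatMap (List.getElem?_eq_some_iff.mp h).1
  rw [he] at h
  simp only [Nat.zero_add] at h ht hr
  cases r with
  | zero =>
    simp only [List.getElem?_cons_zero, Option.some.injEq] at h
    rw [← h] at hk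
    cases hk
  | succ r =>
    have hr' : r < j := by simpa [flaggedRow] using hr
    simp only [List.getElem?_cons_succ, flaggedRow, List.getElem?_map, List.getElem?_range hr',
      Option.map_some, Option.some.injEq] at h
    rw [← h] at hk hd
    have hk := Slice.cross.inj hk
    simp only [decide_eq_true_eq] at hd
    refine ⟨j, hj, r, hr', ?_, hk.symm, ?_, ?_⟩
    · rw [ht, length_cuspWord]
      congr 1
      exact Finset.sum_congr rfl fun q _ => by simp [flaggedRow]
    · by_contra hc
      rw [if_neg hc] at hd
      omega
    · split_ifs at hd
      · exact hd
      · omega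

/-- At a flagged crossing the upper branch of the copy `j`, with label `a + ν j`, meets the lower
branch of the copy `π j`, with label `a + ν (π j) - 1`. These agree because the pair `π j < j` is
graded. -/
theorem flaggedCopy_label_eq {n t w : ℕ} {s : Slice} {π : ℕ → ℕ} (hπ : Function.Involutive π)
    (hok : s.Ok w) (ht : Transport ((s.copy n).map Prod.fst) y) {α β ν : ℕ → A}
    (hν : GradedBy ν π) (hl : ∀ k, s = Slice.lcusp k → β k = β (k + 1) + 1)
    (hr : ∀ k, s = Slice.rcusp k → α k = α (k + 1) + 1)
    (h0 : ∀ a < w, ∀ i < n, y 0 (n * a + i) = α a + ν i)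
    (h1 : ∀ a < s.out w, ∀ i < n, y (s.copy n).length (n * a + i) = β a + ν i) {q k : ℕ}
    (hq : q < (s.flaggedCopy n π t).length) (hk : (s.flaggedCopy n π t)[q].1.1 = Slice.cross k)
    (hd : (s.flaggedCopy n π t)[q].2 = true) : y q k = y q (k + 1) := by
  have main : ∀ {k' : ℕ} {a : A} {z : ℕ → ℕ → A}, Transport (cuspWord (n * k') n) z →
      CuspLabel (n * k') n a ν (z (cuspWord (n * k') n).length) → ∀ {q : ℕ} {e : Entry},
      (flaggedCusp π t (n * k') n)[q]? = some e → e.1.1 = Slice.cross k → e.2 = true →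
      z q k = z q (k + 1) := by
    intro k' a z hz hc q e he hk hd
    obtain ⟨j, hj, r, hr, rfl, rfl, hlt, rfl⟩ := flaggedCusp_cases he hk hd
    obtain ⟨e1, e2⟩ := cuspLabel_of_lt hz hc hj hr
    have := hν (π j) j hlt (hπ j)
    rw [e1, e2, show j - 1 - (j - 1 - π j) = π j by omega, this]
    ring
  cases s with
  | triv => simp [Slice.flaggedCopy] at hq
  | cross k => simp [Slice.flaggedCopy, unflagged] at hd
  | lcusp k' =>
    simp only [Slice.out, Slice.Ok] at h1 hok
    rw [copy_lcusp] at ht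
    rw [← List.length_map (f := Prod.fst), copy_lcusp] at h1
    refine main (a := β k') ht (fun i hi => ⟨h1 k' (by omega) i hi, ?_⟩)
      (List.getElem?_eq_getElem hq) hk hd
    have := h1 (k' + 1) (by omega) i hi
    rw [show n * (k' + 1) + i = n * k' + n + i by ring] at this
    rw [this, hl k' rfl]
    ring
  | rcusp k' =>
    simp only [Slice.Ok] at hok
    rw [copy_rcusp] at ht
    have hrev := ht.reverse
    rw [map_mirror_reverse, List.length_map, List.length_reverse] at hrev
    have hlen : (Slice.flaggedCopy n π t (Slice.rcusp k')).length =
      (flaggedCusp π t (n * k') n).length := by simp [Slice.flaggedCopy]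
    have hlen' : (flaggedCusp π t (n * k') n).length = (cuspWord (n * k') n).length := by
      rw [← List.length_map (f := Prod.fst), flaggedCusp_fst, ← List.length_map (f := Prod.fst),
        cuspEntries_fst]
    rw [hlen] at hq
    simp only [Slice.flaggedCopy, List.getElem_map, List.getElem_reverse, Entry.mirror] at hk hd
    have hk' := (Slice.mirror_mirror _).symm.trans (congrArg Slice.mirror hk)
    have := main (a := α k') hrev (fun i hi => ?_) (List.getElem?_eq_getElem
      (by omega : (flaggedCusp π t (n * k') n).length - 1 - q < _)) hk' hd
    -- The reflected labels are read at the line `q + 1`. Labels follow the diagram, so their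
    -- equality there gives it at the line `q`.
    · have hslice := ht q (by simp only [List.length_map, List.length_reverse]; omega)
      simp only [List.getElem_map, List.getElem_reverse] at hslice
      have hcross : (cuspWord (n * k') n)[(cuspWord (n * k') n).length - 1 - q].mirror =
          Slice.cross k := by
        rw [← hk]
        congr 1
        have e : (cuspWord (n * k') n)[(cuspWord (n * k') n).length - 1 - q]? =
            some (flaggedCusp π t (n * k') n)[(flaggedCusp π t (n * k') n).length - 1 - q].1.1 := by
          rw [← cuspEntries_fst t, ← flaggedCusp_fst π t, List.getElem?_map, List.getElem?_map]
          simp only [List.length_map]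
          rw [List.getElem?_eq_getElem (by omega)]
          rfl
        exact Option.some.inj ((List.getElem?_eq_getElem _).symm.trans e)
      have e1 := hslice k (k + 1) (by
        rw [hcross]; exact (Equiv.swap_apply_left _ _).symm)
      have e2 := hslice (k + 1) k (by
        rw [hcross]; exact (Equiv.swap_apply_right _ _).symm)
      rw [← e1, ← e2]
      simp only [hlen', show (cuspWord (n * k') n).length - ((cuspWord (n * k') n).length - 1 - q) =
        q + 1 by omega] at this
      exact this.symm
    · simp only [Nat.sub_self]
      refine ⟨h0 k' (by omega) i hi, ?_⟩
      have := h0 (k' + 1) (by omega) i hi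
      rw [show n * (k' + 1) + i = n * k' + n + i by ring] at this
      rw [this, hr k' rfl]
      ring

end Carried

/-! ### The potential of the satellite -/

namespace Slice

theorem Continues.shift {s : Slice} {i j : ℕ} (h : s.Continues i j) (m : ℕ) :
    (s.shift m).Continues (m + i) (m + j) := by
  cases s with
  | triv => exact congrArg (m + ·) h
  | cross k =>
    simp only [Slice.shift, Continues, swap_val] at h ⊢
    split_ifs at h ⊢ <;> omega
  | lcusp k =>
    simp only [Slice.shift, Continues, skip] at h ⊢
    split_ifs at h ⊢ <;> omega
  | rcusp k =>
    rw [show i = skip k j from h]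
    simp only [Slice.shift, Continues, skip]
    split_ifs <;> omega

theorem continues_outer {s : Slice} {w : ℕ} (hok : s.Ok w) (m x : ℕ) :
    (s.shift m).Continues (_root_.outer m w x) (_root_.outer m (s.out w) x) := by
  cases s <;> simp only [Slice.shift, Continues, skip, swap_val, _root_.outer, out, Ok] at hok ⊢ <;>
    split_ifs <;> omega

theorem exists_continues {s : Slice} {w j : ℕ} (hok : s.Ok w) (hj : j < s.out w) :
    (∃ i < w, s.Continues i j) ∨ ∃ k, s = lcusp k ∧ (j = k ∨ j = k + 1) := by
  cases s with
  | triv => exact Or.inl ⟨j, hj, rfl⟩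
  | cross k =>
    simp only [out, Ok] at hok hj
    refine Or.inl ⟨Equiv.swap k (k + 1) j, ?_, (Equiv.swap_apply_self _ _ _).symm⟩
    rw [swap_val]
    split_ifs <;> omega
  | lcusp k =>
    simp only [out, Ok] at hok hj
    rcases skip_cases k j with rfl | rfl | ⟨i, rfl⟩
    · exact Or.inr ⟨_, rfl, Or.inl rfl⟩
    · exact Or.inr ⟨_, rfl, Or.inr rfl⟩
    · refine Or.inl ⟨i, ?_, rfl⟩
      unfold skip at hj
      split_ifs at hj <;> omega
  | rcusp k =>
    simp only [out, Ok] at hok hj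
    refine Or.inl ⟨skip k j, ?_, rfl⟩
    unfold skip
    split_ifs <;> omega

end Slice

namespace BasedKnot

variable {K : BasedKnot} {L : Front}

theorem carried_satellitePotential {A : Type*} [CommRing A] (K : BasedKnot) (L : Front)
    (μ η : ℕ → ℕ → A) :
    Carried (K.cuspLabel L μ η) (K.satelliteSlices L) (K.satellitePotential L μ η) := by
  intro t ht
  rw [satellitePotential, satellitePotential, List.take_add_one, List.getElem?_eq_getElem ht,
    List.foldl_append]
  rfl

theorem carried_satellite {A : Type*} [CommRing A] (hK : K.rightward = true) {lab : Origin → A}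
    {y : ℕ → ℕ → A} (h : Carried lab (K.satelliteSlices L) y) :
    (∀ s < K.baseTime, Carried lab ((K.front.slice s).copyEntries L.left s)
      fun r => y (K.leftTime L.left s + r)) ∧
    (∀ t < L.length, y (K.leftTime L.left K.baseTime + (t + 1)) =
      ((L.slice t).shift (L.left * K.baseStrand)).carry (lab (Origin.pattern t))
        (y (K.leftTime L.left K.baseTime + t))) ∧
    ∀ s < K.front.length - K.baseTime,
      Carried lab ((K.front.slice (K.baseTime + s)).copyEntries L.left (K.baseTime + s))
        fun r => y (K.rightTime L s + r) := by
  rw [satelliteSlices_eq hK, List.append_assoc] at h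
  obtain ⟨h1, h2⟩ := h.append
  obtain ⟨h2, h3⟩ := h2.append
  refine ⟨fun s hs => ?_, fun t ht => ?_, fun s hs => ?_⟩
  · have := carried_flatMap h1 hs
    simp only [Nat.zero_add, length_copyEntries] at this
    exact this
  · have := h2 t (by rw [length_patternEntries]; exact ht)
    simp only [length_left, Front.patternEntries, List.getElem_map, List.getElem_range] at this
    exact this
  · have := carried_flatMap h3 hs
    simp only [length_copyEntries, length_left, length_patternEntries, ← add_assoc] at this
    exact this

/-- `μ` and `η` are constant along strands and fit the labels prescribed at left cusps. Beyond the
pattern the description continues because `η` closes up. -/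
theorem satellite_labels {p : ℕ} {μ η : ℕ → ℕ → ZMod p} (hK : K.rightward = true)
    (hL : L.IsAnnular) (hμ : K.front.IsMaslov μ) (hη : L.IsMaslov η) {y : ℕ → ℕ → ZMod p}
    (h : Carried (K.cuspLabel L μ η) (K.satelliteSlices L) y) :
    (∀ s ≤ K.baseTime, ∀ a < K.front.width s, ∀ i < L.left,
      y (K.leftTime L.left s) (L.left * a + i) = μ s a + η 0 i) ∧
    (∀ t ≤ L.length, ∀ i < L.width t, y (K.leftTime L.left K.baseTime + t)
      (L.left * K.baseStrand + i) = μ K.baseTime K.baseStrand + η t i) ∧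
    ∀ s, K.baseTime + s ≤ K.front.length → ∀ a < K.front.width (K.baseTime + s), ∀ i < L.left,
      y (K.rightTime L s) (L.left * a + i) = μ (K.baseTime + s) a + η 0 i := by
  obtain ⟨c1, c2, c3⟩ := carried_satellite hK h
  have hb := K.base_le
  have step : ∀ {s T : ℕ}, s < K.front.length →
      Carried (K.cuspLabel L μ η) ((K.front.slice s).copyEntries L.left s) (fun r => y (T + r)) →
      (∀ a < K.front.width s, ∀ i < L.left, y T (L.left * a + i) = μ s a + η 0 i) →
      ∀ a < K.front.width (s + 1), ∀ i < L.left,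
        y (T + ((K.front.slice s).copy L.left).length) (L.left * a + i) = μ (s + 1) a + η 0 i := by
    intro s T hs hc h0
    have := carried_copy (α := μ s) (β := μ (s + 1)) (ν := η 0) hc (K.planar.ok s hs)
      (fun i hi j hj hij => hμ.strand s hs i hi j (by rw [Front.width_succ]; exact hj) hij)
      (fun k hk => ⟨hμ.lcusp s hs k hk, fun i => by simp [cuspLabel, hk]⟩) h0
    rwa [length_copyEntries, ← Front.width_succ] at this
  have A : ∀ s ≤ K.baseTime, ∀ a < K.front.width s, ∀ i < L.left,
      y (K.leftTime L.left s) (L.left * a + i) = μ s a + η 0 i := by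
    intro s hs
    induction s with
    | zero =>
      intro a ha
      rw [Front.width_zero, K.planar.left_eq] at ha
      omega
    | succ s ih =>
      rw [leftTime_succ]
      exact step (by omega) (c1 s hs) (ih (by omega))
  have B : ∀ t ≤ L.length, ∀ i < L.width t, y (K.leftTime L.left K.baseTime + t)
      (L.left * K.baseStrand + i) = μ K.baseTime K.baseStrand + η t i := by
    intro t ht
    induction t with
    | zero => exact A _ le_rfl _ K.base_lt
    | succ t ih =>
      intro j hj
      rw [c2 t ht]
      have hj' := hj
      rw [Front.width_succ] at hj
      rcases Slice.exists_continues (hL.ok t ht) hj with ⟨i, hi, hij⟩ | ⟨k, hk, hjk⟩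
      · rw [Slice.carry_of_continues (hij.shift _), ih (by omega) i hi,
          hη.strand t ht i hi j hj' hij]
      · have hlab : K.cuspLabel L μ η (Origin.pattern t) =
            μ K.baseTime K.baseStrand + η (t + 1) k := by
          simp [cuspLabel, inserted, insertedPotential, hK, hk]
        rw [hk, hlab]
        rcases hjk with rfl | rfl
        · simp [Slice.shift, Slice.carry]
        · rw [hη.lcusp t ht k hk]
          simp only [Slice.shift, Slice.carry]
          rw [if_neg (by omega), if_neg (by omega), if_pos (by omega)]
          ring
  have O : ∀ t ≤ L.length, ∀ x, y (K.leftTime L.left K.baseTime + t)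
      (outer (L.left * K.baseStrand) (L.width t) x) =
      y (K.leftTime L.left K.baseTime) (outer (L.left * K.baseStrand) L.left x) := by
    intro t ht x
    induction t with
    | zero => rfl
    | succ t ih =>
      rw [c2 t ht, ← ih (by omega), Front.width_succ]
      exact Slice.carry_of_continues (Slice.continues_outer (hL.ok t ht) _ _)
  refine ⟨A, B, fun s hs => ?_⟩
  induction s with
  | zero =>
    intro a ha i hi
    rw [rightTime_zero]
    have hO := O L.length le_rfl
    rw [hL.closed] at hO
    rcases lt_trichotomy a K.baseStrand with hlt | rfl | hlt
    · have hbl := block_lt (n := L.left) hlt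
      have := hO (L.left * a + i)
      rw [outer, if_pos (by omega)] at this
      rw [this]
      exact A _ le_rfl a ha i hi
    · rw [B L.length le_rfl i (by rw [hL.closed]; exact hi), hη.closed i hi]
      rfl
    · have hbl := block_lt (n := L.left) hlt
      have := hO (L.left * a + i - L.left)
      rw [outer, if_neg (by omega), show L.left * a + i - L.left + L.left = L.left * a + i by omega]
        at this
      rw [this]
      exact A _ le_rfl a ha i hi
  | succ s ih =>
    rw [rightTime_succ]
    exact step (s := K.baseTime + s) (by omega) (c3 s (by omega)) (ih (by omega))

/-- The same pairs are graded on both sides of the switch, while the potentials of the two strands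
have changed places. -/
theorem switch_label_eq {p : ℕ} {η : ℕ → ℕ → ZMod p} (hL : L.IsAnnular) (hη : L.IsMaslov η)
    {τ : ℕ → ℕ → ℕ} (hτ : L.IsGenRuling τ) (hg : L.IsGraded η τ) {t k : ℕ} (ht : t < L.length)
    (hk : L.slice t = Slice.cross k) (hs : τ (t + 1) = τ t)
    (hn : ¬ (τ t k = k ∧ τ t (k + 1) = k + 1)) : η t k = η t (k + 1) := by
  have hru := hτ.rules t
  have hok := hL.ok t ht
  rw [hk] at hru hok
  have hw : L.width (t + 1) = L.width t := by rw [Front.width_succ, hk]; rfl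
  have hstrand : ∀ i < L.width t, η (t + 1) (Equiv.swap k (k + 1) i) = η t i := fun i hi =>
    hη.strand t ht i hi _ (by
      simp only [Slice.Ok] at hok
      rw [hw, Slice.swap_val]
      split_ifs <;> omega) (by rw [hk]; rfl)
  simp only [Slice.Ok] at hok
  refine Slice.eq_of_gradedBy (hτ.involutive t) hru.cross_cases.1 hn (hg t ht.le)
    (ν := η (t + 1)) (by rw [← hs]; exact hg (t + 1) ht) (fun i hi => hstrand i ?_) ?_ ?_
  · by_contra hc
    exact hi (hτ.support t i (not_lt.mp hc))
  · rw [← hstrand (k + 1) hok, Equiv.swap_apply_right]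
  · rw [← hstrand k (by omega), Equiv.swap_apply_left]

end BasedKnot

namespace Slice

theorem carry_congr {A : Type*} [AddGroupWithOne A] {s : Slice} {a b : A} {μ : ℕ → A}
    (h : ∀ k, s = lcusp k → a = b) : s.carry a μ = s.carry b μ := by
  cases s with
  | lcusp k => rw [h k rfl]
  | triv | cross k | rcusp k => rfl

theorem restriction_eq_lcusp {s : Slice} {d : Bool} {f : ℕ → ℕ} {k : ℕ}
    (h : (s.restriction d f).getD triv = lcusp k) : (∃ k', s = lcusp k') ∧ d = false := by
  cases s with
  | triv => cases h
  | cross k' => simp only [restriction] at h; split_ifs at h <;> cases h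
  | lcusp k' => cases d <;> simp [restriction] at h ⊢
  | rcusp k' => cases d <;> simp [restriction] at h

end Slice

namespace BasedKnot

variable {K : BasedKnot} {L : Front} {τ Θ : ℕ → ℕ → ℕ} {p : ℕ} {μ η : ℕ → ℕ → ZMod p}

theorem length_flaggedSatellite (hK : K.rightward = true) (L : Front) (τ : ℕ → ℕ → ℕ) :
    (K.flaggedSatellite L τ).length = (K.satelliteSlices L).length := by
  rw [← flaggedSatellite_fst hK L τ, List.length_map]

theorem satellite_length (K : BasedKnot) (L : Front) :
    (K.satellite L).length = (K.satelliteSlices L).length := by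
  rw [Front.length, satellite, List.length_map]

theorem satelliteSlices_eq_flagged (hK : K.rightward = true) {t : ℕ}
    (ht : t < (K.flaggedSatellite L τ).length) :
    (K.satelliteSlices L)[t]? = some (K.flaggedSatellite L τ)[t].1 := by
  rw [← flaggedSatellite_fst hK L τ, List.getElem?_map, List.getElem?_eq_getElem ht]
  rfl

theorem satellitePotential_succ (hK : K.rightward = true) {t : ℕ}
    (ht : t < (K.flaggedSatellite L τ).length) :
    K.satellitePotential L μ η (t + 1) = (K.flaggedSatellite L τ)[t].1.1.carry
      (K.cuspLabel L μ η (K.flaggedSatellite L τ)[t].1.2) (K.satellitePotential L μ η t) := by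
  obtain ⟨hlt, he⟩ := List.getElem?_eq_some_iff.mp (satelliteSlices_eq_flagged hK ht)
  rw [carried_satellitePotential K L μ η t hlt, he]

/-- In the copies of the companion a flagged crossing belongs to a graded pair of copies. In the
pattern it is a switch of the graded ruling `τ`. -/
theorem flagged_label_eq (hK : K.rightward = true) (hL : L.IsAnnular) (hτ : L.IsGenRuling τ)
    (hμ : K.front.IsMaslov μ) (hη : L.IsMaslov η) (hg : L.IsGraded η τ) {t k : ℕ}
    (ht : t < (K.flaggedSatellite L τ).length)
    (hk : (K.flaggedSatellite L τ)[t].1.1 = Slice.cross k)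
    (hd : (K.flaggedSatellite L τ)[t].2 = true) :
    K.satellitePotential L μ η t k = K.satellitePotential L μ η t (k + 1) := by
  have hcar := carried_satellitePotential K L μ η
  obtain ⟨c1, -, c3⟩ := carried_satellite hK hcar
  obtain ⟨A, B, C⟩ := satellite_labels hK hL hμ hη hcar
  have hget := List.getElem?_eq_getElem ht
  have hb := K.base_le
  have copy_case : ∀ {s r T : ℕ}, s < K.front.length → t = T + r →
      (K.flaggedSatellite L τ)[t]? = ((K.front.slice s).flaggedCopy L.left (τ 0) s)[r]? →
      Carried (K.cuspLabel L μ η) ((K.front.slice s).copyEntries L.left s)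
        (fun r => K.satellitePotential L μ η (T + r)) →
      (∀ a < K.front.width s, ∀ i < L.left,
        K.satellitePotential L μ η T (L.left * a + i) = μ s a + η 0 i) →
      (∀ a < K.front.width (s + 1), ∀ i < L.left,
        K.satellitePotential L μ η (T + ((K.front.slice s).copy L.left).length) (L.left * a + i) =
          μ (s + 1) a + η 0 i) →
      K.satellitePotential L μ η t k = K.satellitePotential L μ η t (k + 1) := by
    rintro s r T hs' rfl he hc h0 h1
    rw [hget] at he
    obtain ⟨hr, he⟩ := List.getElem?_eq_some_iff.mp he.symm
    have htr := hc.transport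
    rw [copyEntries_fst] at htr
    rw [Front.width_succ] at h1
    exact flaggedCopy_label_eq (hτ.involutive 0) (K.planar.ok s hs') htr
      (hg 0 (Nat.zero_le _)) (hμ.lcusp s hs') (hμ.rcusp s hs') h0 h1 hr (by rw [he]; exact hk)
      (by rw [he]; exact hd)
  rcases flaggedSatellite_cases ht with ⟨s, hs', r, hr, he⟩ | ⟨r, hr, rfl, he⟩ | ⟨s, hs', r, hr, he⟩
  · refine copy_case (by omega) hr he (c1 s hs') (A s hs'.le) ?_
    rw [← leftTime_succ]
    exact A (s + 1) hs'
  · rw [hget, Option.some.injEq] at he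
    rw [he] at hd hk
    have hsh : ∃ k', L.slice r = Slice.cross k' ∧ k = L.left * K.baseStrand + k' := by
      cases hx : L.slice r <;> rw [hx] at hk <;> cases hk
      exact ⟨_, rfl, rfl⟩
    obtain ⟨k', hk', rfl⟩ := hsh
    have hok := hL.ok r hr
    rw [hk'] at hok hd
    simp only [Slice.rulingFlag, decide_eq_true_eq, Slice.Ok] at hd hok
    rw [B r hr.le k' (by omega), add_assoc, B r hr.le (k' + 1) hok,
      switch_label_eq hL hη hτ hg hr hk' hd.1 hd.2]
  · refine copy_case (s := K.baseTime + s) (Nat.add_lt_of_lt_sub' hs') hr he (c3 s hs')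
      (C s (by omega)) ?_
    rw [← rightTime_succ]
    exact C (s + 1) (by omega)

/-- A grading of the partial ruling can be read off on the strands of the inserted pattern.
Conversely, the grading propagates from the empty line through all slices, because flagged switches
join equal potentials. -/
theorem isGraded_states (hK : K.rightward = true) (hL : L.IsAnnular) (hτ : L.IsGenRuling τ)
    (hμ : K.front.IsMaslov μ) (hη : L.IsMaslov η) (h0 : Θ 0 = id)
    (hs : Steps (K.flaggedSatellite L τ) Θ) (hi : ∀ t, Function.Involutive (Θ t)) :
    (K.satellite L).IsGraded (K.satellitePotential L μ η) Θ ↔ L.IsGraded η τ := by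
  obtain ⟨-, B, -⟩ := satellite_labels hK hL hμ hη (carried_satellitePotential K L μ η)
  constructor
  · intro h t ht i j hij he
    have hpt := hτ.pairing t
    have hi' : i < L.width t := by
      by_contra hc
      rw [hpt.supp i (not_lt.mp hc)] at he
      omega
    have hj' : j < L.width t := he ▸ hpt.lt_of_lt hi'
    have hst := (satellite_states hL hτ hs h0).2.1 t ht
    have := h (K.leftTime L.left K.baseTime + t) (by
      rw [satellite_length, ← length_flaggedSatellite hK L τ]
      exact leftTime_le_length K L τ hK ht) (L.left * K.baseStrand + i) (L.left * K.baseStrand + j)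
      (by omega) (by rw [hst, stack_mid hi', he])
    rw [B t ht i hi', B t ht j hj', add_assoc] at this
    exact add_left_cancel this
  · intro hg t ht
    rw [satellite_length, ← length_flaggedSatellite hK L τ] at ht
    induction t with
    | zero =>
      intro i j hij he
      rw [h0] at he
      exact absurd he hij.ne
    | succ t ih =>
      show GradedBy _ _
      rw [satellitePotential_succ hK ht]
      exact (hs t ht).gradedBy (hi t) (ih (by omega)) fun k hk hd =>
        flagged_label_eq hK hL hτ hμ hη hg ht hk hd

theorem fixedPotential_fixCount {A : Type*} (L : Front) (τ : ℕ → ℕ → ℕ) (η : ℕ → ℕ → A) {t i : ℕ}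
    (hi : i < L.width t) (hf : τ t i = i) :
    L.fixedPotential τ η t (fixCount (τ t) i) = η t i := by
  classical
  have hc : fixCount (τ t) i = Nat.count (fun q => q < L.width t ∧ τ t q = q) i := by
    have : ∀ m ≤ i, fixCount (τ t) m = Nat.count (fun q => q < L.width t ∧ τ t q = q) m := by
      intro m hm
      induction m with
      | zero => simp [fixCount]
      | succ m ih =>
        rw [fixCount_succ, Nat.count_succ, ih (by omega)]
        congr 1
        simp only [show m < L.width t by omega, true_and]
    exact this i le_rfl
  rw [Front.fixedPotential, hc, Nat.nth_count ⟨hi, hf⟩]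

theorem flaggedCopy_lcusp {n t k q : ℕ} {s : Slice} {π : ℕ → ℕ} {e : Entry}
    (h : (s.flaggedCopy n π t)[q]? = some e) (hk : e.1.1 = Slice.lcusp k) (hd : e.2 = false) :
    ∃ j < n, e.1.2 = Origin.companion t j ∧ π j = j := by
  cases s with
  | triv => simp [Slice.flaggedCopy] at h
  | cross k' =>
    have := List.mem_of_getElem? h
    simp only [Slice.flaggedCopy, List.mem_map, gridWord, List.mem_flatMap, withOrigin, rowDown,
      unflagged] at this
    obtain ⟨-, ⟨_, -, _, ⟨_, -, rfl⟩, rfl⟩, rfl⟩ := this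
    cases hk
  | lcusp k' =>
    have := List.mem_of_getElem? h
    simp only [Slice.flaggedCopy, flaggedCusp, List.mem_flatMap, List.mem_cons, List.mem_range,
      flaggedRow, List.mem_map] at this
    obtain ⟨j, hj, rfl | ⟨_, -, rfl⟩⟩ := this
    · exact ⟨j, hj, rfl, by simpa using hd⟩
    · cases hk
  | rcusp k' =>
    have := List.mem_of_getElem? h
    simp only [Slice.flaggedCopy, flaggedCusp, List.mem_flatMap, List.mem_cons, List.mem_range,
      flaggedRow, List.mem_map, List.mem_reverse] at this
    obtain ⟨_, ⟨j, -, rfl | ⟨_, -, rfl⟩⟩, rfl⟩ := this <;> cases hk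

theorem keep_getD {c : ℕ → ℕ} {o : Origin} {r : Option Slice} {x : Slice × Origin}
    (h : keep c o r = [x]) : x.1 = r.getD Slice.triv := by
  cases o with
  | companion t i =>
    cases r with
    | none => simp [keep] at h
    | some s => simp [keep] at h; rw [← h]; rfl
  | pattern t => simp [keep] at h; rw [← h]

theorem keep_cases (c : ℕ → ℕ) (o : Origin) (r : Option Slice) :
    (keep c o r = [] ∧ r = none) ∨ ∃ x, keep c o r = [x] := by
  cases o with
  | companion t i =>
    cases r with
    | none => exact Or.inl ⟨rfl, rfl⟩
    | some s => exact Or.inr ⟨_, rfl⟩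
  | pattern t => exact Or.inr ⟨_, rfl⟩

/-- Equal labels at flagged switches make carrying commute with restriction. At kept left cusps the
labels agree because such a cusp comes from a copy fixed by `τ 0`, and `fixedPotential` gives it the
value of `η` on that copy. -/
theorem satellitePotential_kept (hK : K.rightward = true) (hL : L.IsAnnular)
    (hτ : L.IsGenRuling τ) (hμ : K.front.IsMaslov μ) (hη : L.IsMaslov η) (h0 : Θ 0 = id)
    (hs : Steps (K.flaggedSatellite L τ) Θ) (hp : ∀ t, Pairing ((K.satellite L).width t) (Θ t))
    (hok : ∀ t, ((K.satellite L).slice t).Ok ((K.satellite L).width t))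
    (hg : L.IsGraded η τ) {t : ℕ} (ht : t ≤ (K.satellite L).length) (i : ℕ) :
    K.satellitePotential (L.fixedPart τ) μ (L.fixedPotential τ η) (K.keptTime L τ Θ t) i =
      K.satellitePotential L μ η t (fixNth (Θ t) i) := by
  rw [satellite_length, ← length_flaggedSatellite hK L τ] at ht
  induction t generalizing i with
  | zero => rw [keptTime, Nat.zero_min]; rfl
  | succ t ih =>
    have ht' : t < (K.flaggedSatellite L τ).length := ht
    have hsl := getElem_flaggedSatellite hK ht'
    have hok' := hok t
    have hp' := hp (t + 1)
    rw [Front.width_succ, hsl] at hp'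
    rw [hsl] at hok'
    have ih := funext fun i => ih ht'.le i
    have hstep := hs t ht'
    have hsw : ∀ k, (K.flaggedSatellite L τ)[t].1.1 = Slice.cross k →
        (K.flaggedSatellite L τ)[t].2 = true →
        K.satellitePotential L μ η t k = K.satellitePotential L μ η t (k + 1) :=
      fun k => flagged_label_eq hK hL hτ hμ hη hg ht'
    rw [satellitePotential_succ hK ht', Slice.carry_restriction (hp t) hok' hp' hstep _ _ hsw, ← ih]
    have hkt : K.keptTime L τ Θ (t + 1) = K.keptTime L τ Θ t +
        (keepAt (fixCount (τ 0)) (K.flaggedSatellite L τ) Θ t).length := by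
      rw [keptTime, keptTime, min_eq_left ht, min_eq_left ht'.le, keepTime, keepTime,
        Finset.sum_range_succ]
    have hka := keepAt_of_lt ht' (fixCount (τ 0)) Θ
    rcases keep_cases (fixCount (τ 0)) (K.flaggedSatellite L τ)[t].1.2
      ((K.flaggedSatellite L τ)[t].1.1.restriction (K.flaggedSatellite L τ)[t].2 (Θ t)) with
      ⟨hk, hr⟩ | ⟨x, hk⟩
    · rw [hkt, hka, hk, hr]
      rfl
    · rw [hk] at hka
      have hv := ((run_flaggedSatellite hK hL hτ).keepAt_eq hs h0).2 t ht' x hka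
      have hkt' : keepTime (fixCount (τ 0)) (K.flaggedSatellite L τ) Θ t = K.keptTime L τ Θ t := by
        rw [keptTime, min_eq_left ht'.le]
      rw [hkt'] at hv
      rw [hkt, hka]
      obtain ⟨hlt, hx⟩ := List.getElem?_eq_some_iff.mp hv
      rw [List.length_singleton, carried_satellitePotential _ _ _ _ _ hlt, hx, ← keep_getD hk]
      -- The label enters only at left cusps.
      refine congrFun (Slice.carry_congr fun k hxk => ?_) i
      rw [keep_getD hk] at hxk
      obtain ⟨⟨k', hl⟩, hd⟩ := Slice.restriction_eq_lcusp hxk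
      have hget := List.getElem?_eq_getElem ht'
      have copy_case : ∀ {s r : ℕ}, (K.flaggedSatellite L τ)[t]? =
          ((K.front.slice s).flaggedCopy L.left (τ 0) s)[r]? →
          K.cuspLabel (L.fixedPart τ) μ (L.fixedPotential τ η) x.2 =
            K.cuspLabel L μ η (K.flaggedSatellite L τ)[t].1.2 := by
        intro s r he
        rw [hget] at he
        obtain ⟨j, hj, ho, hf⟩ := flaggedCopy_lcusp he.symm hl hd
        rw [ho] at hk ⊢
        have hx2 : x.2 = Origin.companion s (fixCount (τ 0) j) := by
          cases hr : (K.flaggedSatellite L τ)[t].1.1.restriction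
              (K.flaggedSatellite L τ)[t].2 (Θ t) with
          | none => simp [keep, hr] at hk
          | some s' => simp [keep, hr] at hk; rw [← hk]
        rw [hx2]
        simp only [cuspLabel, fixedPotential_fixCount L τ η (t := 0) hj hf]
      rcases flaggedSatellite_cases ht' with ⟨s, -, r, -, he⟩ | ⟨r, -, -, he⟩ | ⟨s, -, r, -, he⟩
      · exact copy_case he
      -- The left cusps of the pattern are flagged, so none of them is kept.
      · rw [hget, Option.some.injEq] at he
        rw [he] at hl hd
        cases hx : L.slice r <;> rw [hx] at hl hd <;> cases hl
        cases hd
      · exact copy_case he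

end BasedKnot

/-! ### The correspondence -/

namespace BasedKnot

/-- The pairs of a generalized normal ruling `τ` of `L` and a reduced normal ruling of
`S(K, L^τ)`. -/
structure IsPair (K : BasedKnot) (L : Front) (τ σ : ℕ → ℕ → ℕ) : Prop where
  gen : L.IsGenRuling τ
  normal : (K.satellite (L.fixedPart τ)).IsNormalRuling σ
  reduced : K.IsReduced (L.fixedPart τ) σ

/-- `Φ` is a bijection from pairs onto the normal rulings of `S(K, L)` that is compatible with `j`
and with gradings. -/
structure Correspondence (K : BasedKnot) (L : Front)
    (Φ : (ℕ → ℕ → ℕ) → (ℕ → ℕ → ℕ) → ℕ → ℕ → ℕ) : Prop where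
  normal : ∀ τ σ, K.IsPair L τ σ → (K.satellite L).IsNormalRuling (Φ τ σ)
  surjective : ∀ ρ, (K.satellite L).IsNormalRuling ρ → ∃ τ σ, K.IsPair L τ σ ∧ Φ τ σ = ρ
  injective : ∀ τ σ τ' σ', K.IsPair L τ σ → K.IsPair L τ' σ' → Φ τ σ = Φ τ' σ' → τ = τ' ∧ σ = σ'
  jIndex : ∀ τ σ, K.IsPair L τ σ → (K.satellite L).jIndex (Φ τ σ) =
    L.jIndex τ + (K.satellite (L.fixedPart τ)).jIndex σ
  graded : ∀ (p : ℕ) (μ η : ℕ → ℕ → ZMod p), K.front.IsMaslov μ → L.IsMaslov η →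
    ∀ τ σ, K.IsPair L τ σ →
      ((K.satellite L).IsGraded (K.satellitePotential L μ η) (Φ τ σ) ↔ L.IsGraded η τ ∧
        (K.satellite (L.fixedPart τ)).IsGraded
          (K.satellitePotential (L.fixedPart τ) μ (L.fixedPotential τ η)) σ)

variable {K : BasedKnot} {L : Front}

/-- `Φ τ σ` joins `σ` to the partial ruling given by `τ`. For surjectivity, the thin pairs of `ρ`
give `τ`, the ruling `ρ` extends the partial ruling, and `σ` is its restriction to the fixed
strands. For injectivity, `τ` is recovered as the pattern ruling, and then `σ` as the restriction.
-/
theorem exists_correspondence_of_rightward (hK : K.rightward = true) (hL : L.IsAnnular) :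
    ∃ Φ, K.Correspondence L Φ := by
  choose! Θ h0 hs hend H using fun τ (hτ : L.IsGenRuling τ) => exists_partialRuling hK hL hτ
  have hlift : ∀ τ (hτ : L.IsGenRuling τ) (σ : ℕ → ℕ → ℕ) t, Lift (Θ τ t)
      (σ (K.keptTime L τ (Θ τ) t)) (join (Θ τ t) (σ (K.keptTime L τ (Θ τ) t))) :=
    fun τ hτ σ t => lift_join ((H τ hτ).pairing t) _
  have hpat : ∀ τ σ, K.IsPair L τ σ →
      K.patternRuling L (fun t => join (Θ τ t) (σ (K.keptTime L τ (Θ τ) t))) = τ :=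
    fun τ σ h => (patternRuling_eq_iff hK hL h.gen (h0 τ h.gen) (hs τ h.gen) (H τ h.gen).pairing
      h.normal (hlift τ h.gen σ)).2 ((isReduced_iff hK hL h.gen h.normal).1 h.reduced)
  have hnormal : ∀ τ σ, K.IsPair L τ σ → (K.satellite L).IsNormalRuling
      fun t => join (Θ τ t) (σ (K.keptTime L τ (Θ τ) t)) :=
    fun τ σ h => isNormalRuling_join hK hL h.gen (h0 τ h.gen) (hs τ h.gen) (H τ h.gen) h.normal
      ((isReduced_iff hK hL h.gen h.normal).1 h.reduced)
  refine ⟨fun τ σ t => join (Θ τ t) (σ (K.keptTime L τ (Θ τ) t)), ⟨hnormal, fun ρ hρ => ?_,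
    fun τ σ τ' σ' h h' he => ?_, fun τ σ h => ?_, fun p μ η hμ hη τ σ h => ?_⟩⟩
  · have hτ := isGenRuling_patternRuling hK hL hρ
    set τ := K.patternRuling L ρ with hτdef
    have hext : ∀ t x, Θ τ t x ≠ x → ρ t x = Θ τ t x := by
      intro t
      rcases le_total t (K.satellite L).length with ht | ht
      · exact extends_satellite hK hL hρ (hs τ hτ) (h0 τ hτ) (fun t => ((H τ hτ).pairing t).inv) ht
      · intro x hx
        rw [satellite_length, ← length_flaggedSatellite hK L τ] at ht
        rw [hend τ hτ t ht] at hx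
        exact absurd rfl hx
    obtain ⟨σ, hσ, hl⟩ := (H τ hτ).exists_restrict hρ hext
    refine ⟨τ, σ, ⟨hτ, hσ, (isReduced_iff hK hL hτ hσ).2 ?_⟩, ?_⟩
    · exact (patternRuling_eq_iff hK hL hτ (h0 τ hτ) (hs τ hτ) (H τ hτ).pairing hσ hl).1 rfl
    · funext t
      exact (hlift τ hτ σ t).ext_right (hl t)
  · obtain rfl : τ = τ' := by rw [← hpat τ σ h, ← hpat τ' σ' h', he]
    refine ⟨rfl, (H τ h.gen).eq_of_lift h.normal.toIsGenRuling h'.normal.toIsGenRuling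
      (hlift τ h.gen σ) fun t => ?_⟩
    rw [congrFun he t]
    exact hlift τ h.gen σ' t
  · rw [(H τ h.gen).jIndex_lift (hnormal τ σ h) (hlift τ h.gen σ), sum_partialJTerm hK h.gen]
  · have hi : ∀ t, Function.Involutive (Θ τ t) := fun t => ((H τ h.gen).pairing t).inv
    rw [(H τ h.gen).isGraded_lift_iff (hlift τ h.gen σ) fun hg t ht i =>
        satellitePotential_kept hK hL h.gen hμ hη (h0 τ h.gen) (hs τ h.gen) (H τ h.gen).pairing
          (H τ h.gen).ok ((isGraded_states hK hL h.gen hμ hη (h0 τ h.gen) (hs τ h.gen) hi).1 hg) ht i,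
      isGraded_states hK hL h.gen hμ hη (h0 τ h.gen) (hs τ h.gen) hi]

end BasedKnot

/-! ### Reflection of the pattern -/

namespace Front

variable {L : Front} {τ : ℕ → ℕ → ℕ}

theorem ext_slice {F G : Front} (h1 : F.left = G.left) (h2 : F.length = G.length)
    (h3 : ∀ t < F.length, F.slice t = G.slice t) : F = G := by
  cases F with
  | mk l w =>
    cases G with
    | mk l' w' =>
      congr 1
      refine List.ext_getElem h2 fun t ht ht' => ?_
      have := h3 t ht
      rwa [slice_of_lt _ ht, slice_of_lt _ ht'] at this

theorem reflect_length (L : Front) : L.reflect.length = L.length := by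
  simp [Front.length, reflect]

theorem reflect_slice {t : ℕ} (ht : t < L.length) :
    L.reflect.slice t = (L.slice (L.length - 1 - t)).mirror := by
  rw [slice_of_lt _ (by rw [reflect_length]; exact ht), slice_of_lt _ (by omega)]
  simp only [reflect, List.getElem_map, List.getElem_reverse]
  rfl

theorem reflect_width (hL : L.IsAnnular) (t : ℕ) : L.reflect.width t = L.width (L.length - t) := by
  have key : ∀ t ≤ L.length, L.reflect.width t = L.width (L.length - t) := by
    intro t ht
    induction t with
    | zero => rfl
    | succ t ih =>
      rw [width_succ, ih (by omega), reflect_slice (by omega)]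
      have := (hL.ok (L.length - 1 - t) (by omega)).mirror.2
      rw [← width_succ, show L.length - 1 - t + 1 = L.length - t by omega] at this
      rw [this]
      congr 1
      omega
  rcases le_total t L.length with ht | ht
  · exact key t ht
  · rw [width_of_le _ (by rw [reflect_length]; exact ht), reflect_length, key _ le_rfl]
    congr 1
    omega

theorem reflect_isAnnular (hL : L.IsAnnular) : L.reflect.IsAnnular where
  ok t ht := by
    rw [reflect_length] at ht
    rw [reflect_width hL, reflect_slice ht]
    have := (hL.ok (L.length - 1 - t) (by omega)).mirror.1
    rwa [← width_succ, show L.length - 1 - t + 1 = L.length - t by omega] at this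
  closed := by
    rw [reflect_length, reflect_width hL, Nat.sub_self]
    exact hL.closed.symm

theorem reflect_reflect (hL : L.IsAnnular) : L.reflect.reflect = L := by
  refine ext_slice ?_ (by rw [reflect_length, reflect_length]) fun t ht => ?_
  · show L.reflect.width L.reflect.length = _
    rw [reflect_length, reflect_width hL, Nat.sub_self, width_zero]
  · rw [reflect_length, reflect_length] at ht
    rw [reflect_slice (by rw [reflect_length]; exact ht), reflect_length,
      reflect_slice (by omega), Slice.mirror_mirror]
    congr 1
    omega

/-- Rulings of a front, read from right to left. -/
def backward (L : Front) (τ : ℕ → ℕ → ℕ) (t : ℕ) : ℕ → ℕ := τ (L.length - t)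

theorem IsGenRuling.backward (hL : L.IsAnnular) (h : L.IsGenRuling τ) :
    L.reflect.IsGenRuling (L.backward τ) where
  involutive t := h.involutive _
  support t i hi := h.support _ i (by rwa [reflect_width hL] at hi)
  rules t := by
    rcases lt_or_ge t L.length with ht | ht
    · rw [reflect_slice ht]
      have := (h.rules (L.length - 1 - t)).mirror (h.involutive _)
      rw [show L.length - 1 - t + 1 = L.length - t by omega] at this
      rwa [Front.backward, Front.backward, show L.length - (t + 1) = L.length - 1 - t by omega]
    · rw [slice_of_le _ (by rw [reflect_length]; exact ht)]
      show L.backward τ (t + 1) = L.backward τ t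
      rw [Front.backward, Front.backward]
      congr 1
      omega
  closed := by
    rw [reflect_length, Front.backward, Front.backward, Nat.sub_self, Nat.sub_zero]
    exact h.closed.symm

theorem backward_backward (h : L.IsGenRuling τ) : L.backward (L.backward τ) = τ := by
  funext t
  rw [backward, backward]
  rcases le_total t L.length with ht | ht
  · congr 1
    omega
  · rw [h.of_le ht]
    congr 1
    omega

theorem reflect_backward (L : Front) (τ : ℕ → ℕ → ℕ) : L.reflect.backward τ = L.backward τ := by
  funext t
  rw [backward, backward, reflect_length]

end Front

/-- The involution does not change at a crossing of two fixed strands, so it does not matter at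
which end the fixed strands are read. -/
theorem Slice.Rules.fixedSlice_eq {s : Slice} {f g : ℕ → ℕ} (hf : Function.Involutive f)
    (hg : Function.Involutive g) (h : s.Rules f g) :
    (s.fixedSlice f).mirror = s.mirror.fixedSlice g := by
  cases s with
  | triv | lcusp k | rcusp k => rfl
  | cross k =>
    simp only [Slice.fixedSlice, Slice.mirror]
    by_cases hfix : f k = k ∧ f (k + 1) = k + 1
    · have : g = f := by
        rcases h.cross_cases.2 with h | h
        · exact conj_eq_of_fixed hf h hfix.1 hfix.2
        · exact h.1
      rw [this, if_pos hfix]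
    · rw [if_neg hfix, if_neg]
      intro hfix'
      have : f = g := by
        rcases h.cross_cases.2 with h' | h'
        · exact conj_eq_of_fixed hg (conj_symm hf h.cross_cases.1 h').2 hfix'.1 hfix'.2
        · exact h'.1.symm
      exact hfix (this ▸ hfix')

namespace Front

variable {L : Front} {τ : ℕ → ℕ → ℕ}

theorem fixedPart_reflect (hτ : L.IsGenRuling τ) (hL : L.IsAnnular) :
    (L.fixedPart τ).reflect = L.reflect.fixedPart (L.backward τ) := by
  refine ext_slice ?_ (by rw [reflect_length, fixedPart_length, fixedPart_length, reflect_length])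
    fun t ht => ?_
  · show (L.fixedPart τ).width _ = _
    rw [fixedPart_width, fixedPart_left, backward, Nat.sub_zero, hτ.closed]
    show _ = fixCount (τ 0) (L.width L.length)
    rw [hL.closed]
  · rw [reflect_length, fixedPart_length] at ht
    rw [reflect_slice (by rw [fixedPart_length]; exact ht), fixedPart_slice, fixedPart_slice,
      reflect_slice ht, fixedPart_length]
    have := (hτ.rules (L.length - 1 - t)).fixedSlice_eq (hτ.involutive _) (hτ.involutive _)
    rwa [show L.length - 1 - t + 1 = L.length - t by omega] at this

/-- Reflection turns left cusps into right cusps, and there are equally many of both because the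
width closes up. -/
theorem jIndex_backward (hL : L.IsAnnular) :
    L.reflect.jIndex (L.backward τ) = L.jIndex τ := by
  rw [jIndex_eq_sum, jIndex_eq_sum, reflect_length]
  have h1 : ∑ t ∈ Finset.range L.length,
      (L.reflect.slice t).jTerm (L.backward τ t) (L.backward τ (t + 1)) =
      ∑ t ∈ Finset.range L.length, (L.slice t).mirror.jTerm (τ (t + 1)) (τ t) := by
    rw [← Finset.sum_range_reflect]
    refine Finset.sum_congr rfl fun t ht => ?_
    have ht := Finset.mem_range.mp ht
    rw [reflect_slice (by omega), backward, backward,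
      show L.length - (L.length - 1 - t) = t + 1 by omega,
      show L.length - (L.length - 1 - t + 1) = t by omega,
      show L.length - 1 - (L.length - 1 - t) = t by omega]
  have h2 : ∀ t ∈ Finset.range L.length, (2 : ℤ) * (L.slice t).jTerm (τ t) (τ (t + 1)) =
      2 * (L.slice t).mirror.jTerm (τ (t + 1)) (τ t) + ((L.width (t + 1) : ℤ) - L.width t) := by
    intro t ht
    have hok := hL.ok t (Finset.mem_range.mp ht)
    rw [width_succ]
    cases hs : L.slice t with
    | triv => simp [Slice.jTerm, Slice.mirror, Slice.out]
    | cross k =>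
      simp only [Slice.jTerm, Slice.mirror, Slice.out, sub_self, add_zero]
      congr 1
      by_cases h : τ (t + 1) = τ t
      · rw [h]
      · rw [if_neg (fun h' => h h'.1), if_neg (fun h' => h h'.1.symm)]
    | lcusp k => simp [Slice.jTerm, Slice.mirror, Slice.out]
    | rcusp k =>
      rw [hs] at hok
      simp only [Slice.Ok] at hok
      have : 2 ≤ L.width t := by omega
      simp only [Slice.jTerm, Slice.mirror, Slice.out]
      push_cast [this]
      ring
  have h3 := Finset.sum_congr rfl h2
  rw [Finset.sum_add_distrib, ← Finset.mul_sum, ← Finset.mul_sum,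
    Finset.sum_range_sub (fun t => (L.width t : ℤ)), hL.closed, width_zero, sub_self] at h3
  rw [h1]
  linarith

/-- A potential of a front, read from right to left. -/
def backwardPotential {A : Type*} (L : Front) (η : ℕ → ℕ → A) (t : ℕ) : ℕ → A :=
  -- At the line `0` the value is `η 0` and not `η L.length`. A Maslov potential makes these agree
  -- only within the width, while the labels of the copies of `K` use `η 0` itself.
  if t = 0 then η 0 else η (L.length - t)

theorem IsMaslov.backward {p : ℕ} {η : ℕ → ℕ → ZMod p} (hL : L.IsAnnular) (h : L.IsMaslov η) :
    L.reflect.IsMaslov (L.backwardPotential η) := by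
  have hb : ∀ t i, i < L.width (L.length - t) →
      L.backwardPotential η t i = η (L.length - t) i := by
    intro t i hi
    rw [backwardPotential]
    split_ifs with h0
    · subst h0
      rw [Nat.sub_zero, hL.closed] at hi
      rw [Nat.sub_zero, h.closed i hi]
    · rfl
  have hs : ∀ t < L.length, ∀ s, L.reflect.slice t = s → L.slice (L.length - 1 - t) = s.mirror :=
    fun t ht s hs => by rw [← hs, reflect_slice ht, Slice.mirror_mirror]
  refine ⟨fun t ht i hi j hj hij => ?_, fun t ht k hk => ?_, fun t ht k hk => ?_, fun i hi => ?_⟩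
  · rw [reflect_length] at ht
    rw [reflect_width hL] at hi hj
    rw [hb _ _ hi, hb _ _ hj]
    rw [show L.length - (t + 1) = L.length - 1 - t by omega] at hj ⊢
    have e : L.length - 1 - t + 1 = L.length - t := by omega
    have := h.strand (L.length - 1 - t) (by omega) j hj i (by rwa [e]) (by
      rw [hs t ht _ rfl]
      exact hij.mirror)
    rw [e] at this
    exact this.symm
  · rw [reflect_length] at ht
    have hk := hs t ht _ hk
    have hok := hL.ok (L.length - 1 - t) (by omega)
    rw [hk] at hok
    simp only [Slice.mirror, Slice.Ok] at hok
    have := h.rcusp _ (by omega) k hk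
    rw [hb _ _ (by rw [show L.length - (t + 1) = L.length - 1 - t by omega]; omega),
      hb _ _ (by rw [show L.length - (t + 1) = L.length - 1 - t by omega]; omega),
      show L.length - (t + 1) = L.length - 1 - t by omega]
    exact this
  · rw [reflect_length] at ht
    have hk := hs t ht _ hk
    have hok := hL.ok (L.length - 1 - t) (by omega)
    have hw := L.width_succ (L.length - 1 - t)
    have e : L.length - 1 - t + 1 = L.length - t := by omega
    rw [hk] at hok hw
    rw [e] at hw
    simp only [Slice.mirror, Slice.Ok, Slice.out] at hok hw
    have := h.lcusp _ (by omega) k hk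
    rw [e] at this
    rwa [hb _ _ (by omega), hb _ _ (by omega)]
  · have hi' : i < L.width L.length := hi
    rw [hL.closed] at hi'
    rw [reflect_length, hb _ _ (by rw [Nat.sub_self]; exact hi'), Nat.sub_self]
    rfl

theorem isGraded_backward {p : ℕ} {η : ℕ → ℕ → ZMod p} (hη : L.IsMaslov η)
    (hτ : L.IsGenRuling τ) :
    L.reflect.IsGraded (L.backwardPotential η) (L.backward τ) ↔ L.IsGraded η τ := by
  have hlast : GradedBy (η L.length) (τ L.length) ↔ GradedBy (η 0) (τ 0) := by
    rw [hτ.closed]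
    refine forall_congr' fun i => forall_congr' fun j => forall_congr' fun hij =>
      forall_congr' fun he => ?_
    have hi : i < L.left := by
      by_contra hc
      have := (hτ.pairing 0).supp i (not_lt.mp hc)
      omega
    have hj : j < L.left := he ▸ (hτ.pairing 0).lt_of_lt hi
    rw [hη.closed i hi, hη.closed j hj]
  have hb : ∀ t ≤ L.length, GradedBy (L.backwardPotential η t) (L.backward τ t) ↔
      GradedBy (η (L.length - t)) (τ (L.length - t)) := by
    intro t ht
    rw [backwardPotential, backward]
    split_ifs with h0
    · subst h0
      rw [Nat.sub_zero, hlast, hτ.closed]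
    · rfl
  constructor
  · intro h t ht
    have := (hb (L.length - t) (by omega)).1 (h _ (by rw [reflect_length]; omega))
    rwa [show L.length - (L.length - t) = t by omega] at this
  · intro h t ht
    rw [reflect_length] at ht
    exact (hb t ht).2 (h _ (by omega))

theorem fixedPotential_backward {A : Type*} {η : ℕ → ℕ → A} (hL : L.IsAnnular)
    (hτ : L.IsGenRuling τ) :
    (L.fixedPart τ).backwardPotential (L.fixedPotential τ η) =
      L.reflect.fixedPotential (L.backward τ) (L.backwardPotential η) := by
  funext t i
  simp only [backwardPotential, fixedPotential, fixedPart_length, backward, reflect_width hL]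
  split_ifs with h0
  · subst h0
    rw [Nat.sub_zero, hL.closed, hτ.closed]
    rfl
  · rfl

end Front

namespace BasedKnot

/-- The same knot, oriented to the right at the base point. -/
def toRight (K : BasedKnot) : BasedKnot := { K with rightward := true }

variable {K : BasedKnot} {L : Front}

theorem satelliteSlices_toRight (hK : K.rightward = false) (hL : L.IsAnnular) :
    K.satelliteSlices L = K.toRight.satelliteSlices L.reflect := by
  have h1 : L.reflect.left = L.left := hL.closed
  have h2 : K.inserted L = L.reflect := by simp [inserted, hK]
  have h3 : K.toRight.inserted L.reflect = L.reflect := rfl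
  rw [satelliteSlices, satelliteSlices, h1, h2, h3]
  rfl

theorem satellite_toRight (hK : K.rightward = false) (hL : L.IsAnnular) :
    K.satellite L = K.toRight.satellite L.reflect := by
  rw [satellite, satellite, satelliteSlices_toRight hK hL]

theorem satellitePotential_toRight {A : Type*} [AddGroupWithOne A] (hK : K.rightward = false)
    (hL : L.IsAnnular) (μ η : ℕ → ℕ → A) : K.satellitePotential L μ η =
      K.toRight.satellitePotential L.reflect μ (L.backwardPotential η) := by
  have hlab : K.cuspLabel L μ η = K.toRight.cuspLabel L.reflect μ (L.backwardPotential η) := by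
    funext o
    have h2 : K.inserted L = L.reflect := by simp [inserted, hK]
    have h3 : K.toRight.inserted L.reflect = L.reflect := rfl
    cases o with
    | companion t i => rfl
    | pattern t =>
      simp only [cuspLabel, h2, h3, insertedPotential, hK]
      rfl
  funext t
  rw [satellitePotential, satellitePotential, satelliteSlices_toRight hK hL, hlab]

theorem isReduced_toRight (hK : K.rightward = false) (hL : L.IsAnnular) {τ : ℕ → ℕ → ℕ}
    (hτ : L.IsGenRuling τ) (σ : ℕ → ℕ → ℕ) : K.IsReduced (L.fixedPart τ) σ ↔
      K.toRight.IsReduced (L.reflect.fixedPart (L.backward τ)) σ := by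
  have hM := Front.fixedPart_isAnnular hL hτ
  have hleft : (L.reflect.fixedPart (L.backward τ)).left = (L.fixedPart τ).left := by
    rw [← Front.fixedPart_reflect hτ hL]
    exact hM.closed
  have hcusp : ∀ t, K.FromLeftCusp (L.fixedPart τ) t ↔
      K.toRight.FromLeftCusp (L.reflect.fixedPart (L.backward τ)) t := fun t => by
    rw [FromLeftCusp, FromLeftCusp, satelliteSlices_toRight hK hM, Front.fixedPart_reflect hτ hL]
    rfl
  rw [IsReduced, IsReduced, Front.fixedPart_isEmpty_iff, Front.fixedPart_isEmpty_iff, hleft,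
    satellite_toRight hK hM, Front.fixedPart_reflect hτ hL]
  simp only [hcusp]

theorem isPair_toRight (hK : K.rightward = false) (hL : L.IsAnnular) {τ σ : ℕ → ℕ → ℕ}
    (hτ : L.IsGenRuling τ) : K.IsPair L τ σ ↔ K.toRight.IsPair L.reflect (L.backward τ) σ := by
  have hM := Front.fixedPart_isAnnular hL hτ
  constructor
  · rintro ⟨-, h2, h3⟩
    refine ⟨hτ.backward hL, ?_, (isReduced_toRight hK hL hτ σ).1 h3⟩
    rwa [satellite_toRight hK hM, Front.fixedPart_reflect hτ hL] at h2
  · rintro ⟨-, h2, h3⟩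
    refine ⟨hτ, ?_, (isReduced_toRight hK hL hτ σ).2 h3⟩
    rwa [satellite_toRight hK hM, Front.fixedPart_reflect hτ hL]

/-- If the knot is oriented to the left at the base point, the satellite is that of the reflected
pattern with the other orientation. Rulings, fixed fronts and potentials are reflected along with
it. -/
theorem exists_correspondence (K : BasedKnot) (hL : L.IsAnnular) :
    ∃ Φ, K.Correspondence L Φ := by
  cases hK : K.rightward with
  | true => exact exists_correspondence_of_rightward hK hL
  | false =>
    obtain ⟨Φ, hΦ⟩ := exists_correspondence_of_rightward (K := K.toRight) rfl
      (Front.reflect_isAnnular hL)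
    have hpair : ∀ τ σ, K.IsPair L τ σ → K.toRight.IsPair L.reflect (L.backward τ) σ :=
      fun τ σ h => (isPair_toRight hK hL h.gen).1 h
    have hsat := satellite_toRight hK hL
    refine ⟨fun τ σ => Φ (L.backward τ) σ, ⟨fun τ σ h => ?_, fun ρ hρ => ?_,
      fun τ σ τ' σ' h h' he => ?_, fun τ σ h => ?_, fun p μ η hμ hη τ σ h => ?_⟩⟩
    · rw [hsat]
      exact hΦ.normal _ _ (hpair τ σ h)
    · rw [hsat] at hρ
      obtain ⟨τ, σ, h, he⟩ := hΦ.surjective ρ hρ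
      have hgen : L.IsGenRuling (L.backward τ) := by
        have := h.gen.backward (Front.reflect_isAnnular hL)
        rwa [Front.reflect_reflect hL, Front.reflect_backward] at this
      have hbb : L.backward (L.backward τ) = τ := by
        have := Front.backward_backward h.gen
        rwa [Front.reflect_backward, Front.reflect_backward] at this
      refine ⟨L.backward τ, σ, (isPair_toRight hK hL hgen).2 (by rwa [hbb]), ?_⟩
      rw [hbb]
      exact he
    · obtain ⟨e1, e2⟩ := hΦ.injective _ _ _ _ (hpair τ σ h) (hpair τ' σ' h') he
      refine ⟨?_, e2⟩
      rw [← Front.backward_backward h.gen, e1, Front.backward_backward h'.gen]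
    · have hM := Front.fixedPart_isAnnular hL h.gen
      rw [hsat, hΦ.jIndex _ _ (hpair τ σ h), Front.jIndex_backward hL, satellite_toRight hK hM,
        Front.fixedPart_reflect h.gen hL]
    · have hM := Front.fixedPart_isAnnular hL h.gen
      rw [hsat, satellitePotential_toRight hK hL,
        hΦ.graded p μ _ hμ (hη.backward hL) _ _ (hpair τ σ h), Front.isGraded_backward hη h.gen,
        satellite_toRight hK hM, satellitePotential_toRight hK hM, Front.fixedPart_reflect h.gen hL,
        Front.fixedPotential_backward hL h.gen]

end BasedKnot

/-! ### Normal rulings of the pattern, and the main theorem -/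

namespace Front

theorem slice_eq_triv {F : Front} (h : ∀ s ∈ F.word, s = Slice.triv) (t : ℕ) :
    F.slice t = Slice.triv := by
  rcases lt_or_ge t F.length with ht | ht
  · rw [slice_of_lt _ ht]
    exact h _ (List.getElem_mem _)
  · exact slice_of_le _ ht

theorem isNormalRuling_id {F : Front} (h : ∀ s ∈ F.word, s = Slice.triv) (h0 : F.left = 0) :
    F.IsNormalRuling fun _ => id where
  involutive _ _ := rfl
  support _ _ _ := rfl
  rules t := by
    rw [slice_eq_triv h]
    rfl
  closed := rfl
  fixedPointFree t i hi := by
    have : F.width t = 0 := by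
      clear hi
      induction t with
      | zero => exact h0
      | succ t ih => rw [width_succ, slice_eq_triv h, ← ih]; rfl
    omega

theorem jIndex_of_triv {F : Front} (h : ∀ s ∈ F.word, s = Slice.triv) (ρ : ℕ → ℕ → ℕ) :
    F.jIndex ρ = 0 := by
  rw [jIndex_eq_sum]
  exact Finset.sum_eq_zero fun t _ => by rw [slice_eq_triv h]; rfl

theorem fixedPart_word_triv {L : Front} {τ : ℕ → ℕ → ℕ} (hL : L.IsAnnular)
    (hτ : L.IsNormalRuling τ) : ∀ s ∈ (L.fixedPart τ).word, s = Slice.triv := by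
  intro s hs
  obtain ⟨t, ht, rfl⟩ := List.mem_iff_getElem.mp hs
  have hlt : t < L.length := by rw [← fixedPart_length L τ]; exact ht
  rw [← slice_of_lt _ ht, fixedPart_slice]
  have hok := hL.ok t hlt
  cases hx : L.slice t with
  | triv | lcusp k | rcusp k => rfl
  | cross k =>
    rw [hx] at hok
    simp only [Slice.Ok] at hok
    exact if_neg fun h => hτ.fixedPointFree t k (by omega) h.1

theorem fixedPart_left_eq_zero {L : Front} {τ : ℕ → ℕ → ℕ} (hτ : L.IsNormalRuling τ) :
    (L.fixedPart τ).left = 0 := by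
  rw [fixedPart_left]
  have : ∀ m ≤ L.left, fixCount (τ 0) m = 0 := by
    intro m hm
    induction m with
    | zero => simp [fixCount]
    | succ m ih => rw [fixCount_succ, ih (by omega), if_neg (hτ.fixedPointFree 0 m hm)]
  exact this _ le_rfl

end Front

namespace BasedKnot

variable {K : BasedKnot} {L : Front}

theorem satellite_word_triv (h0 : L.left = 0) (h : ∀ s ∈ L.word, s = Slice.triv) :
    ∀ s ∈ (K.satellite L).word, s = Slice.triv := by
  have hcopy : ∀ s : Slice, s.copy 0 = [] := by
    intro s
    cases s <;> simp [Slice.copy, leftCuspCopy]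
  have hins : ∀ s ∈ (K.inserted L).word, s = Slice.triv := by
    intro s hs
    rw [inserted] at hs
    split_ifs at hs
    · exact h s hs
    · simp only [Front.reflect, List.mem_map, List.mem_reverse] at hs
      obtain ⟨s', hs', rfl⟩ := hs
      rw [h s' hs']
      rfl
  intro s hs
  simp only [satellite, satelliteSlices, List.map_append, List.mem_append, List.mem_map,
    List.mem_flatMap, copySlices, h0, hcopy, List.not_mem_nil, and_false, exists_false, false_and,
    List.mem_range, List.map_nil, or_false, false_or] at hs
  obtain ⟨x, ⟨t, -, rfl⟩, rfl⟩ := hs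
  rw [Front.slice_eq_triv hins]
  rfl

/-- A normal ruling fixes no strand, so `L^τ` is empty and its satellite has only trivial slices. -/
theorem isPair_of_normal (hL : L.IsAnnular) {τ : ℕ → ℕ → ℕ} (hτ : L.IsNormalRuling τ) :
    K.IsPair L τ fun _ => id where
  gen := hτ.toIsGenRuling
  normal := Front.isNormalRuling_id (satellite_word_triv (Front.fixedPart_left_eq_zero hτ)
    (Front.fixedPart_word_triv hL hτ)) rfl
  reduced := Or.inl (Front.fixedPart_isEmpty_iff.2 (Front.fixedPart_left_eq_zero hτ))

end BasedKnot

theorem coeff_finsum_T {α : Type*} [Fintype α] (f : α → ℤ) (m : ℤ) :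
    (∑ᶠ a, LaurentPolynomial.T (R := ℤ) (f a)).coeff m = ∑ a, if f a = m then 1 else 0 := by
  rw [finsum_eq_sum_of_fintype, AddMonoidAlgebra.coeff_sum, Finsupp.finsetSum_apply]
  exact Finset.sum_congr rfl fun a _ => LaurentPolynomial.T_apply _ _

/-- The coefficients count the elements with exponent `m`, and `e` preserves exponents. -/
theorem coeff_finsum_T_le {α β : Type*} [Finite α] [Finite β] {f : α → ℤ} {g : β → ℤ} (e : α ↪ β)
    (h : ∀ a, g (e a) = f a) (m : ℤ) :
    (∑ᶠ a, LaurentPolynomial.T (R := ℤ) (f a)).coeff m ≤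
      (∑ᶠ b, LaurentPolynomial.T (R := ℤ) (g b)).coeff m := by
  have := Fintype.ofFinite α
  have := Fintype.ofFinite β
  rw [coeff_finsum_T, coeff_finsum_T]
  simp only [← h]
  rw [← Finset.sum_map Finset.univ e fun b => if g b = m then (1 : ℤ) else 0]
  exact Finset.sum_le_sum_of_subset_of_nonneg (Finset.subset_univ _) fun b _ _ => by
    split_ifs <;> norm_num

theorem mainTheorem5 (K : BasedKnot) (L : Front) (hL : L.IsAnnular) :
    (∃ Φ : (Σ τ : L.GenRuling, K.ReducedRuling (L.fixedPart τ.1)) ≃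
          (K.satellite L).NormalRuling,
      (∀ (τ : L.GenRuling) (σ : K.ReducedRuling (L.fixedPart τ.1)),
        (K.satellite L).jIndex (Φ ⟨τ, σ⟩).1 =
          L.jIndex τ.1 + (K.satellite (L.fixedPart τ.1)).jIndex σ.1) ∧
      (∀ (p : ℕ) (μ η : ℕ → ℕ → ZMod p), K.front.IsMaslov μ → L.IsMaslov η →
        ∀ (τ : L.GenRuling) (σ : K.ReducedRuling (L.fixedPart τ.1)),
          (K.satellite L).IsGraded (K.satellitePotential L μ η) (Φ ⟨τ, σ⟩).1 ↔
            L.IsGraded η τ.1 ∧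
              (K.satellite (L.fixedPart τ.1)).IsGraded
                (K.satellitePotential (L.fixedPart τ.1) μ (L.fixedPotential τ.1 η)) σ.1)) ∧
    (∀ (p : ℕ) (μ η : ℕ → ℕ → ZMod p), K.front.IsMaslov μ → L.IsMaslov η →
      ∀ m : ℤ, (L.rulingPolynomial η).coeff m ≤
        ((K.satellite L).rulingPolynomial (K.satellitePotential L μ η)).coeff m) := by
  obtain ⟨Φ, hΦ⟩ := K.exists_correspondence hL
  have hpair : ∀ (τ : L.GenRuling) (σ : K.ReducedRuling (L.fixedPart τ.1)),
      K.IsPair L τ.1 σ.1 := fun τ σ => ⟨τ.2, σ.2.1, σ.2.2⟩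
  constructor
  · let F : (Σ τ : L.GenRuling, K.ReducedRuling (L.fixedPart τ.1)) → (K.satellite L).NormalRuling :=
      fun x => ⟨Φ x.1.1 x.2.1, hΦ.normal _ _ (hpair x.1 x.2)⟩
    have hF : Function.Bijective F := by
      constructor
      · rintro ⟨⟨τ, hτ⟩, σ⟩ ⟨⟨τ', hτ'⟩, σ'⟩ h
        obtain ⟨e1, e2⟩ := hΦ.injective _ _ _ _ (hpair ⟨τ, hτ⟩ σ) (hpair ⟨τ', hτ'⟩ σ')
          (congrArg Subtype.val h)
        dsimp only at e1
        subst e1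
        obtain rfl : σ = σ' := Subtype.ext e2
        rfl
      · rintro ⟨ρ, hρ⟩
        obtain ⟨τ, σ, h, he⟩ := hΦ.surjective ρ hρ
        exact ⟨⟨⟨τ, h.gen⟩, ⟨σ, h.normal, h.reduced⟩⟩, Subtype.ext he⟩
    exact ⟨Equiv.ofBijective F hF, fun τ σ => hΦ.jIndex _ _ (hpair τ σ),
      fun p μ η hμ hη τ σ => hΦ.graded p μ η hμ hη _ _ (hpair τ σ)⟩
  · intro p μ η hμ hη m
    have hid : ∀ τ, L.IsNormalRuling τ → K.IsPair L τ fun _ => id :=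
      fun τ hτ => BasedKnot.isPair_of_normal hL hτ
    -- Each graded normal ruling of `L` is paired with the empty ruling, which is vacuously graded
    -- and contributes nothing to `j`.
    let e : {ρ : ℕ → ℕ → ℕ // L.IsNormalRuling ρ ∧ L.IsGraded η ρ} ↪
        {ρ : ℕ → ℕ → ℕ // (K.satellite L).IsNormalRuling ρ ∧
          (K.satellite L).IsGraded (K.satellitePotential L μ η) ρ} :=
      { toFun := fun τ => ⟨Φ τ.1 fun _ => id, hΦ.normal _ _ (hid _ τ.2.1),
          (hΦ.graded p μ η hμ hη _ _ (hid _ τ.2.1)).2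
            ⟨τ.2.2, fun t _ i j hij he => absurd he hij.ne⟩⟩
        inj' := fun τ τ' h => Subtype.ext (hΦ.injective _ _ _ _ (hid _ τ.2.1) (hid _ τ'.2.1)
          (congrArg Subtype.val h)).1 }
    refine coeff_finsum_T_le e (fun τ => ?_) m
    show (K.satellite L).jIndex (Φ τ.1 fun _ => id) = _
    rw [hΦ.jIndex _ _ (hid _ τ.2.1), Front.jIndex_of_triv (BasedKnot.satellite_word_triv
      (Front.fixedPart_left_eq_zero τ.2.1) (Front.fixedPart_word_triv hL τ.2.1)), add_zero]
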